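/- Let $p$ be an odd prime, $\mathbf k$ a finite field of characteristic $p$, $W=W(\mathbf k)$ its ring of Witt vectors. Let $F$ be a finite extension of $\mathbb Q_l$, $l\ne p$, with absolute Galois group $G_F$, inertia group $I_F$ and residue field of order $q$; let $\chi:G_F\to W^\times$ be the $p$-adic cyclotomic character and $\bar\chi$ its reduction. Let $F^{\rm tr}$ be the maximal tamely ramified extension of $F$, $\sigma\in{\rm Gal}(F^{\rm tr}/F)$ a lift of the (arithmetic) Frobenius and $\tau$ a topological generator of the tame inertia group. A *coefficient ring* is a complete Noetherian local $W$-algebra with residue field $\mathbf k$. Two liftings to a coefficient ring $A$ are *strictly equivalent* if they are conjugate by a matrix that reduces to the identity. A *deformation condition* for a continuous $\bar\rho:G_F\to GL_2(\mathbf k)$ is a collection of continuous liftings of $\bar\rho$ to coefficient rings, containing $\bar\rho$, closed under strict equivalence and change of coefficient ring, such that a lifting to a fibre product of Artinian coefficient rings belongs to it if both projections do, a lifting to an Artinian $A$ belongs to it if its image under some injection $A\hookrightarrow A'$ of Artinian coefficient rings does, and a lifting belongs to it if its reductions to all Artinian quotients do. A pair $(R,\rho)$ is *versal* for a collection $\mathcal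 D$ of liftings if $R$ is a coefficient ring, $\rho\in\mathcal D$ is a lifting to $R$, every lifting in $\mathcal D$ to a coefficient ring $A$ is strictly equivalent to the specialisation of $\rho$ along some morphism $R\to A$, and this morphism is unique for $A=\mathbf k[\epsilon]/(\epsilon^2)$. A deformation condition $\mathcal D$ with fixed determinant is *substantial* if it is smooth (its versal ring is a power series ring over $W$ in finitely many variables) and its tangent space has dimension at least $\dim_{\mathbf k}H^0(G_F,{\rm ad}^0\bar\rho)$. The *unramified* condition consists of all liftings with determinant $\chi$ that are trivial on $I_F$. A condition is of *Steinberg type* if there are a continuous character $\varepsilon:G_F\to W^\times$ with reduction $\bar\varepsilon$ and a basis in which $\bar\rho=\begin{pmatrix}\bar\chi&*\\0&1\end{pmatrix}\bar\varepsilon$, with $\bar\chi\neq1$ if $\bar\rho$ is semisimple, such that the condition consists of the liftings which, in that basis, are strictly equivalent to a representation $\begin{pmatrix}\chi&*\\0&1\end{pmatrix}\varepsilon$. A condition *corresponds* to a quotient $R/I$ of the versal ring if it consists of the liftings strictly equivalent to a specialisation of $\rho$ along a morphism that kills $I$. Let $h_n\in\mathbb Z[T]$ be given by $h_1=1$, $h_2=T$,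 $h_{n+2}=Th_{n+1}-h_n$. **Proposition.** Let $\bar\rho:G_F\to GL_2(\mathbf k)$ be continuous and unramified with $\bar\rho({\rm Frob})=\begin{pmatrix}q\alpha&0\\0&\alpha^{-1}\end{pmatrix}$, where $\alpha\in\mathbf k^\times$ and $q\alpha\ne\alpha^{-1}$ in $\mathbf k$. Let $\hat\alpha$ be the Teichmüller lift of $\alpha$. In each of the following cases a versal pair $(R,\rho)$ for the liftings of $\bar\rho$ with determinant $\chi$ exists; for every such pair there is an isomorphism of $W$-algebras from $R$ to the ring displayed, under which $\rho$, up to strict equivalence, is a representation of ${\rm Gal}(F^{\rm tr}/F)$ with the displayed values. (i) Suppose $\alpha^2\ne1$ and $q^2\alpha^2\neq1$ in $\mathbf k$. If $q\equiv1\bmod p$ then $R\cong W[[S,T]]/\langle(1+T)^q-(1+T)\rangle$ and $$\rho(\sigma)=\begin{pmatrix}q\hat\alpha(1+S)&0\\0&(\hat\alpha(1+S))^{-1}\end{pmatrix},\quad\rho(\tau)=\begin{pmatrix}1+T&0\\0&(1+T)^{-1}\end{pmatrix}.$$ If $q\not\equiv1\bmod p$ then $R\cong W[[S]]$, $\rho(\sigma)$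 is given by the same formula, and $\rho(\tau)=1$. In both cases a deformation condition with determinant $\chi$ is substantial if and only if it is the unramified condition. (ii) If $\alpha^2=1$ and $q^2\not\equiv1\bmod p$ then $R\cong W[[S,T]]/(ST)$ and $$\rho(\sigma)=\hat\alpha\begin{pmatrix}q(1+S)&0\\0&(1+S)^{-1}\end{pmatrix},\quad\rho(\tau)=\begin{pmatrix}1&T\\0&1\end{pmatrix}.$$ A deformation condition with determinant $\chi$ is substantial if and only if it is the unramified condition or of Steinberg type. (iii) If $\alpha^2=1$ and $q\equiv-1\bmod p$ then $R\cong W[[S,T_1,T_2]]/J$, where, with $\sqrt{1+T_1T_2}$ the square root that has constant term $1$, $$J=\big\langle T_1\big(q(1+S)^2-h_q(2\sqrt{1+T_1T_2})\big),\ T_2\big(1-q(1+S)^2h_q(2\sqrt{1+T_1T_2})\big)\big\rangle,$$ $$\rho(\sigma)=\hat\alpha\begin{pmatrix}q(1+S)&0\\0&(1+S)^{-1}\end{pmatrix},\quad\rho(\tau)=\begin{pmatrix}\sqrt{1+T_1T_2}&T_1\\T_2&\sqrt{1+T_1T_2}\end{pmatrix}.$$ A deformation condition with determinant $\chi$ is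 substantial if and only if it is the unramified condition or of Steinberg type. There are two ramified ones: the condition of Steinberg type with $\varepsilon({\rm Frob})=\hat\alpha$, which corresponds to the quotient $W[[S,T_1,T_2]]/(S,T_2)$, and the one with $\varepsilon({\rm Frob})=-\hat\alpha$ (for the basis in the opposite order), which corresponds to the quotient $W[[S,T_1,T_2]]/(T_1,\,1+q(1+S))$. -/

import Mathlib

universe u v

noncomputable section

open scoped MatrixGroups

namespace LocalDef

/-! ### Coefficient rings and liftings -/

section Coefficients

variable (p : ℕ) [Fact p.Prime] (k : Type u) [Field k]

/-- A coefficient ring: a complete Noetherian local algebra over the ring of Witt vectors `W(k)`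
with residue field `k`. The reduction map `res` to the residue field is recorded; it is compatible
with the canonical map `W(k) → k` (so it is surjective, and its kernel is the maximal ideal). -/
structure CoeffRing : Type (u + 1) where
  carrier : Type u
  [commRing : CommRing carrier]
  [algebra : Algebra (WittVector p k) carrier]
  [isLocal : IsLocalRing carrier]
  [isNoetherian : IsNoetherianRing carrier]
  [isComplete : IsAdicComplete (IsLocalRing.maximalIdeal carrier) carrier]
  res : carrier →+* k
  res_algebraMap : ∀ w, res (algebraMap (WittVector p k) carrier w) = WittVector.constantCoeff w

instance : CoeSort (CoeffRing p k) (Type u) := ⟨CoeffRing.carrier⟩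

attribute [instance] CoeffRing.commRing CoeffRing.algebra CoeffRing.isLocal
  CoeffRing.isNoetherian CoeffRing.isComplete

variable {p k}

/-- Morphisms of coefficient rings: `W(k)`-algebra maps inducing the identity on residue fields. -/
structure CoeffHom (A B : CoeffRing p k) where
  toAlgHom : A →ₐ[WittVector p k] B
  res_comp : ∀ a, B.res (toAlgHom a) = A.res a

variable (p k) in
/-- The dual numbers `k[ε]/(ε²)` as a coefficient ring, `W(k)` acting through `W(k) → k`. -/
def dualCoeff : CoeffRing p k :=
  letI alg : Algebra (WittVector p k) (DualNumber k) :=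
    ((algebraMap k (DualNumber k)).comp WittVector.constantCoeff).toAlgebra
  haveI complete : IsAdicComplete (IsLocalRing.maximalIdeal (DualNumber k)) (DualNumber k) := by
    have hsq : (IsLocalRing.maximalIdeal (DualNumber k)) ^ 2 = ⊥ := by
      rw [DualNumber.maximalIdeal_eq_span_singleton_eps, Ideal.span_singleton_pow]
      simp [pow_two]
    refine { haus' := fun x hx => ?_, prec' := fun f hf => ⟨f 2, fun n => ?_⟩ }
    · have h := hx 2
      rw [hsq] at h
      simpa using h
    · rcases le_total n 2 with h | h
      · exact hf h
      · have h2 := hf h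
        rw [hsq] at h2
        have h3 : f 2 = f n := by simpa [SModEq.bot] using h2
        rw [h3]
        exact SModEq.refl _
  { carrier := DualNumber k
    res := TrivSqZeroExt.fstHom k k k
    res_algebraMap := fun _ => rfl }

section Liftings

variable {G : Type v} [Group G]

/-- The representation over `B` obtained from one over `A` by a morphism `A → B`. -/
def push {A B : CoeffRing p k} (f : CoeffHom A B) (ρ : G →* GL (Fin 2) A) : G →* GL (Fin 2) B :=
  (Matrix.GeneralLinearGroup.map (f.toAlgHom : A →+* B)).comp ρ

/-- Conjugation by a matrix that reduces to the identity. -/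
def StrictEquiv {A : CoeffRing p k} (ρ ρ' : G →* GL (Fin 2) A) : Prop :=
  ∃ M : GL (Fin 2) A, Matrix.GeneralLinearGroup.map A.res M = 1 ∧ ∀ g, M * ρ g * M⁻¹ = ρ' g

variable [TopologicalSpace G]

/-- Continuity for the adic topology defined by the maximal ideal: for every `n`, the kernel of the
reduction modulo the `n`-th power of the maximal ideal is open. -/
def IsContRep {A : CoeffRing p k} (ρ : G →* GL (Fin 2) A) : Prop :=
  ∀ n : ℕ, IsOpen {g : G | ∀ i j,
    (ρ g : Matrix (Fin 2) (Fin 2) A) i j - (1 : Matrix (Fin 2) (Fin 2) A) i j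
      ∈ IsLocalRing.maximalIdeal A ^ n}

/-- Continuous liftings of the residual representation `ρbar`. -/
def IsLifting (ρbar : G →* GL (Fin 2) k) (A : CoeffRing p k) (ρ : G →* GL (Fin 2) A) : Prop :=
  IsContRep ρ ∧ (Matrix.GeneralLinearGroup.map A.res).comp ρ = ρbar

variable (p k G) in
/-- A collection of representations over coefficient rings. -/
abbrev Collection : Type (max (u + 1) v) :=
  ∀ A : CoeffRing.{u} p k, (G →* GL (Fin 2) A) → Prop

/-- Deformation conditions for `ρbar` in the sense of Mazur: a collection of liftings, closed under
strict equivalence and under change of coefficient rings, with the Mayer-Vietoris property for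
fibre products and descent along injections of Artinian coefficient rings, and determined on a
general coefficient ring by the Artinian quotients. -/
structure IsDeformationCondition (ρbar : G →* GL (Fin 2) k) (D : Collection p k G) : Prop where
  isLifting : ∀ A ρ, D A ρ → IsLifting ρbar A ρ
  residual : ∀ A ρ, Function.Bijective A.res → IsLifting ρbar A ρ → D A ρ
  strictEquiv : ∀ (A : CoeffRing p k) (ρ ρ' : G →* GL (Fin 2) A), StrictEquiv ρ ρ' → D A ρ → D A ρ'
  push : ∀ A B (f : CoeffHom A B) ρ, D A ρ → D B (push f ρ)
  /-- `P` is the fibre product of `A` and `B` over `C`. -/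
  fibreProduct : ∀ (P A B C : CoeffRing p k) (pA : CoeffHom P A) (pB : CoeffHom P B)
    (a : CoeffHom A C) (b : CoeffHom B C),
    IsArtinianRing P → IsArtinianRing A → IsArtinianRing B → IsArtinianRing C →
    (∀ z, a.toAlgHom (pA.toAlgHom z) = b.toAlgHom (pB.toAlgHom z)) →
    (∀ x y, a.toAlgHom x = b.toAlgHom y → ∃! z, pA.toAlgHom z = x ∧ pB.toAlgHom z = y) →
    ∀ ρ, IsLifting ρbar P ρ → D A (LocalDef.push pA ρ) → D B (LocalDef.push pB ρ) → D P ρ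
  injective : ∀ (A B : CoeffRing p k) (f : CoeffHom A B),
    IsArtinianRing A → IsArtinianRing B → Function.Injective f.toAlgHom →
    ∀ ρ, IsLifting ρbar A ρ → D B (LocalDef.push f ρ) → D A ρ
  limit : ∀ (A : CoeffRing p k) ρ, IsLifting ρbar A ρ →
    (∀ (B : CoeffRing p k) (f : CoeffHom A B), IsArtinianRing B →
      Function.Surjective f.toAlgHom → D B (LocalDef.push f ρ)) → D A ρ

/-- `(R, ρ)` is a versal deformation ring and versal representation for the collection `D`: every
member of `D` is strictly equivalent to a specialisation of `ρ`, and the specialisation is unique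
when the coefficient ring is `k[ε]/(ε²)`. -/
structure IsVersal (D : Collection p k G) (R : CoeffRing p k) (ρ : G →* GL (Fin 2) R) : Prop where
  mem : D R ρ
  exists_hom : ∀ A ρ', D A ρ' → ∃ f : CoeffHom R A, StrictEquiv (push f ρ) ρ'
  unique : ∀ ρ', D (dualCoeff p k) ρ' → ∀ f f' : CoeffHom R (dualCoeff p k),
    StrictEquiv (push f ρ) ρ' → StrictEquiv (push f' ρ) ρ' → f = f'

/-- All members of `D` have determinant `d`. -/
def HasDet (d : G →* (WittVector p k)ˣ) (D : Collection p k G) : Prop :=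
  ∀ A ρ, D A ρ → ∀ g, (ρ g : Matrix (Fin 2) (Fin 2) A).det = algebraMap (WittVector p k) A (d g)

/-- The collection of all liftings of `ρbar` with determinant `d`. -/
def liftingsWithDet (ρbar : G →* GL (Fin 2) k) (d : G →* (WittVector p k)ˣ) :
    Collection p k G := fun A ρ =>
  IsLifting ρbar A ρ ∧
    ∀ g, (ρ g : Matrix (Fin 2) (Fin 2) A).det = algebraMap (WittVector p k) A (d g)

/-- `D` is smooth: its versal deformation ring is a power series ring over `W(k)`. -/
def IsSmooth (D : Collection p k G) : Prop :=
  ∃ (R : CoeffRing p k) (ρ : G →* GL (Fin 2) R), IsVersal D R ρ ∧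
    ∃ n : ℕ, Nonempty (R ≃ₐ[WittVector p k] MvPowerSeries (Fin n) (WittVector p k))

end Liftings

section Tangent

variable {G : Type v} [Group G]

/-- The 1-coboundaries of `G` with values in `ad ρbar`. -/
def coboundaries (ρbar : G →* GL (Fin 2) k) : Submodule k (G → Matrix (Fin 2) (Fin 2) k) :=
  LinearMap.range
    ({ toFun := fun X g => X - (ρbar g : Matrix (Fin 2) (Fin 2) k) * X *
          ((ρbar g)⁻¹ : GL (Fin 2) k)
       map_add' := fun X Y => by
         funext g
         simp only [Pi.add_apply, mul_add, add_mul]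
         abel
       map_smul' := fun c X => by
         funext g
         simp [smul_sub] } :
      Matrix (Fin 2) (Fin 2) k →ₗ[k] (G → Matrix (Fin 2) (Fin 2) k))

/-- The cocycles `c : G → ad ρbar` such that `(1 + ε c) ρbar` belongs to `D`. -/
def tangentCocycles (ρbar : G →* GL (Fin 2) k) (D : Collection p k G) :
    Set (G → Matrix (Fin 2) (Fin 2) k) :=
  {c | ∃ ρ : G →* GL (Fin 2) (DualNumber k), D (dualCoeff p k) ρ ∧ ∀ g i j,
    (ρ g : Matrix (Fin 2) (Fin 2) (DualNumber k)) i j =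
      TrivSqZeroExt.inl ((ρbar g : Matrix (Fin 2) (Fin 2) k) i j) +
      TrivSqZeroExt.inr ((c g * (ρbar g : Matrix (Fin 2) (Fin 2) k)) i j)}

/-- The tangent space of `D`, inside cochains modulo coboundaries (so inside `H¹(G, ad ρbar)`).
For a deformation condition the classes of the cocycles in `tangentCocycles` already form a
subspace, so that taking the span changes nothing. -/
def tangentSpace (ρbar : G →* GL (Fin 2) k) (D : Collection p k G) :
    Submodule k ((G → Matrix (Fin 2) (Fin 2) k) ⧸ coboundaries ρbar) :=
  Submodule.span k ((coboundaries ρbar).mkQ '' tangentCocycles ρbar D)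

/-- `H⁰(G, ad⁰ ρbar)`: the trace zero matrices that commute with the image of `ρbar`. -/
def adZeroInvariants (ρbar : G →* GL (Fin 2) k) : Submodule k (Matrix (Fin 2) (Fin 2) k) where
  carrier := {X | X.trace = 0 ∧ ∀ g, (ρbar g : Matrix (Fin 2) (Fin 2) k) * X = X * ρbar g}
  add_mem' := fun {X Y} hX hY => ⟨by simp [hX.1, hY.1], fun g => by
    rw [mul_add, add_mul, hX.2 g, hY.2 g]⟩
  zero_mem' := ⟨by simp, fun g => by simp⟩
  smul_mem' := fun c X hX => ⟨by simp [hX.1], fun g => by simp [hX.2 g]⟩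

end Tangent

end Coefficients

/-! ### Local fields -/

section LocalFields

variable (l : ℕ) [Fact l.Prime]

/-- The valuation ring of an algebraic extension `L` of `ℚ_l`: the unit ball for the unique
extension of the `l`-adic absolute value. -/
def integerRing (L : Type v) [Field L] [Algebra ℚ_[l] L] [Algebra.IsAlgebraic ℚ_[l] L] :
    ValuationSubring L where
  carrier := {x | spectralNorm ℚ_[l] L x ≤ 1}
  mul_mem' := fun {x y} hx hy => by
    have h : spectralNorm ℚ_[l] L (x * y) = spectralNorm ℚ_[l] L x * spectralNorm ℚ_[l] L y :=
      map_mul (spectralMulAlgNorm ℚ_[l] L) x y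
    change spectralNorm ℚ_[l] L (x * y) ≤ 1
    rw [h]
    exact mul_le_one₀ hx (spectralNorm_nonneg y) hy
  one_mem' := (spectralNorm_one (K := ℚ_[l]) (L := L)).le
  add_mem' := fun {x y} hx hy => (isNonarchimedean_spectralNorm x y).trans (max_le hx hy)
  zero_mem' := by
    change spectralNorm ℚ_[l] L 0 ≤ 1
    rw [spectralNorm_zero]
    exact zero_le_one
  neg_mem' := fun {x} hx => by
    change spectralNorm ℚ_[l] L (-x) ≤ 1
    rw [spectralNorm_neg (Algebra.IsAlgebraic.isAlgebraic x)]
    exact hx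
  mem_or_inv_mem' := fun x => by
    change spectralNorm ℚ_[l] L x ≤ 1 ∨ spectralNorm ℚ_[l] L x⁻¹ ≤ 1
    have h : spectralNorm ℚ_[l] L x⁻¹ = (spectralNorm ℚ_[l] L x)⁻¹ :=
      map_inv₀ (spectralMulAlgNorm ℚ_[l] L) x
    rw [h]
    rcases le_total (spectralNorm ℚ_[l] L x) 1 with h1 | h1
    · exact Or.inl h1
    · exact Or.inr (inv_le_one_of_one_le₀ h1)

/-- The order of the residue field. -/
def residueCard (F : Type v) [Field F] [Algebra ℚ_[l] F] [Algebra.IsAlgebraic ℚ_[l] F] : ℕ :=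
  Nat.card (IsLocalRing.ResidueField (integerRing l F))

variable (F : Type v) [Field F] [Algebra ℚ_[l] F]

/-- The inertia elements of the Galois group of `L/F`: they act trivially on the residue field
of `L`. -/
def inertia (L : Type v) [Field L] [Algebra ℚ_[l] L] [Algebra F L] : Set (L ≃ₐ[F] L) :=
  {g | ∀ x : L, spectralNorm ℚ_[l] L x ≤ 1 → spectralNorm ℚ_[l] L (g x - x) < 1}

/-- The (arithmetic) Frobenius elements of the Galois group of `L/F`: they act as `x ↦ x ^ q` on
the residue field of `L`, where `q` is the order of the residue field of `F`. -/
def IsFrobenius [Algebra.IsAlgebraic ℚ_[l] F] (L : Type v) [Field L] [Algebra ℚ_[l] L]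
    [Algebra F L] (g : L ≃ₐ[F] L) : Prop :=
  ∀ x : L, spectralNorm ℚ_[l] L x ≤ 1 →
    spectralNorm ℚ_[l] L (g x - x ^ residueCard l F) < 1

/-- The extension to `L` of the `l`-adic absolute value, as a multiplicative map. -/
def absHom (L : Type v) [Field L] [Algebra ℚ_[l] L] [Algebra.IsAlgebraic ℚ_[l] L] : L →* ℝ where
  toFun := spectralNorm ℚ_[l] L
  map_one' := spectralNorm_one
  map_mul' := spectralAlgNorm_mul

/-- The value group `|E^×|` of an intermediate field `E` of the algebraic closure of `F`. -/
def valueGroup [Algebra.IsAlgebraic ℚ_[l] (AlgebraicClosure F)]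
    (E : IntermediateField F (AlgebraicClosure F)) : Subgroup ℝˣ :=
  ((Units.map (absHom l (AlgebraicClosure F))).comp
    (Units.map (E.val : E →* AlgebraicClosure F))).range

/-- `E/F` is finite and tamely ramified: its ramification index `(|E^×| : |F^×|)` is prime to the
residue characteristic `l` (residue field extensions of `F` are separable). -/
def IsTame [Algebra.IsAlgebraic ℚ_[l] (AlgebraicClosure F)]
    (E : IntermediateField F (AlgebraicClosure F)) : Prop :=
  FiniteDimensional F E ∧ Nat.Coprime l ((valueGroup l F ⊥).relIndex (valueGroup l F E))

/-- The maximal tamely ramified extension of `F`: the compositum of all finite tamely ramified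
extensions of `F` in the algebraic closure. -/
def maxTame [Algebra.IsAlgebraic ℚ_[l] (AlgebraicClosure F)] :
    IntermediateField F (AlgebraicClosure F) :=
  ⨆ E : {E : IntermediateField F (AlgebraicClosure F) // IsTame l F E}, E.1

theorem valueGroup_map_le [Algebra.IsAlgebraic ℚ_[l] (AlgebraicClosure F)]
    (s : AlgebraicClosure F ≃ₐ[F] AlgebraicClosure F)
    (E : IntermediateField F (AlgebraicClosure F)) :
    valueGroup l F E ≤ valueGroup l F (E.map (s : AlgebraicClosure F →ₐ[F] AlgebraicClosure F)) := by
  rintro _ ⟨x, rfl⟩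
  refine ⟨Units.map ((E.equivMap (s : AlgebraicClosure F →ₐ[F] AlgebraicClosure F)) :
    E →* E.map (s : AlgebraicClosure F →ₐ[F] AlgebraicClosure F)) x, ?_⟩
  ext
  exact (spectralNorm_eq_of_equiv (s.restrictScalars ℚ_[l]) (x : E).1).symm

theorem valueGroup_map [Algebra.IsAlgebraic ℚ_[l] (AlgebraicClosure F)]
    (s : AlgebraicClosure F ≃ₐ[F] AlgebraicClosure F)
    (E : IntermediateField F (AlgebraicClosure F)) :
    valueGroup l F (E.map (s : AlgebraicClosure F →ₐ[F] AlgebraicClosure F)) =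
      valueGroup l F E := by
  refine le_antisymm ?_ (valueGroup_map_le l F s E)
  refine (valueGroup_map_le l F s.symm _).trans (le_of_eq ?_)
  rw [IntermediateField.map_map]
  congr 1
  have : ((s.symm : AlgebraicClosure F →ₐ[F] AlgebraicClosure F).comp
      (s : AlgebraicClosure F →ₐ[F] AlgebraicClosure F)) = AlgHom.id F _ := by
    ext x
    simp
  rw [this, IntermediateField.map_id]

theorem IsTame.map [Algebra.IsAlgebraic ℚ_[l] (AlgebraicClosure F)]
    (s : AlgebraicClosure F ≃ₐ[F] AlgebraicClosure F)
    {E : IntermediateField F (AlgebraicClosure F)} (hE : IsTame l F E) :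
    IsTame l F (E.map (s : AlgebraicClosure F →ₐ[F] AlgebraicClosure F)) := by
  have := hE.1
  refine ⟨LinearEquiv.finiteDimensional
    (E.equivMap (s : AlgebraicClosure F →ₐ[F] AlgebraicClosure F)).toLinearEquiv, ?_⟩
  rw [valueGroup_map]
  exact hE.2

instance [Algebra.IsAlgebraic ℚ_[l] (AlgebraicClosure F)] : Normal F (maxTame l F) := by
  rw [IntermediateField.normal_iff_forall_map_le']
  intro s
  rw [maxTame, IntermediateField.map_iSup]
  exact iSup_le fun E => le_iSup
    (fun E : {E : IntermediateField F (AlgebraicClosure F) // IsTame l F E} => E.1)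
    ⟨_, E.2.map l F s⟩

instance [FiniteDimensional ℚ_[l] F] : Algebra.IsAlgebraic ℚ_[l] (AlgebraicClosure F) :=
  Algebra.IsAlgebraic.trans ℚ_[l] F (AlgebraicClosure F)

/-- The restriction map from the absolute Galois group to the tame Galois group. -/
def tameRestrict [Algebra.IsAlgebraic ℚ_[l] (AlgebraicClosure F)] :
    (AlgebraicClosure F ≃ₐ[F] AlgebraicClosure F) →* (maxTame l F ≃ₐ[F] maxTame l F) :=
  AlgEquiv.restrictNormalHom (maxTame l F)

end LocalFields

/-! ### Deformation conditions for Galois representations of local fields -/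

section Galois

variable {p : ℕ} [Fact p.Prime] {k : Type u} [Field k] [CharP k p]

variable (p k) in
/-- The `p`-adic cyclotomic character with values in `W(k)^×`. -/
def cyclo (F : Type v) [Field F] :
    (AlgebraicClosure F ≃ₐ[F] AlgebraicClosure F) →* (WittVector p k)ˣ :=
  (Units.map (((WittVector.map (ZMod.castHom (dvd_refl p) k)).comp
      ((WittVector.equiv p).symm : ℤ_[p] →+* WittVector p (ZMod p)) :
        ℤ_[p] →+* WittVector p k) : ℤ_[p] →* WittVector p k)).comp
    ((cyclotomicCharacter (AlgebraicClosure F) p).comp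
      (MulSemiringAction.toRingAut (AlgebraicClosure F ≃ₐ[F] AlgebraicClosure F)
        (AlgebraicClosure F)))

variable (l : ℕ) [Fact l.Prime] {F : Type v} [Field F] [Algebra ℚ_[l] F]

/-- Substantial deformation conditions: smooth, with
`dim t ≥ dim H⁰(G_F, ad⁰ ρbar) + [F : ℚ_p] δ`, where `δ` is `1` if `F` has residue characteristic
`p` and `0` otherwise. -/
def IsSubstantial (ρbar : (AlgebraicClosure F ≃ₐ[F] AlgebraicClosure F) →* GL (Fin 2) k)
    (D : Collection p k (AlgebraicClosure F ≃ₐ[F] AlgebraicClosure F)) : Prop :=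
  IsDeformationCondition ρbar D ∧ IsSmooth D ∧
    Module.finrank k (adZeroInvariants ρbar) + (if l = p then Module.finrank ℚ_[l] F else 0) ≤
      Module.finrank k (tangentSpace ρbar D)

/-- `D` is the collection of all unramified liftings of `ρbar` with determinant `d`. -/
def IsUnramifiedCondition
    (ρbar : (AlgebraicClosure F ≃ₐ[F] AlgebraicClosure F) →* GL (Fin 2) k)
    (d : (AlgebraicClosure F ≃ₐ[F] AlgebraicClosure F) →* (WittVector p k)ˣ)
    (D : Collection p k (AlgebraicClosure F ≃ₐ[F] AlgebraicClosure F)) : Prop :=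
  ∀ A ρ, D A ρ ↔ liftingsWithDet ρbar d A ρ ∧ ∀ g ∈ inertia l F (AlgebraicClosure F), ρ g = 1

/-- `D` is of Steinberg type for the continuous character `ε` with values in `W(k)^×`: in a suitable
basis (change of basis `M`) `ρbar` has the shape `(χ *; 0 1) ε` modulo `p`, with `χ` non-trivial
modulo `p` if `ρbar` is semisimple, and, in that basis, `D` is the collection of the liftings
strictly equivalent to a representation `(χ *; 0 1) ε`. Here `χ` is the cyclotomic character. -/
def IsSteinbergCondition
    (ρbar : (AlgebraicClosure F ≃ₐ[F] AlgebraicClosure F) →* GL (Fin 2) k)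
    (ε : (AlgebraicClosure F ≃ₐ[F] AlgebraicClosure F) →* (WittVector p k)ˣ)
    (D : Collection p k (AlgebraicClosure F ≃ₐ[F] AlgebraicClosure F)) : Prop :=
  (∀ n : ℕ, IsOpen {g | (ε g : WittVector p k) - 1 ∈ Ideal.span {(p : WittVector p k)} ^ n}) ∧
  ∃ M : GL (Fin 2) k,
    (∀ g, (M * ρbar g * M⁻¹) 0 0 = WittVector.constantCoeff
          ((cyclo p k F g * ε g : _ˣ) : WittVector p k) ∧
      (M * ρbar g * M⁻¹) 1 0 = 0 ∧
      (M * ρbar g * M⁻¹) 1 1 = WittVector.constantCoeff (ε g : WittVector p k)) ∧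
    ((∃ N : GL (Fin 2) k, ∀ g, (N * ρbar g * N⁻¹) 0 1 = 0 ∧ (N * ρbar g * N⁻¹) 1 0 = 0) →
      ∃ g, WittVector.constantCoeff (cyclo p k F g : WittVector p k) ≠ 1) ∧
    ∀ A ρ, D A ρ ↔ IsLifting ρbar A ρ ∧
      ∃ N : GL (Fin 2) A, Matrix.GeneralLinearGroup.map A.res N = M ∧
        ∀ g, (N * ρ g * N⁻¹) 0 0 =
            algebraMap (WittVector p k) A ((cyclo p k F g * ε g : _ˣ) : WittVector p k) ∧
          (N * ρ g * N⁻¹) 1 0 = 0 ∧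
          (N * ρ g * N⁻¹) 1 1 = algebraMap (WittVector p k) A (ε g : WittVector p k)

/-- The isomorphism `e : R ≃ Q` presents the representation `ρ` over `R` on the tame Galois group:
up to strict equivalence `ρ` factors through a representation of the tame Galois group that takes
(after applying `e`) the values `Mσ` at `σ` and `Mτ` at `τ`. -/
def IsTamePresentation [Algebra.IsAlgebraic ℚ_[l] (AlgebraicClosure F)]
    (σ τ : maxTame l F ≃ₐ[F] maxTame l F)
    {R : CoeffRing p k} (ρ : (AlgebraicClosure F ≃ₐ[F] AlgebraicClosure F) →* GL (Fin 2) R)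
    {Q : Type u} [CommRing Q] [Algebra (WittVector p k) Q] (e : R ≃ₐ[WittVector p k] Q)
    (Mσ Mτ : Matrix (Fin 2) (Fin 2) Q) : Prop :=
  ∃ ρt : (maxTame l F ≃ₐ[F] maxTame l F) →* GL (Fin 2) R,
    StrictEquiv ρ (ρt.comp (tameRestrict l F)) ∧
    (ρt σ : Matrix (Fin 2) (Fin 2) R).map e = Mσ ∧
    (ρt τ : Matrix (Fin 2) (Fin 2) R).map e = Mτ

/-- `D` corresponds to the quotient of `R` by the ideal `I` (where `ρ` is versal over `R`): the
members of `D` are the representations strictly equivalent to a specialisation of `ρ` along a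
morphism that factors through `R ⧸ I`. -/
def CorrespondsTo {G : Type v} [Group G] {R : CoeffRing p k} (ρ : G →* GL (Fin 2) R)
    (I : Ideal R) (D : Collection p k G) : Prop :=
  ∀ A ρ', D A ρ' ↔ ∃ f : CoeffHom R A, (∀ x ∈ I, f.toAlgHom x = 0) ∧ StrictEquiv (push f ρ) ρ'

end Galois

/-- The polynomials `h_n` with `h_1 = 1`, `h_2 = T`, `h_{n+2} = T h_{n+1} - h_n` (so `h_0 = 0`). -/
def hPoly : ℕ → Polynomial ℤ
  | 0 => 0
  | 1 => 1
  | n + 2 => Polynomial.X * hPoly (n + 1) - hPoly n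

section Presentations

variable {P : Type u} [CommRing P]

/-- The diagonal matrix with entries `q a (1 + S)` and `(a (1 + S))⁻¹`; it is used where
`a (1 + S)` is a unit. -/
def diagMatrix (q : ℕ) (a S : P) : Matrix (Fin 2) (Fin 2) P :=
  !![(q : P) * a * (1 + S), 0; 0, Ring.inverse (a * (1 + S))]

/-- The matrix `a (q (1 + S) 0; 0 (1 + S)⁻¹)`; it is used where `1 + S` is a unit. -/
def scaledDiagMatrix (q : ℕ) (a S : P) : Matrix (Fin 2) (Fin 2) P :=
  a • !![(q : P) * (1 + S), 0; 0, Ring.inverse (1 + S)]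

/-- The ideal `(T₁ (q (1 + S)² - h_q(2r)), T₂ (1 - q (1 + S)² h_q(2r)))`. -/
def oddIdeal (q : ℕ) (S T₁ T₂ r : P) : Ideal P :=
  Ideal.span
    {T₁ * ((q : P) * (1 + S) ^ 2 - Polynomial.aeval (2 * r) (hPoly q)),
     T₂ * (1 - (q : P) * (1 + S) ^ 2 * Polynomial.aeval (2 * r) (hPoly q))}

end Presentations

end LocalDef

end

set_option linter.unusedSectionVars false
noncomputable section
open scoped MatrixGroups
namespace LocalDef

/-! ### Complete local rings -/

/-! ### Quotients of complete local rings and the topology given by the variables of a power series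
ring. -/

section Complete

open IsLocalRing

/-! A lifting is trivial on inertia modulo the maximal ideal, so modulo each power of the maximal
ideal inertia acts through a `p`-group. As `l ≠ p`, the open normal subgroups with this property
have tamely ramified fixed fields. A lifting is therefore the same as a pair of matrices, the images
of `σ` and `τ`, with the prescribed reductions and with `σ τ σ⁻¹ = τ ^ q`. The structure `TameData`
records this; `tameData` proves it, by estimates of absolute values for the relation and by Kummer
theory for the universal property. What remains is matrix algebra for an abstract group, collected
under `LocalSetup`.

Since `ρbar σ` has distinct eigenvalues, Hensel's lemma diagonalises the image of `σ` by a matrix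
that reduces to the identity (`exists_diagonalize`), and the fixed determinant leaves one parameter
`S`. Let `w, x, y, z` be the entries of the image of `τ`. By the Cayley-Hamilton theorem the `q`-th
power of a matrix `t` of determinant one is `h_q(tr t) t - h_{q-1}(tr t)`, so the relation becomes
four scalar equations (`NormalForm`). The equations for `x`, `y` and `w - z` have cofactors with
residues `q (α² - 1)`, `1 - q² α²` and `q - 1`; whenever such a cofactor is a unit the unknown
vanishes. Solving the surviving equations gives the rings of the three cases. Specialisations exist
by evaluating power series. They are unique over the dual numbers because conjugation by a matrix
congruent to one changes, to first order, neither `τ` nor the diagonal of `σ`. Two versal pairs are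
isomorphic: uniqueness over the dual numbers makes the maps between them surjective
(`CoeffHom.surjective_of_dual`), and a surjective endomorphism of a Noetherian ring is injective.

The invariants of `ad⁰` form a line, so the versal ring of a substantial condition is a power series
ring `R` in at least one variable. It is a domain with a point in `W`. Over a domain the equations,
such as `S x = 0`, split into factors, and the versal representation is unramified or satisfies one
of the conditions `special α` and `special (-α)` (`mem_of_isDomain`). The only other possibility,
`x` and `y` both nonzero, would force `τ ^ (q + 1) = 1`, whereas for odd `p` a matrix over `R` that
reduces to the identity has no finite order except one (`eq_one_of_pow_eq_one`). Each of the three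
candidate conditions has versal ring `W[[X]]`. This ring then surjects onto `R`, and `R` surjects
onto it, so the two conditions coincide (`eq_of_mem_of_isVersal_unit`).

Finally, the special conditions are those of Steinberg type: the shape `(χ *; 0 1) ε` says that the
second row of the change of basis is a common left eigenvector with character `ε`, and the second
row and `ε σ` leave only the slopes `α` and, when `q ≡ -1`, also `-α` (`special_iff_hasShape`,
`eq_special_of_isSteinbergFor`). -/

theorem isAdicComplete_maximalIdeal_quotient {R : Type*} [CommRing R] [IsLocalRing R]
    [IsNoetherianRing R] [IsAdicComplete (maximalIdeal R) R] (J : Ideal R) [IsLocalRing (R ⧸ J)] :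
    IsAdicComplete (maximalIdeal (R ⧸ J)) (R ⧸ J) := by
  -- Precompleteness is surjectivity of the map to the completion, and completion preserves
  -- surjections.
  have h1 : IsPrecomplete (maximalIdeal R) (R ⧸ J) := by
    rw [← AdicCompletion.of_surjective_iff]
    intro y
    obtain ⟨z, rfl⟩ := AdicCompletion.map_surjective (maximalIdeal R)
      (f := (Submodule.mkQ J : R →ₗ[R] R ⧸ J)) (Submodule.mkQ_surjective J) y
    obtain ⟨x, rfl⟩ := AdicCompletion.of_surjective (maximalIdeal R) R z
    exact ⟨Submodule.mkQ J x, by rw [AdicCompletion.map_of]⟩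
  have h2 : IsAdicComplete (maximalIdeal R) (R ⧸ J) := { h1 with }
  have h3 : (maximalIdeal R).map (algebraMap R (R ⧸ J)) = maximalIdeal (R ⧸ J) := by
    have := IsLocalRing.map_maximalIdeal_of_surjective (Ideal.Quotient.mk J)
      Ideal.Quotient.mk_surjective
    simpa using this
  rw [← h3, IsAdicComplete.map_algebraMap_iff]
  exact h2

variable {σ : Type*} {R : Type*} [CommRing R]

/-- Every further factor from the ideal of the variables has no constant term, so it raises the
order by at least one. -/
theorem coeff_eq_zero_of_mem_span_X_pow {n : ℕ} {f : MvPowerSeries σ R}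
    (hf : f ∈ (Ideal.span (Set.range MvPowerSeries.X) : Ideal (MvPowerSeries σ R)) ^ n)
    (d : σ →₀ ℕ) (hd : d.degree < n) : MvPowerSeries.coeff d f = 0 := by
  classical
  induction n generalizing f d with
  | zero => omega
  | succ n ih =>
    rw [pow_succ] at hf
    induction hf using Submodule.mul_induction_on' with
    | add x _ y _ hx hy => rw [map_add, hx, hy, add_zero]
    | mem_mul_mem x hx y hy =>
      rw [MvPowerSeries.coeff_mul]
      refine Finset.sum_eq_zero fun ⟨a, b⟩ hab => ?_
      rw [Finset.HasAntidiagonal.mem_antidiagonal] at hab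
      have hab' : a.degree + b.degree = d.degree := by rw [← hab, map_add]
      by_cases ha : a.degree < n
      · rw [ih hx a ha, zero_mul]
      · have hb : b = 0 := by
          rw [← Finsupp.degree_eq_zero_iff]; omega
        have : MvPowerSeries.coeff b y = 0 := by
          rw [hb, MvPowerSeries.coeff_zero_eq_constantCoeff_apply, ← RingHom.mem_ker]
          refine (Ideal.span_le.mpr ?_ : Ideal.span _ ≤ RingHom.ker _) hy
          rintro _ ⟨i, rfl⟩
          simp [RingHom.mem_ker]
        rw [this, mul_zero]

/-- The truncations form a Cauchy sequence for the ideal of the variables, for which the ring is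
complete. Comparison of coefficients identifies the limit with `f`, and the rate of convergence is
the assertion. No explicit division of the tail by monomials is needed. -/
theorem truncTotal_sub_mem_span_X_pow [Finite σ] (n : ℕ) (f : MvPowerSeries σ R) :
    ((f.truncTotal n : MvPolynomial σ R) : MvPowerSeries σ R) - f ∈
      (Ideal.span (Set.range MvPowerSeries.X) : Ideal (MvPowerSeries σ R)) ^ n := by
  set I : Ideal (MvPowerSeries σ R) := Ideal.span (Set.range MvPowerSeries.X) with hI
  have hmap : (MvPolynomial.idealOfVars σ R).map
      (MvPolynomial.coeToMvPowerSeries.ringHom (σ := σ) (R := R)) ≤ I := by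
    rw [MvPolynomial.idealOfVars, Ideal.map_span, Ideal.span_le]
    rintro _ ⟨_, ⟨i, rfl⟩, rfl⟩
    exact Ideal.subset_span ⟨i, by simp⟩
  obtain ⟨L, hL⟩ := IsPrecomplete.prec (I := I) (M := MvPowerSeries σ R) inferInstance
    (f := fun N => ((f.truncTotal N : MvPolynomial σ R) : MvPowerSeries σ R)) (by
      intro a b hab
      rw [SModEq.sub_mem, smul_eq_mul, Ideal.mul_top]
      have h := MvPowerSeries.truncTotal_sub_truncTotal_mem_pow_idealOfVars le_rfl hab f
      have h2 := Ideal.mem_map_of_mem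
        (MvPolynomial.coeToMvPowerSeries.ringHom (σ := σ) (R := R)) h
      rw [Ideal.map_pow, map_sub] at h2
      have h3 := Ideal.pow_right_mono hmap a h2
      simpa using h3)
  have hLf : L = f := by
    ext d
    have h := hL (d.degree + 1)
    rw [SModEq.sub_mem, smul_eq_mul, Ideal.mul_top] at h
    have h' := coeff_eq_zero_of_mem_span_X_pow h d (Nat.lt_succ_self _)
    rw [map_sub, MvPolynomial.coeff_coe,
      MvPowerSeries.coeff_truncTotal _ (Nat.lt_succ_self _), sub_eq_zero] at h'
    exact h'.symm
  have h := hL n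
  rwa [SModEq.sub_mem, smul_eq_mul, Ideal.mul_top, hLf] at h

end Complete

/-! ### Completeness of power series rings over a complete local ring. -/

section PowerSeriesComplete

open IsLocalRing

variable {σ : Type*} {W : Type*} [CommRing W] [IsLocalRing W]

theorem mem_maximalIdeal_mvPowerSeries {f : MvPowerSeries σ W} :
    f ∈ maximalIdeal (MvPowerSeries σ W) ↔
      MvPowerSeries.constantCoeff f ∈ maximalIdeal W := by
  rw [mem_maximalIdeal, mem_maximalIdeal, mem_nonunits_iff, mem_nonunits_iff,
    MvPowerSeries.isUnit_iff_constantCoeff]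

theorem coeff_mem_of_mem_maximalIdeal_pow {n : ℕ} {f : MvPowerSeries σ W}
    (hf : f ∈ maximalIdeal (MvPowerSeries σ W) ^ n) (d : σ →₀ ℕ) :
    MvPowerSeries.coeff d f ∈ maximalIdeal W ^ (n - d.degree) := by
  classical
  induction n generalizing f d with
  | zero => simp
  | succ n ih =>
    rw [pow_succ] at hf
    induction hf using Submodule.mul_induction_on' with
    | add x _ y _ hx hy => rw [map_add]; exact Ideal.add_mem _ hx hy
    | mem_mul_mem x hx y hy =>
      rw [MvPowerSeries.coeff_mul]
      refine Ideal.sum_mem _ fun ⟨a, b⟩ hab => ?_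
      rw [Finset.HasAntidiagonal.mem_antidiagonal] at hab
      have hab' : a.degree + b.degree = d.degree := by rw [← hab, map_add]
      by_cases hb : b = 0
      · have hy' : MvPowerSeries.coeff b y ∈ maximalIdeal W := by
          rw [hb, MvPowerSeries.coeff_zero_eq_constantCoeff_apply]
          exact mem_maximalIdeal_mvPowerSeries.mp hy
        have h2 := Ideal.mul_mem_mul (ih hx a) hy'
        rw [← pow_succ] at h2
        refine Ideal.pow_le_pow_right ?_ h2
        subst hb
        simp only [map_zero, add_zero] at hab'
        omega
      · have : b.degree ≠ 0 := by rwa [Ne, Finsupp.degree_eq_zero_iff]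
        exact Ideal.mul_mem_right _ _ (Ideal.pow_le_pow_right (by omega) (ih hx a))

/-- The part of total degree at least `n` lies in the `n`-th power of the ideal of the variables. Of
the finitely many remaining terms, one of degree `d` gets `n - d` factors from its coefficient and
`d` factors from its monomial. -/
theorem mem_maximalIdeal_pow_of_coeff_mem [Finite σ] {n : ℕ} {f : MvPowerSeries σ W}
    (hf : ∀ d : σ →₀ ℕ, MvPowerSeries.coeff d f ∈ maximalIdeal W ^ (n - d.degree)) :
    f ∈ maximalIdeal (MvPowerSeries σ W) ^ n := by
  have hX : (Ideal.span (Set.range MvPowerSeries.X) : Ideal (MvPowerSeries σ W)) ≤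
      maximalIdeal (MvPowerSeries σ W) := by
    rw [Ideal.span_le]
    rintro _ ⟨i, rfl⟩
    exact mem_maximalIdeal_mvPowerSeries.mpr (by simp)
  have hC : (maximalIdeal W).map (MvPowerSeries.C (σ := σ)) ≤
      maximalIdeal (MvPowerSeries σ W) := by
    rw [Ideal.map_le_iff_le_comap]
    intro w hw
    rw [Ideal.mem_comap]
    exact mem_maximalIdeal_mvPowerSeries.mpr (by simpa using hw)
  have h1 := Ideal.pow_right_mono hX n (truncTotal_sub_mem_span_X_pow n f)
  rw [← sub_sub_self (((f.truncTotal n : MvPolynomial σ W) : MvPowerSeries σ W)) f]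
  refine Ideal.sub_mem _ ?_ h1
  set P := f.truncTotal n
  rw [P.as_sum, ← MvPolynomial.coeToMvPowerSeries.ringHom_apply, map_sum]
  refine Ideal.sum_mem _ fun d hd => ?_
  rw [MvPolynomial.coeToMvPowerSeries.ringHom_apply, MvPolynomial.coe_monomial]
  have hdn : d.degree < n := by
    by_contra h
    rw [MvPolynomial.mem_support_iff] at hd
    exact hd (MvPowerSeries.coeff_truncTotal_eq_zero _ (not_lt.mp h))
  have hc : P.coeff d ∈ maximalIdeal W ^ (n - d.degree) := by
    rw [MvPowerSeries.coeff_truncTotal _ hdn]; exact hf d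
  have hm : (MvPowerSeries.monomial d (P.coeff d) : MvPowerSeries σ W) =
      MvPowerSeries.C (P.coeff d) * d.prod fun i e => MvPowerSeries.X i ^ e := by
    have := MvPolynomial.monomial_eq (s := d) (a := P.coeff d)
    have h2 := congrArg (MvPolynomial.coeToMvPowerSeries.ringHom (σ := σ) (R := W)) this
    simpa only [map_mul, Finsupp.prod, map_prod, map_pow, MvPolynomial.coeToMvPowerSeries.ringHom_apply,
      MvPolynomial.coe_X, MvPolynomial.coe_C, MvPolynomial.coe_monomial] using h2
  have hpow : maximalIdeal (MvPowerSeries σ W) ^ n =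
      maximalIdeal (MvPowerSeries σ W) ^ (n - d.degree) *
        maximalIdeal (MvPowerSeries σ W) ^ d.degree := by
    rw [← pow_add, Nat.sub_add_cancel hdn.le]
  rw [hm, hpow]
  refine Ideal.mul_mem_mul ?_ ?_
  · have := Ideal.mem_map_of_mem (MvPowerSeries.C (σ := σ)) hc
    rw [Ideal.map_pow] at this
    exact Ideal.pow_right_mono hC _ this
  · rw [Finsupp.degree_apply, Finsupp.prod, ← Finset.prod_pow_eq_pow_sum]
    refine Ideal.prod_mem_prod fun i _ => Ideal.pow_mem_pow ?_ _
    exact mem_maximalIdeal_mvPowerSeries.mpr (by simp)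

theorem isAdicComplete_mvPowerSeries [Finite σ] [IsAdicComplete (maximalIdeal W) W] :
    IsAdicComplete (maximalIdeal (MvPowerSeries σ W)) (MvPowerSeries σ W) := by
  refine { haus' := fun f hf => ?_, prec' := fun f hf => ?_ }
  · ext d
    refine IsHausdorff.haus (I := maximalIdeal W) inferInstance _ fun n => ?_
    have h := hf (n + d.degree)
    rw [SModEq.sub_mem, smul_eq_mul, Ideal.mul_top, sub_zero] at h ⊢
    simpa using coeff_mem_of_mem_maximalIdeal_pow h d
  -- Limits are taken coefficientwise. The coefficient at `d` loses `d.degree` powers of the maximal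
  -- ideal, which the shift of the index restores.
  · have h1 : ∀ d : σ →₀ ℕ, ∃ L : W, ∀ n, MvPowerSeries.coeff d (f (n + d.degree)) - L ∈
        maximalIdeal W ^ n := by
      intro d
      obtain ⟨L, hL⟩ := IsPrecomplete.prec (I := maximalIdeal W) (M := W) inferInstance
        (f := fun n => MvPowerSeries.coeff d (f (n + d.degree))) (by
          intro a b hab
          have h := hf (show a + d.degree ≤ b + d.degree by omega)
          rw [SModEq.sub_mem, smul_eq_mul, Ideal.mul_top] at h ⊢
          simpa using coeff_mem_of_mem_maximalIdeal_pow h d)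
      refine ⟨L, fun n => ?_⟩
      have := hL n
      rwa [SModEq.sub_mem, smul_eq_mul, Ideal.mul_top] at this
    choose L hL using h1
    obtain ⟨g, hg⟩ : ∃ g : MvPowerSeries σ W, ∀ d, MvPowerSeries.coeff d g = L d :=
      ⟨fun d => L d, fun d => rfl⟩
    refine ⟨g, fun n => ?_⟩
    rw [SModEq.sub_mem, smul_eq_mul, Ideal.mul_top]
    refine mem_maximalIdeal_pow_of_coeff_mem fun d => ?_
    have e1 := hL d (n - d.degree)
    -- The shifted index equals `n` unless `n < d.degree`, where the truncated subtraction makes the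
    -- required power the unit ideal.
    have e2 : MvPowerSeries.coeff d (f n - f (n - d.degree + d.degree)) ∈
        maximalIdeal W ^ (n - d.degree) := by
      by_cases hn : d.degree ≤ n
      · rw [show n - d.degree + d.degree = n by omega]; simp
      · rw [show n - d.degree = 0 by omega]; simp
    have e3 : MvPowerSeries.coeff d (f n - g) =
        MvPowerSeries.coeff d (f n - f (n - d.degree + d.degree)) +
        (MvPowerSeries.coeff d (f (n - d.degree + d.degree)) - L d) := by
      rw [map_sub, map_sub, hg]
      ring
    rw [e3]
    exact Ideal.add_mem _ e2 e1

end PowerSeriesComplete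

/-! ### Evaluation of power series at elements of an ideal of completeness. -/

section Evaluation

variable {σ W S : Type*} [CommRing W] [CommRing S] [Algebra W S]

theorem sub_C_constantCoeff_mem_span_X [Finite σ] (g : MvPowerSeries σ W) :
    g - MvPowerSeries.C (MvPowerSeries.constantCoeff g) ∈
      (Ideal.span (Set.range MvPowerSeries.X) : Ideal (MvPowerSeries σ W)) := by
  have h := truncTotal_sub_mem_span_X_pow 1 g
  have h2 : g.truncTotal 1 = MvPolynomial.C (MvPowerSeries.constantCoeff g) := by
    classical
    ext d
    rw [MvPowerSeries.coeff_truncTotal_eq_ite, MvPolynomial.coeff_C]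
    by_cases hd : d = 0
    · subst hd; simp
    · have : d.degree ≠ 0 := by rwa [Ne, Finsupp.degree_eq_zero_iff]
      rw [if_neg (by omega), if_neg (Ne.symm hd)]
  rw [h2, pow_one, MvPolynomial.coe_C] at h
  rw [← Ideal.neg_mem_iff, neg_sub]
  exact h

theorem algHom_sub_constantCoeff_mem [Finite σ] {I : Ideal S} (f : MvPowerSeries σ W →ₐ[W] S)
    (hf : ∀ i, f (MvPowerSeries.X i) ∈ I) (g : MvPowerSeries σ W) :
    f g - algebraMap W S (MvPowerSeries.constantCoeff g) ∈ I := by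
  have h1 : Ideal.span (Set.range MvPowerSeries.X) ≤ I.comap f := by
    rw [Ideal.span_le]
    rintro _ ⟨i, rfl⟩
    exact hf i
  have h2 := h1 (sub_C_constantCoeff_mem_span_X g)
  rw [Ideal.mem_comap, map_sub] at h2
  convert h2 using 2
  exact (f.commutes _).symm

theorem exists_mvPowerSeries_algHom [Finite σ] (I : Ideal S) [IsAdicComplete I S] (a : σ → S)
    (ha : ∀ i, a i ∈ I) :
    ∃ f : MvPowerSeries σ W →ₐ[W] S, ∀ i, f (MvPowerSeries.X i) = a i := by
  -- With the discrete topology on the coefficients the structure map to `S` is continuous without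
  -- any assumption.
  let _ : WithIdeal W := ⟨⊥⟩
  let _ : WithIdeal S := ⟨I⟩
  have hc := (IsAdic.isAdicComplete_iff (R := S) (I := I) rfl).mp inferInstance
  have := hc.1
  have := hc.2
  have hφ : Continuous (algebraMap W S) :=
    (WithIdeal.uniformContinuous_of_map_le (f := algebraMap W S) (by
      change Ideal.map _ ⊥ ≤ _
      rw [Ideal.map_bot]; exact bot_le)).continuous
  have hE : MvPowerSeries.HasEval a :=
    { hpow := fun s => WithIdeal.isTopologicallyNilpotent_of_mem (ha s)
      tendsto_zero := by rw [Filter.cofinite_eq_bot]; exact Filter.tendsto_bot }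
  refine ⟨{ MvPowerSeries.eval₂Hom hφ hE with
    commutes' := fun r => ?_ }, fun i => ?_⟩
  · change MvPowerSeries.eval₂Hom hφ hE (MvPowerSeries.C r) = _
    rw [MvPowerSeries.coe_eval₂Hom, MvPowerSeries.eval₂_C]
  · change MvPowerSeries.eval₂Hom hφ hE (MvPowerSeries.X i) = _
    rw [MvPowerSeries.coe_eval₂Hom, MvPowerSeries.eval₂_X]

/-- Two algebra maps that agree on the variables agree on polynomials, and truncations approximate a
power series. Continuity is automatic: the variables are sent into `I`, hence the `n`-th power of
their ideal into `I ^ n`. -/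
theorem mvPowerSeries_algHom_ext [Finite σ] {I : Ideal S} [IsHausdorff I S]
    {f g : MvPowerSeries σ W →ₐ[W] S} (hf : ∀ i, f (MvPowerSeries.X i) ∈ I)
    (h : ∀ i, f (MvPowerSeries.X i) = g (MvPowerSeries.X i)) : f = g := by
  have key : ∀ (f : MvPowerSeries σ W →ₐ[W] S), (∀ i, f (MvPowerSeries.X i) ∈ I) →
      ∀ (n : ℕ) (x : MvPowerSeries σ W),
        f ((MvPowerSeries.truncTotal n x : MvPolynomial σ W) : MvPowerSeries σ W) - f x ∈
          I ^ n := by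
    intro f hf n x
    have h1 : Ideal.span (Set.range MvPowerSeries.X) ≤ I.comap f := by
      rw [Ideal.span_le]
      rintro _ ⟨i, rfl⟩
      exact hf i
    have h2 := Ideal.le_comap_pow f n (Ideal.pow_right_mono h1 n (truncTotal_sub_mem_span_X_pow n x))
    rwa [Ideal.mem_comap, map_sub] at h2
  refine AlgHom.ext fun x => ?_
  rw [← sub_eq_zero]
  refine IsHausdorff.haus (I := I) inferInstance _ fun n => ?_
  rw [SModEq.sub_mem, smul_eq_mul, Ideal.mul_top, sub_zero]
  have e : f.comp (MvPolynomial.coeToMvPowerSeries.algHom W) =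
      g.comp (MvPolynomial.coeToMvPowerSeries.algHom W) := by
    refine MvPolynomial.algHom_ext fun i => ?_
    simpa using h i
  have e2 : f ((MvPowerSeries.truncTotal n x : MvPolynomial σ W) : MvPowerSeries σ W) =
      g ((MvPowerSeries.truncTotal n x : MvPolynomial σ W) : MvPowerSeries σ W) := by
    have := congrArg (fun F => F (MvPowerSeries.truncTotal n x)) e
    simpa using this
  have h1 := key f hf n x
  have h2 := key g (fun i => h i ▸ hf i) n x
  have h3 := Ideal.sub_mem _ h2 h1
  rw [e2] at h3
  convert h3 using 1
  ring

end Evaluation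

/-! ### Coefficient rings, their morphisms, quotients and truncations. -/

section CoeffRingBasics

open IsLocalRing

variable {p : ℕ} [Fact p.Prime] {k : Type u} [Field k]

namespace CoeffRing

/-- The Teichmüller lift. -/
def teich (A : CoeffRing p k) (a : k) : A := algebraMap (WittVector p k) A (WittVector.teichmuller p a)

@[simp]
theorem res_teich (A : CoeffRing p k) (a : k) : A.res (A.teich a) = a := by
  rw [teich, A.res_algebraMap]
  exact WittVector.teichmuller_coeff_zero p a

theorem res_surjective (A : CoeffRing p k) : Function.Surjective A.res :=
  fun a => ⟨A.teich a, A.res_teich a⟩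

theorem ker_res (A : CoeffRing p k) : RingHom.ker A.res = maximalIdeal A :=
  IsLocalRing.eq_maximalIdeal (RingHom.ker_isMaximal_of_surjective _ A.res_surjective)

theorem mem_maximalIdeal {A : CoeffRing p k} {x : A} : x ∈ maximalIdeal A ↔ A.res x = 0 := by
  rw [← A.ker_res, RingHom.mem_ker]

theorem isUnit_iff {A : CoeffRing p k} {x : A} : IsUnit x ↔ A.res x ≠ 0 := by
  rw [← notMem_maximalIdeal, mem_maximalIdeal]

theorem natCast_mem [CharP k p] (A : CoeffRing p k) : (p : A) ∈ maximalIdeal A := by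
  rw [mem_maximalIdeal, map_natCast, CharP.cast_eq_zero]

theorem eq_of_forall_sub_mem {A : CoeffRing p k} {x y : A}
    (h : ∀ n, x - y ∈ maximalIdeal A ^ n) : x = y := by
  rw [← sub_eq_zero]
  refine IsHausdorff.haus (I := maximalIdeal A) inferInstance _ fun n => ?_
  rw [SModEq.sub_mem, smul_eq_mul, Ideal.mul_top, sub_zero]
  exact h n

theorem finite_quotient [Finite k] (A : CoeffRing p k) (n : ℕ) :
    Finite (A ⧸ maximalIdeal A ^ n) := by
  have : Finite (A ⧸ maximalIdeal A) := by
    refine Finite.of_injective (Ideal.Quotient.lift (maximalIdeal A) A.res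
      fun x hx => mem_maximalIdeal.mp hx) ?_
    rw [injective_iff_map_eq_zero]
    intro x hx
    obtain ⟨x, rfl⟩ := Ideal.Quotient.mk_surjective x
    rw [Ideal.Quotient.lift_mk] at hx
    exact Ideal.Quotient.eq_zero_iff_mem.mpr (mem_maximalIdeal.mpr hx)
  exact Ideal.finite_quotient_pow (IsNoetherian.noetherian _) n

/-- The quotient of a coefficient ring by a proper ideal. -/
def quot (A : CoeffRing p k) (J : Ideal A) (hJ : J ≤ maximalIdeal A) : CoeffRing p k :=
  haveI : Nontrivial (A ⧸ J) := Ideal.Quotient.nontrivial_iff.mpr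
    fun h => (maximalIdeal.isMaximal A).ne_top (top_le_iff.mp (h ▸ hJ))
  haveI : IsLocalRing (A ⧸ J) := IsLocalRing.of_surjective' (Ideal.Quotient.mk J)
    Ideal.Quotient.mk_surjective
  haveI := isAdicComplete_maximalIdeal_quotient J
  { carrier := A ⧸ J
    res := Ideal.Quotient.lift J A.res fun _ hx => mem_maximalIdeal.mp (hJ hx)
    res_algebraMap := fun w => A.res_algebraMap w }

end CoeffRing

namespace CoeffHom

variable {A B C : CoeffRing p k}

theorem ext' {f g : CoeffHom A B} (h : f.toAlgHom = g.toAlgHom) : f = g := by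
  cases f; cases g; congr

theorem ext_apply {f g : CoeffHom A B} (h : ∀ x, f.toAlgHom x = g.toAlgHom x) : f = g :=
  ext' (AlgHom.ext h)

variable (A) in
/-- The identity morphism. -/
def id : CoeffHom A A := ⟨AlgHom.id _ _, fun _ => rfl⟩

/-- Composition of morphisms. -/
def comp (g : CoeffHom B C) (f : CoeffHom A B) : CoeffHom A C :=
  ⟨g.toAlgHom.comp f.toAlgHom, fun a => by
    rw [AlgHom.comp_apply, g.res_comp, f.res_comp]⟩

@[simp]
theorem comp_apply (g : CoeffHom B C) (f : CoeffHom A B) (x : A) :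
    (g.comp f).toAlgHom x = g.toAlgHom (f.toAlgHom x) := rfl

/-- The inverse of a bijective morphism. -/
def inverse (f : CoeffHom A B) (hf : Function.Bijective f.toAlgHom) : CoeffHom B A :=
  ⟨(AlgEquiv.ofBijective f.toAlgHom hf).symm.toAlgHom, fun b => by
    obtain ⟨a, rfl⟩ := hf.2 b
    rw [f.res_comp]
    congr 1
    exact (AlgEquiv.ofBijective f.toAlgHom hf).symm_apply_apply a⟩

theorem inverse_apply (f : CoeffHom A B) (hf : Function.Bijective f.toAlgHom) (x : A) :
    (f.inverse hf).toAlgHom (f.toAlgHom x) = x :=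
  (AlgEquiv.ofBijective f.toAlgHom hf).symm_apply_apply x

theorem apply_inverse (f : CoeffHom A B) (hf : Function.Bijective f.toAlgHom) (x : B) :
    f.toAlgHom ((f.inverse hf).toAlgHom x) = x :=
  (AlgEquiv.ofBijective f.toAlgHom hf).apply_symm_apply x

theorem map_mem (f : CoeffHom A B) {x : A} (hx : x ∈ maximalIdeal A) :
    f.toAlgHom x ∈ maximalIdeal B := by
  rw [CoeffRing.mem_maximalIdeal] at *
  rw [f.res_comp, hx]

theorem map_mem_pow (f : CoeffHom A B) {n : ℕ} {x : A} (hx : x ∈ maximalIdeal A ^ n) :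
    f.toAlgHom x ∈ maximalIdeal B ^ n := by
  have h : (maximalIdeal A).map f.toAlgHom ≤ maximalIdeal B :=
    Ideal.map_le_iff_le_comap.mpr fun x hx => f.map_mem hx
  have h2 := Ideal.mem_map_of_mem f.toAlgHom hx
  rw [Ideal.map_pow] at h2
  exact Ideal.pow_right_mono h n h2

/-- The morphism from an algebra map that sends the maximal ideal to the maximal ideal. -/
def ofMem (f : A →ₐ[WittVector p k] B) (hf : ∀ x ∈ maximalIdeal A, f x ∈ maximalIdeal B) :
    CoeffHom A B :=
  ⟨f, fun a => by
    have h1 : a - A.teich (A.res a) ∈ maximalIdeal A := by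
      rw [CoeffRing.mem_maximalIdeal, map_sub, A.res_teich, sub_self]
    have h2 := CoeffRing.mem_maximalIdeal.mp (hf _ h1)
    rw [map_sub, map_sub, sub_eq_zero] at h2
    rw [h2, CoeffRing.teich, f.commutes]
    exact B.res_teich _⟩

/-- The projection to a quotient. -/
def toQuot (A : CoeffRing p k) (J : Ideal A) (hJ : J ≤ maximalIdeal A) :
    CoeffHom A (A.quot J hJ) :=
  ⟨Ideal.Quotient.mkₐ _ J, fun _ => rfl⟩

theorem toQuot_surjective (A : CoeffRing p k) (J : Ideal A) (hJ : J ≤ maximalIdeal A) :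
    Function.Surjective (toQuot A J hJ).toAlgHom := Ideal.Quotient.mk_surjective

theorem toQuot_eq_zero {A : CoeffRing p k} {J : Ideal A} (hJ : J ≤ maximalIdeal A) {x : A} :
    (toQuot A J hJ).toAlgHom x = 0 ↔ x ∈ J := Ideal.Quotient.eq_zero_iff_mem

/-- Morphisms out of a quotient. -/
def liftQuot (f : CoeffHom A B) (J : Ideal A) (hJ : J ≤ maximalIdeal A)
    (h : ∀ x ∈ J, f.toAlgHom x = 0) : CoeffHom (A.quot J hJ) B :=
  ⟨Ideal.Quotient.liftₐ J f.toAlgHom h, fun x => by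
    obtain ⟨x, rfl⟩ := Ideal.Quotient.mk_surjective x
    exact f.res_comp x⟩

@[simp]
theorem liftQuot_toQuot (f : CoeffHom A B) (J : Ideal A) (hJ : J ≤ maximalIdeal A)
    (h : ∀ x ∈ J, f.toAlgHom x = 0) (x : A) :
    (f.liftQuot J hJ h).toAlgHom ((toQuot A J hJ).toAlgHom x) = f.toAlgHom x := rfl

theorem map_teich (f : CoeffHom A B) (a : k) : f.toAlgHom (A.teich a) = B.teich a :=
  f.toAlgHom.commutes _

end CoeffHom

namespace CoeffRing

/-- The reduction modulo a power of the maximal ideal. -/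
def trunc (A : CoeffRing p k) (n : ℕ) : CoeffRing p k :=
  A.quot (maximalIdeal A ^ (n + 1)) (Ideal.pow_le_self (Nat.succ_ne_zero n))

/-- The projection to the reduction modulo a power of the maximal ideal. -/
def toTrunc (A : CoeffRing p k) (n : ℕ) : CoeffHom A (A.trunc n) :=
  CoeffHom.toQuot A _ _

theorem toTrunc_eq_zero {A : CoeffRing p k} {n : ℕ} {x : A} :
    (A.toTrunc n).toAlgHom x = 0 ↔ x ∈ maximalIdeal A ^ (n + 1) :=
  CoeffHom.toQuot_eq_zero _

theorem toTrunc_surjective (A : CoeffRing p k) (n : ℕ) :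
    Function.Surjective (A.toTrunc n).toAlgHom := CoeffHom.toQuot_surjective _ _ _

instance finite_trunc [Finite k] (A : CoeffRing p k) (n : ℕ) : Finite (A.trunc n) :=
  A.finite_quotient (n + 1)

instance isArtinianRing_trunc [Finite k] (A : CoeffRing p k) (n : ℕ) :
    IsArtinianRing (A.trunc n) := inferInstance

theorem eq_of_forall_toTrunc {A : CoeffRing p k} {x y : A}
    (h : ∀ n, (A.toTrunc n).toAlgHom x = (A.toTrunc n).toAlgHom y) : x = y := by
  refine eq_of_forall_sub_mem fun n => ?_
  have := h n
  rw [← sub_eq_zero, ← map_sub, toTrunc_eq_zero] at this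
  exact Ideal.pow_le_pow_right (Nat.le_succ n) this

end CoeffRing

theorem maximalIdeal_wittVector [CharP k p] [Finite k] :
    maximalIdeal (WittVector p k) = Ideal.span {(p : WittVector p k)} := by
  rw [← WittVector.ker_constantCoeff]
  exact (IsLocalRing.eq_maximalIdeal (RingHom.ker_isMaximal_of_surjective (WittVector.constantCoeff (p := p) (R := k))
    (WittVector.constantCoeff_surjective p))).symm

variable (p k) in
/-- The power series ring over `W(k)` as a coefficient ring. -/
def powerSeriesCoeff [CharP k p] [Finite k] (σ : Type) [Finite σ] : CoeffRing p k :=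
  haveI : IsAdicComplete (maximalIdeal (WittVector p k)) (WittVector p k) := by
    rw [maximalIdeal_wittVector]; infer_instance
  haveI := isAdicComplete_mvPowerSeries (σ := σ) (W := WittVector p k)
  { carrier := MvPowerSeries σ (WittVector p k)
    res := WittVector.constantCoeff.comp MvPowerSeries.constantCoeff
    res_algebraMap := fun w => by
      rw [RingHom.comp_apply]
      exact congrArg _ (MvPowerSeries.constantCoeff_C w) }

section PowerSeriesCoeff

variable [CharP k p] [Finite k] {σ : Type} [Finite σ]

variable (p k) in
/-- The variables of the power series ring. -/
def varX (i : σ) : powerSeriesCoeff p k σ :=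
  (MvPowerSeries.X i : MvPowerSeries σ (WittVector p k))

theorem varX_mem (i : σ) : varX p k i ∈ maximalIdeal (powerSeriesCoeff p k σ) := by
  rw [CoeffRing.mem_maximalIdeal]
  change WittVector.constantCoeff (MvPowerSeries.constantCoeff _) = _
  exact (congrArg WittVector.constantCoeff (MvPowerSeries.constantCoeff_X i)).trans (map_zero _)

theorem exists_evalHom (A : CoeffRing p k) (a : σ → A) (ha : ∀ i, a i ∈ maximalIdeal A) :
    ∃ f : CoeffHom (powerSeriesCoeff p k σ) A, ∀ i, f.toAlgHom (varX p k i) = a i := by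
  obtain ⟨f, hf⟩ := exists_mvPowerSeries_algHom (W := WittVector p k) (maximalIdeal A) a ha
  refine ⟨⟨f, fun g => ?_⟩, hf⟩
  have h := algHom_sub_constantCoeff_mem (I := maximalIdeal A) f (fun i => hf i ▸ ha i) g
  rw [CoeffRing.mem_maximalIdeal, map_sub, sub_eq_zero, A.res_algebraMap] at h
  exact h

/-- Evaluation of power series at elements of the maximal ideal. -/
def evalHom (A : CoeffRing p k) (a : σ → A) (ha : ∀ i, a i ∈ maximalIdeal A) :
    CoeffHom (powerSeriesCoeff p k σ) A := (exists_evalHom A a ha).choose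

@[simp]
theorem evalHom_X (A : CoeffRing p k) (a : σ → A) (ha : ∀ i, a i ∈ maximalIdeal A) (i : σ) :
    (evalHom A a ha).toAlgHom (varX p k i) = a i :=
  (exists_evalHom A a ha).choose_spec i

theorem powerSeriesCoeff_hom_ext {A : CoeffRing p k} {f g : CoeffHom (powerSeriesCoeff p k σ) A}
    (h : ∀ i, f.toAlgHom (varX p k i) = g.toAlgHom (varX p k i)) : f = g :=
  CoeffHom.ext' (mvPowerSeries_algHom_ext (I := maximalIdeal A) (σ := σ) (W := WittVector p k)
    (fun i => f.map_mem (varX_mem i)) h)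

end PowerSeriesCoeff

end CoeffRingBasics

open IsLocalRing

/-! ### Morphisms to the dual numbers and the criterion for surjectivity. -/

section DualNumbers

variable {p : ℕ} [Fact p.Prime] {k : Type u} [Field k] [CharP k p] [Finite k]

/-- An element of the dual numbers, from its residue and its `ε`-coefficient. -/
def dualMk (a b : k) : dualCoeff p k := (TrivSqZeroExt.inl a + TrivSqZeroExt.inr b : DualNumber k)

theorem fst_dualMk (a b : k) : TrivSqZeroExt.fst (R := k) (M := k) (dualMk (p := p) a b) = a :=
  add_zero a

theorem snd_dualMk (a b : k) : TrivSqZeroExt.snd (R := k) (M := k) (dualMk (p := p) a b) = b :=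
  zero_add b

theorem dual_ext {x y : dualCoeff p k}
    (h1 : TrivSqZeroExt.fst (R := k) (M := k) x = TrivSqZeroExt.fst (R := k) (M := k) y)
    (h2 : TrivSqZeroExt.snd (R := k) (M := k) x = TrivSqZeroExt.snd (R := k) (M := k) y) : x = y :=
  TrivSqZeroExt.ext h1 h2

theorem dualMk_add (a b c d : k) :
    dualMk (p := p) (a + c) (b + d) = dualMk a b + dualMk c d := by
  refine dual_ext ?_ ?_
  · rw [fst_dualMk]
    refine Eq.trans ?_ (TrivSqZeroExt.fst_add _ _).symm
    rw [fst_dualMk, fst_dualMk]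
  · rw [snd_dualMk]
    refine Eq.trans ?_ (TrivSqZeroExt.snd_add _ _).symm
    rw [snd_dualMk, snd_dualMk]

theorem dualMk_mul (a b c d : k) :
    dualMk (p := p) (a * c) (a * d + c * b) = dualMk a b * dualMk c d := by
  refine dual_ext ?_ ?_
  · rw [fst_dualMk]
    refine Eq.trans ?_ (TrivSqZeroExt.fst_mul _ _).symm
    rw [fst_dualMk, fst_dualMk]
  · rw [snd_dualMk]
    refine Eq.trans ?_ (TrivSqZeroExt.snd_mul _ _).symm
    rw [fst_dualMk, fst_dualMk, snd_dualMk, snd_dualMk, smul_eq_mul, op_smul_eq_mul, mul_comm c b]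

theorem dualMk_zero : dualMk (p := p) (0 : k) 0 = 0 :=
  dual_ext (fst_dualMk _ _) (snd_dualMk _ _)

theorem res_dualMk (a b : k) : (dualCoeff p k).res (dualMk a b) = a := fst_dualMk a b

theorem dualMk_inj {a b c d : k} (h : dualMk (p := p) a b = dualMk c d) : a = c ∧ b = d := by
  constructor
  · rw [← fst_dualMk (p := p) a b, h, fst_dualMk]
  · rw [← snd_dualMk (p := p) a b, h, snd_dualMk]

theorem exists_dualMk (x : dualCoeff p k) : ∃ a b, x = dualMk a b :=
  ⟨TrivSqZeroExt.fst (R := k) (M := k) x, TrivSqZeroExt.snd (R := k) (M := k) x,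
    (TrivSqZeroExt.inl_fst_add_inr_snd_eq (R := k) (M := k) x).symm⟩

theorem algebraMap_dualCoeff (w : WittVector p k) :
    algebraMap (WittVector p k) (dualCoeff p k) w = dualMk (WittVector.constantCoeff w) 0 :=
  dual_ext (fst_dualMk _ _).symm (snd_dualMk _ _).symm

variable (R : CoeffRing p k)

theorem sub_teich_res_mem (r : R) : r - R.teich (R.res r) ∈ maximalIdeal R := by
  rw [CoeffRing.mem_maximalIdeal, map_sub, R.res_teich, sub_self]

/-- The morphism to the dual numbers attached to a functional on the maximal ideal. -/
theorem exists_dualHom (L : maximalIdeal R →+ k)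
    (hL : ∀ (a : R) (x : maximalIdeal R), L (a • x) = R.res a * L x)
    (hp : L ⟨(p : R), R.natCast_mem⟩ = 0) :
    ∃ f : CoeffHom R (dualCoeff p k), ∀ x : maximalIdeal R, f.toAlgHom x = dualMk 0 (L x) := by
  set δ : R → k := fun r => L ⟨r - R.teich (R.res r), sub_teich_res_mem R r⟩ with hδ
  have hW : ∀ (w : WittVector p k) (h : algebraMap (WittVector p k) R w ∈ maximalIdeal R),
      L ⟨algebraMap (WittVector p k) R w, h⟩ = 0 := by
    intro w h
    rw [CoeffRing.mem_maximalIdeal, R.res_algebraMap, ← RingHom.mem_ker,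
      WittVector.ker_constantCoeff, Ideal.mem_span_singleton] at h
    obtain ⟨y, rfl⟩ := h
    have : (⟨algebraMap (WittVector p k) R (p * y), h⟩ : maximalIdeal R) =
        algebraMap (WittVector p k) R y • ⟨(p : R), R.natCast_mem⟩ := by
      ext; simp [Algebra.smul_def, mul_comm]
    rw [this, hL, hp, mul_zero]
  -- The Teichmüller section is not additive. Since `L` kills the image of `p W`, any other lift of
  -- the residue of `r` from `W` gives the same value, and this freedom makes `δ` additive and a
  -- derivation.
  have key : ∀ (r : R) (w : WittVector p k) (h : r - algebraMap (WittVector p k) R w ∈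
      maximalIdeal R), L ⟨r - algebraMap (WittVector p k) R w, h⟩ = δ r := by
    intro r w h
    have h2 : algebraMap (WittVector p k) R (WittVector.teichmuller p (R.res r) - w) ∈
        maximalIdeal R := by
      have := Ideal.sub_mem _ h (sub_teich_res_mem R r)
      rw [map_sub]
      convert this using 1
      simp only [CoeffRing.teich]; ring
    have h3 : (⟨r - algebraMap (WittVector p k) R w, h⟩ : maximalIdeal R) =
        ⟨r - R.teich (R.res r), sub_teich_res_mem R r⟩ + ⟨_, h2⟩ := by
      ext; simp [CoeffRing.teich]
    rw [h3, map_add, hW, add_zero]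
  have hres : ∀ r : R, algebraMap (WittVector p k) R (WittVector.teichmuller p (R.res r)) =
    R.teich (R.res r) := fun _ => rfl
  have hadd : ∀ r s, δ (r + s) = δ r + δ s := by
    intro r s
    have e : (r + s) - algebraMap (WittVector p k) R (WittVector.teichmuller p (R.res r) +
        WittVector.teichmuller p (R.res s)) =
        (r - R.teich (R.res r)) + (s - R.teich (R.res s)) := by
      rw [map_add, hres, hres]; ring
    have hm : (r + s) - algebraMap (WittVector p k) R (WittVector.teichmuller p (R.res r) +
        WittVector.teichmuller p (R.res s)) ∈ maximalIdeal R := by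
      rw [e]; exact Ideal.add_mem _ (sub_teich_res_mem R r) (sub_teich_res_mem R s)
    rw [← key (r + s) _ hm, hδ]
    simp only [← map_add]
    congr 1
    ext
    exact e
  have hmul : ∀ r s, δ (r * s) = R.res r * δ s + R.res s * δ r := by
    intro r s
    have e : (r * s) - algebraMap (WittVector p k) R (WittVector.teichmuller p (R.res r) *
        WittVector.teichmuller p (R.res s)) =
        R.teich (R.res r) * (s - R.teich (R.res s)) + s * (r - R.teich (R.res r)) := by
      rw [map_mul, hres, hres]; ring
    have hm : (r * s) - algebraMap (WittVector p k) R (WittVector.teichmuller p (R.res r) *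
        WittVector.teichmuller p (R.res s)) ∈ maximalIdeal R := by
      rw [e]; exact Ideal.add_mem _ (Ideal.mul_mem_left _ _ (sub_teich_res_mem R s))
        (Ideal.mul_mem_left _ _ (sub_teich_res_mem R r))
    have h2 : (⟨_, hm⟩ : maximalIdeal R) =
        R.teich (R.res r) • ⟨s - R.teich (R.res s), sub_teich_res_mem R s⟩ +
        s • ⟨r - R.teich (R.res r), sub_teich_res_mem R r⟩ := by
      ext; exact e
    rw [← key (r * s) _ hm, h2, map_add, hL, hL, R.res_teich]
  have halg : ∀ w, δ (algebraMap (WittVector p k) R w) = 0 := by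
    intro w
    have h0 : algebraMap (WittVector p k) R w - algebraMap (WittVector p k) R w ∈ maximalIdeal R := by
      rw [sub_self]; exact Ideal.zero_mem _
    rw [← key _ w h0]
    convert map_zero L using 2
    ext; simp
  refine ⟨⟨{ toFun := fun r => dualMk (R.res r) (δ r)
             map_one' := ?_, map_mul' := ?_, map_zero' := ?_, map_add' := ?_, commutes' := ?_ },
    fun r => ?_⟩, fun x => ?_⟩
  · have := halg 1
    rw [map_one] at this
    rw [this, map_one, ← map_one (algebraMap (WittVector p k) (dualCoeff p k)),
      algebraMap_dualCoeff, map_one]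
  · intro r s
    rw [hmul, map_mul, dualMk_mul]
  · have := halg 0
    rw [map_zero] at this
    rw [this, map_zero, dualMk_zero]
  · intro r s
    rw [hadd, map_add, dualMk_add]
  · intro w
    rw [halg, R.res_algebraMap, algebraMap_dualCoeff]
  · exact res_dualMk _ _
  · change dualMk (R.res x) (δ x) = _
    have hx : R.res x = 0 := CoeffRing.mem_maximalIdeal.mp x.2
    have h0 : (x : R) - algebraMap (WittVector p k) R 0 ∈ maximalIdeal R := by
      rw [map_zero, sub_zero]; exact x.2
    rw [hx, ← key x 0 h0]
    congr 2
    ext; simp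

variable {R}

/-- If the image of the maximal ideal of `Q` did not span the cotangent space of `R`, a nonzero
functional would vanish on it. That functional also kills `p`, which comes from `Q`, and so defines
a morphism to the dual numbers that differs from the constant one but agrees with it on `Q`. By
Nakayama's lemma the maximal ideal of `Q` therefore generates that of `R`, and completeness of `Q`
gives surjectivity. -/
theorem CoeffHom.surjective_of_dual {Q : CoeffRing p k} (g : CoeffHom Q R)
    (h : ∀ f f' : CoeffHom R (dualCoeff p k), f.comp g = f'.comp g → f = f') :
    Function.Surjective g.toAlgHom := by
  set s : Set (maximalIdeal R) := {y | ∃ x ∈ maximalIdeal Q, g.toAlgHom x = y} with hs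
  have h1 : Submodule.span (ResidueField R) ((maximalIdeal R).toCotangent '' s) = ⊤ := by
    by_contra hne
    obtain ⟨ℓ, hℓ0, hℓ⟩ := Submodule.exists_le_ker_of_lt_top _ (lt_top_iff_ne_top.mpr hne)
    have hker : ∀ a ∈ maximalIdeal R, R.res a = 0 := fun a ha => CoeffRing.mem_maximalIdeal.mp ha
    have hloc : IsLocalHom R.res := ⟨fun a ha => CoeffRing.isUnit_iff.mpr ha.ne_zero⟩
    set φ : ResidueField R →+* k := ResidueField.lift R.res with hφ
    set L : maximalIdeal R →+ k :=
      { toFun := fun x => φ (ℓ ((maximalIdeal R).toCotangent x))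
        map_zero' := by simp
        map_add' := by simp } with hLdef
    have hL : ∀ (a : R) (x : maximalIdeal R), L (a • x) = R.res a * L x := by
      intro a x
      change φ (ℓ ((maximalIdeal R).toCotangent (a • x))) = _
      rw [map_smul]
      have e : (a • (maximalIdeal R).toCotangent x : CotangentSpace R) =
        (residue R a) • (maximalIdeal R).toCotangent x := rfl
      rw [e, map_smul, smul_eq_mul, map_mul]
      rfl
    have hs0 : ∀ y ∈ s, L y = 0 := by
      intro y hy
      have : ℓ ((maximalIdeal R).toCotangent y) = 0 :=
        LinearMap.mem_ker.mp (hℓ (Submodule.subset_span ⟨y, hy, rfl⟩))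
      change φ (ℓ ((maximalIdeal R).toCotangent y)) = 0
      rw [this, map_zero]
    have hp : L ⟨(p : R), R.natCast_mem⟩ = 0 := hs0 _ ⟨(p : Q), Q.natCast_mem, by simp⟩
    obtain ⟨f, hf⟩ := exists_dualHom R L hL hp
    obtain ⟨f', hf'⟩ := exists_dualHom R 0 (by simp) rfl
    have hff : f = f' := by
      refine h _ _ (CoeffHom.ext_apply fun x => ?_)
      rw [CoeffHom.comp_apply, CoeffHom.comp_apply]
      have hx : x = (x - Q.teich (Q.res x)) + Q.teich (Q.res x) := by ring
      have hm := sub_teich_res_mem Q x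
      rw [hx, map_add, map_add, map_add, g.map_teich, f.map_teich, f'.map_teich]
      congr 1
      have e1 := hf ⟨_, g.map_mem hm⟩
      have e2 := hf' ⟨_, g.map_mem hm⟩
      rw [hs0 _ ⟨_, hm, rfl⟩] at e1
      exact e1.trans e2.symm
    apply hℓ0
    ext v
    obtain ⟨x, rfl⟩ := (maximalIdeal R).toCotangent_surjective v
    have e := (hf x).symm.trans ((congrArg (fun F => F.toAlgHom (x : R)) hff).trans (hf' x))
    have e2 : L x = 0 := (dualMk_inj e).2
    exact φ.injective (e2.trans (map_zero φ).symm)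
  rw [CotangentSpace.span_image_eq_top_iff] at h1
  have h2 : (maximalIdeal Q).map (g.toAlgHom : Q →+* R) = maximalIdeal R := by
    refine le_antisymm (Ideal.map_le_iff_le_comap.mpr fun x hx => g.map_mem hx) fun x hx => ?_
    have hx' : (⟨x, hx⟩ : maximalIdeal R) ∈ Submodule.span R s := by rw [h1]; trivial
    have h3 := Submodule.mem_map_of_mem (f := (maximalIdeal R).subtype) hx'
    rw [Submodule.map_span] at h3
    refine (Submodule.span_le.mpr ?_ : Submodule.span R _ ≤ (maximalIdeal Q).map _) h3
    rintro _ ⟨y, ⟨z, hz, hzy⟩, rfl⟩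
    have := Ideal.mem_map_of_mem (g.toAlgHom : Q →+* R) hz
    simpa [hzy] using this
  have h3 : IsHausdorff ((maximalIdeal Q).map (g.toAlgHom : Q →+* R)) R := by
    rw [h2]; infer_instance
  refine surjective_of_mk_map_comp_surjective (I := maximalIdeal Q) (g.toAlgHom : Q →+* R)
    fun y => ?_
  obtain ⟨y, rfl⟩ := Ideal.Quotient.mk_surjective y
  refine ⟨Q.teich (R.res y), ?_⟩
  rw [RingHom.comp_apply, eq_comm, Ideal.Quotient.mk_eq_mk_iff_sub_mem, h2]
  have : (g.toAlgHom : Q →+* R) (Q.teich (R.res y)) = R.teich (R.res y) := g.map_teich _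
  rw [this]
  exact sub_teich_res_mem R y

/-- The kernels of the powers of `g` become constant at some `n`. An element of the kernel of `g` is
the image under `g ^ n` of an element killed by `g ^ (n + 1)`, hence already by `g ^ n`. -/
theorem injective_of_surjective_ringHom {R : Type*} [CommRing R] [IsNoetherianRing R]
    (g : R →+* R) (hg : Function.Surjective g) : Function.Injective g := by
  rw [injective_iff_map_eq_zero]
  intro x hx
  let f : ℕ →o Ideal R :=
    { toFun := fun n => RingHom.ker (g ^ n)
      monotone' := monotone_nat_of_le_succ fun n y hy => by
        rw [RingHom.mem_ker] at *
        rw [pow_succ', RingHom.mul_def, RingHom.comp_apply, hy, map_zero] }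
  obtain ⟨n, hn⟩ := monotone_stabilizes_iff_noetherian.mpr ‹IsNoetherianRing R› f
  have hs : Function.Surjective (g ^ n) := by
    rw [RingHom.coe_pow]; exact hg.iterate n
  obtain ⟨y, rfl⟩ := hs x
  have h1 : y ∈ f (n + 1) := by
    change y ∈ RingHom.ker (g ^ (n + 1))
    rw [RingHom.mem_ker, pow_succ', RingHom.mul_def, RingHom.comp_apply, hx]
  rw [← hn (n + 1) (Nat.le_succ n)] at h1
  exact h1

end DualNumbers

/-! ### Strict equivalence and the uniqueness of versal pairs. -/

section Versal

variable {p : ℕ} [Fact p.Prime] {k : Type u} [Field k] {G : Type v} [Group G]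

theorem push_comp {A B C : CoeffRing p k} (g : CoeffHom B C) (f : CoeffHom A B)
    (ρ : G →* GL (Fin 2) A) : push (g.comp f) ρ = push g (push f ρ) := rfl

theorem push_apply {A B : CoeffRing p k} (f : CoeffHom A B) (ρ : G →* GL (Fin 2) A) (g : G)
    (i j : Fin 2) : (push f ρ g) i j = f.toAlgHom (ρ g i j) := rfl

theorem coe_push {A B : CoeffRing p k} (f : CoeffHom A B) (ρ : G →* GL (Fin 2) A) (g : G) :
    (push f ρ g : Matrix (Fin 2) (Fin 2) B) =
      (ρ g : Matrix (Fin 2) (Fin 2) A).map f.toAlgHom := rfl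

theorem res_push {A B : CoeffRing p k} (f : CoeffHom A B) (ρ : G →* GL (Fin 2) A) :
    (Matrix.GeneralLinearGroup.map B.res).comp (push f ρ) =
      (Matrix.GeneralLinearGroup.map A.res).comp ρ := by
  ext g i j
  exact f.res_comp _

namespace StrictEquiv

variable {A B : CoeffRing p k} {ρ ρ' ρ'' : G →* GL (Fin 2) A}

theorem refl (ρ : G →* GL (Fin 2) A) : StrictEquiv ρ ρ := ⟨1, map_one _, fun g => by simp⟩

theorem symm (h : StrictEquiv ρ ρ') : StrictEquiv ρ' ρ := by
  obtain ⟨M, hM, h⟩ := h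
  refine ⟨M⁻¹, by rw [map_inv, hM, inv_one], fun g => ?_⟩
  rw [← h]; group

theorem trans (h : StrictEquiv ρ ρ') (h' : StrictEquiv ρ' ρ'') : StrictEquiv ρ ρ'' := by
  obtain ⟨M, hM, h⟩ := h
  obtain ⟨N, hN, h'⟩ := h'
  refine ⟨N * M, by rw [map_mul, hM, hN, one_mul], fun g => ?_⟩
  rw [← h', ← h]; group

theorem push (f : CoeffHom A B) (h : StrictEquiv ρ ρ') :
    StrictEquiv (LocalDef.push f ρ) (LocalDef.push f ρ') := by
  obtain ⟨M, hM, h⟩ := h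
  refine ⟨Matrix.GeneralLinearGroup.map (f.toAlgHom : A →+* B) M, ?_, fun g => ?_⟩
  · rw [← hM]
    ext i j
    exact f.res_comp _
  · rw [← map_inv]
    change _ * Matrix.GeneralLinearGroup.map _ _ * _ = Matrix.GeneralLinearGroup.map _ _
    rw [← map_mul, ← map_mul, h]

theorem res_eq (h : StrictEquiv ρ ρ') :
    (Matrix.GeneralLinearGroup.map A.res).comp ρ =
      (Matrix.GeneralLinearGroup.map A.res).comp ρ' := by
  obtain ⟨M, hM, h⟩ := h
  refine MonoidHom.ext fun g => ?_
  rw [MonoidHom.comp_apply, MonoidHom.comp_apply, ← h, map_mul, map_mul, map_inv, hM]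
  simp

end StrictEquiv

/-- Stability of a collection under change of coefficient rings. -/
def Collection.PushClosed (D : Collection p k G) : Prop :=
  ∀ A B (f : CoeffHom A B) ρ, D A ρ → D B (push f ρ)

variable {D : Collection p k G} [CharP k p] [Finite k]

/-- A morphism from `R` to the dual numbers is determined by the strict equivalence class of the
lifting it induces, and that class depends only on its composite with `g`. -/
theorem IsVersal.surjective (hD : D.PushClosed) {R Q : CoeffRing p k} {ρ : G →* GL (Fin 2) R}
    (hR : IsVersal D R ρ) {ρQ : G →* GL (Fin 2) Q} (g : CoeffHom Q R)
    (hg : StrictEquiv (push g ρQ) ρ) : Function.Surjective g.toAlgHom := by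
  refine g.surjective_of_dual fun f f' hff => ?_
  refine hR.unique (push f ρ) (hD _ _ f _ hR.mem) f f' (StrictEquiv.refl _) ?_
  refine ((hg.push f').symm.trans ?_).trans (hg.push f)
  rw [← push_comp, ← push_comp, hff]
  exact StrictEquiv.refl _

/-- The map `π` need not respect the `W`-structures or the representations: any surjection back
makes the composite a surjective endomorphism of a Noetherian ring. This weak form is used both for
uniqueness and to compare with power series rings. -/
theorem IsVersal.bijective (hD : D.PushClosed) {R Q : CoeffRing p k} {ρ : G →* GL (Fin 2) R}
    (hR : IsVersal D R ρ) {ρQ : G →* GL (Fin 2) Q} (g : CoeffHom Q R)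
    (hg : StrictEquiv (push g ρQ) ρ) (π : R →+* Q) (hπ : Function.Surjective π) :
    Function.Bijective g.toAlgHom := by
  have hs := hR.surjective hD g hg
  refine ⟨?_, hs⟩
  have : Function.Injective (π.comp (g.toAlgHom : Q →+* R)) :=
    injective_of_surjective_ringHom _ (hπ.comp hs)
  exact Function.Injective.of_comp this

theorem IsVersal.exists_equiv (hD : D.PushClosed) {R Q : CoeffRing p k} {ρ : G →* GL (Fin 2) R}
    (hR : IsVersal D R ρ) {ρQ : G →* GL (Fin 2) Q} (hQ : IsVersal D Q ρQ) :
    ∃ f : CoeffHom R Q, Function.Bijective f.toAlgHom ∧ StrictEquiv (push f ρ) ρQ := by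
  obtain ⟨f, hf⟩ := hR.exists_hom _ _ hQ.mem
  obtain ⟨g, hg⟩ := hQ.exists_hom _ _ hR.mem
  exact ⟨f, hQ.bijective hD f hf (g.toAlgHom : Q →+* R) (hR.surjective hD g hg), hf⟩

end Versal

/-! ### Powers of matrices congruent to the identity. -/

section MatrixCongruence

variable {R : Type*} [CommRing R] {n : Type*} [Fintype n] [DecidableEq n]

theorem matrix_mul_mem {I J : Ideal R} {X Y : Matrix n n R} (hX : ∀ i j, X i j ∈ I)
    (hY : ∀ i j, Y i j ∈ J) (i j : n) : (X * Y) i j ∈ I * J := by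
  rw [Matrix.mul_apply]
  exact Ideal.sum_mem _ fun l _ => Ideal.mul_mem_mul (hX i l) (hY l j)

theorem map_quotient_eq_iff {I : Ideal R} {X Y : Matrix n n R} :
    X.map (Ideal.Quotient.mk I) = Y.map (Ideal.Quotient.mk I) ↔ ∀ i j, (X - Y) i j ∈ I := by
  rw [← Matrix.ext_iff]
  refine forall_congr' fun i => forall_congr' fun j => ?_
  rw [Matrix.map_apply, Matrix.map_apply, Ideal.Quotient.mk_eq_mk_iff_sub_mem, Matrix.sub_apply]

theorem matrix_pow_prime_pow_sub_one_mem {I : Ideal R} {p : ℕ} (hp : (p : R) ∈ I)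
    {X : Matrix n n R} (hX : ∀ i j, (X - 1) i j ∈ I) (m : ℕ) (i j : n) :
    (X ^ p ^ m - 1) i j ∈ I ^ (m + 1) := by
  induction m generalizing i j with
  | zero => simpa using hX i j
  | succ m ih =>
    set Y := X ^ p ^ m with hY
    -- Each further `p`-th power gains one factor from `I`, because the geometric sum is congruent
    -- to `p` modulo `I`.
    have h1 : (X ^ p ^ (m + 1) - 1) = (Y - 1) * ∑ i ∈ Finset.range p, Y ^ i := by
      rw [mul_geom_sum, hY, ← pow_mul, pow_succ]
    have h2 : ∀ i j, (∑ i ∈ Finset.range p, Y ^ i) i j ∈ I := by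
      have hY1 : Y.map (Ideal.Quotient.mk I) = 1 := by
        have := (map_quotient_eq_iff (I := I) (X := Y) (Y := 1)).mpr
          fun i j => Ideal.pow_le_self (Nat.succ_ne_zero m) (ih i j)
        rw [this]; simp
      have e : (Ideal.Quotient.mk I).mapMatrix (∑ i ∈ Finset.range p, Y ^ i) = 0 := by
        rw [map_sum]
        simp_rw [map_pow, RingHom.mapMatrix_apply, hY1, one_pow]
        rw [Finset.sum_const, Finset.card_range, nsmul_eq_mul, mul_one]
        have : ((p : R ⧸ I)) = 0 := by
          rw [← map_natCast (Ideal.Quotient.mk I)]; exact Ideal.Quotient.eq_zero_iff_mem.mpr hp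
        rw [← Matrix.diagonal_natCast, this, Matrix.diagonal_zero]
      intro a b
      have := congrFun (congrFun e a) b
      exact Ideal.Quotient.eq_zero_iff_mem.mp this
    rw [h1, pow_succ]
    exact matrix_mul_mem ih h2 i j

end MatrixCongruence

/-! ### Liftings as pairs of matrices satisfying the tame relation. -/

section TameGroups

variable {p : ℕ} [Fact p.Prime] {k : Type u} [Field k] {G : Type v} [Group G]

theorem push_toTrunc_eq_one_iff {A : CoeffRing p k} {ρ : G →* GL (Fin 2) A} {n : ℕ} {g : G} :
    push (A.toTrunc n) ρ g = 1 ↔ ∀ i j,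
      (ρ g : Matrix (Fin 2) (Fin 2) A) i j - (1 : Matrix (Fin 2) (Fin 2) A) i j ∈
        maximalIdeal A ^ (n + 1) := by
  rw [Matrix.GeneralLinearGroup.ext_iff]
  refine forall_congr' fun i => forall_congr' fun j => ?_
  rw [← CoeffRing.toTrunc_eq_zero, map_sub, sub_eq_zero, push_apply]
  have : (A.toTrunc n).toAlgHom ((1 : Matrix (Fin 2) (Fin 2) A) i j) =
      ((1 : GL (Fin 2) (A.trunc n)) : Matrix (Fin 2) (Fin 2) _) i j := by
    rw [Units.val_one, Matrix.one_apply, Matrix.one_apply]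
    split_ifs <;> simp
  rw [this]

theorem isContRep_iff [TopologicalSpace G] {A : CoeffRing p k} {ρ : G →* GL (Fin 2) A} :
    IsContRep ρ ↔ ∀ n, IsOpen ((push (A.toTrunc n) ρ).ker : Set G) := by
  have e : ∀ n, ((push (A.toTrunc n) ρ).ker : Set G) = {g : G | ∀ i j,
    (ρ g : Matrix (Fin 2) (Fin 2) A) i j - (1 : Matrix (Fin 2) (Fin 2) A) i j
      ∈ maximalIdeal A ^ (n + 1)} := fun n => by
    ext g
    exact push_toTrunc_eq_one_iff
  simp_rw [e]
  refine ⟨fun h n => h (n + 1), fun h n => ?_⟩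
  -- `trunc n` is the reduction modulo the power `n + 1`; the power zero imposes no condition.
  rcases n with _ | n
  · simp
  · exact h n

theorem gl_eq_of_forall_toTrunc {A : CoeffRing p k} {x y : GL (Fin 2) A}
    (h : ∀ n, Matrix.GeneralLinearGroup.map ((A.toTrunc n).toAlgHom : A →+* A.trunc n) x =
      Matrix.GeneralLinearGroup.map ((A.toTrunc n).toAlgHom : A →+* A.trunc n) y) : x = y := by
  refine Matrix.GeneralLinearGroup.ext fun i j => CoeffRing.eq_of_forall_toTrunc fun n => ?_
  exact (Matrix.GeneralLinearGroup.ext_iff _ _).mp (h n) i j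

/-- The transition maps between the reductions of a coefficient ring. -/
def CoeffRing.transition (A : CoeffRing p k) {m n : ℕ} (h : m ≤ n) :
    CoeffHom (A.trunc n) (A.trunc m) :=
  (A.toTrunc m).liftQuot _ _ fun _ hx =>
    CoeffRing.toTrunc_eq_zero.mpr (Ideal.pow_le_pow_right (Nat.succ_le_succ h) hx)

theorem CoeffRing.transition_toTrunc (A : CoeffRing p k) {m n : ℕ} (h : m ≤ n) (x : A) :
    (A.transition h).toAlgHom ((A.toTrunc n).toAlgHom x) = (A.toTrunc m).toAlgHom x := rfl

theorem exists_limit_rep (A : CoeffRing p k) (φ : ∀ n, G →* GL (Fin 2) (A.trunc n))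
    (hφ : ∀ m n (h : m ≤ n), push (A.transition h) (φ n) = φ m) :
    ∃ ρ : G →* GL (Fin 2) A, ∀ n, push (A.toTrunc n) ρ = φ n := by
  have h1 : ∀ g (i j : Fin 2), ∃ L : A, ∀ n, (A.toTrunc n).toAlgHom L = φ n g i j := by
    intro g i j
    choose a ha using fun n => A.toTrunc_surjective n (φ n g i j)
    have hmn : ∀ m n, m ≤ n → (A.toTrunc m).toAlgHom (a n) = φ m g i j := by
      intro m n h
      rw [← A.transition_toTrunc h, ha, ← hφ m n h, push_apply]
    obtain ⟨L, hL⟩ := IsPrecomplete.prec (I := maximalIdeal A) (M := A) inferInstance (f := a) (by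
      intro m n h
      rw [SModEq.sub_mem, smul_eq_mul, Ideal.mul_top]
      refine Ideal.pow_le_pow_right (Nat.le_succ m) ?_
      rw [← CoeffRing.toTrunc_eq_zero, map_sub, hmn m n h, ha, sub_self])
    refine ⟨L, fun n => ?_⟩
    have := hL (n + 1)
    rw [SModEq.sub_mem, smul_eq_mul, Ideal.mul_top, ← CoeffRing.toTrunc_eq_zero, map_sub,
      hmn n (n + 1) (Nat.le_succ n), sub_eq_zero] at this
    exact this.symm
  choose L hL using h1
  have hmap : ∀ n g, (Matrix.of (L g)).map (A.toTrunc n).toAlgHom =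
      (φ n g : Matrix (Fin 2) (Fin 2) (A.trunc n)) := by
    intro n g
    ext i j
    exact hL g i j n
  let ρ0 : G →* Matrix (Fin 2) (Fin 2) A :=
    { toFun := fun g => Matrix.of (L g)
      map_one' := by
        ext i j
        refine CoeffRing.eq_of_forall_toTrunc fun n => ?_
        have h1 := congrFun (congrFun (hmap n 1) i) j
        rw [map_one, Units.val_one] at h1
        refine h1.trans ?_
        rw [Matrix.one_apply, Matrix.one_apply]
        split_ifs <;> simp
      map_mul' := fun g g' => by
        ext i j
        refine CoeffRing.eq_of_forall_toTrunc fun n => ?_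
        have h1 := congrFun (congrFun (hmap n (g * g')) i) j
        rw [map_mul, Units.val_mul, ← hmap, ← hmap] at h1
        refine h1.trans ?_
        rw [Matrix.mul_apply, Matrix.mul_apply, map_sum]
        simp [Matrix.map_apply] }
  refine ⟨ρ0.toHomUnits, fun n => MonoidHom.ext fun g => Matrix.GeneralLinearGroup.ext fun i j => ?_⟩
  exact hL g i j n

/-- This is why a lifting sees inertia only through `p`-groups: an element that is residually
trivial has `p`-power order modulo every power of the maximal ideal. -/
theorem push_pow_eq_one [CharP k p] {A : CoeffRing p k} {ρ : G →* GL (Fin 2) A} {g : G}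
    (hg : Matrix.GeneralLinearGroup.map A.res (ρ g) = 1) (n : ℕ) :
    push (A.toTrunc n) ρ g ^ p ^ n = 1 := by
  rw [← map_pow, push_toTrunc_eq_one_iff]
  have h1 : ∀ i j, ((ρ g : Matrix (Fin 2) (Fin 2) A) - 1) i j ∈ maximalIdeal A := by
    intro i j
    rw [CoeffRing.mem_maximalIdeal, Matrix.sub_apply, map_sub, sub_eq_zero]
    have := (Matrix.GeneralLinearGroup.ext_iff _ _).mp hg i j
    refine this.trans ?_
    rw [Units.val_one, Matrix.one_apply, Matrix.one_apply]
    split_ifs <;> simp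
  intro i j
  have := matrix_pow_prime_pow_sub_one_mem A.natCast_mem h1 n i j
  rw [map_pow, Units.val_pow_eq_pow_val]
  exact this

/-- What the liftings of a representation trivial on `I` see of the absolute Galois group of a
local field: the relation between a Frobenius element `σ` and a tame inertia element `τ`, the
generation by these elements and the universal property. Here `P` is the wild inertia group. -/
structure TameData (p q : ℕ) {G : Type v} [Group G] [TopologicalSpace G] (I P : Subgroup G)
    (σ τ : G) : Prop where
  tau_mem : τ ∈ I
  relation : ∀ H : Subgroup G, H.Normal → IsOpen (H : Set G) →
    (∀ i ∈ I, ∃ m : ℕ, i ^ p ^ m ∈ H) → σ * τ * σ⁻¹ * (τ ^ q)⁻¹ ∈ H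
  generation : ∀ H : Subgroup G, H.Normal → IsOpen (H : Set G) →
    (∀ i ∈ I, ∃ m : ℕ, i ^ p ^ m ∈ H) → ∀ g, ∃ (a : ℕ) (j : ℤ), (σ ^ a * τ ^ j)⁻¹ * g ∈ H
  inertia : ∀ H : Subgroup G, H.Normal → IsOpen (H : Set G) →
    (∀ i ∈ I, ∃ m : ℕ, i ^ p ^ m ∈ H) → ∀ g ∈ I, ∃ j : ℤ, (τ ^ j)⁻¹ * g ∈ H
  wild : ∀ H : Subgroup G, H.Normal → IsOpen (H : Set G) →
    (∀ i ∈ I, ∃ m : ℕ, i ^ p ^ m ∈ H) → P ≤ H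
  exists_hom : ∀ (Γ : Type u) [Group Γ] [Finite Γ] (s t : Γ) (m : ℕ), t ^ p ^ m = 1 →
    s * t * s⁻¹ = t ^ q → ∃ Φ : G →* Γ, IsOpen (Φ.ker : Set G) ∧ Φ σ = s ∧ Φ τ = t ∧
      (∀ i ∈ I, Φ i ^ p ^ m = 1) ∧ ∀ g ∈ P, Φ g = 1

variable [TopologicalSpace G] [IsTopologicalGroup G] {q : ℕ} {I P : Subgroup G} {σ τ : G}

/-- Applied to the intersection of the two kernels, generation writes every element as a power of
`σ` times a power of `τ`. The exponents for the two maps may differ, so their sum serves for both.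
-/
theorem TameData.hom_eq (h : TameData.{u} p q I P σ τ) {Γ : Type*} [Group Γ] {φ ψ : G →* Γ}
    (hφ : IsOpen (φ.ker : Set G)) (hψ : IsOpen (ψ.ker : Set G))
    (hφI : ∀ i ∈ I, ∃ m : ℕ, φ i ^ p ^ m = 1) (hψI : ∀ i ∈ I, ∃ m : ℕ, ψ i ^ p ^ m = 1)
    (hσ : φ σ = ψ σ) (hτ : φ τ = ψ τ) : φ = ψ := by
  refine MonoidHom.ext fun g => ?_
  obtain ⟨a, j, hg⟩ := h.generation (φ.ker ⊓ ψ.ker) inferInstance (hφ.inter hψ) (fun i hi => by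
    obtain ⟨m, hm⟩ := hφI i hi
    obtain ⟨n, hn⟩ := hψI i hi
    refine ⟨m + n, ?_⟩
    rw [Subgroup.mem_inf, MonoidHom.mem_ker, MonoidHom.mem_ker, map_pow, map_pow]
    constructor
    · rw [pow_add, pow_mul, hm, one_pow]
    · rw [add_comm, pow_add, pow_mul, hn, one_pow]) g
  rw [Subgroup.mem_inf, MonoidHom.mem_ker, MonoidHom.mem_ker] at hg
  have e1 := hg.1
  have e2 := hg.2
  rw [map_mul, map_inv, inv_mul_eq_one] at e1 e2
  rw [← e1, ← e2]
  simp [hσ, hτ]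

variable [CharP k p] [Finite k]

section Liftings

variable {ρbar : G →* GL (Fin 2) k}

theorem IsLifting.res_apply {A : CoeffRing p k} {ρ : G →* GL (Fin 2) A} (h : IsLifting ρbar A ρ)
    (g : G) : Matrix.GeneralLinearGroup.map A.res (ρ g) = ρbar g := DFunLike.congr_fun h.2 g

theorem IsLifting.exists_pow (hI : ∀ i ∈ I, ρbar i = 1) {A : CoeffRing p k}
    {ρ : G →* GL (Fin 2) A} (h : IsLifting ρbar A ρ) (n : ℕ) (i : G) (hi : i ∈ I) :
    ∃ m : ℕ, push (A.toTrunc n) ρ i ^ p ^ m = 1 :=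
  ⟨n, push_pow_eq_one (by rw [h.res_apply, hI i hi]) n⟩

theorem TameData.lifting_relation (h : TameData.{u} p q I P σ τ) (hI : ∀ i ∈ I, ρbar i = 1)
    {A : CoeffRing p k} {ρ : G →* GL (Fin 2) A} (hρ : IsLifting ρbar A ρ) :
    ρ σ * ρ τ * (ρ σ)⁻¹ = ρ τ ^ q := by
  refine gl_eq_of_forall_toTrunc fun n => ?_
  have := h.relation (push (A.toTrunc n) ρ).ker inferInstance (isContRep_iff.mp hρ.1 n) (fun i hi => by
    obtain ⟨m, hm⟩ := hρ.exists_pow hI n i hi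
    exact ⟨m, by rw [MonoidHom.mem_ker, map_pow, hm]⟩)
  rw [MonoidHom.mem_ker, map_mul, map_inv, mul_inv_eq_one] at this
  rw [← map_inv, ← map_mul, ← map_mul, ← map_pow]
  exact this

theorem TameData.lifting_wild (h : TameData.{u} p q I P σ τ) (hI : ∀ i ∈ I, ρbar i = 1)
    {A : CoeffRing p k} {ρ : G →* GL (Fin 2) A} (hρ : IsLifting ρbar A ρ) {g : G} (hg : g ∈ P) :
    ρ g = 1 := by
  refine gl_eq_of_forall_toTrunc fun n => ?_
  have := h.wild (push (A.toTrunc n) ρ).ker inferInstance (isContRep_iff.mp hρ.1 n) (fun i hi => by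
    obtain ⟨m, hm⟩ := hρ.exists_pow hI n i hi
    exact ⟨m, by rw [MonoidHom.mem_ker, map_pow, hm]⟩) hg
  rw [MonoidHom.mem_ker] at this
  rw [map_one]
  exact this

theorem TameData.lifting_inertia (h : TameData.{u} p q I P σ τ) (hI : ∀ i ∈ I, ρbar i = 1)
    {A : CoeffRing p k} {ρ : G →* GL (Fin 2) A} (hρ : IsLifting ρbar A ρ) (hτ : ρ τ = 1) {g : G}
    (hg : g ∈ I) : ρ g = 1 := by
  refine gl_eq_of_forall_toTrunc fun n => ?_
  obtain ⟨j, hj⟩ := h.inertia (push (A.toTrunc n) ρ).ker inferInstance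
    (isContRep_iff.mp hρ.1 n) (fun i hi => by
      obtain ⟨m, hm⟩ := hρ.exists_pow hI n i hi
      exact ⟨m, by rw [MonoidHom.mem_ker, map_pow, hm]⟩) g hg
  rw [MonoidHom.mem_ker, map_mul, map_inv, inv_mul_eq_one, map_zpow] at hj
  have e : push (A.toTrunc n) ρ τ = 1 := by
    change Matrix.GeneralLinearGroup.map _ (ρ τ) = 1
    rw [hτ, map_one]
  rw [e, one_zpow] at hj
  rw [map_one]
  exact hj.symm

theorem TameData.lifting_ext (h : TameData.{u} p q I P σ τ) (hI : ∀ i ∈ I, ρbar i = 1)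
    {A : CoeffRing p k} {ρ ρ' : G →* GL (Fin 2) A} (hρ : IsLifting ρbar A ρ)
    (hρ' : IsLifting ρbar A ρ') (hσ : ρ σ = ρ' σ) (hτ : ρ τ = ρ' τ) : ρ = ρ' := by
  refine MonoidHom.ext fun g => gl_eq_of_forall_toTrunc fun n => ?_
  have := h.hom_eq (isContRep_iff.mp hρ.1 n) (isContRep_iff.mp hρ'.1 n) (hρ.exists_pow hI n)
    (hρ'.exists_pow hI n) (congrArg (Matrix.GeneralLinearGroup.map _) hσ)
    (congrArg (Matrix.GeneralLinearGroup.map _) hτ)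
  exact DFunLike.congr_fun this g

/-- Modulo each power of the maximal ideal the target is a finite group in which `t` has `p`-power
order, so the universal property provides a homomorphism. Such homomorphisms are determined by their
values at `σ` and `τ`, hence compatible, and the lifting is their limit. -/
theorem TameData.exists_lifting (h : TameData.{u} p q I P σ τ) (hI : ∀ i ∈ I, ρbar i = 1)
    (hopen : IsOpen (ρbar.ker : Set G)) (A : CoeffRing p k) (s t : GL (Fin 2) A)
    (hs : Matrix.GeneralLinearGroup.map A.res s = ρbar σ)
    (ht : Matrix.GeneralLinearGroup.map A.res t = 1) (hst : s * t * s⁻¹ = t ^ q) :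
    ∃ ρ : G →* GL (Fin 2) A, IsLifting ρbar A ρ ∧ ρ σ = s ∧ ρ τ = t := by
  have hfin : ∀ n, Finite (GL (Fin 2) (A.trunc n)) := fun n => inferInstance
  let r : ∀ n, GL (Fin 2) A →* GL (Fin 2) (A.trunc n) :=
    fun n => Matrix.GeneralLinearGroup.map ((A.toTrunc n).toAlgHom : A →+* A.trunc n)
  have htn : ∀ n, r n t ^ p ^ n = 1 := fun n =>
    push_pow_eq_one (G := GL (Fin 2) A) (ρ := MonoidHom.id _) ht n
  have h1 := fun n => h.exists_hom (GL (Fin 2) (A.trunc n)) (r n s) (r n t) n (htn n) (by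
    rw [← map_inv, ← map_mul, ← map_mul, hst, map_pow])
  choose Φ hΦo hΦσ hΦτ hΦI hΦP using h1
  have hker : ∀ (n : ℕ) (Γ : Type u) [Group Γ] (f : GL (Fin 2) (A.trunc n) →* Γ),
      IsOpen ((f.comp (Φ n)).ker : Set G) := fun n Γ _ f =>
    Subgroup.isOpen_mono (H₁ := (Φ n).ker) (fun g hg => by
      rw [MonoidHom.mem_ker] at *
      rw [MonoidHom.comp_apply, hg, map_one]) (hΦo n)
  obtain ⟨ρ, hρ⟩ := exists_limit_rep A Φ (fun m n hmn => by
    refine h.hom_eq (hker n _ _) (hΦo m) (fun i hi => ⟨n, ?_⟩) (fun i hi => ⟨m, hΦI m i hi⟩) ?_ ?_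
    · rw [← map_pow]
      change Matrix.GeneralLinearGroup.map _ (Φ n _) = 1
      rw [map_pow, hΦI n i hi, map_one]
    · change Matrix.GeneralLinearGroup.map _ (Φ n _) = _
      rw [hΦσ, hΦσ]; rfl
    · change Matrix.GeneralLinearGroup.map _ (Φ n _) = _
      rw [hΦτ, hΦτ]; rfl)
  have hρσ : ρ σ = s := gl_eq_of_forall_toTrunc fun n =>
    (DFunLike.congr_fun (hρ n) σ).trans (hΦσ n)
  have hρτ : ρ τ = t := gl_eq_of_forall_toTrunc fun n =>
    (DFunLike.congr_fun (hρ n) τ).trans (hΦτ n)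
  refine ⟨ρ, ⟨isContRep_iff.mpr fun n => by rw [hρ]; exact hΦo n, ?_⟩, hρσ, hρτ⟩
  have e : (Matrix.GeneralLinearGroup.map A.res).comp ρ =
      (Matrix.GeneralLinearGroup.map (A.trunc 0).res).comp (Φ 0) := by
    rw [← hρ, res_push]
  refine h.hom_eq (by rw [e]; exact hker 0 _ _) hopen (fun i hi => ⟨0, ?_⟩)
    (fun i hi => ⟨0, by rw [hI i hi, one_pow]⟩) ?_ ?_
  · rw [e, ← map_pow, MonoidHom.comp_apply, map_pow, hΦI 0 i hi, map_one]
  · rw [MonoidHom.comp_apply, hρσ, hs]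
  · rw [MonoidHom.comp_apply, hρτ, ht, hI τ h.tau_mem]

/-- Modulo each power of the maximal ideal both the determinant and the character are homomorphisms
with open kernel and `p`-power torsion values on inertia, so that a comparison at `σ` and `τ`
suffices. -/
theorem TameData.det_eq (h : TameData.{u} p q I P σ τ) (hI : ∀ i ∈ I, ρbar i = 1)
    {χ : G →* (WittVector p k)ˣ} (hχI : ∀ i ∈ I, χ i = 1)
    (hχ : ∀ n : ℕ, IsOpen {g | (χ g : WittVector p k) - 1 ∈ Ideal.span {(p : WittVector p k)} ^ n})
    {A : CoeffRing p k} {ρ : G →* GL (Fin 2) A} (hρ : IsLifting ρbar A ρ)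
    (hσ : (ρ σ : Matrix (Fin 2) (Fin 2) A).det = algebraMap (WittVector p k) A (χ σ))
    (hτ : (ρ τ : Matrix (Fin 2) (Fin 2) A).det = 1) (g : G) :
    (ρ g : Matrix (Fin 2) (Fin 2) A).det = algebraMap (WittVector p k) A (χ g) := by
  refine CoeffRing.eq_of_forall_toTrunc fun n => ?_
  let ψ : G →* (A.trunc n)ˣ :=
    (Units.map (algebraMap (WittVector p k) (A.trunc n) : WittVector p k →* A.trunc n)).comp χ
  let φ : G →* (A.trunc n)ˣ := Matrix.GeneralLinearGroup.det.comp (push (A.toTrunc n) ρ)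
  have hφv : ∀ g, (φ g : A.trunc n) =
      (A.toTrunc n).toAlgHom (ρ g : Matrix (Fin 2) (Fin 2) A).det := fun g =>
    (RingHom.map_det ((A.toTrunc n).toAlgHom : A →+* A.trunc n)
      (ρ g : Matrix (Fin 2) (Fin 2) A)).symm
  have hψv : ∀ g, (ψ g : A.trunc n) =
      (A.toTrunc n).toAlgHom (algebraMap (WittVector p k) A (χ g)) := fun g =>
    ((A.toTrunc n).toAlgHom.commutes _).symm
  have e : φ = ψ := by
    refine h.hom_eq ?_ ?_ (fun i hi => ?_) (fun i hi => ⟨0, ?_⟩) ?_ ?_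
    · exact Subgroup.isOpen_mono (H₁ := (push (A.toTrunc n) ρ).ker) (fun g hg => by
        rw [MonoidHom.mem_ker] at *
        change Matrix.GeneralLinearGroup.det _ = 1
        rw [hg, map_one]) (isContRep_iff.mp hρ.1 n)
    · refine Subgroup.isOpen_of_mem_nhds (g := 1) _ (Filter.mem_of_superset
        ((hχ (n + 1)).mem_nhds (by simp)) fun g hg => ?_)
      change ψ g = 1
      ext
      rw [hψv, Units.val_one, ← map_one (A.toTrunc n).toAlgHom, ← sub_eq_zero, ← map_sub,
        CoeffRing.toTrunc_eq_zero]
      have h1 := Ideal.mem_map_of_mem (algebraMap (WittVector p k) A)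
        (show (χ g : WittVector p k) - 1 ∈ Ideal.span {(p : WittVector p k)} ^ (n + 1) from hg)
      rw [Ideal.map_pow, Ideal.map_span, Set.image_singleton, map_natCast, map_sub, map_one] at h1
      exact Ideal.pow_right_mono ((Ideal.span_singleton_le_iff_mem _).mpr A.natCast_mem) _ h1
    · obtain ⟨m, hm⟩ := hρ.exists_pow hI n i hi
      refine ⟨m, ?_⟩
      change Matrix.GeneralLinearGroup.det _ ^ _ = 1
      rw [← map_pow, hm, map_one]
    · change Units.map _ (χ i) ^ _ = 1
      rw [hχI i hi, map_one, one_pow]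
    · ext
      rw [hφv, hψv, hσ]
    · ext
      rw [hφv, hψv, hτ, hχI τ h.tau_mem, Units.val_one, map_one, map_one]
      exact (map_one _).symm
  rw [← hφv, ← hψv, e]

end Liftings

end TameGroups

/-! ### The absolute value on algebraic extensions of the `l`-adic numbers. -/

section AbsoluteValue

variable {l : ℕ} [Fact l.Prime] {L : Type v} [Field L] [Algebra ℚ_[l] L] [Algebra.IsAlgebraic ℚ_[l] L]

theorem absHom_nonneg (x : L) : 0 ≤ absHom l L x := spectralNorm_nonneg x

theorem absHom_zero : absHom l L 0 = 0 := spectralNorm_zero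

theorem absHom_eq_zero {x : L} : absHom l L x = 0 ↔ x = 0 :=
  ⟨fun h => by
    by_contra hx
    have := map_mul (absHom l L) x x⁻¹
    rw [mul_inv_cancel₀ hx, map_one, h, zero_mul] at this
    exact one_ne_zero this, fun h => by rw [h, absHom_zero]⟩

theorem absHom_pos {x : L} (hx : x ≠ 0) : 0 < absHom l L x :=
  (absHom_nonneg x).lt_of_ne fun h => hx (absHom_eq_zero.mp h.symm)

theorem absHom_inv (x : L) : absHom l L x⁻¹ = (absHom l L x)⁻¹ :=
  map_inv₀ (spectralMulAlgNorm ℚ_[l] L) x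

theorem absHom_div (x y : L) : absHom l L (x / y) = absHom l L x / absHom l L y := by
  rw [div_eq_mul_inv, map_mul, absHom_inv, div_eq_mul_inv]

theorem absHom_neg (x : L) : absHom l L (-x) = absHom l L x :=
  spectralNorm_neg (Algebra.IsAlgebraic.isAlgebraic x)

theorem absHom_sub_comm (x y : L) : absHom l L (x - y) = absHom l L (y - x) := by
  rw [← absHom_neg, neg_sub]

theorem absHom_add_le (x y : L) : absHom l L (x + y) ≤ max (absHom l L x) (absHom l L y) :=
  isNonarchimedean_spectralNorm x y

theorem absHom_sub_le (x y : L) : absHom l L (x - y) ≤ max (absHom l L x) (absHom l L y) := by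
  rw [sub_eq_add_neg, ← absHom_neg y]
  exact absHom_add_le _ _

theorem absHom_add_lt {x y : L} {c : ℝ} (hx : absHom l L x < c) (hy : absHom l L y < c) :
    absHom l L (x + y) < c := (absHom_add_le x y).trans_lt (max_lt hx hy)

theorem absHom_sub_lt {x y : L} {c : ℝ} (hx : absHom l L x < c) (hy : absHom l L y < c) :
    absHom l L (x - y) < c := (absHom_sub_le x y).trans_lt (max_lt hx hy)

theorem absHom_sub_lt_trans {x y z : L} {c : ℝ} (hx : absHom l L (x - y) < c)
    (hy : absHom l L (y - z) < c) : absHom l L (x - z) < c := by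
  rw [← sub_add_sub_cancel x y z]
  exact absHom_add_lt hx hy

theorem absHom_sum_le {ι : Type*} (s : Finset ι) (f : ι → L) {c : ℝ} (hc : 0 ≤ c)
    (h : ∀ i ∈ s, absHom l L (f i) ≤ c) : absHom l L (∑ i ∈ s, f i) ≤ c := by
  classical
  induction s using Finset.induction_on with
  | empty => rwa [Finset.sum_empty, absHom_zero]
  | insert a s ha ih =>
    rw [Finset.sum_insert ha]
    exact (absHom_add_le _ _).trans (max_le (h _ (Finset.mem_insert_self _ _))
      (ih fun i hi => h i (Finset.mem_insert_of_mem hi)))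

theorem absHom_sum_lt {ι : Type*} (s : Finset ι) (f : ι → L) {c : ℝ} (hc : 0 < c)
    (h : ∀ i ∈ s, absHom l L (f i) < c) : absHom l L (∑ i ∈ s, f i) < c := by
  classical
  induction s using Finset.induction_on with
  | empty => rwa [Finset.sum_empty, absHom_zero]
  | insert a s ha ih =>
    rw [Finset.sum_insert ha]
    exact absHom_add_lt (h _ (Finset.mem_insert_self _ _))
      (ih fun i hi => h i (Finset.mem_insert_of_mem hi))

theorem absHom_algebraMap_padic (x : ℚ_[l]) : absHom l L (algebraMap ℚ_[l] L x) = ‖x‖ :=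
  spectralNorm_extends x

theorem absHom_natCast_of_coprime {n : ℕ} (h : n.Coprime l) : absHom l L (n : L) = 1 := by
  rw [← map_natCast (algebraMap ℚ_[l] L), absHom_algebraMap_padic]
  exact Padic.norm_natCast_eq_one_iff.mpr h.symm

theorem absHom_prime_lt_one : absHom l L (l : L) < 1 := by
  rw [← map_natCast (algebraMap ℚ_[l] L), absHom_algebraMap_padic]
  exact Padic.norm_p_lt_one

theorem absHom_prime_ne_zero : absHom l L (l : L) ≠ 0 := by
  rw [← map_natCast (algebraMap ℚ_[l] L), absHom_algebraMap_padic, norm_ne_zero_iff]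
  exact_mod_cast (Fact.out : l.Prime).ne_zero

theorem absHom_eq_one_of_pow {x : L} {n : ℕ} (hn : n ≠ 0) (h : x ^ n = 1) : absHom l L x = 1 := by
  have := congrArg (absHom l L) h
  rw [map_pow, map_one] at this
  exact (pow_eq_one_iff_of_nonneg (absHom_nonneg x) hn).mp this

theorem absHom_pow_sub_pow_lt {x y : L} (hx : absHom l L x ≤ 1) (hy : absHom l L y ≤ 1)
    (h : absHom l L (x - y) < 1) (n : ℕ) : absHom l L (x ^ n - y ^ n) < 1 := by
  rw [← geom_sum₂_mul, map_mul]
  refine mul_lt_one_of_nonneg_of_lt_one_right ?_ (absHom_nonneg _) h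
  refine absHom_sum_le _ _ zero_le_one fun i _ => ?_
  rw [map_mul, map_pow, map_pow]
  exact mul_le_one₀ (pow_le_one₀ (absHom_nonneg x) hx) (pow_nonneg (absHom_nonneg y) _)
    (pow_le_one₀ (absHom_nonneg y) hy)

theorem natCast_ne_zero_of_coprime {n : ℕ} (h : n.Coprime l) : n ≠ 0 := by
  rintro rfl
  exact (Fact.out : l.Prime).one_lt.ne' ((Nat.coprime_zero_left l).mp h)

/-- Distinct roots of unity of order prime to the residue characteristic have distinct
reductions. -/
theorem eq_of_pow_eq_one {x y : L} {n : ℕ} (hn : n.Coprime l) (hx : x ^ n = 1) (hy : y ^ n = 1)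
    (h : absHom l L (x - y) < 1) : x = y := by
  have hn0 := natCast_ne_zero_of_coprime hn
  have hy1 := absHom_eq_one_of_pow (l := l) hn0 hy
  have hx1 := absHom_eq_one_of_pow (l := l) hn0 hx
  by_contra hne
  -- If `x ≠ y` this factor of `x ^ n - y ^ n` vanishes. It is also congruent to `n y ^ (n - 1)`, of
  -- absolute value one since `n` is prime to `l`, which is the contradiction.
  have h0 : ∑ i ∈ Finset.range n, x ^ i * y ^ (n - 1 - i) = 0 := by
    have := geom_sum₂_mul x y n
    rw [hx, hy, sub_self] at this
    exact (mul_eq_zero.mp this).resolve_right (sub_ne_zero.mpr hne)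
  have h1 : (n : L) * y ^ (n - 1) =
      ∑ i ∈ Finset.range n, (y ^ i - x ^ i) * y ^ (n - 1 - i) := by
    simp_rw [sub_mul]
    rw [Finset.sum_sub_distrib, h0, sub_zero, Finset.sum_congr rfl (fun i hi => ?_),
      Finset.sum_const, Finset.card_range, nsmul_eq_mul]
    rw [← pow_add]
    congr 1
    have := Finset.mem_range.mp hi
    omega
  have h2 : absHom l L ((n : L) * y ^ (n - 1)) < 1 := by
    rw [h1]
    refine absHom_sum_lt _ _ one_pos fun i _ => ?_
    rw [map_mul, map_pow, hy1, one_pow, mul_one]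
    exact absHom_pow_sub_pow_lt hy1.le hx1.le (by rwa [absHom_sub_comm]) i
  rw [map_mul, map_pow, hy1, one_pow, mul_one, absHom_natCast_of_coprime hn] at h2
  exact lt_irrefl _ h2

theorem mem_integerRing {x : L} : x ∈ integerRing l L ↔ absHom l L x ≤ 1 := Iff.rfl

theorem mem_maximalIdeal_integerRing {x : integerRing l L} :
    x ∈ maximalIdeal (integerRing l L) ↔ absHom l L (x : L) < 1 := by
  rw [mem_maximalIdeal, mem_nonunits_iff, not_iff_comm, not_lt]
  constructor
  · intro h
    have hx : (x : L) ≠ 0 := fun h0 => by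
      rw [h0, absHom_zero] at h
      exact absurd h (by norm_num)
    refine IsUnit.of_mul_eq_one ⟨(x : L)⁻¹, ?_⟩ (Subtype.ext (mul_inv_cancel₀ hx))
    rw [mem_integerRing, absHom_inv]
    exact inv_le_one_of_one_le₀ h
  · intro h
    obtain ⟨y, hy⟩ := h.exists_right_inv
    have h1 := congrArg (fun z : integerRing l L => absHom l L (z : L)) hy
    simp only [MulMemClass.coe_mul, map_mul, OneMemClass.coe_one, map_one] at h1
    have h2 := mem_integerRing.mp y.2
    by_contra hlt
    have := mul_lt_one_of_nonneg_of_lt_one_left (absHom_nonneg (x : L)) (not_le.mp hlt) h2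
    exact lt_irrefl _ (h1 ▸ this)

theorem residue_eq_iff {x y : integerRing l L} :
    residue (integerRing l L) x = residue (integerRing l L) y ↔
      absHom l L ((x : L) - y) < 1 := by
  rw [← sub_eq_zero, ← map_sub, residue_eq_zero_iff, mem_maximalIdeal_integerRing]
  rfl

theorem residue_eq_zero_iff' {x : integerRing l L} :
    residue (integerRing l L) x = 0 ↔ absHom l L (x : L) < 1 := by
  rw [residue_eq_zero_iff, mem_maximalIdeal_integerRing]

instance charP_residueField_integerRing : CharP (ResidueField (integerRing l L)) l := by
  have h : ((l : ℕ) : ResidueField (integerRing l L)) = 0 := by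
    rw [← map_natCast (residue (integerRing l L)), residue_eq_zero_iff']
    exact_mod_cast absHom_prime_lt_one (l := l) (L := L)
  exact (CharP.charP_iff_prime_eq_zero (Fact.out : l.Prime)).mpr h

end AbsoluteValue

/-! ### Residue fields and roots of unity of order prime to the residue characteristic. -/

section ResidueFields

variable {l : ℕ} [Fact l.Prime] {L : Type v} [Field L] [Algebra ℚ_[l] L] [Algebra.IsAlgebraic ℚ_[l] L]

theorem exists_natCast_norm_sub_lt {c : ℚ_[l]} (hc : ‖c‖ ≤ 1) : ∃ a : ℕ, ‖c - a‖ < 1 := by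
  obtain ⟨a, -, ha⟩ := PadicInt.exists_mem_range (⟨c, hc⟩ : ℤ_[l])
  refine ⟨a, ?_⟩
  rw [PadicInt.maximalIdeal_eq_span_p, Ideal.mem_span_singleton,
    ← PadicInt.norm_lt_one_iff_dvd] at ha
  exact ha

/-- An element of the residue field of an algebraic extension of `ℚ_l` is fixed by a power of the
Frobenius map, bounded in terms of the degree of a lift. -/
theorem exists_pow_eq_self (x : integerRing l L) :
    ∃ e : ℕ, 0 < e ∧ e ≤ (minpoly ℚ_[l] (x : L)).natDegree ∧
      residue (integerRing l L) x ^ l ^ e = residue (integerRing l L) x := by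
  set P := minpoly ℚ_[l] (x : L) with hP
  have hint : IsIntegral ℚ_[l] (x : L) := Algebra.IsIntegral.isIntegral _
  have hmon : P.Monic := minpoly.monic hint
  have hcoef : ∀ n, ‖P.coeff n‖ ≤ 1 := (spectralValue_le_one_iff hmon).mp x.2
  choose a ha using fun n => exists_natCast_norm_sub_lt (hcoef n)
  set d := P.natDegree with hd
  let _ : Algebra (ZMod l) (ResidueField (integerRing l L)) := ZMod.algebra _ l
  set y := residue (integerRing l L) x with hy
  -- A reduction of the minimal polynomial: its coefficients have norm at most one and are
  -- approximated by natural numbers, so `f` is monic of the same degree and kills the residue of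
  -- `x`.
  set f : Polynomial (ZMod l) :=
    Polynomial.X ^ d + ∑ i ∈ Finset.range d, Polynomial.C (a i : ZMod l) * Polynomial.X ^ i with hf
  have hdeg : (∑ i ∈ Finset.range d, Polynomial.C (a i : ZMod l) * Polynomial.X ^ i :
      Polynomial (ZMod l)).degree < (d : WithBot ℕ) := by
    refine (Polynomial.degree_sum_le _ _).trans_lt ((Finset.sup_lt_iff (WithBot.bot_lt_coe d)).mpr
      fun i hi => (Polynomial.degree_C_mul_X_pow_le _ _).trans_lt ?_)
    exact Nat.cast_lt.mpr (Finset.mem_range.mp hi)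
  have hfm : f.Monic := Polynomial.monic_X_pow_add hdeg
  have hfd : f.natDegree = d := by
    rw [Polynomial.natDegree_eq_of_degree_eq_some]
    rw [hf, Polynomial.degree_add_eq_left_of_degree_lt, Polynomial.degree_X_pow]
    rwa [Polynomial.degree_X_pow]
  have hf0 : Polynomial.aeval y f = 0 := by
    have h1 : (x : L) ^ d + ∑ i ∈ Finset.range d, algebraMap ℚ_[l] L (P.coeff i) * (x : L) ^ i = 0 := by
      have := minpoly.aeval ℚ_[l] (x : L)
      rw [← hP, Polynomial.aeval_eq_sum_range, Finset.sum_range_succ, ← hd,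
        hmon.coeff_natDegree, one_smul, add_comm] at this
      simpa [Algebra.smul_def] using this
    have h2 : absHom l L ((x : L) ^ d + ∑ i ∈ Finset.range d, (a i : L) * (x : L) ^ i) < 1 := by
      rw [← sub_zero (_ + _), ← h1, add_sub_add_left_eq_sub, ← Finset.sum_sub_distrib]
      refine absHom_sum_lt _ _ one_pos fun i _ => ?_
      rw [← sub_mul, map_mul, map_pow, ← map_natCast (algebraMap ℚ_[l] L), ← map_sub,
        absHom_algebraMap_padic, ← norm_neg, neg_sub]
      exact mul_lt_one_of_nonneg_of_lt_one_left (norm_nonneg _) (ha i)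
        (pow_le_one₀ (absHom_nonneg _) x.2)
    have h3 : residue (integerRing l L) (x ^ d + ∑ i ∈ Finset.range d, (a i : integerRing l L) * x ^ i)
        = 0 := by
      rw [residue_eq_zero_iff']
      push_cast
      exact h2
    rw [hf]
    simpa using h3
  have hyint : IsIntegral (ZMod l) y := ⟨f, hfm, hf0⟩
  refine ⟨(minpoly (ZMod l) y).natDegree, minpoly.natDegree_pos hyint, ?_, ?_⟩
  · rw [← hfd]
    exact Polynomial.natDegree_le_of_dvd (minpoly.dvd _ _ hf0) hfm.ne_zero
  -- An irreducible polynomial of degree `e` over the field with `l` elements divides `X ^ (l ^ e) -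
  -- X`.
  · have h := ((minpoly.irreducible hyint).natDegree_dvd_iff_dvd_X_pow_card_pow_sub_X
      (n := (minpoly (ZMod l) y).natDegree)).mp dvd_rfl
    have h2 := Polynomial.aeval_eq_zero_of_dvd_aeval_eq_zero h (minpoly.aeval _ y)
    rw [Nat.card_zmod] at h2
    simpa [sub_eq_zero] using h2

theorem exists_coprime_pow_sub_one_lt {x : L} (hx : absHom l L x = 1) :
    ∃ n : ℕ, n.Coprime l ∧ absHom l L (x ^ n - 1) < 1 := by
  obtain ⟨e, he, -, h⟩ := exists_pow_eq_self (l := l) (⟨x, hx.le⟩ : integerRing l L)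
  have hl := (Fact.out : l.Prime)
  have h1 : 1 ≤ l ^ e := Nat.one_le_pow _ _ hl.pos
  refine ⟨l ^ e - 1, ?_, ?_⟩
  · refine Nat.Coprime.coprime_dvd_right (dvd_pow_self l he.ne') ?_
    exact (Nat.coprime_self_sub_left h1).mpr (Nat.coprime_one_left _)
  · rw [← map_pow, residue_eq_iff] at h
    change absHom l L (x ^ l ^ e - x) < 1 at h
    have e1 : x ^ l ^ e - x = x * (x ^ (l ^ e - 1) - 1) := by
      rw [mul_sub, ← pow_succ', Nat.sub_add_cancel h1, mul_one]
    rwa [e1, map_mul, hx, one_mul] at h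

/-- The exponents `e` attached to the individual elements are at most the degree of `L`, so all
divide its factorial. Hence every residue is a root of one fixed nonzero polynomial. -/
instance finite_residueField_integerRing [FiniteDimensional ℚ_[l] L] :
    Finite (ResidueField (integerRing l L)) := by
  set d := Module.finrank ℚ_[l] L with hd
  have h : ∀ y : ResidueField (integerRing l L), y ^ l ^ d.factorial = y := by
    intro y
    obtain ⟨x, rfl⟩ := residue_surjective y
    obtain ⟨e, he, hed, h⟩ := exists_pow_eq_self x
    obtain ⟨c, hc⟩ := Nat.dvd_factorial he (hed.trans (minpoly.natDegree_le (x : L)))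
    rw [hd, hc, pow_mul]
    clear hc
    induction c with
    | zero => simp
    | succ c ih => rw [pow_succ, pow_mul, ih, h]
  have hne : (Polynomial.X ^ l ^ d.factorial - Polynomial.X :
      Polynomial (ResidueField (integerRing l L))) ≠ 0 :=
    FiniteField.X_pow_card_pow_sub_X_ne_zero _ (Nat.factorial_ne_zero _)
      (Fact.out : l.Prime).one_lt
  have hfin := Polynomial.rootSet_finite (Polynomial.X ^ l ^ d.factorial - Polynomial.X :
      Polynomial (ResidueField (integerRing l L))) (ResidueField (integerRing l L))
  refine Set.finite_univ_iff.mp (hfin.subset fun y _ => ?_)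
  rw [Polynomial.mem_rootSet]
  exact ⟨hne, by simp [h y]⟩

theorem residueCard_eq_pow [FiniteDimensional ℚ_[l] L] :
    ∃ f : ℕ, 0 < f ∧ residueCard l L = l ^ f := by
  have := Fintype.ofFinite (ResidueField (integerRing l L))
  obtain ⟨n, -, hn⟩ := FiniteField.card (ResidueField (integerRing l L)) l
  exact ⟨n, n.2, by rw [residueCard, Nat.card_eq_fintype_card, hn]⟩

/-- For a suitable `n` prime to `l`, the product of the `x - ζ` over the `n`-th roots of unity is `x
^ n - 1`, of absolute value less than one. One of the factors must then be small. -/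
theorem exists_root_of_unity_near [IsAlgClosed L] {x : L} (hx : absHom l L x = 1) :
    ∃ (n : ℕ) (ζ : L), n.Coprime l ∧ ζ ^ n = 1 ∧ absHom l L (x - ζ) < 1 := by
  obtain ⟨n, hn, h⟩ := exists_coprime_pow_sub_one_lt hx
  have hn0 := natCast_ne_zero_of_coprime hn
  have : CharZero L := charZero_of_injective_algebraMap (algebraMap ℚ_[l] L).injective
  have : NeZero (n : L) := ⟨Nat.cast_ne_zero.mpr hn0⟩
  obtain ⟨ζ, hζ⟩ := HasEnoughRootsOfUnity.exists_primitiveRoot L n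
  have e := Polynomial.X_pow_sub_one_eq_prod (Nat.pos_of_ne_zero hn0) hζ
  have e2 := congrArg (Polynomial.eval x) e
  rw [Polynomial.eval_prod] at e2
  simp only [Polynomial.eval_sub, Polynomial.eval_pow, Polynomial.eval_X, Polynomial.eval_one,
    Polynomial.eval_C] at e2
  by_contra hcon
  push Not at hcon
  have h2 : 1 ≤ absHom l L (x ^ n - 1) := by
    rw [e2, map_prod]
    refine Finset.prod_induction _ (fun r : ℝ => 1 ≤ r) (fun a b ha hb => one_le_mul_of_one_le_of_one_le ha hb)
      le_rfl fun ξ hξ => ?_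
    refine hcon n ξ hn ?_
    rw [Polynomial.mem_nthRootsFinset (Nat.pos_of_ne_zero hn0)] at hξ
    exact hξ
  exact not_lt.mpr h2 h

end ResidueFields

/-! ### The inertia group and the maximal unramified extension. -/

section Inertia

theorem charZero_of_padic (l : ℕ) [Fact l.Prime] (F : Type v) [Field F] [Algebra ℚ_[l] F] :
    CharZero F :=
  charZero_of_injective_algebraMap (algebraMap ℚ_[l] F).injective

theorem isGalois_algebraicClosure (l : ℕ) [Fact l.Prime] (F : Type v) [Field F] [Algebra ℚ_[l] F] :
    IsGalois F (AlgebraicClosure F) :=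
  haveI := charZero_of_padic l F
  inferInstance

variable {l : ℕ} [Fact l.Prime] {F : Type v} [Field F] [Algebra ℚ_[l] F] [FiniteDimensional ℚ_[l] F]

local notation "Ω" => AlgebraicClosure F

theorem absHom_algEquiv {L : Type*} [Field L] [Algebra F L] [Algebra ℚ_[l] L]
    [IsScalarTower ℚ_[l] F L] [Algebra.IsAlgebraic ℚ_[l] L] (g : L ≃ₐ[F] L) (x : L) :
    absHom l L (g x) = absHom l L x :=
  (spectralNorm_eq_of_equiv (g.restrictScalars ℚ_[l]) x).symm

theorem absHom_algebraMap {E L : Type*} [Field E] [Field L] [Algebra E L] [Algebra ℚ_[l] E]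
    [Algebra ℚ_[l] L] [IsScalarTower ℚ_[l] E L] [Algebra.IsAlgebraic ℚ_[l] L]
    [Algebra.IsAlgebraic ℚ_[l] E] (x : E) :
    absHom l L (algebraMap E L x) = absHom l E x :=
  (spectralNorm.eq_of_tower x).symm

variable (l F) in
/-- The inertia subgroup of the absolute Galois group. -/
def inertiaSubgroup : Subgroup (Ω ≃ₐ[F] Ω) where
  carrier := inertia l F Ω
  one_mem' := fun x _ => by
    rw [AlgEquiv.one_apply, sub_self, spectralNorm_zero]
    exact one_pos
  mul_mem' := fun {g h} hg hh x hx => by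
    have h1 : absHom l Ω (g (h x) - g x) < 1 := by
      rw [← map_sub, absHom_algEquiv]
      exact hh x hx
    exact absHom_sub_lt_trans h1 (hg x hx)
  inv_mem' := fun {g} hg x hx => by
    have h1 := hg (g⁻¹ x) (by
      change absHom l Ω (g⁻¹ x) ≤ 1
      rw [absHom_algEquiv]; exact hx)
    have e : g (g⁻¹ x) = x := by rw [← AlgEquiv.mul_apply, mul_inv_cancel, AlgEquiv.one_apply]
    rw [e] at h1
    change absHom l Ω (g⁻¹ x - x) < 1
    rw [absHom_sub_comm]
    exact h1

theorem mem_inertiaSubgroup {g : Ω ≃ₐ[F] Ω} :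
    g ∈ inertiaSubgroup l F ↔ ∀ x : Ω, absHom l Ω x ≤ 1 → absHom l Ω (g x - x) < 1 := Iff.rfl

instance inertiaSubgroup_normal : (inertiaSubgroup l F).Normal where
  conj_mem := fun i hi g => by
    rw [mem_inertiaSubgroup] at *
    intro x hx
    have h1 := hi (g⁻¹ x) (by rwa [absHom_algEquiv])
    rw [← absHom_algEquiv g, map_sub] at h1
    have e : g (g⁻¹ x) = x := by rw [← AlgEquiv.mul_apply, mul_inv_cancel, AlgEquiv.one_apply]
    rwa [e] at h1

theorem inertia_root_of_unity {g : Ω ≃ₐ[F] Ω} (hg : g ∈ inertiaSubgroup l F) {n : ℕ}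
    (hn : n.Coprime l) {ζ : Ω} (hζ : ζ ^ n = 1) : g ζ = ζ :=
  eq_of_pow_eq_one hn (by rw [← map_pow, hζ, map_one]) hζ
    (hg ζ (absHom_eq_one_of_pow (natCast_ne_zero_of_coprime hn) hζ).le)

/-- An automorphism acting on roots of unity of order prime to `l` by the `a`-th power map acts so
on the residue field. -/
theorem absHom_sub_pow_lt_of_roots {g : Ω ≃ₐ[F] Ω} {a : ℕ} (ha : 0 < a)
    (h : ∀ (n : ℕ) (ζ : Ω), n.Coprime l → ζ ^ n = 1 → g ζ = ζ ^ a) {x : Ω} (hx : absHom l Ω x ≤ 1) :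
    absHom l Ω (g x - x ^ a) < 1 := by
  rcases hx.lt_or_eq with hlt | heq
  · refine absHom_sub_lt (by rwa [absHom_algEquiv]) ?_
    rw [map_pow]
    exact pow_lt_one₀ (absHom_nonneg x) hlt ha.ne'
  · obtain ⟨n, ζ, hn, hζ, hxζ⟩ := exists_root_of_unity_near heq
    have h1 : absHom l Ω (g x - ζ ^ a) < 1 := by
      rw [← h n ζ hn hζ, ← map_sub, absHom_algEquiv]
      exact hxζ
    refine absHom_sub_lt_trans h1 (absHom_pow_sub_pow_lt ?_ hx (by rwa [absHom_sub_comm]) a)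
    exact (absHom_eq_one_of_pow (natCast_ne_zero_of_coprime hn) hζ).le

theorem mem_inertiaSubgroup_of_roots {g : Ω ≃ₐ[F] Ω}
    (h : ∀ (n : ℕ) (ζ : Ω), n.Coprime l → ζ ^ n = 1 → g ζ = ζ) : g ∈ inertiaSubgroup l F := by
  intro x hx
  have := absHom_sub_pow_lt_of_roots (l := l) (g := g) (a := 1) one_pos
    (fun n ζ hn hζ => by rw [pow_one, h n ζ hn hζ]) hx
  rwa [pow_one] at this

/-- The elements fixed by inertia lie in an extension generated by a root of unity. -/
theorem exists_mem_adjoin_of_fixed {x : Ω} (hx : ∀ i ∈ inertiaSubgroup l F, i x = x) :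
    ∃ (n : ℕ) (ζ : Ω), n.Coprime l ∧ ζ ^ n = 1 ∧ x ∈ IntermediateField.adjoin F {ζ} := by
  have := isGalois_algebraicClosure l F
  set S : Set Ω := {ζ | ∃ n : ℕ, n.Coprime l ∧ ζ ^ n = 1} with hS
  -- An automorphism that fixes all roots of unity of order prime to `l` is inertial, because every
  -- unit is close to such a root. By Galois theory the fixed elements of inertia then lie in the
  -- field these roots generate.
  have h1 : x ∈ IntermediateField.adjoin F S := by
    rw [← InfiniteGalois.fixedField_fixingSubgroup (IntermediateField.adjoin F S)]
    intro g
    refine hx g (mem_inertiaSubgroup_of_roots fun n ζ hn hζ => ?_)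
    exact g.2 ⟨ζ, IntermediateField.subset_adjoin F S ⟨n, hn, hζ⟩⟩
  obtain ⟨T, hTS, hT⟩ := IntermediateField.exists_finset_of_mem_adjoin h1
  have h2 : ∃ n : ℕ, n.Coprime l ∧ ∀ ζ ∈ T, ζ ^ n = 1 := by
    have : ∀ ζ : T, ∃ n : ℕ, n.Coprime l ∧ (ζ : Ω) ^ n = 1 := fun ζ => hTS ζ.2
    choose n hn hn1 using this
    refine ⟨∏ ζ, n ζ, Nat.Coprime.prod_left fun i _ => hn i, fun ζ hζ => ?_⟩
    obtain ⟨c, hc⟩ := Finset.dvd_prod_of_mem n (Finset.mem_univ (⟨ζ, hζ⟩ : T))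
    rw [hc, pow_mul, hn1 ⟨ζ, hζ⟩, one_pow]
  obtain ⟨n, hn, hn1⟩ := h2
  have := charZero_of_padic l F
  have : NeZero (n : Ω) := ⟨Nat.cast_ne_zero.mpr (natCast_ne_zero_of_coprime hn)⟩
  have hn0 : NeZero n := ⟨natCast_ne_zero_of_coprime hn⟩
  obtain ⟨ζ, hζ⟩ := HasEnoughRootsOfUnity.exists_primitiveRoot Ω n
  refine ⟨n, ζ, hn, hζ.pow_eq_one, ?_⟩
  refine (IntermediateField.adjoin_le_iff.mpr fun ξ hξ => ?_ :
    IntermediateField.adjoin F (T : Set Ω) ≤ _) hT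
  obtain ⟨i, -, rfl⟩ := hζ.eq_pow_of_pow_eq_one (hn1 ξ hξ)
  exact pow_mem (IntermediateField.mem_adjoin_simple_self F ζ) i

/-- This is unramifiedness of `F(ζ)`: the powers of `ζ` behave like an orthonormal basis. If the
value were less than one, it would be so at all conjugates of `ζ`. These have distinct residues, so
the reduction of `f` would have more roots than its degree and vanish, against the coefficient of
absolute value one. -/
theorem absHom_aeval_root_of_unity {n : ℕ} (hn : n.Coprime l) {ζ : Ω} (hζ : ζ ^ n = 1)
    {f : Polynomial F} (hdeg : f.degree < (minpoly F ζ).degree)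
    (hf : ∀ i, absHom l F (f.coeff i) ≤ 1) {j : ℕ} (hj : absHom l F (f.coeff j) = 1) :
    absHom l Ω (Polynomial.aeval ζ f) = 1 := by
  have hGal := isGalois_algebraicClosure l F
  have hζint : IsIntegral F ζ := Algebra.IsIntegral.isIntegral ζ
  have hn0 := natCast_ne_zero_of_coprime hn
  have hf' : ∀ i, absHom l Ω (algebraMap F Ω (f.coeff i)) ≤ 1 := fun i => by
    rw [absHom_algebraMap]; exact hf i
  have hev : ∀ ξ : Ω, Polynomial.aeval ξ f =
      ∑ i ∈ Finset.range (f.natDegree + 1), algebraMap F Ω (f.coeff i) * ξ ^ i := fun ξ => by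
    rw [Polynomial.aeval_eq_sum_range]
    simp [Algebra.smul_def]
  refine le_antisymm ?_ ?_
  · rw [hev]
    refine absHom_sum_le _ _ zero_le_one fun i _ => ?_
    rw [map_mul, map_pow, absHom_eq_one_of_pow hn0 hζ, one_pow, mul_one]
    exact hf' i
  by_contra hlt
  rw [not_le] at hlt
  let c : ℕ → integerRing l Ω := fun i => ⟨algebraMap F Ω (f.coeff i), hf' i⟩
  set r := residue (integerRing l Ω) with hr
  set P : Polynomial (ResidueField (integerRing l Ω)) :=
    ∑ i ∈ Finset.range (f.natDegree + 1), Polynomial.C (r (c i)) * Polynomial.X ^ i with hP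
  have hroot : ∀ ξ : (minpoly F ζ).rootSet Ω, (ξ : Ω) ^ n = 1 ∧
      absHom l Ω (Polynomial.aeval (ξ : Ω) f) < 1 := by
    intro ξ
    obtain ⟨g, hg⟩ := minpoly.exists_algEquiv_of_root' (K := F) (x := (ξ : Ω)) (y := ζ)
      (Algebra.IsAlgebraic.isAlgebraic ζ) (Polynomial.aeval_eq_zero_of_mem_rootSet ξ.2)
    rw [← hg, ← map_pow, hζ, map_one, Polynomial.aeval_algHom_apply, absHom_algEquiv]
    exact ⟨rfl, hlt⟩
  let z : (minpoly F ζ).rootSet Ω → integerRing l Ω := fun ξ =>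
    ⟨ξ, (absHom_eq_one_of_pow hn0 (hroot ξ).1).le⟩
  have hz : Function.Injective fun ξ => r (z ξ) := by
    intro ξ ξ' h
    have := residue_eq_iff.mp h
    exact Subtype.ext (eq_of_pow_eq_one hn (hroot ξ).1 (hroot ξ').1 this)
  have hPz : ∀ ξ, P.eval (r (z ξ)) = 0 := by
    intro ξ
    have h1 : r (∑ i ∈ Finset.range (f.natDegree + 1), c i * z ξ ^ i) = 0 := by
      rw [hr, residue_eq_zero_iff']
      have := (hroot ξ).2
      rw [hev] at this
      push_cast
      exact this
    rw [hP, Polynomial.eval_finsetSum]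
    simpa using h1
  have hne : f ≠ 0 := by
    rintro rfl
    rw [Polynomial.coeff_zero, absHom_zero] at hj
    exact zero_ne_one hj
  have hcard : Fintype.card ((minpoly F ζ).rootSet Ω) = (minpoly F ζ).natDegree :=
    Polynomial.card_rootSet_eq_natDegree (Algebra.IsSeparable.isSeparable F ζ)
      (Normal.splits inferInstance ζ)
  have hlt2 : f.natDegree < (minpoly F ζ).natDegree := Polynomial.natDegree_lt_natDegree hne hdeg
  have hcoeff : ∀ j ≤ f.natDegree, P.coeff j = r (c j) := by
    intro j hj
    rw [hP, Polynomial.finsetSum_coeff]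
    simp only [Polynomial.coeff_C_mul, Polynomial.coeff_X_pow]
    rw [Finset.sum_eq_single j]
    · simp
    · intro i _ hij
      rw [if_neg (Ne.symm hij), mul_zero]
    · intro h
      exact absurd (Finset.mem_range.mpr (Nat.lt_succ_of_le hj)) h
  have hPd : P.natDegree ≤ f.natDegree := by
    refine Polynomial.natDegree_sum_le_of_forall_le _ _ fun i hi => ?_
    exact (Polynomial.natDegree_C_mul_X_pow_le _ _).trans
      (Nat.lt_succ_iff.mp (Finset.mem_range.mp hi))
  have hP0 : P = 0 := Polynomial.eq_zero_of_natDegree_lt_card_of_eval_eq_zero P hz hPz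
    (hcard ▸ hPd.trans_lt hlt2)
  have hjd : j ≤ f.natDegree := by
    refine Polynomial.le_natDegree_of_ne_zero fun h => ?_
    rw [h, absHom_zero] at hj
    exact zero_ne_one hj
  have h3 := hcoeff j hjd
  rw [hP0, Polynomial.coeff_zero, eq_comm, hr, residue_eq_zero_iff'] at h3
  change absHom l Ω (algebraMap F Ω (f.coeff j)) < 1 at h3
  rw [absHom_algebraMap, hj] at h3
  exact lt_irrefl _ h3

/-- Written as a polynomial in `ζ` of degree less than that of the minimal polynomial, `x` has the
absolute value of its largest coefficient: divide by that coefficient and apply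
`absHom_aeval_root_of_unity`. -/
theorem exists_absHom_eq_of_mem_adjoin {n : ℕ} (hn : n.Coprime l) {ζ : Ω} (hζ : ζ ^ n = 1) {x : Ω}
    (hx : x ∈ IntermediateField.adjoin F {ζ}) (hx0 : x ≠ 0) :
    ∃ y : F, y ≠ 0 ∧ absHom l Ω x = absHom l F y := by
  have hζint : IsIntegral F ζ := Algebra.IsIntegral.isIntegral ζ
  have hx' : x ∈ (IntermediateField.adjoin F {ζ}).toSubalgebra := hx
  rw [IntermediateField.adjoin_simple_toSubalgebra_of_isAlgebraic hζint.isAlgebraic,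
    Algebra.adjoin_singleton_eq_range_aeval] at hx'
  obtain ⟨f0, hf0⟩ := hx'
  have hmon := minpoly.monic hζint
  set f := f0 %ₘ minpoly F ζ with hf
  have hfx : Polynomial.aeval ζ f = x := by
    rw [hf, Polynomial.aeval_modByMonic_eq_self_of_root (minpoly.aeval F ζ)]
    exact hf0
  have hdeg : f.degree < (minpoly F ζ).degree := Polynomial.degree_modByMonic_lt _ hmon
  have hne : f ≠ 0 := by
    intro h
    rw [h, map_zero] at hfx
    exact hx0 hfx.symm
  obtain ⟨j, hj, hmax⟩ := f.support.exists_max_image (fun i => absHom l F (f.coeff i))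
    (Polynomial.support_nonempty.mpr hne)
  have hc : f.coeff j ≠ 0 := Polynomial.mem_support_iff.mp hj
  refine ⟨f.coeff j, hc, ?_⟩
  have h1 := absHom_aeval_root_of_unity (l := l) hn hζ (f := Polynomial.C (f.coeff j)⁻¹ * f) (j := j)
    (by rwa [Polynomial.degree_C_mul (inv_ne_zero hc)]) (fun i => ?_) ?_
  · rw [map_mul, Polynomial.aeval_C, hfx, map_mul, absHom_algebraMap, absHom_inv,
      inv_mul_eq_one₀ (absHom_pos hc).ne'] at h1
    exact h1.symm
  · rw [Polynomial.coeff_C_mul, map_mul, absHom_inv, inv_mul_le_iff₀ (absHom_pos hc), mul_one]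
    by_cases hi : f.coeff i = 0
    · rw [hi, absHom_zero]; exact absHom_nonneg _
    · exact hmax i (Polynomial.mem_support_iff.mpr hi)
  · rw [Polynomial.coeff_C_mul, inv_mul_cancel₀ hc, map_one]

theorem exists_absHom_eq_of_fixed {x : Ω} (hx : ∀ i ∈ inertiaSubgroup l F, i x = x) (hx0 : x ≠ 0) :
    ∃ y : F, y ≠ 0 ∧ absHom l Ω x = absHom l F y := by
  obtain ⟨n, ζ, hn, hζ, h⟩ := exists_mem_adjoin_of_fixed hx
  exact exists_absHom_eq_of_mem_adjoin hn hζ h hx0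

end Inertia

/-! ### Open subgroups and their fixed fields. -/

section Krull

variable {F : Type v} [Field F] [CharZero F]

local notation "Ω" => AlgebraicClosure F

theorem fixingSubgroup_fixedField_of_isOpen {H : Subgroup (Ω ≃ₐ[F] Ω)}
    (hH : IsOpen (H : Set (Ω ≃ₐ[F] Ω))) :
    (IntermediateField.fixedField H).fixingSubgroup = H :=
  InfiniteGalois.fixingSubgroup_fixedField ⟨H, Subgroup.isClosed_of_isOpen H hH⟩

theorem finiteDimensional_fixedField {H : Subgroup (Ω ≃ₐ[F] Ω)}
    (hH : IsOpen (H : Set (Ω ≃ₐ[F] Ω))) :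
    FiniteDimensional F (IntermediateField.fixedField H) := by
  rw [← InfiniteGalois.isOpen_iff_finite, fixingSubgroup_fixedField_of_isOpen hH]
  exact hH

theorem mem_of_fixes {H : Subgroup (Ω ≃ₐ[F] Ω)} (hH : IsOpen (H : Set (Ω ≃ₐ[F] Ω)))
    {g : Ω ≃ₐ[F] Ω} (hg : ∀ x : Ω, (∀ h ∈ H, h x = x) → g x = x) : g ∈ H := by
  rw [← fixingSubgroup_fixedField_of_isOpen hH]
  exact fun x => hg x fun h hh => x.2 ⟨h, hh⟩

end Krull

/-! ### Value groups, and tameness of extensions whose inertia acts through a `p`-group. -/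

section Tame

variable {l : ℕ} [Fact l.Prime] {F : Type v} [Field F] [Algebra ℚ_[l] F] [FiniteDimensional ℚ_[l] F]

local notation "Ω" => AlgebraicClosure F

instance isScalarTower_intermediateField (E : IntermediateField F Ω) : IsScalarTower ℚ_[l] E Ω :=
  IsScalarTower.of_algebraMap_eq fun x => IsScalarTower.algebraMap_apply ℚ_[l] F Ω x

instance isAlgebraic_intermediateField (E : IntermediateField F Ω) : Algebra.IsAlgebraic ℚ_[l] E :=
  Algebra.IsAlgebraic.trans ℚ_[l] F E

theorem mem_valueGroup {E : IntermediateField F Ω} {u : ℝˣ} :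
    u ∈ valueGroup l F E ↔ ∃ x ∈ E, x ≠ 0 ∧ absHom l Ω x = u := by
  constructor
  · rintro ⟨x, rfl⟩
    exact ⟨(x : E), (x : E).2, fun h => x.ne_zero (Subtype.ext h), rfl⟩
  · rintro ⟨x, hx, hx0, h⟩
    exact ⟨Units.mk0 (⟨x, hx⟩ : E) fun h => hx0 (congrArg Subtype.val h), Units.ext h⟩

/-- If `x` has degree `d`, then `|x| ^ d` is the norm of the constant coefficient of the minimal
polynomial, a power of `l`. The factorial of the degree of `L` is an exponent that serves all `x` at
once. -/
theorem exists_absHom_pow_eq_zpow {L : Type*} [Field L] [Algebra ℚ_[l] L] [FiniteDimensional ℚ_[l] L]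
    {x : L} (hx : x ≠ 0) :
    ∃ z : ℤ, absHom l L x ^ (Module.finrank ℚ_[l] L).factorial = (l : ℝ) ^ z := by
  have hint : IsIntegral ℚ_[l] x := Algebra.IsIntegral.isIntegral x
  set d := (minpoly ℚ_[l] x).natDegree with hd
  have hd0 : 0 < d := minpoly.natDegree_pos hint
  have h1 : absHom l L x ^ d = ‖(minpoly ℚ_[l] x).coeff 0‖ := by
    have := spectralNorm.spectralNorm_eq_norm_coeff_zero_rpow ℚ_[l] L x
    change spectralNorm ℚ_[l] L x ^ d = _
    rw [this, one_div, Real.rpow_inv_natCast_pow (norm_nonneg _) hd0.ne']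
  obtain ⟨c, hc⟩ := Nat.dvd_factorial hd0 (minpoly.natDegree_le x)
  have hn := Padic.norm_eq_zpow_neg_valuation (minpoly.coeff_zero_ne_zero hint hx)
  refine ⟨-((minpoly ℚ_[l] x).coeff 0).valuation * c, ?_⟩
  rw [hc, pow_mul, h1, hn, zpow_mul, zpow_natCast]

/-- Raising to a fixed power embeds the value group, which consists of positive reals, in the powers
of `l`. -/
instance isCyclic_valueGroup (E : IntermediateField F Ω) [FiniteDimensional F E] :
    IsCyclic (valueGroup l F E) := by
  have : FiniteDimensional ℚ_[l] E := FiniteDimensional.trans ℚ_[l] F E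
  have hl : (l : ℝ) ≠ 0 := Nat.cast_ne_zero.mpr (Fact.out : l.Prime).ne_zero
  set D := (Module.finrank ℚ_[l] E).factorial with hD
  have hpos : ∀ u : valueGroup l F E, 0 < ((u : ℝˣ) : ℝ) := by
    intro u
    obtain ⟨x, hx, hx0, h⟩ := mem_valueGroup.mp u.2
    rw [← h]
    exact absHom_pos hx0
  have hmem : ∀ u : valueGroup l F E, (u : ℝˣ) ^ D ∈ Subgroup.zpowers (Units.mk0 (l : ℝ) hl) := by
    intro u
    obtain ⟨x, hx, hx0, h⟩ := mem_valueGroup.mp u.2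
    obtain ⟨z, hz⟩ := exists_absHom_pow_eq_zpow (l := l) (L := E) (x := ⟨x, hx⟩)
      (fun h => hx0 (congrArg Subtype.val h))
    refine ⟨z, Units.ext ?_⟩
    simp only [Units.val_zpow_eq_zpow_val, Units.val_mk0, Units.val_pow_eq_pow_val]
    rw [← hz, ← h]
    congr 1
    exact (absHom_algebraMap (E := E) (L := Ω) _).symm
  let f : valueGroup l F E →* Subgroup.zpowers (Units.mk0 (l : ℝ) hl) :=
    { toFun := fun u => ⟨(u : ℝˣ) ^ D, hmem u⟩
      map_one' := by ext; simp
      map_mul' := fun u v => by ext; simp [mul_pow] }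
  refine isCyclic_of_injective f fun u v huv => ?_
  have h1 := congrArg (fun w : Subgroup.zpowers (Units.mk0 (l : ℝ) hl) => ((w : ℝˣ) : ℝ)) huv
  have h2 : ((u : ℝˣ) : ℝ) ^ D = ((v : ℝˣ) : ℝ) ^ D := by simpa [f] using h1
  exact Subtype.ext (Units.ext
    ((pow_left_inj₀ (hpos u).le (hpos v).le (Nat.factorial_ne_zero _)).mp h2))

/-- The quotient of the value groups is cyclic, so that the ramification index equals its exponent,
and the latter divides `M`. -/
theorem isTame_of_exponent {E : IntermediateField F Ω} [hE : FiniteDimensional F E] {M : ℕ}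
    (hM : M.Coprime l)
    (h : ∀ x ∈ E, x ≠ 0 → ∃ y : F, y ≠ 0 ∧ absHom l Ω x ^ M = absHom l F y) : IsTame l F E := by
  refine ⟨hE, ?_⟩
  have hcyc : IsCyclic (valueGroup l F E ⧸ (valueGroup l F ⊥).subgroupOf (valueGroup l F E)) :=
    isCyclic_of_surjective _ (QuotientGroup.mk'_surjective _)
  have hdvd : (valueGroup l F ⊥).relIndex (valueGroup l F E) ∣ M := by
    rw [Subgroup.relIndex, Subgroup.index, ← IsCyclic.exponent_eq_card]
    refine Monoid.exponent_dvd_of_forall_pow_eq_one fun u => ?_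
    obtain ⟨u, rfl⟩ := QuotientGroup.mk_surjective u
    rw [← QuotientGroup.mk_pow, QuotientGroup.eq_one_iff, Subgroup.mem_subgroupOf]
    obtain ⟨x, hx, hx0, h1⟩ := mem_valueGroup.mp u.2
    obtain ⟨y, hy0, hy⟩ := h x hx hx0
    refine mem_valueGroup.mpr ⟨algebraMap F Ω y, (⊥ : IntermediateField F Ω).algebraMap_mem y,
      by simpa using hy0, ?_⟩
    rw [absHom_algebraMap, ← hy, h1]
    simp
  exact (hM.coprime_dvd_left hdvd).symm

theorem le_maxTame {E : IntermediateField F Ω} (hE : IsTame l F E) : E ≤ maxTame l F :=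
  le_iSup (fun E : {E : IntermediateField F Ω // IsTame l F E} => E.1) ⟨E, hE⟩

theorem root_of_unity_mem_maxTame {n : ℕ} (hn : n.Coprime l) {ζ : Ω} (hζ : ζ ^ n = 1) :
    ζ ∈ maxTame l F := by
  have : FiniteDimensional F (IntermediateField.adjoin F {ζ}) :=
    IntermediateField.adjoin.finiteDimensional (Algebra.IsIntegral.isIntegral ζ)
  refine le_maxTame (isTame_of_exponent (M := 1) (Nat.coprime_one_left l) fun x hx hx0 => ?_)
    (IntermediateField.mem_adjoin_simple_self F ζ)
  simp_rw [pow_one]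
  exact exists_absHom_eq_of_mem_adjoin hn hζ hx hx0

theorem tameRestrict_apply (g : Ω ≃ₐ[F] Ω) (x : maxTame l F) :
    ((tameRestrict l F g x : maxTame l F) : Ω) = g x :=
  AlgEquiv.restrictNormal_commutes g (maxTame l F) x

theorem tameRestrict_surjective : Function.Surjective (tameRestrict l F) :=
  have := isGalois_algebraicClosure l F
  AlgEquiv.restrictNormalHom_surjective (F := F) (K₁ := maxTame l F) Ω

variable {p : ℕ} [Fact p.Prime] (hlp : l ≠ p)

include hlp

/-- The image of inertia modulo `H` is a `p`-group of some order `p ^ M`. The product of the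
conjugates of `x` under it is fixed by inertia, so its absolute value is one of `F`; but this
absolute value is `|x| ^ (p ^ M)`, and `p ^ M` is prime to `l`. -/
theorem isTame_fixedField {H : Subgroup (Ω ≃ₐ[F] Ω)} (hn : H.Normal)
    (hH : IsOpen (H : Set (Ω ≃ₐ[F] Ω)))
    (hI : ∀ i ∈ inertiaSubgroup l F, ∃ m : ℕ, i ^ p ^ m ∈ H) :
    IsTame l F (IntermediateField.fixedField H) := by
  have := charZero_of_padic l F
  have hfin := finiteDimensional_fixedField hH
  set I := inertiaSubgroup l F with hIdef
  let Q := I ⧸ H.subgroupOf I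
  have hQfin : Finite Q := by
    have h1 : Finite ((Ω ≃ₐ[F] Ω) ⧸ H) := Subgroup.quotient_finite_of_isOpen H hH
    have : H.FiniteIndex := Subgroup.finiteIndex_of_finite_quotient
    infer_instance
  have := Fintype.ofFinite Q
  have hQ : IsPGroup p Q := by
    intro x
    obtain ⟨i, rfl⟩ := QuotientGroup.mk_surjective x
    obtain ⟨m, hm⟩ := hI i i.2
    refine ⟨m, ?_⟩
    rw [← QuotientGroup.mk_pow, QuotientGroup.eq_one_iff, Subgroup.mem_subgroupOf]
    exact hm
  obtain ⟨M, hM⟩ := IsPGroup.iff_card.mp hQ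
  refine isTame_of_exponent (M := p ^ M) (Nat.Coprime.pow_left _
    ((Nat.coprime_primes Fact.out Fact.out).mpr hlp.symm)) fun x hx hx0 => ?_
  have hx' : ∀ h ∈ H, h x = x := fun h hh => hx ⟨h, hh⟩
  let f : Q → Ω := Quotient.lift (fun i : I => (i : Ω ≃ₐ[F] Ω) x) (by
    intro a b hab
    have h1 : (a : Ω ≃ₐ[F] Ω)⁻¹ * b ∈ H := by
      have := QuotientGroup.leftRel_apply.mp hab
      rwa [Subgroup.mem_subgroupOf] at this
    have h2 := hx' _ h1
    calc (a : Ω ≃ₐ[F] Ω) x = (a : Ω ≃ₐ[F] Ω) (((a : Ω ≃ₐ[F] Ω)⁻¹ * b) x) := by rw [h2]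
      _ = ((a : Ω ≃ₐ[F] Ω) * ((a : Ω ≃ₐ[F] Ω)⁻¹ * b)) x := rfl
      _ = (b : Ω ≃ₐ[F] Ω) x := by rw [mul_inv_cancel_left])
  have hf : ∀ i : I, f (QuotientGroup.mk i) = (i : Ω ≃ₐ[F] Ω) x := fun i => rfl
  have habs : ∀ c, absHom l Ω (f c) = absHom l Ω x := by
    intro c
    obtain ⟨i, rfl⟩ := QuotientGroup.mk_surjective c
    rw [hf, absHom_algEquiv]
  have hprod : absHom l Ω (∏ c, f c) = absHom l Ω x ^ p ^ M := by
    rw [map_prod, Finset.prod_congr rfl fun c _ => habs c, Finset.prod_const, Finset.card_univ,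
      ← Nat.card_eq_fintype_card, hM]
  rw [← hprod]
  refine exists_absHom_eq_of_fixed (fun i hi => ?_) ?_
  · rw [map_prod]
    refine Fintype.prod_equiv (MulAction.toPerm (⟨i, hi⟩ : I)) _ _ fun c => ?_
    obtain ⟨j, rfl⟩ := QuotientGroup.mk_surjective c
    rfl
  · rw [Finset.prod_ne_zero_iff]
    intro c _ h
    have := habs c
    rw [h, absHom_zero] at this
    exact hx0 (absHom_eq_zero.mp this.symm)

theorem ker_tameRestrict_le {H : Subgroup (Ω ≃ₐ[F] Ω)} (hn : H.Normal)
    (hH : IsOpen (H : Set (Ω ≃ₐ[F] Ω)))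
    (hI : ∀ i ∈ inertiaSubgroup l F, ∃ m : ℕ, i ^ p ^ m ∈ H) : (tameRestrict l F).ker ≤ H := by
  intro g hg
  have := charZero_of_padic l F
  refine mem_of_fixes hH fun x hx => ?_
  have hmem : x ∈ maxTame l F := le_maxTame (isTame_fixedField hlp hn hH hI) fun h => hx h h.2
  have h1 := tameRestrict_apply (l := l) g ⟨x, hmem⟩
  rw [MonoidHom.mem_ker.mp hg] at h1
  exact h1.symm

omit hlp in
theorem mem_inertia_maxTame {g : Ω ≃ₐ[F] Ω} (hg : g ∈ inertiaSubgroup l F) :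
    tameRestrict l F g ∈ inertia l F (maxTame l F) := by
  intro x hx
  have h1 := hg x (by
    change absHom l Ω (algebraMap (maxTame l F) Ω x) ≤ 1
    rw [absHom_algebraMap]; exact hx)
  change absHom l (maxTame l F) _ < 1
  rw [← absHom_algebraMap (L := Ω)]
  change absHom l Ω ((tameRestrict l F g x : maxTame l F) - x) < 1
  rw [tameRestrict_apply]
  exact h1

/-- A topological generator of tame inertia generates the image of inertia in the finite quotients
in which this image is a `p`-group. -/
theorem exists_zpow_inertia {τ : maxTame l F ≃ₐ[F] maxTame l F}
    (hτ : closure (Subgroup.zpowers τ : Set (maxTame l F ≃ₐ[F] maxTame l F)) =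
      inertia l F (maxTame l F)) {t : Ω ≃ₐ[F] Ω} (ht : tameRestrict l F t = τ)
    {H : Subgroup (Ω ≃ₐ[F] Ω)} (hn : H.Normal)
    (hH : IsOpen (H : Set (Ω ≃ₐ[F] Ω)))
    (hI : ∀ i ∈ inertiaSubgroup l F, ∃ m : ℕ, i ^ p ^ m ∈ H) {g : Ω ≃ₐ[F] Ω}
    (hg : g ∈ inertiaSubgroup l F) : ∃ j : ℤ, (t ^ j)⁻¹ * g ∈ H := by
  have := charZero_of_padic l F
  have hfin := finiteDimensional_fixedField hH
  have hle := le_maxTame (isTame_fixedField hlp hn hH hI)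
  let E := IntermediateField.restrict hle
  have hE : FiniteDimensional F E := LinearEquiv.finiteDimensional
    (IntermediateField.restrictAlgEquiv hle).toLinearEquiv
  have hopen : IsOpen ((fun h => (tameRestrict l F g)⁻¹ * h) ⁻¹' (E.fixingSubgroup : Set _)) :=
    E.fixingSubgroup_isOpen.preimage (continuous_const_mul _)
  have hmem : tameRestrict l F g ∈ closure (Subgroup.zpowers τ : Set _) := by
    rw [hτ]; exact mem_inertia_maxTame hg
  obtain ⟨h, hh, j, hj⟩ := mem_closure_iff.mp hmem _ hopen (by simp)
  have hj : τ ^ j = h := hj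
  refine ⟨j, ?_⟩
  have key : (t ^ j)⁻¹ * g = (g⁻¹ * t ^ j)⁻¹ := by group
  rw [key]
  refine H.inv_mem (mem_of_fixes hH fun x hx => ?_)
  have hxE : (⟨x, hle fun h => hx h h.2⟩ : maxTame l F) ∈ E :=
    (IntermediateField.mem_restrict hle _).mpr fun h => hx h h.2
  have hh' : (tameRestrict l F g)⁻¹ * h ∈ E.fixingSubgroup := hh
  have h1 := (IntermediateField.mem_fixingSubgroup_iff _ _).mp hh' _ hxE
  rw [← hj, ← ht, ← map_zpow, ← map_inv, ← map_mul] at h1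
  have h2 := tameRestrict_apply (l := l) (g⁻¹ * t ^ j) ⟨x, hle fun h => hx h h.2⟩
  rw [h1] at h2
  exact h2.symm

end Tame

/-! ### Frobenius elements, the tame relation and generation of the tame quotients. -/

section Frobenius

variable {l : ℕ} [Fact l.Prime] {F : Type v} [Field F] [Algebra ℚ_[l] F] [FiniteDimensional ℚ_[l] F]

local notation "Ω" => AlgebraicClosure F

theorem residueCard_pos : 0 < residueCard l F := Nat.card_pos

theorem absHom_pow_residueCard_sub_lt {x : F} (hx : absHom l F x ≤ 1) :
    absHom l F (x ^ residueCard l F - x) < 1 := by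
  have := Fintype.ofFinite (ResidueField (integerRing l F))
  have h := FiniteField.pow_card (residue (integerRing l F) ⟨x, hx⟩)
  rw [← Nat.card_eq_fintype_card, ← map_pow, residue_eq_iff] at h
  exact h

/-- The elements of the residue field of the algebraic closure fixed by Frobenius come from `F`. -/
theorem exists_lift_of_pow_eq {y : ResidueField (integerRing l Ω)}
    (hy : y ^ residueCard l F = y) :
    ∃ (c : F) (hc : absHom l Ω (algebraMap F Ω c) ≤ 1),
      residue (integerRing l Ω) ⟨algebraMap F Ω c, hc⟩ = y := by
  classical
  have := Fintype.ofFinite (ResidueField (integerRing l F))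
  set q := residueCard l F with hq
  have hq1 : 1 < q := Finite.one_lt_card
  choose c hc using residue_surjective (R := integerRing l F)
  have hcF : ∀ a, absHom l F (c a : F) ≤ 1 := fun a => (c a).2
  have hcΩ : ∀ a, absHom l Ω (algebraMap F Ω (c a : F)) ≤ 1 := fun a => by
    rw [absHom_algebraMap]; exact hcF a
  let φ : ResidueField (integerRing l F) → ResidueField (integerRing l Ω) := fun a =>
    residue (integerRing l Ω) ⟨algebraMap F Ω (c a : F), hcΩ a⟩
  have hinj : Function.Injective φ := by
    intro a b hab
    have h1 := residue_eq_iff.mp hab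
    change absHom l Ω (algebraMap F Ω (c a : F) - algebraMap F Ω (c b : F)) < 1 at h1
    rw [← map_sub, absHom_algebraMap] at h1
    rw [← hc a, ← hc b, residue_eq_iff]
    exact h1
  have hpow : ∀ a, φ a ^ q = φ a := by
    intro a
    rw [← map_pow, residue_eq_iff]
    change absHom l Ω ((algebraMap F Ω (c a : F)) ^ q - algebraMap F Ω (c a : F)) < 1
    rw [← map_pow, ← map_sub, absHom_algebraMap]
    exact absHom_pow_residueCard_sub_lt (hcF a)
  have hne : (Polynomial.X ^ q - Polynomial.X : Polynomial (ResidueField (integerRing l Ω))) ≠ 0 :=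
    FiniteField.X_pow_card_sub_X_ne_zero _ hq1
  have hmem : ∀ w : ResidueField (integerRing l Ω), w ^ q = w →
      w ∈ (Polynomial.X ^ q - Polynomial.X :
        Polynomial (ResidueField (integerRing l Ω))).roots.toFinset := by
    intro w hw
    rw [Multiset.mem_toFinset, Polynomial.mem_roots hne, Polynomial.IsRoot.def]
    simp [hw]
  -- Counting: the lifted residues of `F` are already `q` distinct roots of `X ^ q - X`, so there
  -- are no others.
  have heq : Finset.univ.image φ = (Polynomial.X ^ q - Polynomial.X :
        Polynomial (ResidueField (integerRing l Ω))).roots.toFinset := by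
    refine Finset.eq_of_subset_of_card_le (fun w hw => ?_) ?_
    · obtain ⟨a, -, rfl⟩ := Finset.mem_image.mp hw
      exact hmem _ (hpow a)
    · rw [Finset.card_image_of_injective _ hinj, Finset.card_univ, ← Nat.card_eq_fintype_card]
      refine (Multiset.toFinset_card_le _).trans ((Polynomial.card_roots' _).trans ?_)
      rw [FiniteField.X_pow_card_sub_X_natDegree_eq _ hq1]
      rfl
  have h1 := hmem y hy
  rw [← heq] at h1
  obtain ⟨a, -, ha⟩ := Finset.mem_image.mp h1
  exact ⟨c a, hcΩ a, ha⟩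

theorem residueCard_coprime {n : ℕ} (hn : n.Coprime l) : (residueCard l F).Coprime n := by
  obtain ⟨f, -, hf⟩ := residueCard_eq_pow (l := l) (L := F)
  rw [hf]
  exact (Nat.Coprime.pow_left f hn.symm)

/-- The Galois group acts on the roots of unity of order prime to the residue characteristic through
powers of `q`. -/
theorem exists_apply_root_eq_pow {n : ℕ} (hn : n.Coprime l) {ζ : Ω} (hζ : ζ ^ n = 1)
    (g : Ω ≃ₐ[F] Ω) : ∃ u : ℕ, g ζ = ζ ^ residueCard l F ^ u := by
  have hn0 := natCast_ne_zero_of_coprime hn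
  obtain ⟨f, -, hf⟩ := residueCard_eq_pow (l := l) (L := F)
  set q := residueCard l F with hq
  set κ := ResidueField (integerRing l Ω) with hκ
  have hchar : ExpChar κ l := ExpChar.prime (Fact.out : l.Prime)
  set N := n.totient with hN
  have hN0 : 0 < N := Nat.totient_pos.mpr (Nat.pos_of_ne_zero hn0)
  have hζN : ζ ^ q ^ N = ζ := by
    have h1 : q ^ N ≡ 1 [MOD n] := Nat.ModEq.pow_totient (residueCard_coprime hn)
    obtain ⟨c, hc⟩ := (Nat.modEq_iff_dvd' (Nat.one_le_pow _ _ residueCard_pos)).mp h1.symm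
    rw [← Nat.sub_add_cancel (Nat.one_le_pow N q residueCard_pos), hc, pow_add, pow_mul, hζ, one_pow,
      one_mul, pow_one]
  have habs : ∀ u, absHom l Ω (ζ ^ u) ≤ 1 := fun u => by
    rw [map_pow, absHom_eq_one_of_pow hn0 hζ, one_pow]
  have habs1 : absHom l Ω ζ ≤ 1 := by simpa using habs 1
  set z : κ := residue (integerRing l Ω) ⟨ζ, habs1⟩ with hz
  have hzN : z ^ q ^ N = z := by
    rw [hz, ← map_pow]
    congr 1
    exact Subtype.ext hζN
  -- The product over the orbit of `z` under the `q`-power map, repetitions allowed. It is invariant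
  -- under that map, so its coefficients come from `F`. Consequently `g` preserves the property of
  -- reducing to a root of `P`, and the residue of `g ζ` is some `z ^ q ^ u`.
  set P : Polynomial κ := ∏ u ∈ Finset.range N, (Polynomial.X - Polynomial.C (z ^ q ^ u)) with hP
  have hPmap : P.map (iterateFrobenius κ l f) = P := by
    rw [hP, Polynomial.map_prod]
    have : ∀ u ∈ Finset.range N, (Polynomial.X - Polynomial.C (z ^ q ^ u)).map
        (iterateFrobenius κ l f) = Polynomial.X - Polynomial.C (z ^ q ^ (u + 1)) := by
      intro u _
      rw [Polynomial.map_sub, Polynomial.map_X, Polynomial.map_C, iterateFrobenius_def, ← hf,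
        ← pow_mul, ← pow_succ]
    rw [Finset.prod_congr rfl this]
    obtain ⟨M, hM⟩ : ∃ M, N = M + 1 := ⟨N - 1, by omega⟩
    rw [hM, Finset.prod_range_succ, Finset.prod_range_succ', ← hM, hzN, pow_zero, pow_one]
  have hcoef : ∀ i, P.coeff i ^ q = P.coeff i := by
    intro i
    have h1 := congrArg (fun R => R.coeff i) hPmap
    simp only [Polynomial.coeff_map, iterateFrobenius_def, ← hf] at h1
    exact h1
  choose c hc hcP using fun i => exists_lift_of_pow_eq (hcoef i)
  have hev : ∀ ξ : integerRing l Ω, P.eval (residue (integerRing l Ω) ξ) = 0 ↔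
      absHom l Ω (∑ i ∈ Finset.range (P.natDegree + 1), algebraMap F Ω (c i) * (ξ : Ω) ^ i) < 1 := by
    intro ξ
    rw [Polynomial.eval_eq_sum_range]
    have : ∑ i ∈ Finset.range (P.natDegree + 1), P.coeff i * residue (integerRing l Ω) ξ ^ i =
        residue (integerRing l Ω) (∑ i ∈ Finset.range (P.natDegree + 1),
          ⟨algebraMap F Ω (c i), hc i⟩ * ξ ^ i) := by
      rw [map_sum]
      refine Finset.sum_congr rfl fun i _ => ?_
      rw [map_mul, map_pow, hcP]
    rw [this, residue_eq_zero_iff']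
    push_cast
    rfl
  have hg1 : absHom l Ω (g ζ) ≤ 1 := by rwa [absHom_algEquiv]
  have h0 : P.eval z = 0 := by
    rw [hP, Polynomial.eval_prod]
    refine Finset.prod_eq_zero (Finset.mem_range.mpr hN0) ?_
    simp
  have h1 := (hev _).mp h0
  have h2 : P.eval (residue (integerRing l Ω) ⟨g ζ, hg1⟩) = 0 := by
    rw [hev]
    rw [← absHom_algEquiv g] at h1
    simpa using h1
  rw [hP, Polynomial.eval_prod, Finset.prod_eq_zero_iff] at h2
  obtain ⟨u, -, hu⟩ := h2
  rw [Polynomial.eval_sub, Polynomial.eval_X, Polynomial.eval_C, sub_eq_zero, hz, ← map_pow,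
    residue_eq_iff] at hu
  refine ⟨u, eq_of_pow_eq_one hn (by rw [← map_pow, hζ, map_one]) ?_ hu⟩
  rw [← pow_mul, mul_comm, pow_mul, hζ, one_pow]

theorem tame_norm (x : maxTame l F) : spectralNorm ℚ_[l] (maxTame l F) x = absHom l Ω (x : Ω) :=
  (absHom_algebraMap (E := maxTame l F) (L := Ω) x).symm

theorem frobenius_apply_root {σ : maxTame l F ≃ₐ[F] maxTame l F}
    (hσ : IsFrobenius l F (maxTame l F) σ) {s : Ω ≃ₐ[F] Ω} (hs : tameRestrict l F s = σ)
    {n : ℕ} (hn : n.Coprime l) {ζ : Ω} (hζ : ζ ^ n = 1) : s ζ = ζ ^ residueCard l F := by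
  have hmem : ζ ∈ maxTame l F := root_of_unity_mem_maxTame hn hζ
  have h1 := hσ ⟨ζ, hmem⟩ (by
    rw [tame_norm]
    exact (absHom_eq_one_of_pow (natCast_ne_zero_of_coprime hn) hζ).le)
  rw [tame_norm, ← hs] at h1
  refine eq_of_pow_eq_one hn (by rw [← map_pow, hζ, map_one]) ?_ (by
    rw [← tameRestrict_apply s ⟨ζ, hmem⟩]
    exact h1)
  rw [← pow_mul, mul_comm, pow_mul, hζ, one_pow]

theorem isFrobenius_of_tameRestrict {σ : maxTame l F ≃ₐ[F] maxTame l F}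
    (hσ : IsFrobenius l F (maxTame l F) σ) {s : Ω ≃ₐ[F] Ω} (hs : tameRestrict l F s = σ) :
    IsFrobenius l F Ω s := fun _ hx =>
  absHom_sub_pow_lt_of_roots residueCard_pos (fun _ _ hn hζ => frobenius_apply_root hσ hs hn hζ) hx

theorem isFrobenius_apply_root {s : Ω ≃ₐ[F] Ω} (hs : IsFrobenius l F Ω s)
    {n : ℕ} (hn : n.Coprime l) {ζ : Ω} (hζ : ζ ^ n = 1) : s ζ = ζ ^ residueCard l F := by
  refine eq_of_pow_eq_one hn (by rw [← map_pow, hζ, map_one]) ?_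
    (hs ζ (absHom_eq_one_of_pow (natCast_ne_zero_of_coprime hn) hζ).le)
  rw [← pow_mul, mul_comm, pow_mul, hζ, one_pow]

theorem mem_inertiaSubgroup_of_tameRestrict {s : Ω ≃ₐ[F] Ω}
    (hs : tameRestrict l F s ∈ inertia l F (maxTame l F)) : s ∈ inertiaSubgroup l F := by
  refine mem_inertiaSubgroup_of_roots fun n ζ hn hζ => ?_
  have hmem : ζ ∈ maxTame l F := root_of_unity_mem_maxTame hn hζ
  have h1 := hs ⟨ζ, hmem⟩ (by
    rw [tame_norm]
    exact (absHom_eq_one_of_pow (natCast_ne_zero_of_coprime hn) hζ).le)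
  rw [tame_norm] at h1
  refine eq_of_pow_eq_one hn (by rw [← map_pow, hζ, map_one]) hζ ?_
  rw [← tameRestrict_apply s ⟨ζ, hmem⟩]
  exact h1

theorem topologicalGenerator_mem {τ : maxTame l F ≃ₐ[F] maxTame l F}
    (hτ : closure (Subgroup.zpowers τ : Set (maxTame l F ≃ₐ[F] maxTame l F)) =
      inertia l F (maxTame l F)) {t : Ω ≃ₐ[F] Ω} (ht : tameRestrict l F t = τ) :
    t ∈ inertiaSubgroup l F := by
  refine mem_inertiaSubgroup_of_tameRestrict ?_
  rw [ht, ← hτ]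
  exact subset_closure (Subgroup.mem_zpowers τ)

/-- Two Frobenius elements differ by an element of inertia. -/
theorem IsFrobenius.inv_mul_mem {s s' : Ω ≃ₐ[F] Ω} (hs : IsFrobenius l F Ω s)
    (hs' : IsFrobenius l F Ω s') : s⁻¹ * s' ∈ inertiaSubgroup l F := by
  refine mem_inertiaSubgroup_of_roots fun n ζ hn hζ => ?_
  rw [AlgEquiv.mul_apply, isFrobenius_apply_root hs' hn hζ, ← isFrobenius_apply_root hs hn hζ,
    ← AlgEquiv.mul_apply, inv_mul_cancel, AlgEquiv.one_apply]

section Relation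

variable {p : ℕ} [Fact p.Prime] (hlp : l ≠ p)

/-- The tame commutation relation between Frobenius and inertia. -/
theorem absHom_relation_sub_lt {s t : Ω ≃ₐ[F] Ω} (hs : IsFrobenius l F Ω s)
    (ht : t ∈ inertiaSubgroup l F) {x : Ω} (hx0 : x ≠ 0) :
    absHom l Ω ((s * t * s⁻¹ * (t ^ residueCard l F)⁻¹) x - x) < absHom l Ω x := by
  set q := residueCard l F with hq
  -- multiplicative form of tame ramification
  have hne : ∀ (g : Ω ≃ₐ[F] Ω) (y : Ω), y ≠ 0 → g y ≠ 0 := fun g y hy h =>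
    hy ((map_eq_zero_iff g g.injective).mp h)
  have hquot : ∀ (g : Ω ≃ₐ[F] Ω) (y : Ω), y ≠ 0 → absHom l Ω (g y / y) = 1 := fun g y hy => by
    rw [absHom_div, absHom_algEquiv, div_self (absHom_pos hy).ne']
  -- Modulo the maximal ideal `g y / y` depends only on the absolute value of `y`, because inertia
  -- acts trivially on residues of quotients of absolute value one.
  have hscale : ∀ (g : Ω ≃ₐ[F] Ω), g ∈ inertiaSubgroup l F → ∀ y z : Ω, y ≠ 0 → z ≠ 0 →
      absHom l Ω y = absHom l Ω z → absHom l Ω (g y / y - g z / z) < 1 := by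
    intro g hg y z hy hz hyz
    have h1 : absHom l Ω (y / z) = 1 := by rw [absHom_div, hyz, div_self (absHom_pos hz).ne']
    have h2 := hg (y / z) h1.le
    change absHom l Ω (g (y / z) - y / z) < 1 at h2
    have e : g y / y - g z / z = (g z / z) * (z / y) * (g (y / z) - y / z) := by
      rw [map_div₀]
      have := hne g z hz
      field_simp
    rw [e, map_mul, map_mul, hquot g z hz, one_mul, absHom_div, hyz,
      div_self (absHom_pos hz).ne', one_mul]
    exact h2
  have hpow : ∀ n : ℕ, ∀ y : Ω, y ≠ 0 → absHom l Ω ((t ^ n) y / y - (t y / y) ^ n) < 1 := by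
    intro n y hy
    induction n with
    | zero => simp [div_self hy, absHom_zero]
    | succ n ih =>
      have e : (t ^ (n + 1)) y / y - (t y / y) ^ (n + 1) =
          (t ((t ^ n) y) / (t ^ n) y - t y / y) * ((t ^ n) y / y) +
            (t y / y) * ((t ^ n) y / y - (t y / y) ^ n) := by
        have := hne (t ^ n) y hy
        rw [pow_succ' t n, AlgEquiv.mul_apply]
        generalize t y / y = c
        field_simp
        ring
      rw [e]
      refine absHom_add_lt ?_ ?_
      · rw [map_mul, hquot _ y hy, mul_one]
        exact hscale t ht _ _ (hne _ y hy) hy (absHom_algEquiv _ _)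
      · rw [map_mul, hquot _ y hy, one_mul]
        exact ih
  set y := (t ^ q)⁻¹ x with hy
  have hy0 : y ≠ 0 := hne _ _ hx0
  have hxy : x = (t ^ q) y := by
    rw [hy, ← AlgEquiv.mul_apply, mul_inv_cancel, AlgEquiv.one_apply]
  -- With `w = s⁻¹ y` the first quotient is `s (t w / w)`, congruent to `(t w / w) ^ q` since `s` is
  -- a Frobenius element. By `hscale` and `hpow` this is congruent to `(t y / y) ^ q` and then to `t
  -- ^ q y / y`.
  have h1 : absHom l Ω ((s * t * s⁻¹) y / y - (t ^ q) y / y) < 1 := by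
    set w := s⁻¹ y with hw
    have hw0 : w ≠ 0 := hne _ _ hy0
    have hyw : y = s w := by
      rw [hw, ← AlgEquiv.mul_apply, mul_inv_cancel, AlgEquiv.one_apply]
    have e1 : (s * t * s⁻¹) y / y = s (t w / w) := by
      rw [AlgEquiv.mul_apply, AlgEquiv.mul_apply, ← hw, map_div₀, ← hyw]
    have h2 := hs (t w / w) (hquot t w hw0).le
    change absHom l Ω (s (t w / w) - (t w / w) ^ q) < 1 at h2
    rw [← e1] at h2
    have h3 : absHom l Ω ((t w / w) ^ q - (t y / y) ^ q) < 1 := by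
      refine absHom_pow_sub_pow_lt (hquot _ _ hw0).le (hquot _ _ hy0).le
        (hscale t ht _ _ hw0 hy0 ?_) q
      rw [hw, absHom_algEquiv]
    have h4 := hpow q y hy0
    rw [absHom_sub_comm] at h4
    exact absHom_sub_lt_trans (absHom_sub_lt_trans h2 h3) h4
  have e2 : (s * t * s⁻¹ * (t ^ q)⁻¹) x - x =
      ((s * t * s⁻¹) y / y - (t ^ q) y / y) * y := by
    rw [AlgEquiv.mul_apply _ (t ^ q)⁻¹ x, ← hy, ← hxy]
    field_simp
  rw [e2, map_mul]
  have h3 : absHom l Ω y = absHom l Ω x := absHom_algEquiv _ _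
  rw [h3]
  exact mul_lt_of_lt_one_left (absHom_pos hx0) h1

include hlp

/-- A wild automorphism cannot have nontrivial `p`-power order. For `y = w x - x` with `w ^ (p ^ m)`
fixing `x`, the sum of the `w ^ j y` telescopes to zero. Each summand differs from `y` by something
smaller than `y`, so the sum is close to `p ^ m y`, whose absolute value is that of `y`. -/
theorem mem_of_absHom_sub_lt {w : Ω ≃ₐ[F] Ω}
    (hw : ∀ x : Ω, x ≠ 0 → absHom l Ω (w x - x) < absHom l Ω x) {H : Subgroup (Ω ≃ₐ[F] Ω)}
    (hH : IsOpen (H : Set (Ω ≃ₐ[F] Ω))) {m : ℕ} (hm : w ^ p ^ m ∈ H) : w ∈ H := by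
  have := charZero_of_padic l F
  refine mem_of_fixes hH fun x hx => ?_
  have hfix := hx _ hm
  by_contra hne
  set y := w x - x with hy
  have hy0 : y ≠ 0 := sub_ne_zero.mpr hne
  have h1 : ∀ j : ℕ, absHom l Ω ((w ^ j) y - y) < absHom l Ω y := by
    intro j
    induction j with
    | zero => simpa [absHom_zero] using absHom_pos (l := l) hy0
    | succ j ih =>
      have h2 : absHom l Ω ((w ^ (j + 1)) y - (w ^ j) y) < absHom l Ω y := by
        rw [pow_succ, AlgEquiv.mul_apply, ← map_sub, absHom_algEquiv]
        exact hw y hy0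
      exact absHom_sub_lt_trans h2 ih
  have h2 : ∑ j ∈ Finset.range (p ^ m), (w ^ j) y = 0 := by
    have : ∀ j, (w ^ j) y = (w ^ (j + 1)) x - (w ^ j) x := fun j => by
      rw [hy, map_sub, pow_succ, AlgEquiv.mul_apply]
    simp_rw [this]
    rw [Finset.sum_range_sub (fun j => (w ^ j) x), hfix]
    simp
  have h3 : ((p ^ m : ℕ) : Ω) * y = -∑ j ∈ Finset.range (p ^ m), ((w ^ j) y - y) := by
    rw [Finset.sum_sub_distrib, h2, Finset.sum_const, Finset.card_range, nsmul_eq_mul]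
    ring
  have h4 := congrArg (absHom l Ω) h3
  rw [map_mul, absHom_natCast_of_coprime (Nat.Coprime.pow_left m
    ((Nat.coprime_primes Fact.out Fact.out).mpr hlp.symm)), one_mul, absHom_neg] at h4
  exact (absHom_sum_lt _ _ (absHom_pos hy0) fun j _ => h1 j).ne' h4

theorem tame_relation {s t : Ω ≃ₐ[F] Ω} (hs : IsFrobenius l F Ω s)
    (ht : t ∈ inertiaSubgroup l F) {H : Subgroup (Ω ≃ₐ[F] Ω)}
    (hH : IsOpen (H : Set (Ω ≃ₐ[F] Ω)))
    (hI : ∀ i ∈ inertiaSubgroup l F, ∃ m : ℕ, i ^ p ^ m ∈ H) :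
    s * t * s⁻¹ * (t ^ residueCard l F)⁻¹ ∈ H := by
  obtain ⟨m, hm⟩ := hI (s * t * s⁻¹ * (t ^ residueCard l F)⁻¹)
    ((inertiaSubgroup l F).mul_mem (inertiaSubgroup_normal.conj_mem t ht s)
      ((inertiaSubgroup l F).inv_mem ((inertiaSubgroup l F).pow_mem ht _)))
  exact mem_of_absHom_sub_lt hlp (fun x hx => absHom_relation_sub_lt hs ht hx) hH hm

open scoped Pointwise in
-- The fixed field of the subgroup generated by `H` and inertia lies in some `F(ζ)`, where `g` acts
-- as a power of `s`. After division by that power, `g` is a product of an element of `H` and an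
-- inertial one, and the latter is a power of `t` modulo `H`.
theorem tame_generation {τ : maxTame l F ≃ₐ[F] maxTame l F}
    (hτ : closure (Subgroup.zpowers τ : Set (maxTame l F ≃ₐ[F] maxTame l F)) =
      inertia l F (maxTame l F)) {s t : Ω ≃ₐ[F] Ω} (hs : IsFrobenius l F Ω s)
    (ht : tameRestrict l F t = τ) {H : Subgroup (Ω ≃ₐ[F] Ω)} (hn : H.Normal)
    (hH : IsOpen (H : Set (Ω ≃ₐ[F] Ω)))
    (hI : ∀ i ∈ inertiaSubgroup l F, ∃ m : ℕ, i ^ p ^ m ∈ H) (g : Ω ≃ₐ[F] Ω) :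
    ∃ (a : ℕ) (j : ℤ), (s ^ a * t ^ j)⁻¹ * g ∈ H := by
  have := charZero_of_padic l F
  set K := H ⊔ inertiaSubgroup l F with hK
  have hKo : IsOpen (K : Set (Ω ≃ₐ[F] Ω)) := Subgroup.isOpen_mono le_sup_left hH
  have hfin := finiteDimensional_fixedField hKo
  obtain ⟨x, hx⟩ := Field.exists_primitive_element F (IntermediateField.fixedField K)
  have hxI : ∀ i ∈ inertiaSubgroup l F, i (x : Ω) = x := fun i hi =>
    x.2 ⟨i, (le_sup_right : _ ≤ K) hi⟩
  obtain ⟨n, ζ, hn', hζ, hxζ⟩ := exists_mem_adjoin_of_fixed hxI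
  obtain ⟨a, ha⟩ := exists_apply_root_eq_pow hn' hζ g
  have hsa : ∀ a : ℕ, (s ^ a) ζ = ζ ^ residueCard l F ^ a := by
    intro a
    induction a with
    | zero => simp
    | succ a ih =>
      rw [pow_succ', AlgEquiv.mul_apply, ih, map_pow, isFrobenius_apply_root hs hn' hζ, ← pow_mul,
        pow_succ']
  have hζfix : ((s ^ a)⁻¹ * g) ζ = ζ := by
    rw [AlgEquiv.mul_apply, ha, ← hsa, ← AlgEquiv.mul_apply, inv_mul_cancel, AlgEquiv.one_apply]
  have hxfix : ((s ^ a)⁻¹ * g) x = x := by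
    have hle : IntermediateField.adjoin F {ζ} ≤
        IntermediateField.fixedField (Subgroup.zpowers ((s ^ a)⁻¹ * g)) := by
      rw [IntermediateField.adjoin_le_iff, Set.singleton_subset_iff]
      rintro ⟨h, hh⟩
      exact Subgroup.zpowers_le.mpr
        (show (s ^ a)⁻¹ * g ∈ MulAction.stabilizer (Ω ≃ₐ[F] Ω) ζ from hζfix) hh
    exact hle hxζ ⟨_, Subgroup.mem_zpowers _⟩
  have hmemK : (s ^ a)⁻¹ * g ∈ K := by
    refine mem_of_fixes hKo fun y hy => ?_
    have hyK : y ∈ IntermediateField.fixedField K := fun h => hy h h.2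
    have h1 : (⟨y, hyK⟩ : IntermediateField.fixedField K) ∈ IntermediateField.adjoin F {x} := by
      rw [hx]; trivial
    have h2 : IntermediateField.adjoin F {x} ≤ (IntermediateField.fixedField
        (Subgroup.zpowers ((s ^ a)⁻¹ * g))).comap (IntermediateField.fixedField K).val := by
      rw [IntermediateField.adjoin_le_iff, Set.singleton_subset_iff]
      rintro ⟨h, hh⟩
      exact Subgroup.zpowers_le.mpr
        (show (s ^ a)⁻¹ * g ∈ MulAction.stabilizer (Ω ≃ₐ[F] Ω) (x : Ω) from hxfix) hh
    exact h2 h1 ⟨_, Subgroup.mem_zpowers _⟩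
  have hmem2 : (s ^ a)⁻¹ * g ∈ (H : Set (Ω ≃ₐ[F] Ω)) * (inertiaSubgroup l F : Set (Ω ≃ₐ[F] Ω)) := by
    rw [← Subgroup.normal_mul]
    exact hmemK
  obtain ⟨h, hh, i, hi, hhi⟩ := Set.mem_mul.mp hmem2
  obtain ⟨j, hj⟩ := exists_zpow_inertia hlp hτ ht hn hH hI hi
  refine ⟨a, j, ?_⟩
  have e : (s ^ a * t ^ j)⁻¹ * g = ((t ^ j)⁻¹ * h * t ^ j) * ((t ^ j)⁻¹ * i) := by
    rw [mul_inv_rev, mul_assoc, ← hhi]; group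
  rw [e]
  refine H.mul_mem ?_ hj
  have := hn.conj_mem h hh (t ^ j)⁻¹
  rwa [inv_inv] at this

end Relation

end Frobenius

/-! ### Kummer theory and the universal property of the tame quotient. -/

section Kummer

theorem modEq_of_pow_eq_pow {K : Type*} [CommRing K] [IsDomain K] {ζ : K} {n a b : ℕ}
    (hζ : IsPrimitiveRoot ζ n) (hn : 0 < n) (h : ζ ^ a = ζ ^ b) : a ≡ b [MOD n] := by
  rw [pow_eq_pow_mod a hζ.pow_eq_one, pow_eq_pow_mod b hζ.pow_eq_one] at h
  exact hζ.pow_inj (Nat.mod_lt _ hn) (Nat.mod_lt _ hn) h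

/-- Any element whose absolute value generates the value group will do. This group is infinite
cyclic because `|l| < 1`, so a generator is not a `p`-th power. -/
theorem exists_absHom_ne_pow (l : ℕ) [Fact l.Prime] (F : Type v) [Field F] [Algebra ℚ_[l] F]
    [FiniteDimensional ℚ_[l] F] (p : ℕ) (hp : 1 < p) :
    ∃ π : F, π ≠ 0 ∧ ∀ y : F, absHom l F π ≠ absHom l F y ^ p := by
  have hbot : FiniteDimensional F (⊥ : IntermediateField F (AlgebraicClosure F)) := inferInstance
  obtain ⟨⟨u, hu⟩, hgen⟩ := (isCyclic_valueGroup (l := l) (⊥ : IntermediateField F (AlgebraicClosure F))).exists_generator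
  have hval : ∀ y : F, y ≠ 0 → ∃ j : ℤ, absHom l F y = (u : ℝ) ^ j := by
    intro y hy
    have hmem : Units.mk0 (absHom l F y) (absHom_pos hy).ne' ∈ valueGroup l F ⊥ :=
      mem_valueGroup.mpr ⟨algebraMap F (AlgebraicClosure F) y, (⊥ : IntermediateField F (AlgebraicClosure F)).algebraMap_mem y,
        by simpa using hy, by rw [absHom_algebraMap]; rfl⟩
    obtain ⟨j, hj⟩ := hgen ⟨_, hmem⟩
    refine ⟨j, ?_⟩
    have := congrArg (fun w : valueGroup l F ⊥ => ((w : ℝˣ) : ℝ)) hj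
    simpa using this.symm
  obtain ⟨x, hx, hx0, hxu⟩ := mem_valueGroup.mp hu
  obtain ⟨π, rfl⟩ := IntermediateField.mem_bot.mp hx
  rw [absHom_algebraMap] at hxu
  have hπ : π ≠ 0 := fun h => hx0 (by rw [h, map_zero])
  refine ⟨π, hπ, fun y hy => ?_⟩
  have hu0 : (0 : ℝ) < u := hxu ▸ absHom_pos hπ
  have hu1 : (u : ℝ) ≠ 1 := by
    intro h1
    have hl0 : (l : F) ≠ 0 := fun h => absHom_prime_ne_zero (l := l) (L := F) (by rw [h, absHom_zero])
    obtain ⟨j, hj⟩ := hval _ hl0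
    rw [h1, one_zpow] at hj
    exact absHom_prime_lt_one.ne hj
  have hy0 : y ≠ 0 := by
    rintro rfl
    rw [absHom_zero, zero_pow (by omega)] at hy
    exact (absHom_pos hπ).ne' hy
  obtain ⟨j, hj⟩ := hval y hy0
  rw [hxu, hj, ← zpow_natCast, ← zpow_mul] at hy
  have h2 : (1 : ℤ) = j * p := zpow_right_injective₀ hu0 hu1 (by simpa using hy)
  have h3 : (p : ℤ) ∣ 1 := ⟨j, by rw [h2, mul_comm]⟩
  have h4 : p = 1 := by
    have := Int.eq_one_of_dvd_one (by positivity) h3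
    exact_mod_cast this
  omega

variable {l : ℕ} [Fact l.Prime] {F : Type v} [Field F] [Algebra ℚ_[l] F] [FiniteDimensional ℚ_[l] F]

local notation "Ω" => AlgebraicClosure F

variable {p : ℕ} [Fact p.Prime]

/-- The automorphisms that fix all the roots of `X ^ n - π`. -/
def rootFixer (n : ℕ) (π : F) : Subgroup (Ω ≃ₐ[F] Ω) where
  carrier := {g | ∀ x : Ω, x ^ n = algebraMap F Ω π → g x = x}
  one_mem' := fun _ _ => rfl
  mul_mem' := fun {g h} hg hh x hx => by rw [AlgEquiv.mul_apply, hh x hx, hg x hx]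
  inv_mem' := fun {g} hg x hx => by
    have := hg x hx
    calc g⁻¹ x = g⁻¹ (g x) := by rw [this]
      _ = x := by rw [← AlgEquiv.mul_apply, inv_mul_cancel, AlgEquiv.one_apply]

instance rootFixer_normal (n : ℕ) (π : F) : (rootFixer n π).Normal where
  conj_mem := fun h hh g x hx => by
    have h1 := hh (g⁻¹ x) (by rw [← map_pow, hx, AlgEquiv.commutes])
    rw [AlgEquiv.mul_apply, AlgEquiv.mul_apply, h1, ← AlgEquiv.mul_apply, mul_inv_cancel,
      AlgEquiv.one_apply]

theorem isOpen_rootFixer {n : ℕ} (hn : 0 < n) (π : F) :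
    IsOpen (rootFixer n π : Set (Ω ≃ₐ[F] Ω)) := by
  have hfin : {x : Ω | x ^ n = algebraMap F Ω π}.Finite := by
    refine (Polynomial.rootSet_finite (Polynomial.X ^ n - Polynomial.C π) Ω).subset fun x hx => ?_
    rw [Polynomial.mem_rootSet]
    refine ⟨Polynomial.X_pow_sub_C_ne_zero hn π, ?_⟩
    simp only [Set.mem_ofPred_eq] at hx
    simp [hx]
  have := hfin.isOpen_biInter fun x _ => stabilizer_isOpen_of_isIntegral (K := F) x
  convert! this using 1
  ext g
  simp only [Set.mem_iInter]
  rfl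

variable (hlp : l ≠ p)

include hlp

/-- An inertial `i` multiplies a root `x` by a `p ^ m`-th root of unity, which `i` fixes because `p
≠ l`. Iteration therefore raises this root of unity to powers. -/
theorem pow_mem_rootFixer {m : ℕ} {π : F} (hπ : π ≠ 0) {i : Ω ≃ₐ[F] Ω}
    (hi : i ∈ inertiaSubgroup l F) : i ^ p ^ m ∈ rootFixer (p ^ m) π := by
  intro x hx
  have hcop : (p ^ m).Coprime l :=
    Nat.Coprime.pow_left m ((Nat.coprime_primes Fact.out Fact.out).mpr hlp.symm)
  have hx0 : x ≠ 0 := by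
    rintro rfl
    rw [zero_pow (natCast_ne_zero_of_coprime hcop), eq_comm, map_eq_zero] at hx
    exact hπ hx
  have hz : (i x / x) ^ p ^ m = 1 := by
    rw [div_pow, ← map_pow, hx, AlgEquiv.commutes, div_self]
    simpa using hπ
  have h1 : ∀ n : ℕ, (i ^ n) x = (i x / x) ^ n * x := by
    intro n
    induction n with
    | zero => simp
    | succ n ih =>
      rw [pow_succ', AlgEquiv.mul_apply, ih, map_mul, map_pow, inertia_root_of_unity hi hcop hz,
        pow_succ]
      field_simp
  rw [h1, hz, one_mul]

/-- The Kummer character of a suitable element of `F` is ramified. -/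
theorem isPrimitiveRoot_kummer {τ : maxTame l F ≃ₐ[F] maxTame l F}
    (hτ : closure (Subgroup.zpowers τ : Set (maxTame l F ≃ₐ[F] maxTame l F)) =
      inertia l F (maxTame l F)) {t : Ω ≃ₐ[F] Ω} (ht : tameRestrict l F t = τ) {π : F}
    (hπ0 : π ≠ 0) (hπ : ∀ y : F, absHom l F π ≠ absHom l F y ^ p) {m : ℕ} {x : Ω}
    (hx : x ^ p ^ m = algebraMap F Ω π) : IsPrimitiveRoot (t x / x) (p ^ m) := by
  have hp0 : 0 < p := (Fact.out : p.Prime).pos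
  have hx0 : x ≠ 0 := by
    rintro rfl
    rw [zero_pow (pow_pos hp0 m).ne', eq_comm, map_eq_zero] at hx
    exact hπ0 hx
  have hz : (t x / x) ^ p ^ m = 1 := by
    rw [div_pow, ← map_pow, hx, AlgEquiv.commutes, div_self]
    simpa using hπ0
  rcases m with _ | m
  · rw [pow_zero, pow_one] at hz
    rw [hz, pow_zero]
    exact IsPrimitiveRoot.one
  rw [IsPrimitiveRoot.iff_orderOf]
  -- If the order were smaller, `t` would fix `x ^ (p ^ m)`, and so would all of inertia, which acts
  -- on `x` through powers of `t`. The absolute value of `x ^ (p ^ m)` would then be that of some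
  -- `y` in `F`, and `|π| = |y| ^ p`.
  refine orderOf_eq_prime_pow (fun h => ?_) hz
  have ht1 : t (x ^ p ^ m) = x ^ p ^ m := by
    rwa [div_pow, div_eq_one_iff_eq (pow_ne_zero _ hx0), ← map_pow] at h
  have hfix : ∀ i ∈ inertiaSubgroup l F, i (x ^ p ^ m) = x ^ p ^ m := by
    intro i hi
    obtain ⟨j, hj⟩ := exists_zpow_inertia hlp hτ ht (rootFixer_normal (p ^ (m + 1)) π)
      (isOpen_rootFixer (pow_pos hp0 _) π)
      (fun i hi => ⟨m + 1, pow_mem_rootFixer hlp hπ0 hi⟩) hi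
    have h1 := hj x hx
    have h2 : i x = (t ^ j) x := by
      calc i x = (t ^ j * ((t ^ j)⁻¹ * i)) x := by rw [mul_inv_cancel_left]
        _ = (t ^ j) x := by rw [AlgEquiv.mul_apply, h1]
    rw [map_pow, h2, ← map_pow]
    exact zpow_mem (show t ∈ MulAction.stabilizer (Ω ≃ₐ[F] Ω) (x ^ p ^ m) from ht1) j
  obtain ⟨y, -, hy⟩ := exists_absHom_eq_of_fixed hfix (pow_ne_zero _ hx0)
  refine hπ y ?_
  rw [← hy, ← map_pow, ← pow_mul, ← pow_succ, hx, absHom_algebraMap]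

omit hlp in
-- Modulo `q ^ N - 1` the element `q` has order exactly `N`: the powers below the `N`-th are
-- distinct and, for `N ≥ 2`, less than the modulus.
theorem pow_modEq_imp {q N : ℕ} (hq : 2 ≤ q) (hN : 2 ≤ N) {a b : ℕ}
    (h : q ^ a ≡ q ^ b [MOD q ^ N - 1]) : a ≡ b [MOD N] := by
  have h1 : 1 ≤ q ^ N := Nat.one_le_pow _ _ (by omega)
  have h2 : q ^ N ≡ 1 [MOD q ^ N - 1] := ((Nat.modEq_iff_dvd' h1).mpr dvd_rfl).symm
  have h3 : ∀ a, q ^ a ≡ q ^ (a % N) [MOD q ^ N - 1] := by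
    intro a
    conv_lhs => rw [← Nat.div_add_mod a N, pow_add, pow_mul]
    simpa using (h2.pow (a / N)).mul_right (q ^ (a % N))
  have h4 : ∀ a, q ^ (a % N) < q ^ N - 1 := by
    intro a
    have h5 : a % N ≤ N - 1 := Nat.le_sub_one_of_lt (Nat.mod_lt a (by omega))
    have h6 : q ^ (a % N) ≤ q ^ (N - 1) := Nat.pow_le_pow_right (by omega) h5
    have h7 : q ^ N = q ^ (N - 1) * q := by rw [← pow_succ]; congr 1; omega
    have h8 : q ^ (N - 1) ≥ q := Nat.le_self_pow (by omega) q
    have h9 : q ^ (N - 1) * 2 ≤ q ^ (N - 1) * q := Nat.mul_le_mul_left _ hq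
    omega
  have h5 : q ^ (a % N) = q ^ (b % N) :=
    Nat.ModEq.eq_of_lt_of_lt (((h3 a).symm.trans h).trans (h3 b)) (h4 a) (h4 b)
  exact Nat.pow_right_injective hq h5

/-- The universal property of the tame quotient: a solution of the tame relation in a finite group
comes from a homomorphism. -/
theorem exists_tame_hom {τ : maxTame l F ≃ₐ[F] maxTame l F}
    (hτ : closure (Subgroup.zpowers τ : Set (maxTame l F ≃ₐ[F] maxTame l F)) =
      inertia l F (maxTame l F)) {s t : Ω ≃ₐ[F] Ω} (hs : IsFrobenius l F Ω s)
    (ht : tameRestrict l F t = τ) {Γ : Type u} [Group Γ] [Finite Γ] (S T : Γ) (m : ℕ)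
    (hT : T ^ p ^ m = 1) (hST : S * T * S⁻¹ = T ^ residueCard l F) :
    ∃ Φ : (Ω ≃ₐ[F] Ω) →* Γ, IsOpen (Φ.ker : Set (Ω ≃ₐ[F] Ω)) ∧ Φ s = S ∧ Φ t = T ∧
      ∀ i ∈ inertiaSubgroup l F, Φ i ^ p ^ m = 1 := by
  have hp := (Fact.out : p.Prime)
  have hl := (Fact.out : l.Prime)
  obtain ⟨f, hf0, hf⟩ := residueCard_eq_pow (l := l) (L := F)
  have htI := topologicalGenerator_mem hτ ht
  set q := residueCard l F with hq
  have hq2 : 2 ≤ q := by rw [hf]; exact hl.two_le.trans (Nat.le_self_pow hf0.ne' l)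
  have hcop : (p ^ m).Coprime l := Nat.Coprime.pow_left m ((Nat.coprime_primes hp hl).mpr hlp.symm)
  obtain ⟨π, hπ0, hπ⟩ := exists_absHom_ne_pow l F p hp.one_lt
  obtain ⟨x, hx⟩ := IsAlgClosed.exists_pow_nat_eq (algebraMap F Ω π) (pow_pos hp.pos m)
  have hx0 : x ≠ 0 := by
    rintro rfl
    rw [zero_pow (pow_pos hp.pos m).ne', eq_comm, map_eq_zero] at hx
    exact hπ0 hx
  have hz := isPrimitiveRoot_kummer hlp hτ ht hπ0 hπ hx
  set z := t x / x with hzdef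
  have hc : ∀ g : Ω ≃ₐ[F] Ω, ∃ c : ℕ, g x = z ^ c * x := by
    intro g
    have h1 : (g x / x) ^ p ^ m = 1 := by
      rw [div_pow, ← map_pow, hx, AlgEquiv.commutes, div_self]
      simpa using hπ0
    have : NeZero (p ^ m) := ⟨(pow_pos hp.pos m).ne'⟩
    obtain ⟨c, -, hc⟩ := hz.eq_pow_of_pow_eq_one h1
    exact ⟨c, by rw [hc, div_mul_cancel₀ _ hx0]⟩
  choose c hc using hc
  have hTc : ∀ a b : ℕ, z ^ a = z ^ b → T ^ a = T ^ b := by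
    intro a b h
    exact pow_eq_pow_of_modEq (modEq_of_pow_eq_pow hz (pow_pos hp.pos m) h) hT
  -- The homomorphism will be `g ↦ T ^ c g * S' ^ a g`, with `c g` the Kummer exponent of `g` at `x`
  -- and `a g` the exponent of `q` in its action on a root of unity. The chosen `s` may move `x`,
  -- and this correction makes the image of `s` equal to `S`.
  set S' := (T ^ c s)⁻¹ * S with hS'
  have hS'T : ∀ b : ℕ, S' * T ^ b = T ^ (q * b) * S' := by
    intro b
    have h1 : S * T ^ b = T ^ (q * b) * S := by
      rw [pow_mul, ← hST, conj_pow, inv_mul_cancel_right]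
    have h2 : (T ^ c s)⁻¹ * T ^ (q * b) = T ^ (q * b) * (T ^ c s)⁻¹ :=
      ((Commute.pow_pow_self T (q * b) (c s)).inv_right).eq.symm
    rw [hS', mul_assoc, h1, ← mul_assoc, h2, mul_assoc]
  have hS'aT : ∀ a b : ℕ, S' ^ a * T ^ b = T ^ (q ^ a * b) * S' ^ a := by
    intro a
    induction a with
    | zero => simp
    | succ a ih =>
      intro b
      rw [pow_succ, mul_assoc, hS'T, ← mul_assoc, ih, mul_assoc, ← mul_assoc (q ^ a), ← pow_succ]
  -- A multiple of the order of `S'`, so that `S' ^ a` depends on `a` modulo `N`, and of the totient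
  -- of `p ^ m`, so that `p ^ m` divides `q ^ N - 1`. The factor two ensures `N ≥ 2`, as needed for
  -- `pow_modEq_imp`.
  set N := 2 * (orderOf S' * (p ^ m).totient) with hN
  have hN0 : 0 < orderOf S' * (p ^ m).totient :=
    Nat.mul_pos (orderOf_pos S') (Nat.totient_pos.mpr (pow_pos hp.pos m))
  have hN2 : 2 ≤ N := by omega
  have hSN : S' ^ N = 1 := by
    rw [hN, mul_left_comm, pow_mul, pow_orderOf_eq_one, one_pow]
  have hqN1 : 1 ≤ q ^ N := Nat.one_le_pow _ _ (by omega)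
  set n := q ^ N - 1 with hn
  have hpn : p ^ m ∣ n := by
    rw [hn, ← Nat.modEq_iff_dvd' hqN1]
    have h1 : q ^ (p ^ m).totient ≡ 1 [MOD p ^ m] := Nat.ModEq.pow_totient (residueCard_coprime hcop)
    have h2 := h1.pow (2 * orderOf S')
    rw [one_pow, ← pow_mul] at h2
    rw [hN, show 2 * (orderOf S' * (p ^ m).totient) = (p ^ m).totient * (2 * orderOf S') by ring]
    exact h2.symm
  have hnl : n.Coprime l := by
    have h1 : l ∣ q ^ N := by
      rw [hf]
      exact dvd_pow (dvd_pow_self l hf0.ne') (by omega)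
    refine Nat.Coprime.coprime_dvd_right h1 ?_
    exact (Nat.coprime_self_sub_left hqN1).mpr (Nat.coprime_one_left _)
  have hn0 : n ≠ 0 := natCast_ne_zero_of_coprime hnl
  have := charZero_of_padic l F
  have : NeZero (n : Ω) := ⟨Nat.cast_ne_zero.mpr hn0⟩
  have : NeZero n := ⟨hn0⟩
  obtain ⟨w, hw⟩ := HasEnoughRootsOfUnity.exists_primitiveRoot Ω n
  have hSw : ∀ a b : ℕ, w ^ q ^ a = w ^ q ^ b → S' ^ a = S' ^ b := by
    intro a b h
    exact pow_eq_pow_of_modEq (pow_modEq_imp hq2 hN2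
      (modEq_of_pow_eq_pow hw (Nat.pos_of_ne_zero hn0) h)) hSN
  choose a ha using fun g : Ω ≃ₐ[F] Ω => exists_apply_root_eq_pow hnl hw.pow_eq_one g
  obtain ⟨e, -, he⟩ := hw.eq_pow_of_pow_eq_one (ξ := z) (by
    obtain ⟨d, hd⟩ := hpn
    rw [hd, pow_mul, hz.pow_eq_one, one_pow])
  have hgz : ∀ g : Ω ≃ₐ[F] Ω, g z = z ^ q ^ a g := by
    intro g
    rw [← he, map_pow, ha, ← pow_mul, ← pow_mul, mul_comm]
  -- Multiplicativity is the crossed rule `c (g h) = c g + q ^ a g * c h`, valid modulo `p ^ m`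
  -- since `g` raises `z` to the power `q ^ a g`; it matches the commutation rule of `S'` and `T`.
  let Φ : (Ω ≃ₐ[F] Ω) →* Γ := MonoidHom.mk' (fun g => T ^ c g * S' ^ a g) fun g h => by
    have h1 : z ^ c (g * h) = z ^ (c g + q ^ a g * c h) := by
      refine mul_right_cancel₀ hx0 ?_
      rw [← hc, AlgEquiv.mul_apply, hc h, map_mul, map_pow, hgz, hc g, pow_add, pow_mul]
      ring
    have h2 : w ^ q ^ a (g * h) = w ^ q ^ (a g + a h) := by
      rw [← ha, AlgEquiv.mul_apply, ha h, map_pow, ha g, ← pow_mul, ← pow_add]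
    rw [hTc _ _ h1, hSw _ _ h2]
    calc T ^ (c g + q ^ a g * c h) * S' ^ (a g + a h)
        = T ^ c g * (T ^ (q ^ a g * c h) * S' ^ a g) * S' ^ a h := by
          rw [pow_add, pow_add]; simp only [mul_assoc]
      _ = T ^ c g * S' ^ a g * (T ^ c h * S' ^ a h) := by
          rw [← hS'aT]; simp only [mul_assoc]
  have hΦ : ∀ g, Φ g = T ^ c g * S' ^ a g := fun _ => rfl
  have hcz : ∀ (g : Ω ≃ₐ[F] Ω) (b : ℕ), g x = z ^ b * x → T ^ c g = T ^ b := by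
    intro g b h
    rw [hc] at h
    exact hTc _ _ (mul_right_cancel₀ hx0 h)
  have hiI : ∀ i ∈ inertiaSubgroup l F, S' ^ a i = 1 := by
    intro i hi
    rw [hSw (a i) 0, pow_zero]
    rw [← ha, inertia_root_of_unity hi hnl hw.pow_eq_one, pow_zero, pow_one]
  refine ⟨Φ, ?_, ?_, ?_, ?_⟩
  · refine Subgroup.isOpen_mono (H₁ := MulAction.stabilizer (Ω ≃ₐ[F] Ω) w ⊓
      MulAction.stabilizer (Ω ≃ₐ[F] Ω) x) ?_ ?_
    · rintro g ⟨h1, h2⟩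
      have h1 : g w = w := h1
      have h2 : g x = x := h2
      rw [MonoidHom.mem_ker, hΦ, hcz g 0 (by rw [h2, pow_zero, one_mul]), hSw (a g) 0, pow_zero,
        pow_zero, one_mul]
      rw [← ha, h1, pow_zero, pow_one]
    · exact (stabilizer_isOpen_of_isIntegral (K := F) w).inter
        (stabilizer_isOpen_of_isIntegral (K := F) x)
  · rw [hΦ, hSw (a s) 1, pow_one, hS', mul_inv_cancel_left]
    rw [← ha, isFrobenius_apply_root hs hnl hw.pow_eq_one, pow_one]
  · rw [hΦ, hiI t htI, mul_one, hcz t 1, pow_one]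
    rw [pow_one, hzdef, div_mul_cancel₀ _ hx0]
  · intro i hi
    rw [hΦ, hiI i hi, mul_one, ← pow_mul, mul_comm, pow_mul, hT, one_pow]

theorem tameData {τ : maxTame l F ≃ₐ[F] maxTame l F}
    (hτ : closure (Subgroup.zpowers τ : Set (maxTame l F ≃ₐ[F] maxTame l F)) =
      inertia l F (maxTame l F)) {s t : Ω ≃ₐ[F] Ω} (hs : IsFrobenius l F Ω s)
    (ht : tameRestrict l F t = τ) :
    TameData.{u} p (residueCard l F) (inertiaSubgroup l F) (tameRestrict l F).ker s t where
  tau_mem := topologicalGenerator_mem hτ ht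
  relation := fun _ _ hH hI => tame_relation hlp hs (topologicalGenerator_mem hτ ht) hH hI
  generation := fun _ hn hH hI => tame_generation hlp hτ hs ht hn hH hI
  inertia := fun _ hn hH hI _ hg => exists_zpow_inertia hlp hτ ht hn hH hI hg
  wild := fun _ hn hH hI => ker_tameRestrict_le hlp hn hH hI
  exists_hom := fun Γ _ _ S T m hT hST => by
    obtain ⟨Φ, h1, h2, h3, h4⟩ := exists_tame_hom hlp hτ hs ht S T m hT hST
    refine ⟨Φ, h1, h2, h3, h4, fun g hg => ?_⟩
    exact ker_tameRestrict_le hlp (inferInstance : Φ.ker.Normal) h1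
      (fun i hi => ⟨m, by rw [MonoidHom.mem_ker, map_pow, h4 i hi]⟩) hg

end Kummer

/-! ### Values and continuity of the cyclotomic character. -/

section Cyclotomic

variable {l : ℕ} [Fact l.Prime] {F : Type v} [Field F] [Algebra ℚ_[l] F] [FiniteDimensional ℚ_[l] F]
  {p : ℕ} [Fact p.Prime] {k : Type u} [Field k] [CharP k p]

local notation "Ω" => AlgebraicClosure F

theorem hasEnoughRootsOfUnity_algebraicClosure [CharZero F] (i : ℕ) :
    HasEnoughRootsOfUnity Ω (p ^ i) :=
  have : NeZero ((p ^ i : ℕ) : Ω) := ⟨Nat.cast_ne_zero.mpr (pow_ne_zero _ (Fact.out : p.Prime).ne_zero)⟩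
  inferInstance

theorem toZModPow_cyclotomicCharacter [CharZero F] {g : Ω ≃ₐ[F] Ω} {n a : ℕ} {ζ : Ω}
    (hζ : IsPrimitiveRoot ζ (p ^ n)) (h : g ζ = ζ ^ a) :
    ((cyclotomicCharacter Ω p (MulSemiringAction.toRingAut (Ω ≃ₐ[F] Ω) Ω g)).val).toZModPow n = a := by
  have := fun i => hasEnoughRootsOfUnity_algebraicClosure (F := F) (p := p) i
  have h1 := cyclotomicCharacter.spec p (n := n) (MulSemiringAction.toRingAut (Ω ≃ₐ[F] Ω) Ω g) ζ
    hζ.pow_eq_one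
  have h2 : g ζ = _ := h1
  rw [h] at h2
  have h3 := modEq_of_pow_eq_pow hζ (pow_pos (Fact.out : p.Prime).pos n) h2
  rw [← ZMod.natCast_eq_natCast_iff, ZMod.natCast_val, ZMod.cast_id] at h3
  exact h3.symm

theorem cyclo_eq_of_roots [CharZero F] {g : Ω ≃ₐ[F] Ω} {a : ℕ}
    (h : ∀ (n : ℕ) (ζ : Ω), ζ ^ p ^ n = 1 → g ζ = ζ ^ a) : (cyclo p k F g : WittVector p k) = a := by
  have h1 : (cyclotomicCharacter Ω p (MulSemiringAction.toRingAut (Ω ≃ₐ[F] Ω) Ω g)).val = (a : ℤ_[p]) := by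
    refine PadicInt.ext_of_toZModPow.mp fun n => ?_
    have := hasEnoughRootsOfUnity_algebraicClosure (F := F) (p := p) n
    obtain ⟨ζ, hζ⟩ := HasEnoughRootsOfUnity.exists_primitiveRoot Ω (p ^ n)
    rw [toZModPow_cyclotomicCharacter hζ (h n ζ hζ.pow_eq_one), map_natCast]
  change (WittVector.map (ZMod.castHom (dvd_refl p) k)).comp
      ((WittVector.equiv p).symm : ℤ_[p] →+* WittVector p (ZMod p))
      (cyclotomicCharacter Ω p (MulSemiringAction.toRingAut (Ω ≃ₐ[F] Ω) Ω g)).val = _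
  rw [h1, map_natCast]

theorem cyclo_frobenius (hlp : l ≠ p) {s : Ω ≃ₐ[F] Ω} (hs : IsFrobenius l F Ω s) :
    (cyclo p k F s : WittVector p k) = residueCard l F :=
  have := charZero_of_padic l F
  cyclo_eq_of_roots fun n _ hζ => isFrobenius_apply_root hs
    (Nat.Coprime.pow_left n ((Nat.coprime_primes Fact.out Fact.out).mpr hlp.symm)) hζ

theorem cyclo_inertia (hlp : l ≠ p) {i : Ω ≃ₐ[F] Ω} (hi : i ∈ inertiaSubgroup l F) :
    cyclo p k F i = 1 := by
  have := charZero_of_padic l F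
  refine Units.ext ((cyclo_eq_of_roots (a := 1) fun n _ hζ => ?_).trans Nat.cast_one)
  rw [pow_one, inertia_root_of_unity hi
    (Nat.Coprime.pow_left n ((Nat.coprime_primes Fact.out Fact.out).mpr hlp.symm)) hζ]

theorem isOpen_cyclo [CharZero F] (n : ℕ) : IsOpen {g : Ω ≃ₐ[F] Ω |
    (cyclo p k F g : WittVector p k) - 1 ∈ Ideal.span {(p : WittVector p k)} ^ n} := by
  set J : Ideal (WittVector p k) := Ideal.span {(p : WittVector p k)} ^ n with hJ
  let ψ : (Ω ≃ₐ[F] Ω) →* (WittVector p k ⧸ J)ˣ :=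
    (Units.map (Ideal.Quotient.mk J : WittVector p k →* WittVector p k ⧸ J)).comp (cyclo p k F)
  have hψ : ∀ g, g ∈ ψ.ker ↔ (cyclo p k F g : WittVector p k) - 1 ∈ J := by
    intro g
    rw [MonoidHom.mem_ker, Units.ext_iff, ← Ideal.Quotient.eq_zero_iff_mem, map_sub, sub_eq_zero,
      map_one]
    rfl
  have := hasEnoughRootsOfUnity_algebraicClosure (F := F) (p := p) n
  obtain ⟨ζ, hζ⟩ := HasEnoughRootsOfUnity.exists_primitiveRoot Ω (p ^ n)
  have key : IsOpen (ψ.ker : Set (Ω ≃ₐ[F] Ω)) := by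
    refine Subgroup.isOpen_mono (H₁ := MulAction.stabilizer (Ω ≃ₐ[F] Ω) ζ) (fun g hg => ?_)
      (stabilizer_isOpen_of_isIntegral (K := F) ζ)
    rw [hψ]
    have hg : g ζ = ζ := hg
    have h1 := toZModPow_cyclotomicCharacter hζ (hg.trans (pow_one ζ).symm)
    set c := (cyclotomicCharacter Ω p (MulSemiringAction.toRingAut (Ω ≃ₐ[F] Ω) Ω g)).val with hc
    have h2 : c - 1 ∈ Ideal.span {(p : ℤ_[p]) ^ n} := by
      rw [← PadicInt.ker_toZModPow, RingHom.mem_ker, map_sub, h1, map_one, Nat.cast_one, sub_self]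
    let θ : ℤ_[p] →+* WittVector p k := (WittVector.map (ZMod.castHom (dvd_refl p) k)).comp
      ((WittVector.equiv p).symm : ℤ_[p] →+* WittVector p (ZMod p))
    have h3 := Ideal.mem_map_of_mem θ h2
    rw [Ideal.map_span, Set.image_singleton, map_pow, map_natCast, map_sub, map_one,
      ← Ideal.span_singleton_pow] at h3
    exact h3
  convert! key using 1
  ext g
  exact (hψ g).symm

end Cyclotomic

/-! ### Two by two matrices and the polynomials `h_n`. -/

section TwoByTwo

variable {R : Type*} [CommRing R]

theorem map_aeval_int {S : Type*} [CommRing S] (f : R →+* S) (x : R) (P : Polynomial ℤ) :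
    f (Polynomial.aeval x P) = Polynomial.aeval (f x) P :=
  (Polynomial.aeval_algHom_apply f.toIntAlgHom x P).symm

theorem aeval_two_hPoly (n : ℕ) : Polynomial.aeval (2 : R) (hPoly n) = n := by
  induction n using Nat.strong_induction_on with
  | _ n ih =>
    match n, ih with
    | 0, _ => simp [hPoly]
    | 1, _ => simp [hPoly]
    | n + 2, ih =>
      rw [hPoly, map_sub, map_mul, Polynomial.aeval_X, ih (n + 1) (by omega), ih n (by omega)]
      push_cast
      ring

/-- By the Cayley-Hamilton theorem `t ^ 2` is the trace times `t` minus one, and this produces the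
recursion that defines `hPoly`. -/
theorem pow_succ_eq_hPoly {t : Matrix (Fin 2) (Fin 2) R} (ht : t.det = 1) (n : ℕ) :
    t ^ (n + 1) = Polynomial.aeval t.trace (hPoly (n + 1)) • t -
      Polynomial.aeval t.trace (hPoly n) • (1 : Matrix (Fin 2) (Fin 2) R) := by
  have hsq : t * t = t.trace • t - 1 := by
    rw [Matrix.det_fin_two] at ht
    ext i j
    fin_cases i <;> fin_cases j <;>
      simp [Matrix.mul_apply, Fin.sum_univ_two, Matrix.trace]
    · linear_combination -ht
    · ring
    · ring
    · linear_combination -ht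
  induction n with
  | zero => simp [hPoly]
  | succ n ih =>
    rw [pow_succ, ih, sub_mul, smul_mul_assoc, smul_mul_assoc, one_mul, hsq, hPoly, map_sub, map_mul,
      Polynomial.aeval_X, smul_sub, smul_smul, sub_smul]
    rw [mul_comm (Polynomial.aeval t.trace (hPoly (n + 1)))]
    abel

theorem diag_relation_iff {s₁ s₂ w x y z : R} (ht : w * z - x * y = 1) {q : ℕ} (hq : 0 < q) {H H' : R}
    (hH : H = Polynomial.aeval (w + z) (hPoly q))
    (hH' : H' = Polynomial.aeval (w + z) (hPoly (q - 1))) :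
    !![s₁, 0; 0, s₂] * !![w, x; y, z] = !![w, x; y, z] ^ q * !![s₁, 0; 0, s₂] ↔
      s₁ * w = (H * w - H') * s₁ ∧ s₁ * x = H * x * s₂ ∧ s₂ * y = H * y * s₁ ∧
        s₂ * z = (H * z - H') * s₂ := by
  obtain ⟨n, rfl⟩ : ∃ n, q = n + 1 := ⟨q - 1, by omega⟩
  rw [pow_succ_eq_hPoly (by rw [Matrix.det_fin_two_of]; exact ht)]
  have htr : (!![w, x; y, z] : Matrix (Fin 2) (Fin 2) R).trace = w + z := by
    simp [Matrix.trace, Fin.sum_univ_two]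
  rw [htr, ← hH, show Polynomial.aeval (w + z) (hPoly n) = H' by rw [hH']; rfl, ← Matrix.ext_iff]
  simp [Fin.forall_fin_two, Matrix.one_apply, Matrix.mul_apply, Fin.sum_univ_two]
  tauto

end TwoByTwo

/-! ### Diagonalisation of Frobenius and the equations of the normal form. -/

section NormalForms

variable {p : ℕ} [Fact p.Prime] {k : Type u} [Field k]

theorem CoeffRing.eq_zero_of_mul {A : CoeffRing p k} {x y : A} (h : x * y = 0) (hy : A.res y ≠ 0) :
    x = 0 :=
  ((CoeffRing.isUnit_iff.mpr hy).mul_left_eq_zero).mp h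

theorem CoeffRing.eq_of_sq_eq {A : CoeffRing p k} (h2 : (2 : k) ≠ 0) {x y : A} (h : x ^ 2 = y ^ 2)
    (hxy : A.res x = A.res y) (hy : A.res y ≠ 0) : x = y := by
  rw [← sub_eq_zero]
  refine CoeffRing.eq_zero_of_mul (y := x + y) (by linear_combination h) ?_
  rw [map_add, hxy, ← two_mul]
  exact mul_ne_zero h2 hy

/-- A unit that reduces to `1` and whose order is prime to `p` is trivial. -/
theorem CoeffRing.eq_one_of_pow {A : CoeffRing p k} {x : A} {n : ℕ} (hn : (n : k) ≠ 0)
    (hx : A.res x = 1) (h : x ^ n = 1) : x = 1 := by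
  rw [← sub_eq_zero]
  have h1 := geom_sum_mul x n
  rw [h, sub_self, mul_comm] at h1
  refine CoeffRing.eq_zero_of_mul h1 ?_
  rw [map_sum]
  simpa [hx] using hn

theorem CoeffRing.exists_root (A : CoeffRing p k) {f : Polynomial A} (hf : f.Monic) {a : A}
    (h0 : A.res (f.eval a) = 0) (h1 : A.res (f.derivative.eval a) ≠ 0) :
    ∃ b : A, f.eval b = 0 ∧ A.res b = A.res a := by
  obtain ⟨b, hb, hba⟩ := HenselianRing.is_henselian (R := A) (I := maximalIdeal A) f hf a
    (CoeffRing.mem_maximalIdeal.mpr h0) ((CoeffRing.isUnit_iff.mpr h1).map _)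
  refine ⟨b, hb, ?_⟩
  rw [CoeffRing.mem_maximalIdeal, map_sub, sub_eq_zero] at hba
  exact hba

theorem CoeffRing.exists_sqrt (A : CoeffRing p k) (h2 : (2 : k) ≠ 0) {c : A} (hc : A.res c = 1) :
    ∃ r : A, r ^ 2 = c ∧ A.res r = 1 := by
  obtain ⟨r, hr, hr1⟩ := A.exists_root (f := Polynomial.X ^ 2 - Polynomial.C c) (a := 1)
    (Polynomial.monic_X_pow_sub_C c two_ne_zero) (by simp [hc])
    (by
      simpa [one_add_one_eq_two, show A.res 2 = 2 from map_ofNat A.res 2] using h2)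
  refine ⟨r, ?_, by rw [hr1, map_one]⟩
  simpa [sub_eq_zero] using hr

/-- A matrix whose reduction is diagonal with distinct eigenvalues is strictly equivalent to a
diagonal one. -/
theorem exists_diagonalize {A : CoeffRing p k} {s : Matrix (Fin 2) (Fin 2) A} {a b : k} (hab : a ≠ b)
    (hs : s.map A.res = !![a, 0; 0, b]) :
    ∃ M : GL (Fin 2) A, Matrix.GeneralLinearGroup.map A.res M = 1 ∧
      ∃ x y : A, A.res x = a ∧ A.res y = b ∧
        (M : Matrix (Fin 2) (Fin 2) A) * s = !![x, 0; 0, y] * (M : Matrix (Fin 2) (Fin 2) A) := by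
  obtain ⟨x, y, z, w, rfl⟩ : ∃ x y z w, s = !![x, y; z, w] := ⟨_, _, _, _, Matrix.eta_fin_two s⟩
  have hx : A.res x = a := congrFun (congrFun hs 0) 0
  have hy : A.res y = 0 := congrFun (congrFun hs 0) 1
  have hz : A.res z = 0 := congrFun (congrFun hs 1) 0
  have hw : A.res w = b := congrFun (congrFun hs 1) 1
  -- The characteristic polynomial. The diagonal entry `x` is a root modulo the maximal ideal, and
  -- the derivative there is `x - w`, with residue `a - b ≠ 0`.
  set f : Polynomial A := Polynomial.X ^ 2 + (Polynomial.C (-(x + w)) * Polynomial.X +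
    Polynomial.C (x * w - y * z)) with hf
  have hmon : f.Monic := Polynomial.monic_X_pow_add
    (Polynomial.degree_linear_le.trans_lt (by norm_num))
  obtain ⟨c, hc, hca⟩ := A.exists_root hmon (a := x) (by simp [hf, hx, hy, hz, hw]; ring) (by
    simp only [hf, Polynomial.derivative_add, Polynomial.derivative_X_pow,
      Polynomial.derivative_C_mul, Polynomial.derivative_X, Polynomial.derivative_C]
    simp [hx, hw, map_ofNat]
    intro h
    apply hab
    linear_combination h)
  have hc' : c ^ 2 + (-(x + w) * c + (x * w - y * z)) = 0 := by simpa [hf] using hc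
  rw [hx] at hca
  set d := x + w - c with hd
  have hdb : A.res d = b := by rw [hd, map_sub, map_add, hx, hw, hca]; ring
  have h1 : IsUnit (c - w) := CoeffRing.isUnit_iff.mpr (by
    rw [map_sub, hca, hw]; exact sub_ne_zero.mpr hab)
  obtain ⟨e, he⟩ := h1.exists_right_inv
  have hres : ∀ v : A, A.res v = 0 → A.res (v * e) = 0 := fun v hv => by rw [map_mul, hv, zero_mul]
  -- The rows of this matrix are left eigenvectors of `s` for `c` and `d`, normalised so that the
  -- matrix reduces to the identity.
  have hdet : IsUnit (!![1, y * e; -(z * e), 1] : Matrix (Fin 2) (Fin 2) A).det := by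
    rw [Matrix.det_fin_two_of, CoeffRing.isUnit_iff]
    simp [hy, hz]
  refine ⟨Matrix.GeneralLinearGroup.mk'' _ hdet, ?_, c, d, hca, hdb, ?_⟩
  · refine Matrix.GeneralLinearGroup.ext fun i j => ?_
    change A.res ((!![1, y * e; -(z * e), 1] : Matrix (Fin 2) (Fin 2) A) i j) = _
    fin_cases i <;> fin_cases j <;> simp [hy, hz]
  · change (!![1, y * e; -(z * e), 1] : Matrix (Fin 2) (Fin 2) A) * _ =
      _ * (!![1, y * e; -(z * e), 1] : Matrix (Fin 2) (Fin 2) A)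
    have h2 : c - x = y * z * e := by
      linear_combination (e) * hc' + (x - c) * he
    ext i j
    fin_cases i <;> fin_cases j <;> simp [Matrix.mul_apply, Fin.sum_univ_two]
    · linear_combination -h2
    · linear_combination (-y) * he
    · rw [hd]; linear_combination (-z) * he
    · rw [hd]; linear_combination h2

variable [CharP k p] [Finite k]

theorem CoeffRing.res_inverse {A : CoeffRing p k} {x : A} (hx : A.res x ≠ 0) :
    A.res (Ring.inverse x) = (A.res x)⁻¹ := by
  have h := Ring.mul_inverse_cancel x (CoeffRing.isUnit_iff.mpr hx)
  have h2 := congrArg A.res h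
  rw [map_mul, map_one] at h2
  exact eq_inv_of_mul_eq_one_right h2

theorem CoeffHom.map_aeval_add {A B : CoeffRing p k} (f : CoeffHom A B) (w z : A)
    (P : Polynomial ℤ) :
    f.toAlgHom (Polynomial.aeval (w + z) P) =
      Polynomial.aeval (f.toAlgHom w + f.toAlgHom z) P := by
  rw [← map_add]
  exact map_aeval_int (f.toAlgHom : A →+* B) _ _

theorem CoeffHom.map_inverse {A B : CoeffRing p k} (f : CoeffHom A B) {x : A} (hx : A.res x ≠ 0) :
    f.toAlgHom (Ring.inverse x) = Ring.inverse (f.toAlgHom x) := by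
  have h := congrArg f.toAlgHom (Ring.mul_inverse_cancel x (CoeffRing.isUnit_iff.mpr hx))
  rw [map_mul, map_one] at h
  have hu : IsUnit (f.toAlgHom x) := (CoeffRing.isUnit_iff.mpr hx).map f.toAlgHom
  exact hu.mul_left_cancel (h.trans (Ring.mul_inverse_cancel _ hu).symm)

/-- The data of a lifting in normal form: Frobenius is diagonal with entries `q a (1 + S)` and
`(a (1 + S))⁻¹`, a generator of tame inertia is the matrix with entries `w, x, y, z`. -/
structure NormalForm (A : CoeffRing p k) (q : ℕ) (α : k) (S w x y z : A) : Prop where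
  res_S : A.res S = 0
  res_w : A.res w = 1
  res_x : A.res x = 0
  res_y : A.res y = 0
  res_z : A.res z = 1
  det : w * z - x * y = 1
  rel_w : (Polynomial.aeval (w + z) (hPoly q) - 1) * w = Polynomial.aeval (w + z) (hPoly (q - 1))
  rel_x : x * (q * (A.teich α * (1 + S)) ^ 2 - Polynomial.aeval (w + z) (hPoly q)) = 0
  rel_y : y * (1 - q * (A.teich α * (1 + S)) ^ 2 * Polynomial.aeval (w + z) (hPoly q)) = 0
  rel_z : (Polynomial.aeval (w + z) (hPoly q) - 1) * z = Polynomial.aeval (w + z) (hPoly (q - 1))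

variable {A : CoeffRing p k} {q : ℕ} {α : k}

theorem res_unit_part {S : A} (hS : A.res S = 0) : A.res (A.teich α * (1 + S)) = α := by
  simp [hS]

/-- Each entry of the matrix relation carries a unit coming from the diagonal of `σ`; cancelling it,
or multiplying by `ν` off the diagonal, gives the four equations. -/
theorem normalForm_of_relation (hq : 0 < q) (hqk : (q : k) ≠ 0) (hα : α ≠ 0) {S w x y z : A}
    (hS : A.res S = 0)
    (hw : A.res w = 1) (hx : A.res x = 0) (hy : A.res y = 0) (hz : A.res z = 1)
    (hdet : w * z - x * y = 1) :
    diagMatrix q (A.teich α) S * !![w, x; y, z] = !![w, x; y, z] ^ q * diagMatrix q (A.teich α) S ↔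
      NormalForm A q α S w x y z := by
  rw [diagMatrix, diag_relation_iff hdet hq rfl rfl]
  set ν := A.teich α * (1 + S) with hν
  set H := Polynomial.aeval (w + z) (hPoly q) with hH
  set H' := Polynomial.aeval (w + z) (hPoly (q - 1)) with hH'
  have hνr : A.res ν ≠ 0 := by rw [res_unit_part hS]; exact hα
  have hu := Ring.mul_inverse_cancel ν (CoeffRing.isUnit_iff.mpr hνr)
  set i := Ring.inverse ν with hi
  have e1 : (q : A) * A.teich α * (1 + S) = q * ν := by rw [hν]; ring
  rw [e1]
  have hqν : IsUnit ((q : A) * ν) := CoeffRing.isUnit_iff.mpr (by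
    rw [map_mul, map_natCast]; exact mul_ne_zero hqk hνr)
  have hiu : IsUnit i := IsUnit.of_mul_eq_one ν (by rw [mul_comm]; exact hu)
  constructor
  · rintro ⟨h1, h2, h3, h4⟩
    refine ⟨hS, hw, hx, hy, hz, hdet, ?_, ?_, ?_, ?_⟩
    · refine hqν.mul_left_cancel ?_
      linear_combination -h1
    · linear_combination (ν) * h2 + (H * x) * hu
    · linear_combination (ν) * h3 - y * hu
    · refine hiu.mul_left_cancel ?_
      linear_combination -h4
  · intro h
    refine ⟨?_, ?_, ?_, ?_⟩
    · linear_combination (-(q * ν)) * h.rel_w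
    · refine ((isUnit_iff_exists_inv.mpr ⟨i, hu⟩ : IsUnit ν)).mul_left_cancel ?_
      linear_combination h.rel_x - (H * x) * hu
    · refine ((isUnit_iff_exists_inv.mpr ⟨i, hu⟩ : IsUnit ν)).mul_left_cancel ?_
      linear_combination h.rel_y + y * hu
    · linear_combination (-i) * h.rel_z

namespace NormalForm

variable {S w x y z : A} (h : NormalForm A q α S w x y z)

include h

theorem res_H : A.res (Polynomial.aeval (w + z) (hPoly q)) = q := by
  rw [map_aeval_int, map_add, h.res_w, h.res_z, one_add_one_eq_two, aeval_two_hPoly]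

theorem map {B : CoeffRing p k} (f : CoeffHom A B) :
    NormalForm B q α (f.toAlgHom S) (f.toAlgHom w) (f.toAlgHom x) (f.toAlgHom y) (f.toAlgHom z) where
  res_S := by rw [f.res_comp, h.res_S]
  res_w := by rw [f.res_comp, h.res_w]
  res_x := by rw [f.res_comp, h.res_x]
  res_y := by rw [f.res_comp, h.res_y]
  res_z := by rw [f.res_comp, h.res_z]
  det := by rw [← map_mul, ← map_mul, ← map_sub, h.det, map_one]
  rel_w := by
    have := congrArg f.toAlgHom h.rel_w
    simpa only [map_mul, map_sub, map_one, f.map_aeval_add] using this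
  rel_x := by
    have := congrArg f.toAlgHom h.rel_x
    simpa only [map_mul, map_sub, map_one, map_pow, map_add, map_natCast, map_zero, f.map_aeval_add,
      f.map_teich] using this
  rel_y := by
    have := congrArg f.toAlgHom h.rel_y
    simpa only [map_mul, map_sub, map_one, map_pow, map_add, map_natCast, map_zero, f.map_aeval_add,
      f.map_teich] using this
  rel_z := by
    have := congrArg f.toAlgHom h.rel_z
    simpa only [map_mul, map_sub, map_one, f.map_aeval_add] using this

/-- Since `h_q(2) = q`, the cofactor of `x` in `rel_x` has residue `q (α ^ 2 - 1)` and is a unit. -/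
theorem x_eq_zero (hqk : (q : k) ≠ 0) (hα1 : α ^ 2 ≠ 1) : x = 0 := by
  refine CoeffRing.eq_zero_of_mul h.rel_x ?_
  rw [map_sub, h.res_H, map_mul, map_pow, res_unit_part h.res_S, map_natCast]
  intro h0
  apply hα1
  refine mul_left_cancel₀ hqk ?_
  linear_combination h0

/-- The cofactor of `y` in `rel_y` has residue `1 - q ^ 2 α ^ 2`. -/
theorem y_eq_zero (hα2 : (q : k) ^ 2 * α ^ 2 ≠ 1) : y = 0 := by
  refine CoeffRing.eq_zero_of_mul h.rel_y ?_
  rw [map_sub, map_mul, h.res_H, map_mul, map_pow, res_unit_part h.res_S, map_natCast, map_one]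
  intro h0
  apply hα2
  linear_combination -h0

/-- The difference of `rel_w` and `rel_z` is `(w - z)` times a cofactor with residue `q - 1`. -/
theorem w_eq_z (hq1 : (q : k) ≠ 1) : w = z := by
  rw [← sub_eq_zero]
  refine CoeffRing.eq_zero_of_mul (y := Polynomial.aeval (w + z) (hPoly q) - 1) ?_ ?_
  · linear_combination h.rel_w - h.rel_z
  · rw [map_sub, h.res_H, map_one]
    exact sub_ne_zero.mpr hq1

theorem diag_pow (hq : 0 < q) (hqk : (q : k) ≠ 0) (hα : α ≠ 0) (hx : x = 0) (hy : y = 0) :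
    w ^ q = w := by
  have h1 := (normalForm_of_relation hq hqk hα h.res_S h.res_w h.res_x h.res_y h.res_z h.det).mpr h
  subst hx hy
  have h2 := congrFun (congrFun h1 0) 0
  have h3 : (!![w, 0; 0, z] : Matrix (Fin 2) (Fin 2) A) ^ q = !![w ^ q, 0; 0, z ^ q] := by
    have e : ∀ a b : A, !![a, 0; 0, b] = Matrix.diagonal ![a, b] := fun a b => by
      ext i j; fin_cases i <;> fin_cases j <;> simp
    rw [e, Matrix.diagonal_pow, e]
    congr 1
    ext i
    fin_cases i <;> rfl
  rw [h3] at h2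
  simp [diagMatrix, Matrix.mul_apply, Fin.sum_univ_two] at h2
  have hu : IsUnit ((q : A) * A.teich α * (1 + S)) := CoeffRing.isUnit_iff.mpr (by
    rw [mul_assoc, map_mul, res_unit_part h.res_S, map_natCast]; exact mul_ne_zero hqk hα)
  refine hu.mul_left_cancel ?_
  linear_combination -h2

end NormalForm

end NormalForms

/-! ### Stability of liftings under strict equivalence and change of rings. -/

section Closure

variable {p : ℕ} [Fact p.Prime] {k : Type u} [Field k] {G : Type v} [Group G] [TopologicalSpace G]

theorem StrictEquiv.ker_eq {A : CoeffRing p k} {ρ ρ' : G →* GL (Fin 2) A} (h : StrictEquiv ρ ρ')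
    {B : CoeffRing p k} (f : CoeffHom A B) : (LocalDef.push f ρ').ker = (LocalDef.push f ρ).ker := by
  obtain ⟨M, -, h⟩ := h.push f
  ext g
  rw [MonoidHom.mem_ker, MonoidHom.mem_ker, ← h, mul_inv_eq_one, mul_eq_left]

variable [IsTopologicalGroup G] {ρbar : G →* GL (Fin 2) k}

theorem IsLifting.strictEquiv {A : CoeffRing p k} {ρ ρ' : G →* GL (Fin 2) A}
    (h : IsLifting ρbar A ρ) (hρ : StrictEquiv ρ ρ') : IsLifting ρbar A ρ' := by
  refine ⟨isContRep_iff.mpr fun n => ?_, hρ.res_eq ▸ h.2⟩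
  rw [hρ.ker_eq]
  exact isContRep_iff.mp h.1 n

theorem IsLifting.push {A B : CoeffRing p k} {ρ : G →* GL (Fin 2) A} (h : IsLifting ρbar A ρ)
    (f : CoeffHom A B) : IsLifting ρbar B (push f ρ) := by
  refine ⟨isContRep_iff.mpr fun n => ?_, (res_push f ρ).trans h.2⟩
  refine Subgroup.isOpen_mono (H₁ := (LocalDef.push (A.toTrunc n) ρ).ker) (fun g hg => ?_)
    (isContRep_iff.mp h.1 n)
  rw [MonoidHom.mem_ker, push_toTrunc_eq_one_iff] at *
  intro i j
  have h1 := f.map_mem_pow (hg i j)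
  rw [map_sub] at h1
  rw [push_apply]
  convert h1 using 2
  rw [Matrix.one_apply, Matrix.one_apply]
  split_ifs <;> simp

variable {d : G →* (WittVector p k)ˣ}

theorem StrictEquiv.det_eq {A : CoeffRing p k} {ρ ρ' : G →* GL (Fin 2) A} (h : StrictEquiv ρ ρ')
    (g : G) : (ρ' g : Matrix (Fin 2) (Fin 2) A).det = (ρ g : Matrix (Fin 2) (Fin 2) A).det := by
  obtain ⟨M, -, h⟩ := h
  rw [← h]
  exact congrArg Units.val (show Matrix.GeneralLinearGroup.det (M * ρ g * M⁻¹) =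
    Matrix.GeneralLinearGroup.det (ρ g) by rw [map_mul, map_mul, map_inv, mul_inv_cancel_comm])

theorem det_push {A B : CoeffRing p k} (f : CoeffHom A B) (ρ : G →* GL (Fin 2) A) (g : G) :
    (LocalDef.push f ρ g : Matrix (Fin 2) (Fin 2) B).det =
      f.toAlgHom (ρ g : Matrix (Fin 2) (Fin 2) A).det :=
  (RingHom.map_det (f.toAlgHom : A →+* B) _).symm

theorem liftingsWithDet.strictEquiv {A : CoeffRing p k} {ρ ρ' : G →* GL (Fin 2) A}
    (h : liftingsWithDet ρbar d A ρ) (hρ : StrictEquiv ρ ρ') : liftingsWithDet ρbar d A ρ' :=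
  ⟨h.1.strictEquiv hρ, fun g => by rw [hρ.det_eq, h.2]⟩

theorem liftingsWithDet.push {A B : CoeffRing p k} {ρ : G →* GL (Fin 2) A}
    (h : liftingsWithDet ρbar d A ρ) (f : CoeffHom A B) :
    liftingsWithDet ρbar d B (LocalDef.push f ρ) :=
  ⟨h.1.push f, fun g => by rw [det_push, h.2, f.toAlgHom.commutes]⟩

theorem liftingsWithDet_pushClosed : (liftingsWithDet ρbar d).PushClosed :=
  fun _ _ f _ h => h.push f

end Closure

/-! ### Conjugation to first order. -/

section Conjugation

variable {p : ℕ} [Fact p.Prime] {k : Type u} [Field k] {A : CoeffRing p k}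

theorem res_mul_eq_zero_dual [CharP k p] [Finite k] {x y : dualCoeff p k} (hx : (dualCoeff p k).res x = 0)
    (hy : (dualCoeff p k).res y = 0) : x * y = 0 := by
  obtain ⟨a, b, rfl⟩ := exists_dualMk x
  obtain ⟨c, d, rfl⟩ := exists_dualMk y
  rw [res_dualMk] at hx hy
  rw [← dualMk_mul, hx, hy, ← dualMk_zero]
  simp

theorem res_entries {M : GL (Fin 2) A} (hM : Matrix.GeneralLinearGroup.map A.res M = 1) :
    A.res (M 0 0) = 1 ∧ A.res (M 0 1) = 0 ∧ A.res (M 1 0) = 0 ∧ A.res (M 1 1) = 1 := by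
  have h := (Matrix.GeneralLinearGroup.ext_iff _ _).mp hM
  exact ⟨h 0 0, h 0 1, h 1 0, h 1 1⟩

/-- Conjugation by a matrix that reduces to the identity, over a ring whose maximal ideal has
square zero, does not change the diagonal entries of a residually diagonal matrix. -/
theorem diag_eq_of_conj (hA : ∀ x y : A, A.res x = 0 → A.res y = 0 → x * y = 0) {M : GL (Fin 2) A}
    (hM : Matrix.GeneralLinearGroup.map A.res M = 1) {s s' : Matrix (Fin 2) (Fin 2) A}
    (h : (M : Matrix (Fin 2) (Fin 2) A) * s = s' * (M : Matrix (Fin 2) (Fin 2) A))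
    (h01 : A.res (s 0 1) = 0) (h10 : A.res (s 1 0) = 0) (h01' : A.res (s' 0 1) = 0)
    (h10' : A.res (s' 1 0) = 0) : s 0 0 = s' 0 0 ∧ s 1 1 = s' 1 1 := by
  obtain ⟨m1, m2, m3, m4⟩ := res_entries hM
  have e0 := congrFun (congrFun h 0) 0
  have e1 := congrFun (congrFun h 1) 1
  rw [Matrix.mul_apply, Matrix.mul_apply, Fin.sum_univ_two, Fin.sum_univ_two] at e0 e1
  constructor
  · refine (CoeffRing.isUnit_iff.mpr (m1.trans_ne one_ne_zero)).mul_left_cancel ?_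
    linear_combination e0 - hA _ _ m2 h10 + hA _ _ h01' m3
  · refine (CoeffRing.isUnit_iff.mpr (m4.trans_ne one_ne_zero)).mul_left_cancel ?_
    linear_combination e1 - hA _ _ m3 h01 + hA _ _ h10' m2

/-- To first order, matrices congruent to one commute, so conjugation has no effect on `τ`. This
gives the uniqueness required of a versal pair over the dual numbers. -/
theorem eq_of_conj (hA : ∀ x y : A, A.res x = 0 → A.res y = 0 → x * y = 0) {M : GL (Fin 2) A}
    (hM : Matrix.GeneralLinearGroup.map A.res M = 1) {t t' : Matrix (Fin 2) (Fin 2) A}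
    (h : (M : Matrix (Fin 2) (Fin 2) A) * t = t' * (M : Matrix (Fin 2) (Fin 2) A))
    (ht : t.map A.res = 1) (ht' : t'.map A.res = 1) : t = t' := by
  obtain ⟨m1, m2, m3, m4⟩ := res_entries hM
  have a00 : A.res (t 0 0) = 1 := congrFun (congrFun ht 0) 0
  have a01 : A.res (t 0 1) = 0 := congrFun (congrFun ht 0) 1
  have a10 : A.res (t 1 0) = 0 := congrFun (congrFun ht 1) 0
  have a11 : A.res (t 1 1) = 1 := congrFun (congrFun ht 1) 1
  have b00 : A.res (t' 0 0) = 1 := congrFun (congrFun ht' 0) 0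
  have b01 : A.res (t' 0 1) = 0 := congrFun (congrFun ht' 0) 1
  have b10 : A.res (t' 1 0) = 0 := congrFun (congrFun ht' 1) 0
  have b11 : A.res (t' 1 1) = 1 := congrFun (congrFun ht' 1) 1
  obtain ⟨d0, d1⟩ := diag_eq_of_conj hA hM h a01 a10 b01 b10
  have e0 := congrFun (congrFun h 0) 1
  have e1 := congrFun (congrFun h 1) 0
  rw [Matrix.mul_apply, Matrix.mul_apply, Fin.sum_univ_two, Fin.sum_univ_two] at e0 e1
  have n1 : A.res (M 0 0 - 1) = 0 := by rw [map_sub, m1, map_one, sub_self]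
  have n4 : A.res (M 1 1 - 1) = 0 := by rw [map_sub, m4, map_one, sub_self]
  have r1 : A.res (t 1 1 - t' 0 0) = 0 := by rw [map_sub, a11, b00, sub_self]
  have r2 : A.res (t 0 0 - t' 1 1) = 0 := by rw [map_sub, a00, b11, sub_self]
  ext i j
  fin_cases i <;> fin_cases j
  · exact d0
  · change t 0 1 = t' 0 1
    linear_combination e0 - hA _ _ n1 a01 - hA _ _ m2 r1 + hA _ _ n4 b01
  · change t 1 0 = t' 1 0
    linear_combination e1 - hA _ _ n4 a10 - hA _ _ m3 r2 + hA _ _ n1 b10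
  · exact d1

end Conjugation

/-- A residual representation `ρbar` trivial on `I` and diagonal with distinct eigenvalues on `σ`,
together with a character `χ` trivial on `I` that takes the value `q` on `σ`. -/
structure LocalSetup {p : ℕ} [Fact p.Prime] {k : Type u} [Field k] {G : Type v} [Group G]
    [TopologicalSpace G] (q : ℕ) (I P : Subgroup G) (σ τ : G) (ρbar : G →* GL (Fin 2) k)
    (χ : G →* (WittVector p k)ˣ) (α : k) : Prop where
  tame : TameData.{u} p q I P σ τ
  odd : p ≠ 2
  inertia : ∀ i ∈ I, ρbar i = 1
  isOpen_ker : IsOpen (ρbar.ker : Set G)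
  frob : (ρbar σ : Matrix (Fin 2) (Fin 2) k) = !![(q : k) * α, 0; 0, α⁻¹]
  unit : α ≠ 0
  ne : (q : k) * α ≠ α⁻¹
  char_inertia : ∀ i ∈ I, χ i = 1
  char_cont : ∀ n : ℕ, IsOpen {g | (χ g : WittVector p k) - 1 ∈ Ideal.span {(p : WittVector p k)} ^ n}
  char_frob : (χ σ : WittVector p k) = q

namespace LocalSetup

variable {p : ℕ} [Fact p.Prime] {k : Type u} [Field k] [CharP k p] [Finite k] {G : Type v} [Group G]
  [TopologicalSpace G] [IsTopologicalGroup G] {q : ℕ} {I P : Subgroup G} {σ τ : G}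
  {ρbar : G →* GL (Fin 2) k} {χ : G →* (WittVector p k)ˣ} {α : k}
  (h : LocalSetup q I P σ τ ρbar χ α)

include h

theorem q_ne_zero : (q : k) ≠ 0 := by
  have h1 : ((ρbar σ : Matrix (Fin 2) (Fin 2) k)).det ≠ 0 :=
    ((Matrix.isUnit_iff_isUnit_det _).mp (ρbar σ).isUnit).ne_zero
  rw [h.frob, Matrix.det_fin_two_of] at h1
  intro h0
  simp [h0] at h1

theorem q_pos : 0 < q := by
  rcases Nat.eq_zero_or_pos q with h0 | h0
  · exact absurd (by rw [h0, Nat.cast_zero]) h.q_ne_zero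
  · exact h0

theorem two_ne_zero : (2 : k) ≠ 0 := by
  have : ((2 : ℕ) : k) ≠ 0 := by
    rw [Ne, CharP.cast_eq_zero_iff k p]
    intro h2
    exact h.odd ((Nat.prime_dvd_prime_iff_eq Fact.out Nat.prime_two).mp h2)
  exact_mod_cast this

variable {A : CoeffRing p k}

theorem liftingsWithDet_iff {ρ : G →* GL (Fin 2) A} :
    liftingsWithDet ρbar χ A ρ ↔ IsLifting ρbar A ρ ∧
      (ρ σ : Matrix (Fin 2) (Fin 2) A).det = q ∧ (ρ τ : Matrix (Fin 2) (Fin 2) A).det = 1 := by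
  constructor
  · rintro ⟨h1, h2⟩
    refine ⟨h1, ?_, ?_⟩
    · rw [h2, h.char_frob, map_natCast]
    · rw [h2, h.char_inertia τ h.tame.tau_mem, Units.val_one, map_one]
  · rintro ⟨h1, h2, h3⟩
    refine ⟨h1, h.tame.det_eq h.inertia h.char_inertia h.char_cont h1 ?_ h3⟩
    rw [h2, h.char_frob, map_natCast]

theorem res_sigma {ρ : G →* GL (Fin 2) A} (hρ : IsLifting ρbar A ρ) :
    (ρ σ : Matrix (Fin 2) (Fin 2) A).map A.res = !![(q : k) * α, 0; 0, α⁻¹] :=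
  (congrArg Units.val (hρ.res_apply σ)).trans h.frob

theorem res_tau {ρ : G →* GL (Fin 2) A} (hρ : IsLifting ρbar A ρ) :
    (ρ τ : Matrix (Fin 2) (Fin 2) A).map A.res = 1 :=
  congrArg Units.val ((hρ.res_apply τ).trans (h.inertia τ h.tame.tau_mem))

theorem relation {ρ : G →* GL (Fin 2) A} (hρ : IsLifting ρbar A ρ) :
    (ρ σ : Matrix (Fin 2) (Fin 2) A) * ρ τ = (ρ τ : Matrix (Fin 2) (Fin 2) A) ^ q * ρ σ := by
  have h1 := mul_inv_eq_iff_eq_mul.mp (h.tame.lifting_relation h.inertia hρ)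
  simpa using congrArg Units.val h1

theorem exists_lifting (A : CoeffRing p k) {s t : Matrix (Fin 2) (Fin 2) A}
    (hs : s.map A.res = !![(q : k) * α, 0; 0, α⁻¹]) (ht : t.map A.res = 1) (hds : s.det = q)
    (hdt : t.det = 1) (hst : s * t = t ^ q * s) :
    ∃ ρ : G →* GL (Fin 2) A, liftingsWithDet ρbar χ A ρ ∧
      (ρ σ : Matrix (Fin 2) (Fin 2) A) = s ∧ (ρ τ : Matrix (Fin 2) (Fin 2) A) = t := by
  have hu1 : IsUnit s.det := CoeffRing.isUnit_iff.mpr (by rw [hds, map_natCast]; exact h.q_ne_zero)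
  have hu2 : IsUnit t.det := by rw [hdt]; exact isUnit_one
  obtain ⟨ρ, hρ, h1, h2⟩ := h.tame.exists_lifting h.inertia h.isOpen_ker A
    (Matrix.GeneralLinearGroup.mk'' s hu1) (Matrix.GeneralLinearGroup.mk'' t hu2)
    (Units.ext (hs.trans h.frob.symm)) (Units.ext ht) (mul_inv_eq_of_eq_mul (Units.ext (by
      simpa using hst)))
  have e1 : (ρ σ : Matrix (Fin 2) (Fin 2) A) = s := congrArg Units.val h1
  have e2 : (ρ τ : Matrix (Fin 2) (Fin 2) A) = t := congrArg Units.val h2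
  exact ⟨ρ, h.liftingsWithDet_iff.mpr ⟨hρ, by rw [e1, hds], by rw [e2, hdt]⟩, e1, e2⟩

theorem ext {ρ ρ' : G →* GL (Fin 2) A} (hρ : IsLifting ρbar A ρ) (hρ' : IsLifting ρbar A ρ')
    (hσ : (ρ σ : Matrix (Fin 2) (Fin 2) A) = ρ' σ) (hτ : (ρ τ : Matrix (Fin 2) (Fin 2) A) = ρ' τ) :
    ρ = ρ' :=
  h.tame.lifting_ext h.inertia hρ hρ' (Units.ext hσ) (Units.ext hτ)

omit h in
theorem det_diagMatrix (hα : α ≠ 0) {S : A} (hS : A.res S = 0) :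
    (diagMatrix q (A.teich α) S).det = q := by
  rw [diagMatrix, Matrix.det_fin_two_of]
  have := Ring.mul_inverse_cancel (A.teich α * (1 + S))
    (CoeffRing.isUnit_iff.mpr (by rw [res_unit_part hS]; exact hα))
  linear_combination (q : A) * this

omit h in
theorem res_diagMatrix (hα : α ≠ 0) {S : A} (hS : A.res S = 0) :
    (diagMatrix q (A.teich α) S).map A.res = !![(q : k) * α, 0; 0, α⁻¹] := by
  have h1 := CoeffRing.res_inverse (A := A) (x := A.teich α * (1 + S))
    (by rw [res_unit_part hS]; exact hα)
  rw [res_unit_part hS] at h1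
  rw [diagMatrix]
  ext i j
  fin_cases i <;> fin_cases j <;> simp [h1, hS]

omit h in
theorem map_diagMatrix (hα : α ≠ 0) {S : A} (hS : A.res S = 0) {B : CoeffRing p k}
    (f : CoeffHom A B) :
    (diagMatrix q (A.teich α) S).map f.toAlgHom = diagMatrix q (B.teich α) (f.toAlgHom S) := by
  have h1 := f.map_inverse (x := A.teich α * (1 + S)) (by rw [res_unit_part hS]; exact hα)
  rw [diagMatrix, diagMatrix]
  rw [map_mul, map_add, map_one, f.map_teich] at h1
  ext i j
  fin_cases i <;> fin_cases j <;> simp [h1, f.map_teich]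

omit h in
theorem diagMatrix_injective (hα : α ≠ 0) {S S' : A} (hS : A.res S = 0) (hS' : A.res S' = 0)
    (he : diagMatrix q (A.teich α) S 1 1 = diagMatrix q (A.teich α) S' 1 1) : S = S' := by
  have h1 := Ring.mul_inverse_cancel (A.teich α * (1 + S))
    (CoeffRing.isUnit_iff.mpr (by rw [res_unit_part hS]; exact hα))
  have h2 := Ring.mul_inverse_cancel (A.teich α * (1 + S'))
    (CoeffRing.isUnit_iff.mpr (by rw [res_unit_part hS']; exact hα))
  have he' : Ring.inverse (A.teich α * (1 + S)) = Ring.inverse (A.teich α * (1 + S')) := he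
  rw [he'] at h1
  have hu : IsUnit (Ring.inverse (A.teich α * (1 + S'))) :=
    IsUnit.of_mul_eq_one _ (by rw [mul_comm]; exact h2)
  have h3 := hu.mul_right_cancel (h1.trans h2.symm)
  have h4 : IsUnit (A.teich α) := CoeffRing.isUnit_iff.mpr (by rw [A.res_teich]; exact hα)
  have := h4.mul_left_cancel h3
  linear_combination this

/-- The member `ρ` has the normal form with parameters `S, w, x, y, z`. -/
structure InForm (h : LocalSetup q I P σ τ ρbar χ α) (ρ : G →* GL (Fin 2) A) (S w x y z : A) :
    Prop where
  mem : liftingsWithDet ρbar χ A ρ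
  sigma : (ρ σ : Matrix (Fin 2) (Fin 2) A) = diagMatrix q (A.teich α) S
  tau : (ρ τ : Matrix (Fin 2) (Fin 2) A) = !![w, x; y, z]
  normal : NormalForm A q α S w x y z

theorem inForm_push {ρ : G →* GL (Fin 2) A} {S w x y z : A} (hρ : h.InForm ρ S w x y z)
    {B : CoeffRing p k} (f : CoeffHom A B) :
    h.InForm (push f ρ) (f.toAlgHom S) (f.toAlgHom w) (f.toAlgHom x) (f.toAlgHom y)
      (f.toAlgHom z) where
  mem := hρ.mem.push f
  sigma := by rw [coe_push, hρ.sigma, map_diagMatrix h.unit hρ.normal.res_S]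
  tau := by
    rw [coe_push, hρ.tau]
    ext i j
    fin_cases i <;> fin_cases j <;> rfl
  normal := hρ.normal.map f

theorem inForm_ext {ρ ρ' : G →* GL (Fin 2) A} {S w x y z : A} (hρ : h.InForm ρ S w x y z)
    (hρ' : h.InForm ρ' S w x y z) : ρ = ρ' :=
  h.ext hρ.mem.1 hρ'.mem.1 (hρ.sigma.trans hρ'.sigma.symm) (hρ.tau.trans hρ'.tau.symm)

theorem exists_inForm {S w x y z : A} (hn : NormalForm A q α S w x y z) :
    ∃ ρ : G →* GL (Fin 2) A, h.InForm ρ S w x y z := by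
  obtain ⟨ρ, h1, h2, h3⟩ := h.exists_lifting A (res_diagMatrix h.unit hn.res_S)
    (t := !![w, x; y, z]) (by
      ext i j
      fin_cases i <;> fin_cases j <;> simp [hn.res_w, hn.res_x, hn.res_y, hn.res_z])
    (det_diagMatrix h.unit hn.res_S) (by rw [Matrix.det_fin_two_of]; exact hn.det)
    ((normalForm_of_relation h.q_pos h.q_ne_zero h.unit hn.res_S hn.res_w hn.res_x hn.res_y
      hn.res_z hn.det).mpr hn)
  exact ⟨ρ, h1, h2, h3, hn⟩

theorem inForm_of_eq {ρ : G →* GL (Fin 2) A} (hρ : liftingsWithDet ρbar χ A ρ) {S w x y z : A}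
    (hS : A.res S = 0) (hσ : (ρ σ : Matrix (Fin 2) (Fin 2) A) = diagMatrix q (A.teich α) S)
    (hτ : (ρ τ : Matrix (Fin 2) (Fin 2) A) = !![w, x; y, z]) : h.InForm ρ S w x y z := by
  have hr := h.res_tau hρ.1
  have hd := (h.liftingsWithDet_iff.mp hρ).2.2
  have hst := h.relation hρ.1
  rw [hτ] at hr hd hst
  rw [hσ] at hst
  rw [Matrix.det_fin_two_of] at hd
  refine ⟨hρ, hσ, hτ, (normalForm_of_relation h.q_pos h.q_ne_zero h.unit hS ?_ ?_ ?_ ?_ hd).mp hst⟩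
  · exact congrFun (congrFun hr 0) 0
  · exact congrFun (congrFun hr 0) 1
  · exact congrFun (congrFun hr 1) 0
  · exact congrFun (congrFun hr 1) 1

/-- After diagonalisation of `σ` the determinant condition makes the product of the diagonal entries
equal to `q`, so that the second entry `b` determines both. -/
theorem exists_strictEquiv_inForm {ρ : G →* GL (Fin 2) A} (hρ : liftingsWithDet ρbar χ A ρ) :
    ∃ (ρ' : G →* GL (Fin 2) A) (S w x y z : A), StrictEquiv ρ ρ' ∧ h.InForm ρ' S w x y z := by
  obtain ⟨M, hM, a, b, ha, hb, hs⟩ := exists_diagonalize h.ne (h.res_sigma hρ.1)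
  set ρ' : G →* GL (Fin 2) A := (MulAut.conj M).toMonoidHom.comp ρ with hρ'
  have heq : StrictEquiv ρ ρ' := ⟨M, hM, fun g => rfl⟩
  have hmem := hρ.strictEquiv heq
  have hσ : (ρ' σ : Matrix (Fin 2) (Fin 2) A) = !![a, 0; 0, b] := by
    change ((M * ρ σ * M⁻¹ : GL (Fin 2) A) : Matrix (Fin 2) (Fin 2) A) = _
    rw [Units.val_mul, Units.val_mul, hs, mul_assoc, ← Units.val_mul, mul_inv_cancel, Units.val_one,
      mul_one]
  have hb0 : A.res b ≠ 0 := by rw [hb]; exact inv_ne_zero h.unit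
  have hbu := Ring.mul_inverse_cancel b (CoeffRing.isUnit_iff.mpr hb0)
  have hab : a * b = q := by
    have := (h.liftingsWithDet_iff.mp hmem).2.1
    rw [hσ, Matrix.det_fin_two_of] at this
    linear_combination this
  have htt : A.teich α * A.teich α⁻¹ = 1 := by
    rw [CoeffRing.teich, CoeffRing.teich, ← map_mul, ← map_mul, mul_inv_cancel₀ h.unit, map_one,
      map_one]
  -- The solution of `b⁻¹ = α̂ (1 + S)`, with `α̂` the Teichmüller lift of `α`.
  set S := Ring.inverse b * A.teich α⁻¹ - 1 with hS
  have hS0 : A.res S = 0 := by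
    rw [hS, map_sub, map_mul, A.res_teich, CoeffRing.res_inverse hb0, hb, map_one, inv_inv,
      mul_inv_cancel₀ h.unit, sub_self]
  have hS1 : A.teich α * (1 + S) = Ring.inverse b := by
    rw [hS]; linear_combination (Ring.inverse b) * htt
  refine ⟨ρ', S, _, _, _, _, heq, h.inForm_of_eq hmem hS0 ?_ (Matrix.eta_fin_two _)⟩
  have hq : (q : A) * Ring.inverse b = a := by rw [← hab, mul_assoc, hbu, mul_one]
  rw [hσ, diagMatrix, mul_assoc, hS1, hq, Ring.inverse_inverse (CoeffRing.isUnit_iff.mpr hb0)]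

end LocalSetup

section

variable {p : ℕ} [Fact p.Prime] {k : Type u} [Field k] [CharP k p] [Finite k]

theorem CoeffHom.eq_zero_of_mem_span {A B : CoeffRing p k} (f : CoeffHom A B) {s : Set A}
    (hs : ∀ x ∈ s, f.toAlgHom x = 0) : ∀ x ∈ Ideal.span s, f.toAlgHom x = 0 := fun x hx => by
  have h : Ideal.span s ≤ RingHom.ker (f.toAlgHom : A →+* B) := Ideal.span_le.mpr hs
  exact h hx

theorem res_varX {ι : Type} [Finite ι] (i : ι) : (powerSeriesCoeff p k ι).res (varX p k i) = 0 :=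
  CoeffRing.mem_maximalIdeal.mp (varX_mem i)

theorem CoeffRing.teich_sq (A : CoeffRing p k) {α : k} (hα : α ^ 2 = 1) : A.teich α ^ 2 = 1 := by
  rw [CoeffRing.teich, ← map_pow, ← map_pow, hα, map_one, map_one]

namespace NormalForm

variable {A : CoeffRing p k} {q : ℕ} {α : k}

theorem of_diag (hq : 0 < q) (hqk : (q : k) ≠ 0) (hα : α ≠ 0) {S w z : A} (hS : A.res S = 0)
    (hw : A.res w = 1) (hz : A.res z = 1) (hwz : w * z = 1) (hwq : w ^ q = w) :
    NormalForm A q α S w 0 0 z := by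
  refine (normalForm_of_relation hq hqk hα hS hw (map_zero _) (map_zero _) hz
    (by rw [hwz]; ring)).mp ?_
  have hzq : z ^ q = z := by
    have h1 : (w * z) ^ q = 1 := by rw [hwz, one_pow]
    rw [mul_pow, hwq] at h1
    calc z ^ q = (w * z) * z ^ q := by rw [hwz, one_mul]
      _ = (w * z ^ q) * z := by ring
      _ = z := by rw [h1, one_mul]
  have e : ∀ a b : A, !![a, 0; 0, b] = Matrix.diagonal ![a, b] := fun a b => by
    ext i j; fin_cases i <;> fin_cases j <;> simp
  have e2 : (![w, z] : Fin 2 → A) ^ q = ![w, z] := by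
    ext i
    fin_cases i
    · exact hwq
    · exact hzq
  rw [e w z, Matrix.diagonal_pow, e2, ← e w z, diagMatrix]
  ext i j
  fin_cases i <;> fin_cases j <;> simp [Matrix.mul_apply, Fin.sum_univ_two, mul_comm]

variable {S w x y z : A} (h : NormalForm A q α S w x y z)

include h

theorem w_eq_one (h2 : (2 : k) ≠ 0) (hq1 : (q : k) ≠ 1) (hxy : x * y = 0) : w = 1 := by
  have hd := h.det
  rw [← h.w_eq_z hq1, hxy] at hd
  exact CoeffRing.eq_of_sq_eq h2 (by linear_combination hd) (by rw [h.res_w, map_one]) (by simp)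

theorem two_mul_w (hq1 : (q : k) ≠ 1) : w + z = 2 * w := by
  rw [← h.w_eq_z hq1, two_mul]

/-- With trace two the cofactor of `x` becomes `q ((1 + S) ^ 2 - 1) = S q (2 + S)`, and `q (2 + S)`
is a unit because `p` is odd. -/
theorem x_mul_S (h2 : (2 : k) ≠ 0) (hqk : (q : k) ≠ 0) (hα : α ^ 2 = 1) (hw : w = 1)
    (hz : z = 1) : S * x = 0 := by
  have hx := h.rel_x
  rw [hw, hz, one_add_one_eq_two, aeval_two_hPoly] at hx
  refine CoeffRing.eq_zero_of_mul (y := q * (2 + S)) ?_ ?_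
  · linear_combination hx - (x * q * (1 + S) ^ 2) * A.teich_sq hα
  · rw [map_mul, map_add, map_natCast, h.res_S, add_zero, map_ofNat]
    exact mul_ne_zero hqk h2

end NormalForm

theorem NormalForm.of_upper {A : CoeffRing p k} {q : ℕ} {α : k} (hq : 0 < q) (hα : α ^ 2 = 1) {S x : A}
    (hS : A.res S = 0)
    (hx : A.res x = 0) (hSx : S * x = 0) : NormalForm A q α S 1 x 0 1 where
  res_S := hS
  res_w := map_one _
  res_x := hx
  res_y := map_zero _
  res_z := map_one _
  det := by ring
  rel_w := by
    rw [one_add_one_eq_two, aeval_two_hPoly, aeval_two_hPoly, Nat.cast_pred hq]; ring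
  rel_x := by
    rw [one_add_one_eq_two, aeval_two_hPoly]
    linear_combination (q * (2 + S)) * hSx + (x * q * (1 + S) ^ 2) * A.teich_sq hα
  rel_y := by ring
  rel_z := by
    rw [one_add_one_eq_two, aeval_two_hPoly, aeval_two_hPoly, Nat.cast_pred hq]; ring

/-- The equations for `w` and `z` follow from those for `x` and `y`. The `q`-th power of the matrix
has determinant one, which together with `hrel_x` and `hrel_y` gives `(H r - H') ^ 2 = r ^ 2`. Both
roots have residue one, so `H r - H' = r`. -/
theorem NormalForm.of_symmetric {A : CoeffRing p k} {q : ℕ} {α : k} (h2 : (2 : k) ≠ 0) (hq : 0 < q)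
    (hα : α ^ 2 = 1)
    {S r x y : A} (hS : A.res S = 0) (hr : A.res r = 1) (hx : A.res x = 0) (hy : A.res y = 0)
    (hrxy : r ^ 2 = 1 + x * y)
    (hrel_x : x * ((q : A) * (1 + S) ^ 2 - Polynomial.aeval (2 * r) (hPoly q)) = 0)
    (hrel_y : y * (1 - (q : A) * (1 + S) ^ 2 * Polynomial.aeval (2 * r) (hPoly q)) = 0) :
    NormalForm A q α S r x y r := by
  have ht := A.teich_sq hα
  have e2 : r + r = 2 * r := (two_mul r).symm
  have key : (Polynomial.aeval (2 * r) (hPoly q) - 1) * r =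
      Polynomial.aeval (2 * r) (hPoly (q - 1)) := by
    obtain ⟨n, rfl⟩ : ∃ n, q = n + 1 := ⟨q - 1, by omega⟩
    rw [Nat.add_sub_cancel]
    set H := Polynomial.aeval (2 * r) (hPoly (n + 1)) with hH
    set H' := Polynomial.aeval (2 * r) (hPoly n) with hH'
    have hdet : (!![r, x; y, r] : Matrix (Fin 2) (Fin 2) A).det = 1 := by
      rw [Matrix.det_fin_two_of]; linear_combination hrxy
    have htr : (!![r, x; y, r] : Matrix (Fin 2) (Fin 2) A).trace = 2 * r := by
      simp [Matrix.trace, Fin.sum_univ_two, two_mul]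
    have hpow := pow_succ_eq_hPoly hdet n
    rw [htr, ← hH, ← hH'] at hpow
    have hpd := congrArg Matrix.det hpow
    rw [Matrix.det_pow, hdet, one_pow, Matrix.det_fin_two] at hpd
    simp at hpd
    have hsq : (H * r - H') ^ 2 = r ^ 2 := by
      linear_combination -hpd - hrxy - (H * y) * hrel_x - x * hrel_y
    have hres2 : A.res (2 * r) = 2 := by rw [map_mul, hr, map_ofNat, mul_one]
    have := CoeffRing.eq_of_sq_eq h2 hsq (by
      rw [map_sub, map_mul, hH, hH', map_aeval_int, map_aeval_int, hres2, aeval_two_hPoly,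
        aeval_two_hPoly, hr]
      push_cast; ring) (by rw [hr]; exact one_ne_zero)
    linear_combination this
  refine ⟨hS, hr, hx, hy, hr, by linear_combination hrxy, by rw [e2]; exact key, ?_, ?_,
    by rw [e2]; exact key⟩
  · rw [e2]
    linear_combination hrel_x + (x * q * (1 + S) ^ 2) * ht
  · rw [e2]
    linear_combination hrel_y - (y * q * (1 + S) ^ 2 * Polynomial.aeval (2 * r) (hPoly q)) * ht

end

/-! ### Versal families in the three cases and for the unramified condition. -/

namespace LocalSetup

variable {p : ℕ} [Fact p.Prime] {k : Type u} [Field k] [CharP k p] [Finite k] {G : Type v} [Group G]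
  [TopologicalSpace G] [IsTopologicalGroup G] {q : ℕ} {I P : Subgroup G} {σ τ : G}
  {ρbar : G →* GL (Fin 2) k} {χ : G →* (WittVector p k)ˣ} {α : k}
  (h : LocalSetup q I P σ τ ρbar χ α)

include h

theorem eq_of_strictEquiv_dual {R : CoeffRing p k} {ρ : G →* GL (Fin 2) R} {S w x y z : R}
    (hρ : h.InForm ρ S w x y z) {f f' : CoeffHom R (dualCoeff p k)}
    (hff : StrictEquiv (push f ρ) (push f' ρ)) :
    f.toAlgHom S = f'.toAlgHom S ∧ f.toAlgHom w = f'.toAlgHom w ∧ f.toAlgHom x = f'.toAlgHom x ∧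
      f.toAlgHom y = f'.toAlgHom y ∧ f.toAlgHom z = f'.toAlgHom z := by
  obtain ⟨M, hM, hc⟩ := hff
  have h1 := h.inForm_push hρ f
  have h2 := h.inForm_push hρ f'
  have hA : ∀ x y : dualCoeff p k, (dualCoeff p k).res x = 0 → (dualCoeff p k).res y = 0 →
    x * y = 0 := fun x y => res_mul_eq_zero_dual
  have hcσ := congrArg Units.val (mul_inv_eq_iff_eq_mul.mp (hc σ))
  have hcτ := congrArg Units.val (mul_inv_eq_iff_eq_mul.mp (hc τ))
  rw [Units.val_mul, Units.val_mul] at hcσ hcτ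
  have e1 := eq_of_conj hA hM hcτ (h.res_tau h1.mem.1) (h.res_tau h2.mem.1)
  rw [h1.tau, h2.tau] at e1
  rw [h1.sigma, h2.sigma] at hcσ
  have e2 := (diag_eq_of_conj hA hM hcσ (map_zero _) (map_zero _) (map_zero _) (map_zero _)).2
  exact ⟨diagMatrix_injective h.unit h1.normal.res_S h2.normal.res_S e2,
    congrFun (congrFun e1 0) 0, congrFun (congrFun e1 0) 1, congrFun (congrFun e1 1) 0,
    congrFun (congrFun e1 1) 1⟩

/-- A criterion for versality in terms of normal forms. -/
theorem isVersal_of_inForm {D : Collection p k G}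
    (hD : ∀ A ρ, D A ρ → liftingsWithDet ρbar χ A ρ)
    (hstrict : ∀ (A : CoeffRing p k) (ρ ρ' : G →* GL (Fin 2) A), StrictEquiv ρ ρ' → D A ρ → D A ρ')
    {ι : Type} [Finite ι] {R : CoeffRing p k} (π : CoeffHom (powerSeriesCoeff p k ι) R)
    (hπ : Function.Surjective π.toAlgHom) {ρ : G →* GL (Fin 2) R} {S w x y z : R}
    (hρ : h.InForm ρ S w x y z) (hmem : D R ρ)
    (hgen : ∀ f f' : CoeffHom R (dualCoeff p k), f.toAlgHom S = f'.toAlgHom S →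
      f.toAlgHom w = f'.toAlgHom w → f.toAlgHom x = f'.toAlgHom x → f.toAlgHom y = f'.toAlgHom y →
      ∀ i, f.toAlgHom (π.toAlgHom (varX p k i)) = f'.toAlgHom (π.toAlgHom (varX p k i)))
    (hex : ∀ (A : CoeffRing p k) (ρ' : G →* GL (Fin 2) A) (S' w' x' y' z' : A), D A ρ' →
      h.InForm ρ' S' w' x' y' z' → ∃ f : CoeffHom R A, f.toAlgHom S = S' ∧ f.toAlgHom w = w' ∧
        f.toAlgHom x = x' ∧ f.toAlgHom y = y' ∧ f.toAlgHom z = z') : IsVersal D R ρ where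
  mem := hmem
  exists_hom A ρ' hρ' := by
    obtain ⟨ρ'', S', w', x', y', z', he, hf⟩ := h.exists_strictEquiv_inForm (hD _ _ hρ')
    obtain ⟨f, rfl, rfl, rfl, rfl, rfl⟩ := hex A ρ'' _ _ _ _ _ (hstrict _ _ _ he hρ') hf
    refine ⟨f, ?_⟩
    rw [h.inForm_ext (h.inForm_push hρ f) hf]
    exact he.symm
  unique ρ' hρ' f f' hf hf' := by
    obtain ⟨e1, e2, e3, e4, -⟩ := h.eq_of_strictEquiv_dual hρ (hf.trans hf'.symm)
    have h1 : f.comp π = f'.comp π := powerSeriesCoeff_hom_ext fun i => hgen f f' e1 e2 e3 e4 i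
    refine CoeffHom.ext_apply fun a => ?_
    obtain ⟨b, rfl⟩ := hπ a
    exact congrArg (fun g => g.toAlgHom b) h1

theorem natCast_sub_one_ne_zero (hq1 : (q : k) ≠ 1) : ((q - 1 : ℕ) : k) ≠ 0 := by
  rw [Nat.cast_pred h.q_pos]
  exact sub_ne_zero.mpr hq1

theorem w_eq_one_of_diag {A : CoeffRing p k} {S w x y z : A} (hn : NormalForm A q α S w x y z)
    (hx : x = 0) (hy : y = 0) (hq1 : (q : k) ≠ 1) : w = 1 := by
  have h1 := hn.diag_pow h.q_pos h.q_ne_zero h.unit hx hy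
  refine CoeffRing.eq_one_of_pow (h.natCast_sub_one_ne_zero hq1) hn.res_w ?_
  have hu : IsUnit w := CoeffRing.isUnit_iff.mpr (by rw [hn.res_w]; exact one_ne_zero)
  refine hu.mul_left_cancel ?_
  rw [← pow_succ', Nat.sub_add_cancel h.q_pos, h1, mul_one]

/-- Both off-diagonal entries of `τ` vanish, so that `w` determines `z` and the relation reduces to
`w ^ q = w`, with `w = 1 + T`. -/
theorem exists_isVersal_diag (hα1 : α ^ 2 ≠ 1) (hα2 : (q : k) ^ 2 * α ^ 2 ≠ 1)
    {J : Ideal (powerSeriesCoeff p k (Fin 2))}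
    (hJ : J = Ideal.span {(1 + varX p k 1) ^ q - (1 + varX p k 1)})
    (hJm : J ≤ maximalIdeal (powerSeriesCoeff p k (Fin 2))) :
    ∃ ρ : G →* GL (Fin 2) ((powerSeriesCoeff p k (Fin 2)).quot J hJm),
      IsVersal (liftingsWithDet ρbar χ) _ ρ ∧
      h.InForm ρ ((CoeffHom.toQuot _ J hJm).toAlgHom (varX p k 0))
        ((CoeffHom.toQuot _ J hJm).toAlgHom (1 + varX p k 1)) 0 0
        ((CoeffHom.toQuot _ J hJm).toAlgHom (Ring.inverse (1 + varX p k 1))) := by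
  set π := CoeffHom.toQuot _ J hJm with hπ
  have hr1 : (powerSeriesCoeff p k (Fin 2)).res (1 + varX p k 1) = 1 := by
    rw [map_add, map_one, res_varX, add_zero]
  have hr0 : (powerSeriesCoeff p k (Fin 2)).res (1 + varX p k 1) ≠ 0 := by
    rw [hr1]; exact one_ne_zero
  have hinv := Ring.mul_inverse_cancel _ (CoeffRing.isUnit_iff.mpr hr0)
  obtain ⟨ρ, hρ⟩ := h.exists_inForm (NormalForm.of_diag h.q_pos h.q_ne_zero h.unit
    (S := π.toAlgHom (varX p k 0)) (w := π.toAlgHom (1 + varX p k 1))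
    (z := π.toAlgHom (Ring.inverse (1 + varX p k 1))) (by rw [π.res_comp, res_varX])
    (by rw [π.res_comp, hr1])
    (by rw [π.res_comp, CoeffRing.res_inverse hr0, hr1, inv_one]) (by rw [← map_mul, hinv, map_one])
    (by
      rw [← map_pow, ← sub_eq_zero, ← map_sub]
      refine (CoeffHom.toQuot_eq_zero hJm).mpr ?_
      rw [hJ]
      exact Ideal.mem_span_singleton_self _))
  refine ⟨ρ, ?_, hρ⟩
  refine h.isVersal_of_inForm (fun _ _ => id) (fun _ _ _ he hD => hD.strictEquiv he) π
    (CoeffHom.toQuot_surjective _ _ _) hρ hρ.mem ?_ ?_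
  · intro f f' e1 e2 _ _ i
    fin_cases i
    · exact e1
    · rw [map_add, map_one, map_add, map_add, map_one, map_one] at e2
      exact add_left_cancel e2
  · intro A ρ' S' w' x' y' z' _ hf
    have hx := hf.normal.x_eq_zero h.q_ne_zero hα1
    have hy := hf.normal.y_eq_zero hα2
    have hw := hf.normal.diag_pow h.q_pos h.q_ne_zero h.unit hx hy
    set g := evalHom A ![S', w' - 1] (fun i => CoeffRing.mem_maximalIdeal.mpr (by
      fin_cases i
      · exact hf.normal.res_S
      · change A.res (w' - 1) = 0
        rw [map_sub, hf.normal.res_w, map_one, sub_self])) with hg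
    have g1 : g.toAlgHom (1 + varX p k 1) = w' := by
      rw [map_add, map_one, hg, evalHom_X]
      change 1 + (w' - 1) = w'
      ring
    refine ⟨g.liftQuot J hJm ?_, ?_, ?_, ?_, ?_, ?_⟩
    · rw [hJ]
      refine g.eq_zero_of_mem_span ?_
      rintro _ rfl
      rw [map_sub, map_pow, g1, hw, sub_self]
    · rw [hπ, CoeffHom.liftQuot_toQuot, hg, evalHom_X]; rfl
    · rw [hπ, CoeffHom.liftQuot_toQuot, g1]
    · rw [map_zero, hx]
    · rw [map_zero, hy]
    · rw [hπ, CoeffHom.liftQuot_toQuot, CoeffHom.map_inverse _ hr0, g1]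
      have hd := hf.normal.det
      rw [hx, zero_mul, sub_zero] at hd
      have hu : IsUnit w' := IsUnit.of_mul_eq_one _ hd
      exact hu.mul_left_cancel ((Ring.mul_inverse_cancel _ hu).trans hd.symm)

theorem exists_isVersal_unramified {D : Collection p k G}
    (hD : ∀ A ρ, D A ρ ↔ liftingsWithDet ρbar χ A ρ ∧ ρ τ = 1) :
    ∃ ρ : G →* GL (Fin 2) (powerSeriesCoeff p k Unit), IsVersal D _ ρ ∧
      h.InForm ρ (varX p k ()) 1 0 0 1 := by
  obtain ⟨ρ, hρ⟩ := h.exists_inForm (NormalForm.of_diag h.q_pos h.q_ne_zero h.unit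
    (S := varX p k ()) (w := 1) (z := 1) (res_varX _) (map_one _) (map_one _) (one_mul _)
    (one_pow _))
  refine ⟨ρ, ?_, hρ⟩
  refine h.isVersal_of_inForm (fun A ρ hρ => ((hD A ρ).mp hρ).1) (fun A ρ ρ' he hρ => ?_)
    (CoeffHom.id _) Function.surjective_id hρ ((hD _ _).mpr ⟨hρ.mem, Units.ext ?_⟩) ?_ ?_
  · refine (hD _ _).mpr ⟨((hD _ _).mp hρ).1.strictEquiv he, ?_⟩
    obtain ⟨M, -, hM⟩ := he
    rw [← hM, ((hD _ _).mp hρ).2, mul_one, mul_inv_cancel]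
  · rw [hρ.tau, Units.val_one, Matrix.one_fin_two]
  · intro f f' e1 _ _ _ i
    exact e1
  · intro A ρ' S' w' x' y' z' hD' hf
    have ht := ((hD _ _).mp hD').2
    have ht' := hf.tau
    rw [ht, Units.val_one, Matrix.one_fin_two] at ht'
    refine ⟨evalHom A (fun _ => S') (fun i => CoeffRing.mem_maximalIdeal.mpr hf.normal.res_S),
      evalHom_X _ _ _ _, ?_, ?_, ?_, ?_⟩
    · rw [map_one]; exact congrFun (congrFun ht' 0) 0
    · rw [map_zero]; exact congrFun (congrFun ht' 0) 1
    · rw [map_zero]; exact congrFun (congrFun ht' 1) 0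
    · rw [map_one]; exact congrFun (congrFun ht' 1) 1

theorem tau_eq_one_of_diag {A : CoeffRing p k} (hα1 : α ^ 2 ≠ 1) (hα2 : (q : k) ^ 2 * α ^ 2 ≠ 1)
    (hq1 : (q : k) ≠ 1) {ρ : G →* GL (Fin 2) A} (hρ : liftingsWithDet ρbar χ A ρ) : ρ τ = 1 := by
  obtain ⟨ρ', S, w, x, y, z, he, hf⟩ := h.exists_strictEquiv_inForm hρ
  have hx := hf.normal.x_eq_zero h.q_ne_zero hα1
  have hy := hf.normal.y_eq_zero hα2
  have hw := h.w_eq_one_of_diag hf.normal hx hy hq1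
  have hz := hf.normal.w_eq_z hq1
  have h1 : ρ' τ = 1 := Units.ext (by
    rw [hf.tau, Units.val_one, Matrix.one_fin_two, hx, hy, ← hz, hw])
  obtain ⟨M, -, hM⟩ := he
  have h2 := hM τ
  rw [h1, mul_inv_eq_one, mul_eq_left] at h2
  exact h2

/-- Here `y` vanishes and `w = z`, hence `w ^ 2 = 1` and `w = 1`. Up to a unit, the equation for `x`
becomes `S x = 0`. -/
theorem exists_isVersal_upper (hα1 : α ^ 2 = 1) (hq1 : (q : k) ≠ 1) (hq2 : (q : k) ^ 2 ≠ 1)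
    {J : Ideal (powerSeriesCoeff p k (Fin 2))}
    (hJ : J = Ideal.span {varX p k 0 * varX p k 1})
    (hJm : J ≤ maximalIdeal (powerSeriesCoeff p k (Fin 2))) :
    ∃ ρ : G →* GL (Fin 2) ((powerSeriesCoeff p k (Fin 2)).quot J hJm),
      IsVersal (liftingsWithDet ρbar χ) _ ρ ∧
      h.InForm ρ ((CoeffHom.toQuot _ J hJm).toAlgHom (varX p k 0)) 1
        ((CoeffHom.toQuot _ J hJm).toAlgHom (varX p k 1)) 0 1 := by
  set π := CoeffHom.toQuot _ J hJm with hπ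
  obtain ⟨ρ, hρ⟩ := h.exists_inForm (NormalForm.of_upper h.q_pos hα1
    (S := π.toAlgHom (varX p k 0)) (x := π.toAlgHom (varX p k 1)) (by rw [π.res_comp, res_varX])
    (by rw [π.res_comp, res_varX])
    (by
      rw [← map_mul]
      refine (CoeffHom.toQuot_eq_zero hJm).mpr ?_
      rw [hJ]
      exact Ideal.mem_span_singleton_self _))
  refine ⟨ρ, ?_, hρ⟩
  refine h.isVersal_of_inForm (fun _ _ => id) (fun _ _ _ he hD => hD.strictEquiv he) π
    (CoeffHom.toQuot_surjective _ _ _) hρ hρ.mem ?_ ?_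
  · intro f f' e1 _ e3 _ i
    fin_cases i
    · exact e1
    · exact e3
  · intro A ρ' S' w' x' y' z' _ hf
    have hy := hf.normal.y_eq_zero (by rw [hα1, mul_one]; exact hq2)
    have hw := hf.normal.w_eq_one h.two_ne_zero hq1 (by rw [hy, mul_zero])
    have hz : z' = 1 := (hf.normal.w_eq_z hq1).symm.trans hw
    have hSx := hf.normal.x_mul_S h.two_ne_zero h.q_ne_zero hα1 hw hz
    set g := evalHom A ![S', x'] (fun i => CoeffRing.mem_maximalIdeal.mpr (by
      fin_cases i
      · exact hf.normal.res_S
      · exact hf.normal.res_x)) with hg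
    have g0 : g.toAlgHom (varX p k 0) = S' := evalHom_X _ _ _ _
    have g1 : g.toAlgHom (varX p k 1) = x' := evalHom_X _ _ _ _
    refine ⟨g.liftQuot J hJm ?_, ?_, ?_, ?_, ?_, ?_⟩
    · rw [hJ]
      refine g.eq_zero_of_mem_span ?_
      rintro _ rfl
      rw [map_mul, g0, g1, hSx]
    · rw [hπ, CoeffHom.liftQuot_toQuot, g0]
    · rw [map_one, hw]
    · rw [hπ, CoeffHom.liftQuot_toQuot, g1]
    · rw [map_zero, hy]
    · rw [map_one, hz]

/-- Only `w = z` is forced. The determinant makes `w` the square root of `1 + x y` with residue one,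
which is unique since `p` is odd; the equations for `x` and `y` remain and generate `J`. -/
theorem exists_isVersal_symmetric (hα1 : α ^ 2 = 1) (hq1 : (q : k) ≠ 1)
    {r : powerSeriesCoeff p k (Fin 3)} (hr : r ^ 2 = 1 + varX p k 1 * varX p k 2)
    (hr1 : (powerSeriesCoeff p k (Fin 3)).res r = 1)
    {J : Ideal (powerSeriesCoeff p k (Fin 3))}
    (hJ : J = oddIdeal q (varX p k 0) (varX p k 1) (varX p k 2) r)
    (hJm : J ≤ maximalIdeal (powerSeriesCoeff p k (Fin 3))) :
    ∃ ρ : G →* GL (Fin 2) ((powerSeriesCoeff p k (Fin 3)).quot J hJm),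
      IsVersal (liftingsWithDet ρbar χ) _ ρ ∧
      h.InForm ρ ((CoeffHom.toQuot _ J hJm).toAlgHom (varX p k 0))
        ((CoeffHom.toQuot _ J hJm).toAlgHom r)
        ((CoeffHom.toQuot _ J hJm).toAlgHom (varX p k 1))
        ((CoeffHom.toQuot _ J hJm).toAlgHom (varX p k 2))
        ((CoeffHom.toQuot _ J hJm).toAlgHom r) := by
  set π := CoeffHom.toQuot _ J hJm with hπ
  have hev : ∀ {B : CoeffRing p k} (f : CoeffHom (powerSeriesCoeff p k (Fin 3)) B),
      f.toAlgHom (Polynomial.aeval (2 * r) (hPoly q)) =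
        Polynomial.aeval (2 * f.toAlgHom r) (hPoly q) := fun f => by
    rw [two_mul, f.map_aeval_add, two_mul]
  obtain ⟨ρ, hρ⟩ := h.exists_inForm (NormalForm.of_symmetric h.two_ne_zero h.q_pos hα1
    (S := π.toAlgHom (varX p k 0)) (x := π.toAlgHom (varX p k 1)) (y := π.toAlgHom (varX p k 2))
    (r := π.toAlgHom r) (by rw [π.res_comp, res_varX]) (by rw [π.res_comp, hr1])
    (by rw [π.res_comp, res_varX]) (by rw [π.res_comp, res_varX])
    (by rw [← map_mul, ← map_pow, hr, map_add, map_one])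
    (by
      have h1 : π.toAlgHom (varX p k 1 * ((q : powerSeriesCoeff p k (Fin 3)) * (1 + varX p k 0) ^ 2 -
          Polynomial.aeval (2 * r) (hPoly q))) = 0 := by
        refine (CoeffHom.toQuot_eq_zero hJm).mpr ?_
        rw [hJ]
        exact Ideal.subset_span (Or.inl rfl)
      rwa [map_mul, map_sub, map_mul, map_pow, map_add, map_one, map_natCast, hev] at h1)
    (by
      have h1 : π.toAlgHom (varX p k 2 * (1 - (q : powerSeriesCoeff p k (Fin 3)) *
          (1 + varX p k 0) ^ 2 * Polynomial.aeval (2 * r) (hPoly q))) = 0 := by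
        refine (CoeffHom.toQuot_eq_zero hJm).mpr ?_
        rw [hJ]
        exact Ideal.subset_span (Or.inr rfl)
      rwa [map_mul, map_sub, map_mul, map_mul, map_pow, map_add, map_one, map_natCast, hev] at h1))
  refine ⟨ρ, ?_, hρ⟩
  refine h.isVersal_of_inForm (fun _ _ => id) (fun _ _ _ he hD => hD.strictEquiv he) π
    (CoeffHom.toQuot_surjective _ _ _) hρ hρ.mem ?_ ?_
  · intro f f' e1 _ e3 e4 i
    fin_cases i
    · exact e1
    · exact e3
    · exact e4
  · intro A ρ' S' w' x' y' z' _ hf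
    have hwz := hf.normal.w_eq_z hq1
    have ht := A.teich_sq hα1
    set g := evalHom A ![S', x', y'] (fun i => CoeffRing.mem_maximalIdeal.mpr (by
      fin_cases i
      · exact hf.normal.res_S
      · exact hf.normal.res_x
      · exact hf.normal.res_y)) with hg
    have g0 : g.toAlgHom (varX p k 0) = S' := evalHom_X _ _ _ _
    have g1 : g.toAlgHom (varX p k 1) = x' := evalHom_X _ _ _ _
    have g2 : g.toAlgHom (varX p k 2) = y' := evalHom_X _ _ _ _
    have gr : g.toAlgHom r = w' := by
      refine CoeffRing.eq_of_sq_eq h.two_ne_zero ?_ (by rw [g.res_comp, hr1, hf.normal.res_w])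
        (by rw [hf.normal.res_w]; exact one_ne_zero)
      have hd := hf.normal.det
      rw [← hwz] at hd
      rw [← map_pow, hr, map_add, map_mul, g1, g2, map_one]
      linear_combination -hd
    have hx := hf.normal.rel_x
    have hy := hf.normal.rel_y
    rw [hf.normal.two_mul_w hq1] at hx hy
    refine ⟨g.liftQuot J hJm ?_, ?_, ?_, ?_, ?_, ?_⟩
    · rw [hJ]
      refine g.eq_zero_of_mem_span ?_
      rintro _ (rfl | rfl)
      · rw [map_mul, map_sub, map_mul, map_pow, map_add, map_one, map_natCast, hev, g0, g1, gr]
        linear_combination hx - (x' * q * (1 + S') ^ 2) * ht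
      · rw [map_mul, map_sub, map_mul, map_mul, map_pow, map_add, map_one, map_natCast, hev, g0, g2,
          gr]
        linear_combination hy + (y' * q * (1 + S') ^ 2 * Polynomial.aeval (2 * w') (hPoly q)) * ht
    · rw [hπ, CoeffHom.liftQuot_toQuot, g0]
    · rw [hπ, CoeffHom.liftQuot_toQuot, gr]
    · rw [hπ, CoeffHom.liftQuot_toQuot, g1]
    · rw [hπ, CoeffHom.liftQuot_toQuot, g2]
    · rw [hπ, CoeffHom.liftQuot_toQuot, gr, hwz]

end LocalSetup

/-! ### Deformation conditions cut out by equations. -/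

section DeformationConditions

variable {p : ℕ} [Fact p.Prime] {k : Type u} [Field k] [CharP k p] [Finite k] {G : Type v} [Group G]
  [TopologicalSpace G] [IsTopologicalGroup G] {ρbar : G →* GL (Fin 2) k}

theorem isDeformationCondition_isLifting :
    IsDeformationCondition ρbar (fun A ρ => IsLifting (p := p) ρbar A ρ) where
  isLifting _ _ := id
  residual _ _ _ := id
  strictEquiv _ _ _ he hρ := hρ.strictEquiv he
  push _ _ f _ hρ := hρ.push f
  fibreProduct _ _ _ _ _ _ _ _ _ _ _ _ _ _ _ hρ _ _ := hρ
  injective _ _ _ _ _ _ _ hρ _ := hρ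
  limit _ _ hρ _ := hρ

/-- Natural equations that hold residually cut out a deformation condition. -/
theorem IsDeformationCondition.and_eqns {D : Collection p k G} (hD : IsDeformationCondition ρbar D)
    {ι : Sort*} (Φ : ι → ∀ A : CoeffRing p k, (G →* GL (Fin 2) A) → Matrix (Fin 2) (Fin 2) A)
    (hpush : ∀ i A B (f : CoeffHom A B) ρ, Φ i B (LocalDef.push f ρ) = (Φ i A ρ).map f.toAlgHom)
    (hstrict : ∀ i (A : CoeffRing p k) (ρ ρ' : G →* GL (Fin 2) A), StrictEquiv ρ ρ' →
      Φ i A ρ = 0 → Φ i A ρ' = 0)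
    (hres : ∀ i A ρ, IsLifting ρbar A ρ → (Φ i A ρ).map A.res = 0) :
    IsDeformationCondition ρbar (fun A ρ => D A ρ ∧ ∀ i, Φ i A ρ = 0) where
  isLifting A ρ hρ := hD.isLifting A ρ hρ.1
  residual A ρ hA hρ := ⟨hD.residual A ρ hA hρ, fun i => by
    ext a b
    refine hA.1 ?_
    rw [Matrix.zero_apply, map_zero]
    exact congrFun (congrFun (hres i A ρ hρ) a) b⟩
  strictEquiv A ρ ρ' he hρ := ⟨hD.strictEquiv A ρ ρ' he hρ.1, fun i => hstrict i A ρ ρ' he (hρ.2 i)⟩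
  push A B f ρ hρ := ⟨hD.push A B f ρ hρ.1, fun i => by
    rw [hpush, hρ.2 i, Matrix.map_zero _ (map_zero _)]⟩
  fibreProduct Q A B C pA pB a b h1 h2 h3 h4 hc hu ρ hρ hρA hρB :=
    ⟨hD.fibreProduct Q A B C pA pB a b h1 h2 h3 h4 hc hu ρ hρ hρA.1 hρB.1, fun i => by
      have eA := hρA.2 i
      have eB := hρB.2 i
      rw [hpush] at eA eB
      -- Uniqueness of the element over `(0, 0)` says that the two projections of a fibre product
      -- are jointly injective.
      obtain ⟨z, -, hz⟩ := hu 0 0 (by rw [map_zero, map_zero])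
      ext m n
      rw [hz (Φ i Q ρ m n) ⟨congrFun (congrFun eA m) n, congrFun (congrFun eB m) n⟩]
      exact (hz 0 ⟨map_zero _, map_zero _⟩).symm⟩
  injective A B f h1 h2 hf ρ hρ hB := ⟨hD.injective A B f h1 h2 hf ρ hρ hB.1, fun i => by
    have e := hB.2 i
    rw [hpush] at e
    ext m n
    refine hf ?_
    rw [Matrix.zero_apply, map_zero]
    exact congrFun (congrFun e m) n⟩
  limit A ρ hρ hl := ⟨hD.limit A ρ hρ fun B f hB hf => (hl B f hB hf).1, fun i => by
    ext m n
    refine CoeffRing.eq_of_forall_toTrunc fun N => ?_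
    have e := (hl (A.trunc N) (A.toTrunc N) inferInstance (A.toTrunc_surjective N)).2 i
    rw [hpush] at e
    rw [Matrix.zero_apply, map_zero]
    exact congrFun (congrFun e m) n⟩

theorem IsDeformationCondition.and_eqn {D : Collection p k G} (hD : IsDeformationCondition ρbar D)
    (Φ : ∀ A : CoeffRing p k, (G →* GL (Fin 2) A) → Matrix (Fin 2) (Fin 2) A)
    (hpush : ∀ A B (f : CoeffHom A B) ρ, Φ B (LocalDef.push f ρ) = (Φ A ρ).map f.toAlgHom)
    (hstrict : ∀ (A : CoeffRing p k) (ρ ρ' : G →* GL (Fin 2) A), StrictEquiv ρ ρ' →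
      Φ A ρ = 0 → Φ A ρ' = 0)
    (hres : ∀ A ρ, IsLifting ρbar A ρ → (Φ A ρ).map A.res = 0) :
    IsDeformationCondition ρbar (fun A ρ => D A ρ ∧ Φ A ρ = 0) := by
  have h1 := hD.and_eqns (fun _ : Unit => Φ) (fun _ => hpush) (fun _ => hstrict) (fun _ => hres)
  simpa using h1

end DeformationConditions

section Conj

variable {p : ℕ} [Fact p.Prime] {k : Type u} [Field k] {G : Type v} [Group G]

theorem StrictEquiv.exists_conj {A : CoeffRing p k} {ρ ρ' : G →* GL (Fin 2) A}
    (h : StrictEquiv ρ ρ') : ∃ M N : Matrix (Fin 2) (Fin 2) A, M * N = 1 ∧ N * M = 1 ∧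
      ∀ g, (ρ' g : Matrix (Fin 2) (Fin 2) A) = M * ρ g * N := by
  obtain ⟨M, -, h⟩ := h
  refine ⟨M, ((M⁻¹ : GL (Fin 2) A) : Matrix (Fin 2) (Fin 2) A), M.mul_inv, M.inv_mul, fun g => ?_⟩
  rw [← h, Units.val_mul, Units.val_mul]

theorem StrictEquiv.trace_eq {A : CoeffRing p k} {ρ ρ' : G →* GL (Fin 2) A}
    (h : StrictEquiv ρ ρ') (g : G) : (ρ' g : Matrix (Fin 2) (Fin 2) A).trace =
      (ρ g : Matrix (Fin 2) (Fin 2) A).trace := by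
  obtain ⟨M, N, -, hNM, h⟩ := h.exists_conj
  rw [h, Matrix.trace_mul_comm, ← mul_assoc, hNM, one_mul]

end Conj

/-! ### The unramified and the special conditions and their versal rings. -/

namespace LocalSetup

variable {p : ℕ} [Fact p.Prime] {k : Type u} [Field k] [CharP k p] [Finite k] {G : Type v} [Group G]
  [TopologicalSpace G] [IsTopologicalGroup G] {q : ℕ} {I P : Subgroup G} {σ τ : G}
  {ρbar : G →* GL (Fin 2) k} {χ : G →* (WittVector p k)ˣ} {α : k}
  (h : LocalSetup q I P σ τ ρbar χ α)

include h

/-- The equality is read off by reducing an existing lifting with determinant `χ`, the unramified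
one. -/
theorem det_residual (g : G) :
    (ρbar g : Matrix (Fin 2) (Fin 2) k).det = WittVector.constantCoeff (χ g : WittVector p k) := by
  obtain ⟨ρ, -, hρ⟩ := h.exists_isVersal_unramified (D := fun A ρ => liftingsWithDet ρbar χ A ρ ∧
    ρ τ = 1) (fun _ _ => Iff.rfl)
  have h1 := congrArg (powerSeriesCoeff p k Unit).res (hρ.mem.2 g)
  rw [RingHom.map_det, CoeffRing.res_algebraMap] at h1
  rw [← h1, ← hρ.mem.1.res_apply g]
  rfl

theorem isDeformationCondition_liftingsWithDet :
    IsDeformationCondition ρbar (liftingsWithDet (p := p) ρbar χ) := by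
  have h1 := (isDeformationCondition_isLifting (p := p) (ρbar := ρbar)).and_eqns
    (fun (g : G) A ρ => ((ρ g : Matrix (Fin 2) (Fin 2) A).det -
      algebraMap (WittVector p k) A (χ g)) • (1 : Matrix (Fin 2) (Fin 2) A))
    (fun g A B f ρ => by
      rw [det_push, ← f.toAlgHom.commutes, ← map_sub]
      ext i j
      fin_cases i <;> fin_cases j <;> simp)
    (fun g A ρ ρ' he h0 => by rw [he.det_eq, h0])
    (fun g A ρ hρ => by
      have e : A.res ((ρ g : Matrix (Fin 2) (Fin 2) A).det - algebraMap (WittVector p k) A (χ g)) =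
          0 := by
        rw [map_sub, A.res_algebraMap, ← h.det_residual, ← hρ.res_apply g, RingHom.map_det, sub_eq_zero]
        rfl
      ext i j
      rw [Matrix.map_apply, Matrix.smul_apply, smul_eq_mul, map_mul, e, zero_mul, Matrix.zero_apply])
  convert h1 using 3 with A ρ
  refine and_congr Iff.rfl (forall_congr' fun g => ?_)
  rw [← sub_eq_zero]
  refine ⟨fun e => by rw [e, zero_smul], fun e => ?_⟩
  simpa using congrFun (congrFun e 0) 0

omit h in
/-- The liftings with determinant `χ` that are trivial on `τ`. -/
def unramified (_ : LocalSetup q I P σ τ ρbar χ α) : Collection p k G := fun A ρ =>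
  liftingsWithDet ρbar χ A ρ ∧ (ρ τ : Matrix (Fin 2) (Fin 2) A) - 1 = 0

theorem unramified_iff {A : CoeffRing p k} {ρ : G →* GL (Fin 2) A} :
    h.unramified A ρ ↔ liftingsWithDet ρbar χ A ρ ∧ ρ τ = 1 := by
  rw [unramified, sub_eq_zero, ← Units.val_one, Units.ext_iff]

theorem unramified_iff_inertia {A : CoeffRing p k} {ρ : G →* GL (Fin 2) A} :
    h.unramified A ρ ↔ liftingsWithDet ρbar χ A ρ ∧ ∀ i ∈ I, ρ i = 1 := by
  rw [h.unramified_iff]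
  exact ⟨fun h1 => ⟨h1.1, fun i hi => h.tame.lifting_inertia h.inertia h1.1.1 h1.2 hi⟩,
    fun h1 => ⟨h1.1, h1.2 _ h.tame.tau_mem⟩⟩

theorem isDeformationCondition_unramified : IsDeformationCondition ρbar h.unramified := by
  refine h.isDeformationCondition_liftingsWithDet.and_eqn
    (fun A ρ => (ρ τ : Matrix (Fin 2) (Fin 2) A) - 1) (fun A B f ρ => ?_)
    (fun A ρ ρ' he h0 => ?_) (fun A ρ hρ => ?_)
  · rw [Matrix.map_sub _ (map_sub _), Matrix.map_one _ (map_zero _) (map_one _)]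
    rfl
  · obtain ⟨M, N, h1, -, hc⟩ := he.exists_conj
    rw [sub_eq_zero] at *
    rw [hc, h0, mul_one, h1]
  · rw [Matrix.map_sub _ (map_sub _), Matrix.map_one _ (map_zero _) (map_one _), h.res_tau hρ,
      sub_self]

omit h in
/-- The liftings with determinant `χ` for which `σ` has eigenvalues `q e` and `e`, `e` the Teichmüller
lift of `β`, and `τ - 1` maps the `e`-eigenspace to the `q e`-eigenspace. -/
def special (_ : LocalSetup q I P σ τ ρbar χ α) (β : k) : Collection p k G := fun A ρ =>
  ((liftingsWithDet ρbar χ A ρ ∧ ((ρ σ : Matrix (Fin 2) (Fin 2) A).trace - (q + 1) * A.teich β) •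
      (1 : Matrix (Fin 2) (Fin 2) A) = 0) ∧
    ((ρ σ : Matrix (Fin 2) (Fin 2) A) - (q * A.teich β) • (1 : Matrix (Fin 2) (Fin 2) A)) *
      ((ρ τ : Matrix (Fin 2) (Fin 2) A) - 1) = 0) ∧
    ((ρ τ : Matrix (Fin 2) (Fin 2) A) - 1) *
      ((ρ σ : Matrix (Fin 2) (Fin 2) A) - A.teich β • (1 : Matrix (Fin 2) (Fin 2) A)) = 0

omit h in
theorem map_smul_one {A B : CoeffRing p k} (f : CoeffHom A B) (a : A) :
    (a • (1 : Matrix (Fin 2) (Fin 2) A)).map f.toAlgHom =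
      f.toAlgHom a • (1 : Matrix (Fin 2) (Fin 2) B) := by
  ext i j
  fin_cases i <;> fin_cases j <;> simp

omit h in
theorem map_matrix_mul {A B : CoeffRing p k} (f : CoeffHom A B) (X Y : Matrix (Fin 2) (Fin 2) A) :
    (X * Y).map f.toAlgHom = X.map f.toAlgHom * Y.map f.toAlgHom :=
  Matrix.map_mul (f := (f.toAlgHom : A →+* B))

omit h in
theorem conj_sub_smul {A : CoeffRing p k} {M N X : Matrix (Fin 2) (Fin 2) A} (hMN : M * N = 1) (a : A) :
    M * X * N - a • (1 : Matrix (Fin 2) (Fin 2) A) =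
      M * (X - a • (1 : Matrix (Fin 2) (Fin 2) A)) * N := by
  rw [mul_sub, sub_mul, mul_smul_comm, mul_one, smul_mul_assoc, hMN]

omit h in
theorem conj_mul_conj {A : CoeffRing p k} {M N X Y : Matrix (Fin 2) (Fin 2) A} (hNM : N * M = 1) :
    (M * X * N) * (M * Y * N) = M * (X * Y) * N := by
  calc (M * X * N) * (M * Y * N) = M * X * (N * M) * Y * N := by simp only [mul_assoc]
    _ = M * (X * Y) * N := by rw [hNM, mul_one]; simp only [mul_assoc]

/-- The defining equations commute with change of rings and are invariant under conjugation.
Residually those in `τ - 1` are trivial, and the trace equation is the hypothesis on `β`. -/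
theorem isDeformationCondition_special {β : k} (hβ : (q : k) * α + α⁻¹ = (q + 1) * β) :
    IsDeformationCondition ρbar (h.special β) := by
  have hone : ∀ {A : CoeffRing p k} (X : Matrix (Fin 2) (Fin 2) A),
      X - 1 = X - (1 : A) • (1 : Matrix (Fin 2) (Fin 2) A) := fun X => by rw [one_smul]
  have htau : ∀ (A : CoeffRing p k) (ρ : G →* GL (Fin 2) A), IsLifting ρbar A ρ →
      ((ρ τ : Matrix (Fin 2) (Fin 2) A) - 1).map A.res = 0 := fun A ρ hρ => by
    rw [Matrix.map_sub _ (map_sub _), Matrix.map_one _ (map_zero _) (map_one _), h.res_tau hρ,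
      sub_self]
  refine ((h.isDeformationCondition_liftingsWithDet.and_eqn
    (fun A ρ => ((ρ σ : Matrix (Fin 2) (Fin 2) A).trace - (q + 1) * A.teich β) •
      (1 : Matrix (Fin 2) (Fin 2) A)) (fun A B f ρ => ?_)
    (fun A ρ ρ' he h0 => ?_) (fun A ρ hρ => ?_)).and_eqn
    (fun A ρ => ((ρ σ : Matrix (Fin 2) (Fin 2) A) - (q * A.teich β) •
        (1 : Matrix (Fin 2) (Fin 2) A)) * ((ρ τ : Matrix (Fin 2) (Fin 2) A) - 1)) (fun A B f ρ => ?_)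
    (fun A ρ ρ' he h0 => ?_) (fun A ρ hρ => ?_)).and_eqn
    (fun A ρ => ((ρ τ : Matrix (Fin 2) (Fin 2) A) - 1) *
      ((ρ σ : Matrix (Fin 2) (Fin 2) A) - A.teich β • (1 : Matrix (Fin 2) (Fin 2) A)))
    (fun A B f ρ => ?_) (fun A ρ ρ' he h0 => ?_) (fun A ρ hρ => ?_)
  · rw [map_smul_one, map_sub, map_mul, map_add, map_natCast, map_one, f.map_teich]
    congr 2
    simp [Matrix.trace, push_apply]
  · rw [he.trace_eq, h0]
  · have e : A.res ((ρ σ : Matrix (Fin 2) (Fin 2) A).trace - (q + 1) * A.teich β) = 0 := by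
      have h1 := congrArg Matrix.trace (h.res_sigma hρ)
      rw [Matrix.trace_fin_two_of, hβ] at h1
      rw [map_sub, map_mul, map_add, map_natCast, map_one, A.res_teich, ← h1, sub_eq_zero]
      simp [Matrix.trace]
    ext i j
    rw [Matrix.map_apply, Matrix.smul_apply, smul_eq_mul, map_mul, e, zero_mul, Matrix.zero_apply]
  · rw [map_matrix_mul, Matrix.map_sub _ (map_sub _), Matrix.map_sub _ (map_sub _), map_smul_one,
      Matrix.map_one _ (map_zero _) (map_one _), map_mul, map_natCast, f.map_teich]
    rfl
  · obtain ⟨M, N, h1, h2, hc⟩ := he.exists_conj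
    rw [hone] at h0 ⊢
    rw [hc, hc, conj_sub_smul h1, conj_sub_smul h1, conj_mul_conj h2, h0, mul_zero, zero_mul]
  · refine (Matrix.map_mul (f := A.res)).trans ?_
    rw [htau A ρ hρ, mul_zero]
  · rw [map_matrix_mul, Matrix.map_sub _ (map_sub _), Matrix.map_sub _ (map_sub _), map_smul_one,
      Matrix.map_one _ (map_zero _) (map_one _), f.map_teich]
    rfl
  · obtain ⟨M, N, h1, h2, hc⟩ := he.exists_conj
    rw [hone] at h0 ⊢
    rw [hc, hc, conj_sub_smul h1, conj_sub_smul h1, conj_mul_conj h2, h0, mul_zero, zero_mul]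
  · refine (Matrix.map_mul (f := A.res)).trans ?_
    rw [htau A ρ hρ, zero_mul]

theorem special_iff {β : k} {A : CoeffRing p k} {ρ : G →* GL (Fin 2) A} :
    h.special β A ρ ↔ liftingsWithDet ρbar χ A ρ ∧
      (ρ σ : Matrix (Fin 2) (Fin 2) A).trace = (q + 1) * A.teich β ∧
      ((ρ σ : Matrix (Fin 2) (Fin 2) A) - (q * A.teich β) • (1 : Matrix (Fin 2) (Fin 2) A)) *
        ((ρ τ : Matrix (Fin 2) (Fin 2) A) - 1) = 0 ∧
      ((ρ τ : Matrix (Fin 2) (Fin 2) A) - 1) *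
        ((ρ σ : Matrix (Fin 2) (Fin 2) A) - A.teich β • (1 : Matrix (Fin 2) (Fin 2) A)) = 0 := by
  rw [special, and_assoc, and_assoc]
  refine and_congr Iff.rfl (and_congr ?_ Iff.rfl)
  rw [← sub_eq_zero (b := ((q : A) + 1) * A.teich β)]
  refine ⟨fun e => ?_, fun e => by rw [e, zero_smul]⟩
  simpa using congrFun (congrFun e 0) 0

omit h [Finite k] in
theorem teichmuller_neg (hp : p ≠ 2) (α : k) :
    WittVector.teichmuller p (-α) = -WittVector.teichmuller p α := by
  have h1 : (WittVector.teichmuller p (-1 : k)) = -1 := by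
    have h2 : (WittVector.teichmuller p (-1 : k)) * (WittVector.teichmuller p (-1 : k)) = 1 := by
      rw [← map_mul, neg_one_mul, neg_neg, map_one]
    rcases mul_self_eq_one_iff.mp h2 with h3 | h3
    · exfalso
      have h4 := congrArg WittVector.constantCoeff h3
      rw [map_one] at h4
      have h5 : (-1 : k) = 1 := (WittVector.teichmuller_coeff_zero p (-1 : k)).symm.trans h4
      have h6 : ((2 : ℕ) : k) = 0 := by push_cast; linear_combination -h5
      rw [CharP.cast_eq_zero_iff k p] at h6
      exact hp ((Nat.prime_dvd_prime_iff_eq Fact.out Nat.prime_two).mp h6)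
    · exact h3
  rw [neg_eq_neg_one_mul, map_mul, h1, neg_one_mul]

omit h in
theorem teich_neg (A : CoeffRing p k) (hp : p ≠ 2) (α : k) : A.teich (-α) = -A.teich α := by
  rw [CoeffRing.teich, CoeffRing.teich, teichmuller_neg hp, map_neg]

variable {A : CoeffRing p k} {ρ : G →* GL (Fin 2) A} {S w x y z : A}

theorem sigma_entries (hf : h.InForm ρ S w x y z) (hα1 : α ^ 2 = 1) : ∃ b : A,
    (ρ σ : Matrix (Fin 2) (Fin 2) A) = !![q * (A.teich α * (1 + S)), 0; 0, b] ∧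
      A.teich α * (1 + S) * b = 1 ∧ A.res b = α := by
  have hu : A.res (A.teich α * (1 + S)) ≠ 0 := by
    rw [res_unit_part hf.normal.res_S]; exact h.unit
  refine ⟨Ring.inverse (A.teich α * (1 + S)), by rw [hf.sigma, diagMatrix, mul_assoc],
    Ring.mul_inverse_cancel _ (CoeffRing.isUnit_iff.mpr hu), ?_⟩
  rw [CoeffRing.res_inverse hu, res_unit_part hf.normal.res_S]
  exact inv_eq_of_mul_eq_one_left (by rw [← sq, hα1])

theorem q_ne_one (hα1 : α ^ 2 = 1) : (q : k) ≠ 1 := by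
  intro h1
  apply h.ne
  rw [h1, one_mul]
  exact (inv_eq_of_mul_eq_one_left (by rw [← sq, hα1])).symm

theorem special_iff_entries {β : k} {a b : A} (hρ : liftingsWithDet ρbar χ A ρ)
    (hσ : (ρ σ : Matrix (Fin 2) (Fin 2) A) = !![a, 0; 0, b])
    (hτ : (ρ τ : Matrix (Fin 2) (Fin 2) A) = !![w, x; y, z]) :
    h.special β A ρ ↔ a + b = (q + 1) * A.teich β ∧
      (((a - q * A.teich β) * (w - 1) = 0 ∧ (a - q * A.teich β) * x = 0) ∧
        (b - q * A.teich β) * y = 0 ∧ (b - q * A.teich β) * (z - 1) = 0) ∧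
      ((w - 1) * (a - A.teich β) = 0 ∧ x * (b - A.teich β) = 0) ∧
        y * (a - A.teich β) = 0 ∧ (z - 1) * (b - A.teich β) = 0 := by
  have e1 : ∀ c : A, !![a, 0; 0, b] - c • (1 : Matrix (Fin 2) (Fin 2) A) =
      !![a - c, 0; 0, b - c] := fun c => by
    ext i j; fin_cases i <;> fin_cases j <;> simp
  have e2 : !![w, x; y, z] - (1 : Matrix (Fin 2) (Fin 2) A) = !![w - 1, x; y, z - 1] := by
    ext i j; fin_cases i <;> fin_cases j <;> simp
  have e3 : ∀ a b c d : A, !![a, b; c, d] = 0 ↔ (a = 0 ∧ b = 0) ∧ c = 0 ∧ d = 0 := fun a b c d => by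
    rw [← Matrix.ext_iff]
    simp [Fin.forall_fin_two]
  rw [h.special_iff, hσ, hτ, Matrix.trace_fin_two_of, e1, e1, e2, Matrix.mul_fin_two,
    Matrix.mul_fin_two, e3, e3]
  simp only [zero_mul, mul_zero, add_zero, zero_add]
  exact ⟨fun h1 => h1.2, fun h1 => ⟨hρ, h1⟩⟩

/-- The entry `b` has residue `α`, so `b - q α̂` is a unit and forces `y = 0`. Trace and determinant
give `(b - α̂) (b - q α̂) = 0`, hence `b = α̂` and `S = 0`. -/
theorem special_iff_upper (hα1 : α ^ 2 = 1) (hf : h.InForm ρ S w x y z) :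
    h.special α A ρ ↔ S = 0 ∧ y = 0 := by
  have hq1 := h.q_ne_one hα1
  have ht := A.teich_sq hα1
  obtain ⟨b, hσ, hb, hbr⟩ := h.sigma_entries hf hα1
  rw [h.special_iff_entries hf.mem hσ hf.tau]
  have hb2 : A.res (b - q * A.teich α) ≠ 0 := by
    rw [map_sub, hbr, map_mul, map_natCast, A.res_teich]
    intro h0
    refine hq1 (mul_right_cancel₀ h.unit ?_)
    linear_combination -h0
  have hut : IsUnit (A.teich α) := IsUnit.of_mul_eq_one _ (by rw [← sq]; exact ht)
  constructor
  · rintro ⟨h1, ⟨-, h2, -⟩, -⟩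
    have hbe : b = A.teich α := by
      rw [← sub_eq_zero]
      refine CoeffRing.eq_zero_of_mul (y := b - q * A.teich α) ?_ hb2
      linear_combination b * h1 + q * ht - q * hb
    refine ⟨?_, CoeffRing.eq_zero_of_mul (y := b - q * A.teich α) (by rw [mul_comm]; exact h2) hb2⟩
    rw [hbe] at hb
    linear_combination hb - (1 + S) * ht
  · rintro ⟨rfl, rfl⟩
    have hbe : b = A.teich α := hut.mul_left_cancel (by linear_combination hb - ht)
    have hw := hf.normal.w_eq_one h.two_ne_zero hq1 (mul_zero _)
    have hz := (hf.normal.w_eq_z hq1).symm.trans hw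
    subst hw hz hbe
    refine ⟨by ring, ⟨⟨by ring, by ring⟩, by ring, by ring⟩, ⟨by ring, by ring⟩, by ring, by ring⟩

/-- As `q ≡ -1`, it is the first diagonal entry of `σ` that has residue `-α`. The two eigenvalues
exchange their roles, and so do `x` and `y`. -/
theorem special_iff_lower (hα1 : α ^ 2 = 1) (hqm : (q : k) = -1) (hf : h.InForm ρ S w x y z) :
    h.special (-α) A ρ ↔ x = 0 ∧ 1 + q * (1 + S) = 0 := by
  have hq1 := h.q_ne_one hα1
  have ht := A.teich_sq hα1
  obtain ⟨b, hσ, hb, hbr⟩ := h.sigma_entries hf hα1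
  rw [h.special_iff_entries hf.mem hσ hf.tau, teich_neg A h.odd]
  have h2α : (2 : k) * α ≠ 0 := mul_ne_zero h.two_ne_zero h.unit
  have hb2 : A.res (q * (A.teich α * (1 + S)) + q * A.teich α) ≠ 0 := by
    simp only [map_add, map_mul, map_natCast, A.res_teich, map_one, hf.normal.res_S, hqm]
    intro h0
    exact h2α (by linear_combination -h0)
  constructor
  · rintro ⟨h1, ⟨⟨-, h2⟩, -⟩, -⟩
    have hae : q * (A.teich α * (1 + S)) + A.teich α = 0 := by
      refine CoeffRing.eq_zero_of_mul (y := q * (A.teich α * (1 + S)) + q * A.teich α) ?_ hb2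
      linear_combination (q * (A.teich α * (1 + S))) * h1 + q * ht - q * hb
    refine ⟨CoeffRing.eq_zero_of_mul (y := q * (A.teich α * (1 + S)) + q * A.teich α)
      (by linear_combination h2) hb2, ?_⟩
    linear_combination A.teich α * hae - (1 + q * (1 + S)) * ht
  · rintro ⟨rfl, hS⟩
    have hbe : b = -(q * A.teich α) := by
      linear_combination (-(q * A.teich α)) * hb + b * A.teich α ^ 2 * hS - b * ht
    have hw := hf.normal.w_eq_one h.two_ne_zero hq1 (zero_mul _)
    have hz := (hf.normal.w_eq_z hq1).symm.trans hw
    subst hw hz hbe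
    refine ⟨?_, ⟨⟨by ring, by ring⟩, by ring, by ring⟩, ⟨by ring, by ring⟩, ?_, by ring⟩
    · linear_combination A.teich α * hS
    · linear_combination y * A.teich α * hS

theorem slope_upper (hα1 : α ^ 2 = 1) : (q : k) * α + α⁻¹ = (q + 1) * α := by
  rw [inv_eq_of_mul_eq_one_left (by rw [← sq, hα1])]; ring

theorem slope_lower (hα1 : α ^ 2 = 1) (hqm : (q : k) = -1) :
    (q : k) * α + α⁻¹ = (q + 1) * (-α) := by
  rw [inv_eq_of_mul_eq_one_left (by rw [← sq, hα1]), hqm]; ring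

theorem exists_isVersal_special_upper (hα1 : α ^ 2 = 1) :
    ∃ ρ : G →* GL (Fin 2) (powerSeriesCoeff p k Unit), IsVersal (h.special α) _ ρ ∧
      h.InForm ρ 0 1 (varX p k ()) 0 1 := by
  obtain ⟨ρ, hρ⟩ := h.exists_inForm (NormalForm.of_upper h.q_pos hα1
    (S := 0) (x := varX p k ()) (map_zero _) (res_varX _) (zero_mul _))
  refine ⟨ρ, ?_, hρ⟩
  refine h.isVersal_of_inForm (fun A ρ hρ => (h.special_iff.mp hρ).1)
    (h.isDeformationCondition_special (h.slope_upper hα1)).strictEquiv (CoeffHom.id _)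
    Function.surjective_id hρ ((h.special_iff_upper hα1 hρ).mpr ⟨rfl, rfl⟩) (fun f f' _ _ e _ i => e) ?_
  intro A ρ' S' w' x' y' z' hD hf
  obtain ⟨hS, hy⟩ := (h.special_iff_upper hα1 hf).mp hD
  have hw := hf.normal.w_eq_one h.two_ne_zero (h.q_ne_one hα1) (by rw [hy, mul_zero])
  have hz := (hf.normal.w_eq_z (h.q_ne_one hα1)).symm.trans hw
  exact ⟨evalHom A (fun _ => x') (fun i => CoeffRing.mem_maximalIdeal.mpr hf.normal.res_x),
    by rw [map_zero, hS], by rw [map_one, hw], evalHom_X _ _ _ _, by rw [map_zero, hy],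
    by rw [map_one, hz]⟩

theorem exists_isVersal_special_lower (hα1 : α ^ 2 = 1) (hqm : (q : k) = -1) :
    ∃ ρ : G →* GL (Fin 2) (powerSeriesCoeff p k Unit), IsVersal (h.special (-α)) _ ρ ∧
      ∃ S, h.InForm ρ S 1 0 (varX p k ()) 1 := by
  have hqu : ∀ A : CoeffRing p k, A.res (q : A) ≠ 0 := fun A => by
    rw [map_natCast]; exact h.q_ne_zero
  have hinv : ∀ A : CoeffRing p k, (q : A) * Ring.inverse (q : A) = 1 := fun A =>
    Ring.mul_inverse_cancel _ (CoeffRing.isUnit_iff.mpr (hqu A))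
  have hS0 : ∀ A : CoeffRing p k, 1 + (q : A) * (1 + (-Ring.inverse (q : A) - 1)) = 0 := fun A => by
    linear_combination -hinv A
  -- The value of `S` solves `1 + q (1 + S) = 0`; its residue is zero because `q = -1` in `k`.
  obtain ⟨ρ, hρ⟩ := h.exists_inForm (NormalForm.of_symmetric h.two_ne_zero h.q_pos hα1
    (S := -Ring.inverse (q : powerSeriesCoeff p k Unit) - 1) (r := 1) (x := 0) (y := varX p k ())
    (by
      rw [map_sub, map_neg, CoeffRing.res_inverse (hqu _), map_natCast, hqm, map_one, inv_neg_one]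
      ring)
    (map_one _) (map_zero _) (res_varX _) (by ring) (by ring)
    (by
      rw [mul_one, aeval_two_hPoly]
      linear_combination varX p k () *
        (1 - (q : powerSeriesCoeff p k Unit) * (1 + (-Ring.inverse (q : powerSeriesCoeff p k Unit) - 1))) * hS0 _))
  have hmem := (h.special_iff_lower hα1 hqm hρ).mpr ⟨rfl, hS0 _⟩
  refine ⟨ρ, ?_, _, hρ⟩
  refine h.isVersal_of_inForm (fun A ρ hρ => (h.special_iff.mp hρ).1)
    (h.isDeformationCondition_special (h.slope_lower hα1 hqm)).strictEquiv (CoeffHom.id _)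
    Function.surjective_id hρ hmem (fun f f' _ _ _ e i => e) ?_
  intro A ρ' S' w' x' y' z' hD hf
  obtain ⟨hx, hS⟩ := (h.special_iff_lower hα1 hqm hf).mp hD
  have hw := hf.normal.w_eq_one h.two_ne_zero (h.q_ne_one hα1) (by rw [hx, zero_mul])
  have hz := (hf.normal.w_eq_z (h.q_ne_one hα1)).symm.trans hw
  refine ⟨evalHom A (fun _ => y') (fun i => CoeffRing.mem_maximalIdeal.mpr hf.normal.res_y),
    ?_, by rw [map_one, hw], by rw [map_zero, hx], evalHom_X _ _ _ _, by rw [map_one, hz]⟩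
  refine (CoeffRing.isUnit_iff.mpr (hqu A)).mul_left_cancel ?_
  rw [map_sub, map_neg, map_one, CoeffHom.map_inverse _ (hqu _), map_natCast]
  linear_combination hS0 A - hS

end LocalSetup

/-! ### Tangent spaces through matrices over the dual numbers. -/

section DualMatrices

variable {p : ℕ} [Fact p.Prime] {k : Type u} [Field k] [CharP k p] [Finite k]

/-- The matrix `X + ε Y` over the dual numbers. -/
def dualMat (X Y : Matrix (Fin 2) (Fin 2) k) : Matrix (Fin 2) (Fin 2) (dualCoeff p k) :=
  fun i j => dualMk (X i j) (Y i j)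

theorem dualMat_mul (X Y X' Y' : Matrix (Fin 2) (Fin 2) k) :
    dualMat (p := p) X Y * dualMat X' Y' = dualMat (X * X') (X * Y' + Y * X') := by
  ext i j
  rw [Matrix.mul_apply, Fin.sum_univ_two]
  change dualMk _ _ * dualMk _ _ + dualMk _ _ * dualMk _ _ = dualMk _ _
  rw [← dualMk_mul, ← dualMk_mul, ← dualMk_add, Matrix.add_apply, Matrix.mul_apply, Matrix.mul_apply,
    Matrix.mul_apply, Fin.sum_univ_two, Fin.sum_univ_two, Fin.sum_univ_two]
  congr 1
  ring

theorem dualMk_one : dualMk (p := p) (1 : k) 0 = 1 :=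
  dual_ext (fst_dualMk _ _) (snd_dualMk _ _)

theorem dualMat_one : dualMat (p := p) (1 : Matrix (Fin 2) (Fin 2) k) 0 = 1 := by
  ext i j
  change dualMk _ _ = _
  fin_cases i <;> fin_cases j
  · exact dualMk_one
  · exact dualMk_zero
  · exact dualMk_zero
  · exact dualMk_one

theorem dualMat_inj {X Y X' Y' : Matrix (Fin 2) (Fin 2) k}
    (h : dualMat (p := p) X Y = dualMat X' Y') : X = X' ∧ Y = Y' := by
  constructor <;> ext i j
  · exact (dualMk_inj (congrFun (congrFun h i) j)).1
  · exact (dualMk_inj (congrFun (congrFun h i) j)).2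

theorem exists_dualMat (M : Matrix (Fin 2) (Fin 2) (dualCoeff p k)) :
    ∃ Y, M = dualMat (M.map (dualCoeff p k).res) Y := by
  have h1 : ∀ i j, ∃ y, M i j = dualMk ((dualCoeff p k).res (M i j)) y := fun i j => by
    obtain ⟨a, b, hab⟩ := exists_dualMk (M i j)
    exact ⟨b, by rw [hab, res_dualMk]⟩
  choose Y hY using h1
  exact ⟨Y, Matrix.ext hY⟩

variable {G : Type v} [Group G] {ρbar : G →* GL (Fin 2) k}

/-- Conjugation by `1 + ε X` replaces the cocycle `c g` by `c g + X - ρbar g X (ρbar g)⁻¹`. -/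
theorem strictEquiv_iff_coboundary {ρ ρ' : G →* GL (Fin 2) (dualCoeff p k)}
    {c c' : G → Matrix (Fin 2) (Fin 2) k}
    (hc : ∀ g, (ρ g : Matrix (Fin 2) (Fin 2) (dualCoeff p k)) = dualMat (ρbar g) (c g * (ρbar g : Matrix (Fin 2) (Fin 2) k)))
    (hc' : ∀ g, (ρ' g : Matrix (Fin 2) (Fin 2) (dualCoeff p k)) = dualMat (ρbar g) (c' g * (ρbar g : Matrix (Fin 2) (Fin 2) k))) :
    StrictEquiv ρ ρ' ↔ c' - c ∈ coboundaries ρbar := by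
  have hinv : ∀ g, (ρbar g : Matrix (Fin 2) (Fin 2) k) * ((ρbar g)⁻¹ : GL (Fin 2) k) = 1 :=
    fun g => (ρbar g).mul_inv
  have hinv' : ∀ g, (((ρbar g)⁻¹ : GL (Fin 2) k) : Matrix (Fin 2) (Fin 2) k) * ρbar g = 1 :=
    fun g => (ρbar g).inv_mul
  constructor
  · rintro ⟨M, hM, h⟩
    obtain ⟨X, hX⟩ := exists_dualMat (M : Matrix (Fin 2) (Fin 2) (dualCoeff p k))
    have hM1 : (M : Matrix (Fin 2) (Fin 2) (dualCoeff p k)).map (dualCoeff p k).res = 1 :=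
      congrArg Units.val hM
    rw [hM1] at hX
    refine ⟨X, funext fun g => ?_⟩
    have h1 := congrArg Units.val (mul_inv_eq_iff_eq_mul.mp (h g))
    rw [Units.val_mul, Units.val_mul, hX, hc, hc', dualMat_mul, dualMat_mul] at h1
    have h2 := (dualMat_inj h1).2
    rw [one_mul, mul_one] at h2
    change X - (ρbar g : Matrix (Fin 2) (Fin 2) k) * X * ((ρbar g)⁻¹ : GL (Fin 2) k) = c' g - c g
    have h3 := congrArg (· * (((ρbar g)⁻¹ : GL (Fin 2) k) : Matrix (Fin 2) (Fin 2) k)) h2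
    simp only [add_mul, mul_assoc, hinv, mul_one] at h3
    rw [mul_assoc, sub_eq_sub_iff_add_eq_add, add_comm X, h3, add_comm]
  · rintro ⟨X, hX⟩
    have e1 : dualMat (p := p) 1 X * dualMat 1 (-X) = 1 := by
      rw [dualMat_mul, one_mul, one_mul, mul_one, neg_add_cancel, dualMat_one]
    have e2 : dualMat (p := p) 1 (-X) * dualMat 1 X = 1 := by
      rw [dualMat_mul, one_mul, one_mul, mul_one, add_neg_cancel, dualMat_one]
    refine ⟨⟨dualMat 1 X, dualMat 1 (-X), e1, e2⟩, ?_, fun g => ?_⟩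
    · refine Units.ext (Matrix.ext fun i j => ?_)
      exact res_dualMk _ _
    · rw [mul_inv_eq_iff_eq_mul]
      refine Units.ext ?_
      rw [Units.val_mul, Units.val_mul, hc, hc', dualMat_mul, dualMat_mul, one_mul, one_mul, mul_one]
      congr 1
      have h1 : X - (ρbar g : Matrix (Fin 2) (Fin 2) k) * X * ((ρbar g)⁻¹ : GL (Fin 2) k) =
        c' g - c g := congrFun hX g
      have h3 := congrArg (· * (ρbar g : Matrix (Fin 2) (Fin 2) k)) h1
      simp only [sub_mul, mul_assoc, hinv', mul_one] at h3
      rw [sub_eq_sub_iff_add_eq_add] at h3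
      rw [mul_one, add_comm, h3, add_comm]

theorem IsLifting.exists_cocycle [TopologicalSpace G] {ρ : G →* GL (Fin 2) (dualCoeff p k)}
    (h : IsLifting ρbar (dualCoeff p k) ρ) : ∃ c : G → Matrix (Fin 2) (Fin 2) k,
      ∀ g, (ρ g : Matrix (Fin 2) (Fin 2) (dualCoeff p k)) = dualMat (ρbar g) (c g * (ρbar g : Matrix (Fin 2) (Fin 2) k)) := by
  have h1 := fun g => exists_dualMat (ρ g : Matrix (Fin 2) (Fin 2) (dualCoeff p k))
  choose Y hY using h1
  refine ⟨fun g => Y g * (((ρbar g)⁻¹ : GL (Fin 2) k) : Matrix (Fin 2) (Fin 2) k), fun g => ?_⟩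
  have h2 : (ρ g : Matrix (Fin 2) (Fin 2) (dualCoeff p k)).map (dualCoeff p k).res = ρbar g :=
    congrArg Units.val (DFunLike.congr_fun h.2 g)
  rw [hY g, h2, mul_assoc, (ρbar g).inv_mul, mul_one]

theorem mem_tangentCocycles {D : Collection p k G} {c : G → Matrix (Fin 2) (Fin 2) k} :
    c ∈ tangentCocycles ρbar D ↔ ∃ ρ : G →* GL (Fin 2) (dualCoeff p k), D (dualCoeff p k) ρ ∧
      ∀ g, (ρ g : Matrix (Fin 2) (Fin 2) (dualCoeff p k)) = dualMat (ρbar g) (c g * (ρbar g : Matrix (Fin 2) (Fin 2) k)) :=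
  exists_congr fun _ => and_congr Iff.rfl
    ⟨fun h g => Matrix.ext fun i j => h g i j, fun h g i j => congrFun (congrFun (h g) i) j⟩

variable (p) in
/-- The endomorphism `x + ε y ↦ x + ε a y` of the dual numbers. -/
def dualScale (a : k) : CoeffHom (dualCoeff p k) (dualCoeff p k) where
  toAlgHom :=
    { toFun := fun x => dualMk (TrivSqZeroExt.fst (R := k) (M := k) x)
        (a * TrivSqZeroExt.snd (R := k) (M := k) x)
      map_one' := by
        rw [← dualMk_one, fst_dualMk, snd_dualMk, mul_zero]
      map_zero' := by
        rw [← dualMk_zero, fst_dualMk, snd_dualMk, mul_zero]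
      map_mul' := fun x y => by
        obtain ⟨x1, x2, rfl⟩ := exists_dualMk x
        obtain ⟨y1, y2, rfl⟩ := exists_dualMk y
        rw [← dualMk_mul]
        simp only [fst_dualMk, snd_dualMk]
        rw [← dualMk_mul]
        congr 1
        ring
      map_add' := fun x y => by
        obtain ⟨x1, x2, rfl⟩ := exists_dualMk x
        obtain ⟨y1, y2, rfl⟩ := exists_dualMk y
        rw [← dualMk_add]
        simp only [fst_dualMk, snd_dualMk]
        rw [← dualMk_add, mul_add]
      commutes' := fun w => by
        rw [algebraMap_dualCoeff, fst_dualMk, snd_dualMk, mul_zero] }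
  res_comp := fun x => res_dualMk _ _

theorem dualScale_dualMk (a b c : k) :
    (dualScale p a).toAlgHom (dualMk b c) = dualMk b (a * c) := by
  change dualMk _ (a * _) = _
  rw [fst_dualMk, snd_dualMk]

variable [TopologicalSpace G] [IsTopologicalGroup G]

theorem push_dualScale {ρ : G →* GL (Fin 2) (dualCoeff p k)} {c : G → Matrix (Fin 2) (Fin 2) k}
    (hc : ∀ g, (ρ g : Matrix (Fin 2) (Fin 2) (dualCoeff p k)) = dualMat (ρbar g) (c g * (ρbar g : Matrix (Fin 2) (Fin 2) k)))
    (a : k) (g : G) : (push (dualScale p a) ρ g : Matrix (Fin 2) (Fin 2) (dualCoeff p k)) =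
      dualMat (ρbar g) ((a • c) g * (ρbar g : Matrix (Fin 2) (Fin 2) k)) := by
  rw [coe_push, hc]
  ext i j
  rw [Matrix.map_apply]
  refine (dualScale_dualMk _ _ _).trans ?_
  rw [Pi.smul_apply, smul_mul_assoc]
  rfl

/-- The morphisms from `W[[X]]` to the dual numbers are `X ↦ a ε`. The one with `a = 1` gives a
cocycle `c`, the others its multiples, because they differ by a scaling of `ε`. The class of `c` is
nonzero since `a = 0` and `a = 1` induce liftings that are not strictly equivalent. -/
theorem finrank_tangentSpace_eq_one {D : Collection p k G} (hD : D.PushClosed)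
    (hlift : ∀ A ρ, D A ρ → IsLifting ρbar A ρ)
    {ρ : G →* GL (Fin 2) (powerSeriesCoeff p k Unit)} (hρ : IsVersal D _ ρ) :
    Module.finrank k (tangentSpace ρbar D) = 1 := by
  have hm : ∀ a : k, ∀ _ : Unit, dualMk (p := p) 0 a ∈ maximalIdeal (dualCoeff p k) := fun a _ =>
    CoeffRing.mem_maximalIdeal.mpr (res_dualMk _ _)
  set f : k → CoeffHom (powerSeriesCoeff p k Unit) (dualCoeff p k) :=
    fun a => evalHom _ (fun _ => dualMk 0 a) (hm a) with hf
  have hfX : ∀ a, (f a).toAlgHom (varX p k ()) = dualMk 0 a := fun a => evalHom_X _ _ _ _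
  have hsc : ∀ a, f a = (dualScale p a).comp (f 1) := fun a => powerSeriesCoeff_hom_ext fun i => by
    rw [hfX, CoeffHom.comp_apply, hfX, dualScale_dualMk, mul_one]
  obtain ⟨c, hc⟩ := (hlift _ _ (hD _ _ (f 1) _ hρ.mem)).exists_cocycle
  have hca : ∀ a g, (push (f a) ρ g : Matrix (Fin 2) (Fin 2) (dualCoeff p k)) =
      dualMat (ρbar g) ((a • c) g * (ρbar g : Matrix (Fin 2) (Fin 2) k)) := fun a g => by
    rw [hsc, push_comp]
    exact push_dualScale hc a g
  have hspan : tangentSpace ρbar D = Submodule.span k {(coboundaries ρbar).mkQ c} := by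
    refine le_antisymm (Submodule.span_le.mpr ?_) (Submodule.span_mono ?_)
    · rintro _ ⟨c', hc', rfl⟩
      obtain ⟨ρ', hρ', hcc⟩ := mem_tangentCocycles.mp hc'
      obtain ⟨g, hg⟩ := hρ.exists_hom _ _ hρ'
      obtain ⟨a0, a, ha⟩ := exists_dualMk (g.toAlgHom (varX p k ()))
      have ha0 : a0 = 0 := by
        rw [← res_dualMk (p := p) a0 a, ← ha, g.res_comp, res_varX]
      have hga : g = f a := powerSeriesCoeff_hom_ext fun i => by
        refine ha.trans ?_
        rw [ha0]
        exact (hfX a).symm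
      rw [hga] at hg
      have h1 := (strictEquiv_iff_coboundary (hca a) hcc).mp hg
      rw [← Submodule.ker_mkQ (coboundaries ρbar), LinearMap.mem_ker, map_sub, sub_eq_zero] at h1
      rw [h1, map_smul]
      exact Submodule.smul_mem _ _ (Submodule.mem_span_singleton_self _)
    · rintro _ rfl
      exact ⟨c, mem_tangentCocycles.mpr ⟨_, hD _ _ (f 1) _ hρ.mem, hc⟩, rfl⟩
  rw [hspan]
  refine finrank_span_singleton fun h0 => ?_
  rw [← LinearMap.mem_ker, Submodule.ker_mkQ] at h0
  have h1 : StrictEquiv (push (f 0) ρ) (push (f 1) ρ) := by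
    refine (strictEquiv_iff_coboundary (hca 0) hc).mpr ?_
    rw [zero_smul, sub_zero]
    exact h0
  have h2 := hρ.unique _ (hD _ _ (f 1) _ hρ.mem) _ _ h1 (StrictEquiv.refl _)
  have h3 := congrArg (fun g => g.toAlgHom (varX p k ())) h2
  simp only [hfX] at h3
  exact zero_ne_one (dualMk_inj h3).2

/-- The reduction map to the residue field, followed by the inclusion in the dual numbers. -/
theorem exists_constHom (R : CoeffRing p k) : ∃ f : CoeffHom R (dualCoeff p k),
    ∀ x, f.toAlgHom x = dualMk (R.res x) 0 := by
  refine ⟨⟨⟨⟨⟨⟨fun x => dualMk (R.res x) 0, ?_⟩, ?_⟩, ?_, ?_⟩, ?_⟩, ?_⟩, fun x => rfl⟩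
  · rw [map_one, dualMk_one]
  · intro x y
    change dualMk (R.res (x * y)) 0 = dualMk (R.res x) 0 * dualMk (R.res y) 0
    rw [map_mul, ← dualMk_mul, mul_zero, mul_zero, add_zero]
  · change dualMk (R.res 0) 0 = 0
    rw [map_zero, dualMk_zero]
  · intro x y
    change dualMk (R.res (x + y)) 0 = dualMk (R.res x) 0 + dualMk (R.res y) 0
    rw [map_add, ← dualMk_add, add_zero]
  · intro w
    change dualMk (R.res _) 0 = _
    rw [algebraMap_dualCoeff, R.res_algebraMap]
  · intro x
    exact res_dualMk _ _

/-- The only morphism to the dual numbers is the constant one, and it induces the zero cocycle. -/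
theorem tangentSpace_eq_bot {D : Collection p k G} (hlift : ∀ A ρ, D A ρ → IsLifting ρbar A ρ)
    {R : CoeffRing p k} {ρ : G →* GL (Fin 2) R} (hρ : IsVersal D R ρ)
    (hR : ∀ f f' : CoeffHom R (dualCoeff p k), f = f') : tangentSpace ρbar D = ⊥ := by
  rw [tangentSpace, Submodule.span_eq_bot]
  rintro _ ⟨c, hc, rfl⟩
  obtain ⟨ρ', hρ', hcc⟩ := mem_tangentCocycles.mp hc
  obtain ⟨g, hg⟩ := hρ.exists_hom _ _ hρ'
  obtain ⟨f, hf⟩ := exists_constHom R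
  rw [hR g f] at hg
  have h0 : ∀ g, (push f ρ g : Matrix (Fin 2) (Fin 2) (dualCoeff p k)) =
      dualMat (ρbar g) ((0 : G → Matrix (Fin 2) (Fin 2) k) g * (ρbar g : Matrix (Fin 2) (Fin 2) k)) := fun g => by
    rw [coe_push, Pi.zero_apply, zero_mul, ← (hlift _ _ hρ.mem).res_apply g]
    ext i j
    exact hf _
  have h1 := (strictEquiv_iff_coboundary h0 hcc).mp hg
  rw [sub_zero] at h1
  rwa [← LinearMap.mem_ker, Submodule.ker_mkQ]

end DualMatrices

namespace LocalSetup

variable {p : ℕ} [Fact p.Prime] {k : Type u} [Field k] [CharP k p] [Finite k] {G : Type v} [Group G]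
  [TopologicalSpace G] [IsTopologicalGroup G] {q : ℕ} {I P : Subgroup G} {σ τ : G}
  {ρbar : G →* GL (Fin 2) k} {χ : G →* (WittVector p k)ˣ} {α : k}
  (h : LocalSetup q I P σ τ ρbar χ α)

include h

theorem residual_mem_zpowers (g : G) : ∃ a : ℕ, ρbar g = ρbar σ ^ a := by
  obtain ⟨a, j, hg⟩ := h.tame.generation ρbar.ker inferInstance h.isOpen_ker
    (fun i hi => ⟨0, by rw [MonoidHom.mem_ker, pow_zero, pow_one]; exact h.inertia i hi⟩) g
  refine ⟨a, ?_⟩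
  rw [MonoidHom.mem_ker, map_mul, map_inv, inv_mul_eq_one, map_mul, map_zpow, map_pow,
    h.inertia τ h.tame.tau_mem, one_zpow, mul_one] at hg
  exact hg.symm

theorem residual_diagonal (g : G) : (ρbar g) 0 1 = 0 ∧ (ρbar g) 1 0 = 0 := by
  obtain ⟨a, ha⟩ := h.residual_mem_zpowers g
  rw [ha]
  have e : ∀ a b : k, !![a, 0; 0, b] = Matrix.diagonal ![a, b] := fun a b => by
    ext i j; fin_cases i <;> fin_cases j <;> simp
  rw [Units.val_pow_eq_pow_val, h.frob, e, Matrix.diagonal_pow]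
  exact ⟨Matrix.diagonal_apply_ne _ (by decide), Matrix.diagonal_apply_ne _ (by decide)⟩

/-- The image of `ρbar` consists of powers of a diagonal matrix with distinct eigenvalues, whose
commutant is the diagonal matrices; trace zero leaves a line. -/
theorem finrank_adZeroInvariants : Module.finrank k (adZeroInvariants ρbar) = 1 := by
  have hspan : adZeroInvariants ρbar = Submodule.span k {!![(1 : k), 0; 0, -1]} := by
    refine le_antisymm ?_ ?_
    · rintro X ⟨hX, hc⟩
      have h1 := hc σ
      rw [h.frob] at h1
      obtain ⟨x, y, z, w, rfl⟩ : ∃ x y z w, X = !![x, y; z, w] := ⟨_, _, _, _, Matrix.eta_fin_two X⟩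
      rw [Matrix.trace_fin_two_of] at hX
      rw [Matrix.mul_fin_two, Matrix.mul_fin_two] at h1
      have h01 : (q : k) * α * y + 0 * w = x * 0 + y * α⁻¹ := congrFun (congrFun h1 0) 1
      have h10 : 0 * x + α⁻¹ * z = z * ((q : k) * α) + w * 0 := congrFun (congrFun h1 1) 0
      have hy : y = 0 := by
        refine (mul_eq_zero.mp (?_ : ((q : k) * α - α⁻¹) * y = 0)).resolve_left
          (sub_ne_zero.mpr h.ne)
        linear_combination h01
      have hz : z = 0 := by
        refine (mul_eq_zero.mp (?_ : ((q : k) * α - α⁻¹) * z = 0)).resolve_left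
          (sub_ne_zero.mpr h.ne)
        linear_combination -h10
      refine Submodule.mem_span_singleton.mpr ⟨x, ?_⟩
      have hw : w = -x := by linear_combination hX
      rw [hy, hz, hw]
      ext i j
      fin_cases i <;> fin_cases j <;> simp
    · rw [Submodule.span_singleton_le_iff_mem]
      refine ⟨by simp [Matrix.trace_fin_two_of], fun g => ?_⟩
      obtain ⟨h1, h2⟩ := h.residual_diagonal g
      have h1' : (ρbar g : Matrix (Fin 2) (Fin 2) k) 0 1 = 0 := h1
      have h2' : (ρbar g : Matrix (Fin 2) (Fin 2) k) 1 0 = 0 := h2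
      ext i j
      fin_cases i <;> fin_cases j <;> simp [Matrix.mul_apply, Fin.sum_univ_two, h1', h2']
  rw [hspan]
  refine finrank_span_singleton fun h0 => ?_
  exact one_ne_zero (congrFun (congrFun h0 0) 0)

end LocalSetup

/-! ### Matrices of finite order that reduce to the identity. -/

section Torsion

variable {p : ℕ} [Fact p.Prime] {k : Type u} [Field k] [CharP k p] [Finite k]

theorem one_add_smul_pow {R : Type*} [CommRing R] (c : R) (X : Matrix (Fin 2) (Fin 2) R) (i : ℕ) :
    ∃ Z, (1 + c • X) ^ i = 1 + (i * c) • X + (c * c) • Z := by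
  induction i with
  | zero => exact ⟨0, by simp⟩
  | succ i ih =>
    obtain ⟨Z, hZ⟩ := ih
    refine ⟨Z + (i : R) • (X * X) + c • (Z * X), ?_⟩
    rw [pow_succ, hZ]
    simp only [add_mul, mul_add, one_mul, mul_one, smul_mul_assoc, mul_smul_comm, smul_add, smul_smul]
    push_cast
    module

/-- Modulo `p ^ 2` the sum is `p + (p (p - 1) / 2) p X`, and for odd `p` the binomial coefficient is
divisible by `p`. For `p = 2` this fails, as `-1` shows. -/
theorem exists_sum_pow_eq (hp : p ≠ 2) {R : Type*} [CommRing R] (X : Matrix (Fin 2) (Fin 2) R) :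
    ∃ Y, ∑ i ∈ Finset.range p, (1 + (p : R) • X) ^ i = (p : R) • (1 + (p : R) • Y) := by
  choose Z hZ using one_add_smul_pow (p : R) X
  obtain ⟨m, hm⟩ := (Fact.out : p.Prime).odd_of_ne_two hp
  have h1 : ∑ i ∈ Finset.range p, i = p * m := by
    rw [Finset.sum_range_id]
    have h2 : p * (p - 1) = p * m * 2 := by
      rw [hm, Nat.add_sub_cancel]; ring
    rw [h2, Nat.mul_div_cancel _ two_pos]
  refine ⟨(m : R) • X + ∑ i ∈ Finset.range p, Z i, ?_⟩
  have h2 : ∑ i ∈ Finset.range p, ((i : R) * p) • X = ((p : R) * m * p) • X := by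
    rw [← Finset.sum_smul, ← Finset.sum_mul, ← Nat.cast_sum, h1, Nat.cast_mul]
  rw [Finset.sum_congr rfl (fun i _ => hZ i), Finset.sum_add_distrib, Finset.sum_add_distrib, h2,
    ← Finset.smul_sum, Finset.sum_const, Finset.card_range, ← Nat.cast_smul_eq_nsmul R]
  module

/-- A matrix over a domain of power series type that reduces to the identity and has finite order is
the identity. -/
theorem eq_one_of_pow_eq_one (hp : p ≠ 2) {R : CoeffRing p k} [IsDomain R] (ψ : R →+* WittVector p k)
    (hψ : ∀ a, WittVector.constantCoeff (ψ a) = R.res a) {N : ℕ} (hN : N ≠ 0)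
    {t : Matrix (Fin 2) (Fin 2) R} (ht : t.map R.res = 1) (h : t ^ N = 1) : t = 1 := by
  -- The matrix `t ^ N` has order dividing a prime `l`, so only prime exponents matter.
  induction N using induction_on_primes generalizing t with
  | zero => exact absurd rfl hN
  | one => rwa [pow_one] at h
  | prime_mul l N hl ih =>
    have hN0 : N ≠ 0 := fun h0 => hN (by rw [h0, mul_zero])
    refine ih hN0 ht ?_
    have hmap : ∀ (X : Matrix (Fin 2) (Fin 2) R) (i : ℕ), (X ^ i).map R.res = X.map R.res ^ i :=
      fun X i => map_pow (R.res.mapMatrix) X i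
    have ht' : (t ^ N).map R.res = 1 := by rw [hmap, ht, one_pow]
    rw [mul_comm, pow_mul] at h
    generalize t ^ N = t at ht' h
    have h1 := mul_geom_sum t l
    rw [h, sub_self] at h1
    set g := ∑ i ∈ Finset.range l, t ^ i with hg
    -- The determinant is tested at the point `ψ`. For `l = p` the geometric sum becomes `p (1 + p
    -- Y)`; for `l ≠ p` it reduces to the scalar `l`, nonzero in `k`. Since `(t - 1) g = 0`,
    -- multiplication by the adjugate then gives `t = 1`.
    have hdet : g.det ≠ 0 := by
      intro h0
      have h2 : (ψ.mapMatrix g).det = 0 := by rw [← RingHom.map_det, h0, map_zero]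
      rw [hg, map_sum] at h2
      simp only [map_pow] at h2
      have h3 : ∀ i j, (ψ.mapMatrix t - 1) i j ∈ Ideal.span {(p : WittVector p k)} := fun i j => by
        rw [← maximalIdeal_wittVector, maximalIdeal_wittVector, ← WittVector.ker_constantCoeff,
          RingHom.mem_ker, Matrix.sub_apply, map_sub, RingHom.mapMatrix_apply, Matrix.map_apply, hψ]
        have h4 := congrFun (congrFun ht' i) j
        rw [Matrix.map_apply] at h4
        rw [h4]
        fin_cases i <;> fin_cases j <;> simp
      choose X hX using fun i j => Ideal.mem_span_singleton'.mp (h3 i j)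
      have h4 : ψ.mapMatrix t = 1 + (p : WittVector p k) • (Matrix.of X) := by
        ext i j
        have := hX i j
        rw [Matrix.sub_apply] at this
        rw [Matrix.add_apply, Matrix.smul_apply, smul_eq_mul, Matrix.of_apply, mul_comm, this,
          add_sub_cancel]
      have hunit : ∀ (Z : Matrix (Fin 2) (Fin 2) (WittVector p k)),
          Z.map WittVector.constantCoeff = 1 → Z.det ≠ 0 := fun Z hZ h5 => by
        have h6 := congrArg WittVector.constantCoeff h5
        rw [RingHom.map_det, RingHom.mapMatrix_apply, hZ, Matrix.det_one, map_zero] at h6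
        exact one_ne_zero h6
      by_cases hlp : l = p
      · subst hlp
        obtain ⟨Y, hY⟩ := exists_sum_pow_eq hp (Matrix.of X)
        rw [h4, hY, Matrix.det_smul] at h2
        rcases mul_eq_zero.mp h2 with h5 | h5
        · exact WittVector.p_nonzero l k (pow_eq_zero_iff (by simp) |>.mp h5)
        · refine hunit _ ?_ h5
          ext i j
          rw [Matrix.map_apply, Matrix.add_apply, Matrix.smul_apply, smul_eq_mul, map_add, map_mul,
            map_natCast, CharP.cast_eq_zero, zero_mul, add_zero, Matrix.one_apply, Matrix.one_apply]
          split_ifs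
          · exact map_one _
          · exact map_zero _
      · have h5 := congrArg WittVector.constantCoeff h2
        rw [RingHom.map_det, map_sum, map_zero] at h5
        have h6 : (WittVector.constantCoeff (p := p) (R := k)).mapMatrix (ψ.mapMatrix t) = 1 := by
          rw [← ht']
          ext i j
          exact hψ _
        simp only [map_pow, h6, one_pow, Finset.sum_const, Finset.card_range] at h5
        rw [← Nat.cast_smul_eq_nsmul k, Matrix.det_smul, Matrix.det_one, mul_one] at h5
        have h7 := (pow_eq_zero_iff (by simp)).mp h5
        rw [CharP.cast_eq_zero_iff k p] at h7
        exact hlp ((Nat.prime_dvd_prime_iff_eq Fact.out hl).mp h7).symm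
    have h2 : (t - 1) * (g * g.adjugate) = 0 := by rw [← mul_assoc, h1, zero_mul]
    rw [Matrix.mul_adjugate, mul_smul_comm, mul_one] at h2
    exact sub_eq_zero.mp ((smul_eq_zero.mp h2).resolve_left hdet)

end Torsion

/-! ### Conditions with power series rings as versal rings. -/

section PowerSeriesRings

variable {p : ℕ} [Fact p.Prime] {k : Type u} [Field k] [CharP k p] [Finite k]

theorem exists_hom_of_algEquiv {R : CoeffRing p k} {n : ℕ}
    (e : R ≃ₐ[WittVector p k] MvPowerSeries (Fin n) (WittVector p k)) :
    ∃ j : CoeffHom (powerSeriesCoeff p k (Fin n)) R, ∀ x, j.toAlgHom (e x) = x := by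
  refine ⟨CoeffHom.ofMem (A := powerSeriesCoeff p k (Fin n))
    (show powerSeriesCoeff p k (Fin n) →ₐ[WittVector p k] R from e.symm.toAlgHom)
    fun x hx => ?_, fun x => e.symm_apply_apply x⟩
  rw [IsLocalRing.mem_maximalIdeal, mem_nonunits_iff] at *
  intro hu
  refine hx ?_
  have := hu.map e
  have h1 : e (e.symm x) = x := e.apply_symm_apply x
  exact (congrArg IsUnit h1).mp this

theorem varX_ne_zero {ι : Type} [Finite ι] (i : ι) : varX p k i ≠ 0 := fun h0 => by
  have h1 := congrArg (MvPowerSeries.coeff (R := WittVector p k) (Finsupp.single i 1)) h0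
  exact one_ne_zero ((MvPowerSeries.coeff_index_single_self_X i).symm.trans (h1.trans (map_zero _)))

theorem exists_surjective_unit (n : ℕ) :
    ∃ π : CoeffHom (powerSeriesCoeff p k (Fin (n + 1))) (powerSeriesCoeff p k Unit),
      Function.Surjective π.toAlgHom := by
  have hm : ∀ i : Fin (n + 1), (if i = 0 then varX p k () else 0) ∈
      maximalIdeal (powerSeriesCoeff p k Unit) := fun i => by
    split_ifs
    · exact varX_mem ()
    · exact Ideal.zero_mem _
  set π := evalHom (powerSeriesCoeff p k Unit) _ hm with hπ
  set s := evalHom (powerSeriesCoeff p k (Fin (n + 1))) (fun _ : Unit => varX p k 0)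
    (fun _ => varX_mem 0) with hs
  have h1 : π.comp s = CoeffHom.id _ := powerSeriesCoeff_hom_ext fun i => by
    rw [CoeffHom.comp_apply, hs, evalHom_X, hπ, evalHom_X, if_pos rfl]
    rfl
  refine ⟨π, fun x => ⟨s.toAlgHom x, ?_⟩⟩
  rw [← CoeffHom.comp_apply, h1]
  rfl

variable {G : Type v} [Group G]

theorem isSmooth_of_isVersal_unit [TopologicalSpace G] {D : Collection p k G}
    {ρ : G →* GL (Fin 2) (powerSeriesCoeff p k Unit)} (hρ : IsVersal D _ ρ) : IsSmooth D :=
  ⟨_, ρ, hρ, 1, ⟨MvPowerSeries.renameEquiv (R := WittVector p k) (Equiv.ofUnique Unit (Fin 1))⟩⟩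

/-- A condition with versal ring a power series ring in at least one variable coincides with any
condition with versal ring a power series ring in one variable that contains its versal member. -/
theorem eq_of_mem_of_isVersal_unit [TopologicalSpace G] {D D' : Collection p k G} (hD : D.PushClosed)
    (hDs : ∀ (A : CoeffRing p k) (ρ ρ' : G →* GL (Fin 2) A), StrictEquiv ρ ρ' → D A ρ → D A ρ')
    (hD' : D'.PushClosed)
    (hDs' : ∀ (A : CoeffRing p k) (ρ ρ' : G →* GL (Fin 2) A), StrictEquiv ρ ρ' → D' A ρ → D' A ρ')
    {R : CoeffRing p k} {ρ : G →* GL (Fin 2) R} (hρ : IsVersal D R ρ) {n : ℕ}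
    (e : R ≃ₐ[WittVector p k] MvPowerSeries (Fin (n + 1)) (WittVector p k))
    {ρ' : G →* GL (Fin 2) (powerSeriesCoeff p k Unit)} (hρ' : IsVersal D' _ ρ') (hmem : D' R ρ) :
    D = D' := by
  obtain ⟨g, hg⟩ := hρ'.exists_hom _ _ hmem
  obtain ⟨π, hπ⟩ := exists_surjective_unit (p := p) (k := k) n
  -- Versality of `ρ` makes `g` surjective from the ring in one variable, and setting all but one
  -- variable to zero gives a surjection back.
  have hb := hρ.bijective hD g hg
    ((π.toAlgHom : powerSeriesCoeff p k (Fin (n + 1)) →+* powerSeriesCoeff p k Unit).comp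
      (show R →+* powerSeriesCoeff p k (Fin (n + 1)) from
        (e : R →+* MvPowerSeries (Fin (n + 1)) (WittVector p k)))) (hπ.comp e.surjective)
  funext A ρA
  refine propext ⟨fun hA => ?_, fun hA => ?_⟩
  · obtain ⟨f, hf⟩ := hρ.exists_hom _ _ hA
    exact hDs' _ _ _ hf (hD' _ _ f _ hmem)
  · obtain ⟨f, hf⟩ := hρ'.exists_hom _ _ hA
    refine hDs _ _ _ ?_ (hD _ _ (f.comp (g.inverse hb)) _ hρ.mem)
    refine (hg.symm.push _).trans ?_
    rw [← push_comp]
    have e1 : (f.comp (g.inverse hb)).comp g = f := CoeffHom.ext_apply fun x => by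
      rw [CoeffHom.comp_apply, CoeffHom.comp_apply, g.inverse_apply]
    rw [e1]
    exact hf

end PowerSeriesRings

/-! ### Classification of the substantial conditions. -/

namespace LocalSetup

variable {p : ℕ} [Fact p.Prime] {k : Type u} [Field k] [CharP k p] [Finite k] {G : Type v} [Group G]
  [TopologicalSpace G] [IsTopologicalGroup G] {q : ℕ} {I P : Subgroup G} {σ τ : G}
  {ρbar : G →* GL (Fin 2) k} {χ : G →* (WittVector p k)ˣ} {α : k}
  (h : LocalSetup q I P σ τ ρbar χ α)

include h

section Domain

variable {R : CoeffRing p k} [IsDomain R] (ψ : R →+* WittVector p k)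
  (hψ : ∀ a, WittVector.constantCoeff (ψ a) = R.res a) {ρ : G →* GL (Fin 2) R} {S w x y z : R}

omit [IsDomain R] in
theorem unramified_of_inForm (hf : h.InForm ρ S w x y z) (hw : w = 1) (hx : x = 0) (hy : y = 0) :
    h.unramified R ρ := by
  have hd := hf.normal.det
  rw [hw, hx, one_mul, zero_mul, sub_zero] at hd
  refine h.unramified_iff.mpr ⟨hf.mem, Units.ext ?_⟩
  rw [hf.tau, hw, hx, hy, hd, Units.val_one, Matrix.one_fin_two]

include hψ

/-- The remaining entry satisfies `w ^ (q - 1) = 1`, and the torsion lemma applies to the scalar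
matrix `w`. -/
theorem unramified_of_isDomain (hq : 1 < q) (hf : h.InForm ρ S w x y z) (hx : x = 0) (hy : y = 0) :
    h.unramified R ρ := by
  refine h.unramified_of_inForm hf ?_ hx hy
  have h1 := hf.normal.diag_pow h.q_pos h.q_ne_zero h.unit hx hy
  have hu : IsUnit w := CoeffRing.isUnit_iff.mpr (by rw [hf.normal.res_w]; exact one_ne_zero)
  have h2 : w ^ (q - 1) = 1 := hu.mul_left_cancel (by
    rw [← pow_succ', Nat.sub_add_cancel h.q_pos, h1, mul_one])
  have h3 := eq_one_of_pow_eq_one h.odd ψ hψ (N := q - 1) (by omega)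
    (t := Matrix.scalar (Fin 2) w) (by
      ext i j
      fin_cases i <;> fin_cases j <;> simp [hf.normal.res_w]) (by rw [← map_pow, h2, map_one])
  have := congrFun (congrFun h3 0) 0
  simpa using this

/-- Each equation is a product equal to zero and the ring is a domain. If `y = 0`, then `w = z = 1`
and `S x = 0`: one of the first two cases. If `y ≠ 0`, then its cofactor vanishes, so `q ^ 2 = 1` in
`k` and `q ≡ -1`. With `x = 0` the cofactor is `(1 + q (1 + S)) (1 - q (1 + S))`, whose second
factor is a unit. With `x ≠ 0` both cofactors vanish, and torsion excludes this. -/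
theorem mem_of_isDomain (hq : 1 < q) (hf : h.InForm ρ S w x y z) (hα : α ^ 2 = 1) :
    h.unramified R ρ ∨ h.special α R ρ ∨ ((q : k) = -1 ∧ h.special (-α) R ρ) := by
  have hq1 := h.q_ne_one hα
  have hwz := hf.normal.w_eq_z hq1
  have ht := R.teich_sq hα
  by_cases hy : y = 0
  · have hw := hf.normal.w_eq_one h.two_ne_zero hq1 (by rw [hy, mul_zero])
    rcases mul_eq_zero.mp (hf.normal.x_mul_S h.two_ne_zero h.q_ne_zero hα hw (hwz.symm.trans hw))
      with hS | hx
    · exact Or.inr (Or.inl ((h.special_iff_upper hα hf).mpr ⟨hS, hy⟩))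
    · exact Or.inl (h.unramified_of_inForm hf hw hx hy)
  · refine Or.inr (Or.inr ?_)
    have hq2 : (q : k) ^ 2 = 1 := by
      by_contra hne
      exact hy (hf.normal.y_eq_zero (by rw [hα, mul_one]; exact hne))
    have hqm : (q : k) = -1 := (mul_self_eq_one_iff.mp ((sq _).symm.trans hq2)).resolve_left hq1
    refine ⟨hqm, ?_⟩
    have hHr := hf.normal.res_H
    set H := Polynomial.aeval (w + z) (hPoly q) with hH
    have hry := (mul_eq_zero.mp hf.normal.rel_y).resolve_left hy
    rw [← hH] at hry
    by_cases hx : x = 0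
    · refine (h.special_iff_lower hα hqm hf).mpr ⟨hx, ?_⟩
      have hw := hf.normal.w_eq_one h.two_ne_zero hq1 (by rw [hx, zero_mul])
      have hHq : H = q := by
        rw [hH, ← hwz, hw, one_add_one_eq_two, aeval_two_hPoly]
      refine CoeffRing.eq_zero_of_mul (y := 1 - q * (1 + S)) ?_ ?_
      · rw [hHq] at hry
        linear_combination hry + (q ^ 2 * (1 + S) ^ 2) * ht
      · simp only [map_sub, map_one, map_mul, map_natCast, map_add, hf.normal.res_S, hqm]
        intro h0
        exact h.two_ne_zero (by linear_combination h0)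
    · exfalso
      have hrx := (mul_eq_zero.mp hf.normal.rel_x).resolve_left hx
      rw [← hH] at hrx
      -- The two cofactors give `H = q ν ^ 2` and `q ν ^ 2 H = 1` with `ν = α̂ (1 + S)`, so `H ^ 2 =
      -- 1`, and the residue of `H` is `q = -1`.
      have hH1 : H = -1 := CoeffRing.eq_of_sq_eq h.two_ne_zero
        (by linear_combination -hry - H * hrx) (by rw [hHr, map_neg, map_one, hqm])
        (by rw [map_neg, map_one]; exact neg_ne_zero.mpr one_ne_zero)
      have hrw := hf.normal.rel_w
      rw [← hH, hH1] at hrw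
      have hdet : (!![w, x; y, z] : Matrix (Fin 2) (Fin 2) R).det = 1 := by
        rw [Matrix.det_fin_two_of]; exact hf.normal.det
      have htr : (!![w, x; y, z] : Matrix (Fin 2) (Fin 2) R).trace = w + z := by
        rw [Matrix.trace_fin_two_of]
      have hpow := pow_succ_eq_hPoly hdet (q - 1)
      rw [htr, Nat.sub_add_cancel h.q_pos, ← hH, hH1, ← hrw] at hpow
      -- With `H = -1` and `H' = -2 w` the `q`-th power is `2 w - t`, which is the inverse of `t`
      -- because its trace is `2 w` and its determinant one.
      have hone : (!![w, x; y, z] : Matrix (Fin 2) (Fin 2) R) ^ (q + 1) = 1 := by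
        have hd := hf.normal.det
        rw [← hwz] at hd
        rw [pow_succ, hpow, ← hwz]
        ext i j
        fin_cases i <;> fin_cases j <;> simp [Matrix.mul_apply, Fin.sum_univ_two]
        · linear_combination hd
        · ring
        · ring
        · linear_combination hd
      have h1 := eq_one_of_pow_eq_one h.odd ψ hψ (N := q + 1) (by omega) (by
        rw [← hf.tau]; exact h.res_tau hf.mem.1) hone
      exact hx (congrFun (congrFun h1 0) 1)

end Domain

section Substantial

variable {D : Collection p k G}

/-- A positive tangent dimension excludes a versal ring without variables. Otherwise the versal ring
is a domain whose constant term map is a point in `W`, so the versal member lies in one of the known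
conditions, each with a versal ring in one variable, and equality follows. -/
theorem eq_of_isSmooth (hq : 1 < q) (hcase : α ^ 2 = 1 ∨ (q : k) ^ 2 * α ^ 2 ≠ 1)
    (hdet : HasDet χ D) (hD : IsDeformationCondition ρbar D) (hs : IsSmooth D)
    (hdim : 0 < Module.finrank k (tangentSpace ρbar D)) :
    D = h.unramified ∨ (α ^ 2 = 1 ∧ D = h.special α) ∨
      (α ^ 2 = 1 ∧ (q : k) = -1 ∧ D = h.special (-α)) := by
  obtain ⟨R, ρ, hρ, n, ⟨e⟩⟩ := hs
  obtain ⟨j, hj⟩ := exists_hom_of_algEquiv e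
  rcases n with _ | n
  · rw [tangentSpace_eq_bot hD.isLifting hρ, finrank_bot] at hdim
    · exact absurd hdim (lt_irrefl _)
    · intro f f'
      have h1 : f.comp j = f'.comp j := powerSeriesCoeff_hom_ext fun i => i.elim0
      refine CoeffHom.ext_apply fun x => ?_
      rw [← hj x]
      exact congrArg (fun g => g.toAlgHom (e x)) h1
  · have hdom' : IsDomain (MvPowerSeries (Fin (n + 1)) (WittVector p k)) :=
      NoZeroDivisors.to_isDomain _
    have hdom : IsDomain R := e.toMulEquiv.isDomain _
    set ψ : R →+* WittVector p k := (MvPowerSeries.constantCoeff).comp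
      (e : R →+* MvPowerSeries (Fin (n + 1)) (WittVector p k)) with hψ
    have hψr : ∀ a, WittVector.constantCoeff (ψ a) = R.res a := fun a => by
      have h1 := j.res_comp (e a)
      rw [hj] at h1
      exact h1.symm
    have hmem : liftingsWithDet ρbar χ R ρ := ⟨hD.isLifting _ _ hρ.mem, hdet _ _ hρ.mem⟩
    obtain ⟨ρ', S, w, x, y, z, he, hf⟩ := h.exists_strictEquiv_inForm hmem
    have key : ∀ {D' : Collection p k G}, IsDeformationCondition ρbar D' → D' R ρ' →
        (∃ ρ₀ : G →* GL (Fin 2) (powerSeriesCoeff p k Unit), IsVersal D' _ ρ₀) → D = D' := by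
      rintro D' hD' hm ⟨ρ₀, h0⟩
      exact eq_of_mem_of_isVersal_unit hD.push hD.strictEquiv hD'.push hD'.strictEquiv hρ e h0
        (hD'.strictEquiv _ _ _ he.symm hm)
    have hunr : h.unramified R ρ' → D = h.unramified := fun hm => by
      obtain ⟨ρ₀, h0, -⟩ := h.exists_isVersal_unramified (fun A ρ => h.unramified_iff)
      exact key h.isDeformationCondition_unramified hm ⟨ρ₀, h0⟩
    by_cases hα : α ^ 2 = 1
    · rcases h.mem_of_isDomain ψ hψr hq hf hα with hm | hm | ⟨hqm, hm⟩
      · exact Or.inl (hunr hm)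
      · obtain ⟨ρ₀, h0, -⟩ := h.exists_isVersal_special_upper hα
        exact Or.inr (Or.inl ⟨hα, key (h.isDeformationCondition_special (h.slope_upper hα)) hm
          ⟨ρ₀, h0⟩⟩)
      · obtain ⟨ρ₀, h0, -⟩ := h.exists_isVersal_special_lower hα hqm
        exact Or.inr (Or.inr ⟨hα, hqm, key (h.isDeformationCondition_special
          (h.slope_lower hα hqm)) hm ⟨ρ₀, h0⟩⟩)
    · exact Or.inl (hunr (h.unramified_of_isDomain ψ hψr hq hf
        (hf.normal.x_eq_zero h.q_ne_zero hα) (hf.normal.y_eq_zero (hcase.resolve_left hα))))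

theorem isSmooth_and_finrank (hD : IsDeformationCondition ρbar D)
    {ρ : G →* GL (Fin 2) (powerSeriesCoeff p k Unit)} (hρ : IsVersal D _ ρ) :
    IsSmooth D ∧ Module.finrank k (adZeroInvariants ρbar) ≤
      Module.finrank k (tangentSpace ρbar D) :=
  ⟨isSmooth_of_isVersal_unit hρ, by
    rw [h.finrank_adZeroInvariants, finrank_tangentSpace_eq_one hD.push hD.isLifting hρ]⟩

/-- The smooth deformation conditions of dimension at least that of the invariants of `ad⁰`. -/
theorem substantial_iff (hq : 1 < q) (hcase : α ^ 2 = 1 ∨ (q : k) ^ 2 * α ^ 2 ≠ 1)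
    (hdet : HasDet χ D) :
    (IsDeformationCondition ρbar D ∧ IsSmooth D ∧ Module.finrank k (adZeroInvariants ρbar) ≤
      Module.finrank k (tangentSpace ρbar D)) ↔
    D = h.unramified ∨ (α ^ 2 = 1 ∧ D = h.special α) ∨
      (α ^ 2 = 1 ∧ (q : k) = -1 ∧ D = h.special (-α)) := by
  constructor
  · rintro ⟨h1, h2, h3⟩
    rw [h.finrank_adZeroInvariants] at h3
    exact h.eq_of_isSmooth hq hcase hdet h1 h2 h3
  · rintro (rfl | ⟨hα, rfl⟩ | ⟨hα, hqm, rfl⟩)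
    · obtain ⟨ρ₀, h0, -⟩ := h.exists_isVersal_unramified (fun A ρ => h.unramified_iff)
      exact ⟨h.isDeformationCondition_unramified,
        h.isSmooth_and_finrank h.isDeformationCondition_unramified h0⟩
    · obtain ⟨ρ₀, h0, -⟩ := h.exists_isVersal_special_upper hα
      have h1 := h.isDeformationCondition_special (h.slope_upper hα)
      exact ⟨h1, h.isSmooth_and_finrank h1 h0⟩
    · obtain ⟨ρ₀, h0, -⟩ := h.exists_isVersal_special_lower hα hqm
      have h1 := h.isDeformationCondition_special (h.slope_lower hα hqm)
      exact ⟨h1, h.isSmooth_and_finrank h1 h0⟩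

theorem special_upper_ne_unramified (hα : α ^ 2 = 1) : h.special α ≠ h.unramified := by
  intro h0
  obtain ⟨ρ, hv, hρ⟩ := h.exists_isVersal_special_upper hα
  have h1 := (h.unramified_iff.mp (h0 ▸ hv.mem)).2
  have h2 := hρ.tau
  rw [h1, Units.val_one, Matrix.one_fin_two] at h2
  exact varX_ne_zero () (congrFun (congrFun h2 0) 1).symm

theorem special_lower_ne_unramified (hα : α ^ 2 = 1) (hqm : (q : k) = -1) :
    h.special (-α) ≠ h.unramified := by
  intro h0
  obtain ⟨ρ, hv, S, hρ⟩ := h.exists_isVersal_special_lower hα hqm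
  have h1 := (h.unramified_iff.mp (h0 ▸ hv.mem)).2
  have h2 := hρ.tau
  rw [h1, Units.val_one, Matrix.one_fin_two] at h2
  exact varX_ne_zero () (congrFun (congrFun h2 1) 0).symm

end Substantial

end LocalSetup

/-! ### Continuous characters and representations of triangular shape. -/

section Characters

variable {p : ℕ} [Fact p.Prime] {k : Type u} [Field k] [CharP k p] [Finite k] {G : Type v} [Group G]
  [TopologicalSpace G] [IsTopologicalGroup G] {q : ℕ} {I P : Subgroup G} {σ τ : G}

theorem TameData.mem_of_generators (h : TameData.{u} p q I P σ τ) {Γ : Type*} [Group Γ] (φ : G →* Γ)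
    (hφ : IsOpen (φ.ker : Set G)) (hI : ∀ i ∈ I, ∃ m : ℕ, φ i ^ p ^ m = 1) {S : Subgroup Γ}
    (hσ : φ σ ∈ S) (hτ : φ τ ∈ S) (g : G) : φ g ∈ S := by
  obtain ⟨a, j, hg⟩ := h.generation φ.ker inferInstance hφ (fun i hi => by
    obtain ⟨m, hm⟩ := hI i hi
    exact ⟨m, by rw [MonoidHom.mem_ker, map_pow, hm]⟩) g
  rw [MonoidHom.mem_ker, map_mul, map_inv, inv_mul_eq_one, map_mul, map_pow, map_zpow] at hg
  rw [← hg]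
  exact S.mul_mem (S.pow_mem hσ a) (S.zpow_mem hτ j)

/-- Continuity of a character with values in the units of the Witt vectors. -/
def IsContChar (ε : G →* (WittVector p k)ˣ) : Prop :=
  ∀ n : ℕ, IsOpen {g | (ε g : WittVector p k) - 1 ∈ Ideal.span {(p : WittVector p k)} ^ n}

/-- The character with values in a coefficient ring attached to a character with values in the Witt
vectors. -/
def charTo (A : CoeffRing p k) (ε : G →* (WittVector p k)ˣ) : G →* Aˣ :=
  (Units.map (algebraMap (WittVector p k) A : WittVector p k →* A)).comp ε

theorem isOpen_ker_charTo {ε : G →* (WittVector p k)ˣ} (hε : IsContChar ε) (A : CoeffRing p k) (n : ℕ) :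
    IsOpen ((charTo (A.trunc n) ε).ker : Set G) := by
  refine Subgroup.isOpen_of_mem_nhds (g := 1) _ (Filter.mem_of_superset
    ((hε (n + 1)).mem_nhds (by simp)) fun g hg => ?_)
  change charTo (A.trunc n) ε g = 1
  ext
  have h0 : ((charTo (A.trunc n) ε g : (A.trunc n)ˣ) : A.trunc n) =
    (A.toTrunc n).toAlgHom (algebraMap (WittVector p k) A (ε g)) := ((A.toTrunc n).toAlgHom.commutes _).symm
  rw [h0, Units.val_one, ← map_one (A.toTrunc n).toAlgHom, ← sub_eq_zero, ← map_sub,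
    CoeffRing.toTrunc_eq_zero]
  have h1 := Ideal.mem_map_of_mem (algebraMap (WittVector p k) A)
    (show (ε g : WittVector p k) - 1 ∈ Ideal.span {(p : WittVector p k)} ^ (n + 1) from hg)
  rw [Ideal.map_pow, Ideal.map_span, Set.image_singleton, map_natCast, map_sub, map_one] at h1
  exact Ideal.pow_right_mono ((Ideal.span_singleton_le_iff_mem _).mpr A.natCast_mem) _ h1

theorem isContChar_iff {ε : G →* (WittVector p k)ˣ} : IsContChar ε ↔ ∀ n : ℕ,
    IsOpen (((Units.map ((Ideal.Quotient.mk (Ideal.span {(p : WittVector p k)} ^ n) :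
        WittVector p k →+* WittVector p k ⧸ Ideal.span {(p : WittVector p k)} ^ n) :
        WittVector p k →* WittVector p k ⧸ Ideal.span {(p : WittVector p k)} ^ n)).comp ε).ker :
          Set G) := by
  refine forall_congr' fun n => ?_
  apply iff_of_eq
  congr 1
  ext g
  rw [SetLike.mem_coe, MonoidHom.mem_ker, Units.ext_iff]
  change _ ↔ Ideal.Quotient.mk _ (ε g : WittVector p k) = 1
  rw [← map_one (Ideal.Quotient.mk _), Ideal.Quotient.mk_eq_mk_iff_sub_mem]
  rfl

theorem isContChar_of_isOpen {ε : G →* (WittVector p k)ˣ} {Γ : Type*} [Group Γ] {Φ : G →* Γ}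
    (hΦ : IsOpen (Φ.ker : Set G)) (h : ∀ g ∈ Φ.ker, ε g = 1) : IsContChar ε :=
  isContChar_iff.mpr fun n => Subgroup.isOpen_mono (fun g hg => by
    rw [MonoidHom.mem_ker, MonoidHom.comp_apply, h g hg, map_one]) hΦ

theorem IsContChar.mul {ε ε' : G →* (WittVector p k)ˣ} (h : IsContChar ε) (h' : IsContChar ε') :
    IsContChar (ε * ε') := by
  rw [isContChar_iff] at *
  intro n
  have ho := (h n).inter (h' n)
  rw [← Subgroup.coe_inf] at ho
  refine Subgroup.isOpen_mono (fun g hg => ?_) ho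
  obtain ⟨h1, h2⟩ := Subgroup.mem_inf.mp hg
  rw [MonoidHom.mem_ker, MonoidHom.comp_apply] at h1 h2
  rw [MonoidHom.mem_ker, MonoidHom.comp_apply, MonoidHom.mul_apply, map_mul, h1, h2, one_mul]

theorem algebraMap_powerSeriesCoeff_injective :
    Function.Injective (algebraMap (WittVector p k) (powerSeriesCoeff p k Unit)) := by
  intro a b hab
  have h1 := congrArg (MvPowerSeries.constantCoeff (σ := Unit) (R := WittVector p k)) hab
  exact (MvPowerSeries.constantCoeff_C (σ := Unit) a).symm.trans
    (h1.trans (MvPowerSeries.constantCoeff_C (σ := Unit) b))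

/-- A continuous character that is residually trivial on inertia is trivial on inertia if
`q ≢ 1` modulo `p`. -/
theorem TameData.char_inertia (h : TameData.{u} p q I P σ τ) (hq : 0 < q) (hq1 : (q : k) ≠ 1)
    {ε : G →* (WittVector p k)ˣ} (hε : IsContChar ε)
    (hεI : ∀ i ∈ I, WittVector.constantCoeff (ε i : WittVector p k) = 1) : ∀ i ∈ I, ε i = 1 := by
  set A := powerSeriesCoeff p k Unit
  -- The scalar representation attached to `ε` is a lifting of its own reduction, so the results on
  -- liftings apply to it. Scalars commute, hence the tame relation gives `ε τ = ε τ ^ q`, and `q -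
  -- 1` is prime to `p`.
  set ρ : G →* GL (Fin 2) A := (Matrix.GeneralLinearGroup.scalar (Fin 2)).comp (charTo A ε) with hρ
  have hent : ∀ g, (ρ g : Matrix (Fin 2) (Fin 2) A) 0 0 = algebraMap (WittVector p k) A (ε g) :=
    fun g => by simp [hρ, charTo]
  have hlift : IsLifting ((Matrix.GeneralLinearGroup.map A.res).comp ρ) A ρ := by
    refine ⟨isContRep_iff.mpr fun n => ?_, rfl⟩
    refine Subgroup.isOpen_mono (fun g hg => ?_) (isOpen_ker_charTo hε A n)
    rw [MonoidHom.mem_ker] at *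
    have h1 : (A.toTrunc n).toAlgHom (algebraMap (WittVector p k) A (ε g)) = 1 :=
      ((A.toTrunc n).toAlgHom.commutes _).trans (congrArg Units.val hg)
    refine Matrix.GeneralLinearGroup.ext fun i j => ?_
    rw [push_apply]
    fin_cases i <;> fin_cases j <;> simp [hρ, charTo, h1]
  have hI : ∀ i ∈ I, ((Matrix.GeneralLinearGroup.map A.res).comp ρ) i = 1 := fun i hi => by
    have h1 : A.res (algebraMap (WittVector p k) A (ε i)) = 1 := by
      rw [A.res_algebraMap, hεI i hi]
    refine Matrix.GeneralLinearGroup.ext fun a b => ?_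
    rw [MonoidHom.comp_apply, Matrix.GeneralLinearGroup.map_apply]
    fin_cases a <;> fin_cases b <;> simp [hρ, charTo, h1]
  have hτ : ρ τ = 1 := by
    have hrel := h.lifting_relation hI hlift
    have hcomm : ρ σ * ρ τ * (ρ σ)⁻¹ = ρ τ := by
      rw [hρ, MonoidHom.comp_apply, MonoidHom.comp_apply, ← map_inv, ← map_mul, ← map_mul,
        mul_inv_cancel_comm]
    rw [hcomm, hρ, MonoidHom.comp_apply, ← map_pow] at hrel
    have h1 : algebraMap (WittVector p k) A (ε τ) = algebraMap (WittVector p k) A (ε τ) ^ q := by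
      have h2 := congrArg (fun M : GL (Fin 2) A => (M : Matrix (Fin 2) (Fin 2) A) 0 0) hrel
      simpa [charTo, Matrix.diagonal_pow] using h2
    have h2 : algebraMap (WittVector p k) A (ε τ) = 1 := by
      refine CoeffRing.eq_one_of_pow (n := q - 1) (by
        rw [Nat.cast_pred hq]; exact sub_ne_zero.mpr hq1)
        (by rw [A.res_algebraMap, hεI τ h.tau_mem]) ?_
      refine ((ε τ).isUnit.map (algebraMap (WittVector p k) A)).mul_left_cancel ?_
      rw [← pow_succ', Nat.sub_add_cancel hq, mul_one]
      exact h1.symm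
    refine Matrix.GeneralLinearGroup.ext fun a b => ?_
    fin_cases a <;> fin_cases b <;> simp [hρ, charTo, h2]
  intro i hi
  have h1 := h.lifting_inertia hI hlift hτ hi
  refine Units.ext (algebraMap_powerSeriesCoeff_injective ?_)
  have h2 := hent i
  rw [h1] at h2
  exact h2.symm.trans (map_one _).symm

end Characters

namespace LocalSetup

variable {p : ℕ} [Fact p.Prime] {k : Type u} [Field k] [CharP k p] [Finite k] {G : Type v} [Group G]
  [TopologicalSpace G] [IsTopologicalGroup G] {q : ℕ} {I P : Subgroup G} {σ τ : G}
  {ρbar : G →* GL (Fin 2) k} {χ : G →* (WittVector p k)ˣ} {α : k}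
  (h : LocalSetup q I P σ τ ρbar χ α)

/-- In the basis given by `N`, the representation `ρ` has the shape `(χ *; 0 1) ε`. -/
def HasShape (χ ε : G →* (WittVector p k)ˣ) {A : CoeffRing p k} (N : GL (Fin 2) A)
    (ρ : G →* GL (Fin 2) A) : Prop :=
  ∀ g, (N * ρ g * N⁻¹) 0 0 = algebraMap (WittVector p k) A ((χ g * ε g : _ˣ) : WittVector p k) ∧
    (N * ρ g * N⁻¹) 1 0 = 0 ∧
    (N * ρ g * N⁻¹) 1 1 = algebraMap (WittVector p k) A (ε g : WittVector p k)

include h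

/-- The pairs of a matrix and a scalar for which `r` is a left eigenvector form a subgroup, so that
modulo each power of the maximal ideal it suffices to look at `σ` and `τ`. -/
theorem vecMul_eq_of_generators {ε : G →* (WittVector p k)ˣ} (hεI : ∀ i ∈ I, ε i = 1)
    (hε : IsContChar ε) {A : CoeffRing p k} {ρ : G →* GL (Fin 2) A} (hρ : IsLifting ρbar A ρ)
    {r : Fin 2 → A}
    (hσ : Matrix.vecMul r (ρ σ : Matrix (Fin 2) (Fin 2) A) = algebraMap (WittVector p k) A (ε σ) • r)
    (hτ : Matrix.vecMul r (ρ τ : Matrix (Fin 2) (Fin 2) A) = r) (g : G) :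
    Matrix.vecMul r (ρ g : Matrix (Fin 2) (Fin 2) A) = algebraMap (WittVector p k) A (ε g) • r := by
  funext j
  refine CoeffRing.eq_of_forall_toTrunc fun n => ?_
  set π := (A.toTrunc n).toAlgHom with hπ
  set r' : Fin 2 → A.trunc n := fun i => π (r i) with hr'
  let S : Subgroup (GL (Fin 2) (A.trunc n) × (A.trunc n)ˣ) :=
    { carrier := {x | Matrix.vecMul r' (x.1 : Matrix (Fin 2) (Fin 2) (A.trunc n)) =
        (x.2 : A.trunc n) • r'}
      one_mem' := by simp
      mul_mem' := fun {x y} hx hy => by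
        have hx' : Matrix.vecMul r' (x.1 : Matrix (Fin 2) (Fin 2) (A.trunc n)) =
          (x.2 : A.trunc n) • r' := hx
        have hy' : Matrix.vecMul r' (y.1 : Matrix (Fin 2) (Fin 2) (A.trunc n)) =
          (y.2 : A.trunc n) • r' := hy
        change Matrix.vecMul r' ((x.1 * y.1 : GL (Fin 2) (A.trunc n)) : Matrix (Fin 2) (Fin 2) _) =
          ((x.2 * y.2 : (A.trunc n)ˣ) : A.trunc n) • r'
        rw [Units.val_mul, Units.val_mul, ← Matrix.vecMul_vecMul, hx', Matrix.smul_vecMul, hy',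
          smul_smul]
      inv_mem' := fun {x} hx => by
        have hx' : Matrix.vecMul r' (x.1 : Matrix (Fin 2) (Fin 2) (A.trunc n)) =
          (x.2 : A.trunc n) • r' := hx
        change Matrix.vecMul r' ((x.1⁻¹ : GL (Fin 2) (A.trunc n)) : Matrix (Fin 2) (Fin 2) _) =
          ((x.2⁻¹ : (A.trunc n)ˣ) : A.trunc n) • r'
        have h1 := congrArg (fun v => ((x.2⁻¹ : (A.trunc n)ˣ) : A.trunc n) • Matrix.vecMul v
          ((x.1⁻¹ : GL (Fin 2) (A.trunc n)) : Matrix (Fin 2) (Fin 2) _)) hx'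
        simp only [Matrix.vecMul_vecMul] at h1
        rw [Units.mul_inv, Matrix.vecMul_one, Matrix.smul_vecMul, smul_smul, Units.inv_mul,
          one_smul] at h1
        exact h1.symm }
  have hmap : ∀ (g : G) (c : A) (hc : Matrix.vecMul r (ρ g : Matrix (Fin 2) (Fin 2) A) = c • r),
      Matrix.vecMul r' (push (A.toTrunc n) ρ g : Matrix (Fin 2) (Fin 2) (A.trunc n)) = π c • r' := by
    intro g c hc
    funext j
    have h1 := congrArg π (congrFun hc j)
    simpa [Matrix.vecMul, dotProduct, Fin.sum_univ_two, coe_push, hr', hπ] using h1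
  have hmem := h.tame.mem_of_generators ((push (A.toTrunc n) ρ).prod (charTo (A.trunc n) ε))
    (S := S) (by
      rw [MonoidHom.ker_prod]
      exact (isContRep_iff.mp hρ.1 n).inter (isOpen_ker_charTo hε A n))
    (fun i hi => by
      obtain ⟨m, hm⟩ := hρ.exists_pow h.inertia n i hi
      refine ⟨m, ?_⟩
      rw [MonoidHom.prod_apply, Prod.pow_mk, hm, charTo, MonoidHom.comp_apply, hεI i hi, map_one,
        one_pow]
      rfl)
    (by
      refine (hmap σ _ hσ).trans ?_
      exact congrArg (· • r') ((A.toTrunc n).toAlgHom.commutes _))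
    (by
      refine (hmap τ 1 (by rw [one_smul, hτ])).trans ?_
      congr 1
      change π 1 = ((charTo (A.trunc n) ε τ : (A.trunc n)ˣ) : A.trunc n)
      rw [charTo, MonoidHom.comp_apply, hεI τ h.tame.tau_mem, map_one, map_one, Units.val_one]) g
  have h1 := congrFun (show Matrix.vecMul r' (push (A.toTrunc n) ρ g : Matrix (Fin 2) (Fin 2) _) =
    ((charTo (A.trunc n) ε g : (A.trunc n)ˣ) : A.trunc n) • r' from hmem) j
  have h2 : ((charTo (A.trunc n) ε g : (A.trunc n)ˣ) : A.trunc n) =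
    π (algebraMap (WittVector p k) A (ε g)) := ((A.toTrunc n).toAlgHom.commutes _).symm
  rw [h2] at h1
  simpa [Matrix.vecMul, dotProduct, Fin.sum_univ_two, coe_push, hr', hπ] using h1

/-- That the second row of `N` is a left eigenvector with character `ε` means that the second row of
the conjugate is `(0, ε)`. The first diagonal entry then follows from the determinant. -/
theorem hasShape_of_generators {ε : G →* (WittVector p k)ˣ} (hεI : ∀ i ∈ I, ε i = 1)
    (hε : IsContChar ε) {A : CoeffRing p k} {ρ : G →* GL (Fin 2) A} (hρ : IsLifting ρbar A ρ)
    (hdσ : (ρ σ : Matrix (Fin 2) (Fin 2) A).det =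
      q * algebraMap (WittVector p k) A (ε σ) ^ 2)
    (hdτ : (ρ τ : Matrix (Fin 2) (Fin 2) A).det = 1) (N : GL (Fin 2) A)
    (hσ : Matrix.vecMul ((N : Matrix (Fin 2) (Fin 2) A) 1) (ρ σ : Matrix (Fin 2) (Fin 2) A) =
      algebraMap (WittVector p k) A (ε σ) • (N : Matrix (Fin 2) (Fin 2) A) 1)
    (hτ : Matrix.vecMul ((N : Matrix (Fin 2) (Fin 2) A) 1) (ρ τ : Matrix (Fin 2) (Fin 2) A) =
      (N : Matrix (Fin 2) (Fin 2) A) 1) : HasShape χ ε N ρ := by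
  intro g
  have h1 := h.vecMul_eq_of_generators hεI hε hρ hσ hτ g
  have hrow : ∀ j, (N * ρ g * N⁻¹) 1 j =
      algebraMap (WittVector p k) A (ε g) * (1 : Matrix (Fin 2) (Fin 2) A) 1 j := fun j => by
    have h2 : Matrix.vecMul (Matrix.vecMul ((N : Matrix (Fin 2) (Fin 2) A) 1)
        (ρ g : Matrix (Fin 2) (Fin 2) A)) ((N⁻¹ : GL (Fin 2) A) : Matrix (Fin 2) (Fin 2) A) j =
        (N * ρ g * N⁻¹) 1 j := by
      change _ = ((N : Matrix (Fin 2) (Fin 2) A) * (ρ g : Matrix (Fin 2) (Fin 2) A) *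
        ((N⁻¹ : GL (Fin 2) A) : Matrix (Fin 2) (Fin 2) A)) 1 j
      rw [Matrix.mul_apply_eq_vecMul, Matrix.mul_apply_eq_vecMul]
    rw [← h2, h1, Matrix.smul_vecMul, Pi.smul_apply, smul_eq_mul, ← Matrix.mul_apply_eq_vecMul]
    congr 1
    exact congrFun (congrFun N.mul_inv 1) j
  have h10 : (N * ρ g * N⁻¹) 1 0 = 0 := by rw [hrow]; simp
  have h11 : (N * ρ g * N⁻¹) 1 1 = algebraMap (WittVector p k) A (ε g) := by rw [hrow]; simp
  refine ⟨?_, h10, h11⟩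
  have hdet := h.tame.det_eq h.inertia (χ := χ * (ε * ε)) (fun i hi => by
      rw [MonoidHom.mul_apply, MonoidHom.mul_apply, h.char_inertia i hi, hεI i hi, one_mul, one_mul])
    (IsContChar.mul h.char_cont (hε.mul hε)) hρ (by
      rw [hdσ, MonoidHom.mul_apply, MonoidHom.mul_apply, Units.val_mul, Units.val_mul, map_mul,
        map_mul, h.char_frob, map_natCast, sq]) hdτ g
  have h2 : (((N * ρ g * N⁻¹ : GL (Fin 2) A)) : Matrix (Fin 2) (Fin 2) A).det =
      (ρ g : Matrix (Fin 2) (Fin 2) A).det :=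
    congrArg Units.val (show Matrix.GeneralLinearGroup.det (N * ρ g * N⁻¹) =
      Matrix.GeneralLinearGroup.det (ρ g) by rw [map_mul, map_mul, map_inv, mul_inv_cancel_comm])
  rw [Matrix.det_fin_two, hdet, h10, h11, mul_zero, sub_zero] at h2
  refine ((ε g).isUnit.map (algebraMap (WittVector p k) A)).mul_right_cancel (h2.trans ?_)
  rw [MonoidHom.mul_apply, MonoidHom.mul_apply, Units.val_mul, Units.val_mul, Units.val_mul, map_mul,
    map_mul, map_mul, mul_assoc]

end LocalSetup

/-! ### Conditions of Steinberg type and their identification with the special ones. -/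

section Steinberg

variable {p : ℕ} [Fact p.Prime] {k : Type u} [Field k] [CharP k p] [Finite k] {G : Type v} [Group G]
  [TopologicalSpace G]

/-- `D` is of Steinberg type for the character `ε`, relative to the character `χ`. -/
def IsSteinbergFor (ρbar : G →* GL (Fin 2) k) (χ ε : G →* (WittVector p k)ˣ)
    (D : Collection p k G) : Prop :=
  IsContChar ε ∧ ∃ M : GL (Fin 2) k,
    (∀ g, (M * ρbar g * M⁻¹) 0 0 = WittVector.constantCoeff ((χ g * ε g : _ˣ) : WittVector p k) ∧
      (M * ρbar g * M⁻¹) 1 0 = 0 ∧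
      (M * ρbar g * M⁻¹) 1 1 = WittVector.constantCoeff (ε g : WittVector p k)) ∧
    ((∃ N : GL (Fin 2) k, ∀ g, (N * ρbar g * N⁻¹) 0 1 = 0 ∧ (N * ρbar g * N⁻¹) 1 0 = 0) →
      ∃ g, WittVector.constantCoeff (χ g : WittVector p k) ≠ 1) ∧
    ∀ A ρ, D A ρ ↔ IsLifting ρbar A ρ ∧
      ∃ N : GL (Fin 2) A, Matrix.GeneralLinearGroup.map A.res N = M ∧ LocalSetup.HasShape χ ε N ρ

theorem exists_teich_lift (A : CoeffRing p k) (M : GL (Fin 2) k) : ∃ N : GL (Fin 2) A,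
    Matrix.GeneralLinearGroup.map A.res N = M ∧
      (N : Matrix (Fin 2) (Fin 2) A) = (M : Matrix (Fin 2) (Fin 2) k).map A.teich := by
  have hres : ((M : Matrix (Fin 2) (Fin 2) k).map A.teich).map A.res = M := by
    ext i j
    exact A.res_teich _
  have hdet : IsUnit ((M : Matrix (Fin 2) (Fin 2) k).map A.teich).det := by
    rw [CoeffRing.isUnit_iff, RingHom.map_det, RingHom.mapMatrix_apply, hres]
    exact ((Matrix.isUnit_iff_isUnit_det _).mp M.isUnit).ne_zero
  exact ⟨Matrix.GeneralLinearGroup.mk'' _ hdet, Units.ext hres, rfl⟩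

theorem CoeffRing.teich_zero (A : CoeffRing p k) : A.teich 0 = 0 := by
  rw [CoeffRing.teich, WittVector.teichmuller_zero, map_zero]

end Steinberg

namespace LocalSetup

variable {p : ℕ} [Fact p.Prime] {k : Type u} [Field k] [CharP k p] [Finite k] {G : Type v} [Group G]
  [TopologicalSpace G] [IsTopologicalGroup G] {q : ℕ} {I P : Subgroup G} {σ τ : G}
  {ρbar : G →* GL (Fin 2) k} {χ : G →* (WittVector p k)ˣ} {α : k}
  (h : LocalSetup q I P σ τ ρbar χ α)

/-- The admissible slopes `β`, together with the shape of the change of basis. -/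
def Slope (q : ℕ) (α β : k) (M : GL (Fin 2) k) : Prop :=
  (β = α ∧ (M : Matrix (Fin 2) (Fin 2) k) 1 0 = 0) ∨
    (β = -α ∧ (q : k) = -1 ∧ (M : Matrix (Fin 2) (Fin 2) k) 1 1 = 0)

theorem Slope.sq {β : k} {M : GL (Fin 2) k} (hM : Slope q α β M) (hα : α ^ 2 = 1) : β ^ 2 = 1 := by
  rcases hM with ⟨rfl, -⟩ | ⟨rfl, -, -⟩
  · exact hα
  · rw [neg_sq, hα]

include h

/-- The second row of `M` is a left eigenvector of `diag(q α, α)` for `β`. If its first entry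
vanishes, `β = α`. Otherwise `β = q α`; the trace then gives `q ^ 2 = 1`, and the second entry has
to vanish. -/
theorem slope_of_residual_shape (hα : α ^ 2 = 1) {M : GL (Fin 2) k} {β : k}
    (h00 : (M * ρbar σ * M⁻¹) 0 0 = q * β) (h10 : (M * ρbar σ * M⁻¹) 1 0 = 0)
    (h11 : (M * ρbar σ * M⁻¹) 1 1 = β) : Slope q α β M := by
  have hq1 := h.q_ne_one hα
  have hαi : α⁻¹ = α := inv_eq_of_mul_eq_one_left (by rw [← pow_two, hα])
  have hmul : ((M * ρbar σ * M⁻¹ : GL (Fin 2) k) : Matrix (Fin 2) (Fin 2) k) * M =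
      (M : Matrix (Fin 2) (Fin 2) k) * ρbar σ := by
    rw [← Units.val_mul, ← Units.val_mul, inv_mul_cancel_right]
  rw [h.frob, hαi] at hmul
  have e0 := congrFun (congrFun hmul 1) 0
  have e1 := congrFun (congrFun hmul 1) 1
  rw [Matrix.mul_apply, Matrix.mul_apply, Fin.sum_univ_two, Fin.sum_univ_two, h10, h11] at e0 e1
  simp at e0 e1
  have htr : (q : k) * α + α = q * β + β := by
    have h1 : ((M * ρbar σ * M⁻¹ : GL (Fin 2) k) : Matrix (Fin 2) (Fin 2) k).trace =
        (ρbar σ : Matrix (Fin 2) (Fin 2) k).trace := by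
      rw [Units.val_mul, Units.val_mul, Matrix.trace_mul_comm, ← mul_assoc, M.inv_mul, one_mul]
    rw [h.frob, Matrix.trace_fin_two_of, Matrix.trace_fin_two, h00, h11, hαi] at h1
    exact h1.symm
  have hdet : (M : Matrix (Fin 2) (Fin 2) k).det ≠ 0 :=
    ((Matrix.isUnit_iff_isUnit_det _).mp M.isUnit).ne_zero
  rw [Matrix.det_fin_two] at hdet
  by_cases hM : (M : Matrix (Fin 2) (Fin 2) k) 1 0 = 0
  · refine Or.inl ⟨?_, hM⟩
    rw [hM, mul_zero, sub_zero] at hdet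
    exact mul_right_cancel₀ (right_ne_zero_of_mul hdet) (by linear_combination e1)
  · refine Or.inr ?_
    have hβ : β = q * α := mul_right_cancel₀ hM (by linear_combination e0)
    have hqm : (q : k) = -1 := by
      rw [hβ] at htr
      have h1 : ((q : k) + 1) * ((q : k) - 1) = 0 := by
        refine (mul_eq_zero.mp (?_ : _ * α = 0)).resolve_right h.unit
        linear_combination -htr
      exact eq_neg_of_add_eq_zero_left ((mul_eq_zero.mp h1).resolve_right (sub_ne_zero.mpr hq1))
    refine ⟨by rw [hβ, hqm, neg_one_mul], hqm, ?_⟩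
    rw [hβ] at e1
    refine (mul_eq_zero.mp (?_ : _ * (((q : k) - 1) * α) = 0)).resolve_right
      (mul_ne_zero (sub_ne_zero.mpr hq1) h.unit)
    linear_combination e1

/-- In normal form the second row of the Teichmüller lift of `M`, having one zero entry, is an
eigenvector of both `σ` and `τ`; the strict equivalence to normal form is then absorbed in `N`.
Conversely the equations of `special` hold for triangular matrices by multiplication and are
invariant under conjugation. Thus `ε` and `M` enter only through the slope. -/
theorem special_iff_hasShape (hα : α ^ 2 = 1) {ε : G →* (WittVector p k)ˣ} (hεI : ∀ i ∈ I, ε i = 1)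
    (hε : IsContChar ε) {β : k} (hβ : (ε σ : WittVector p k) = WittVector.teichmuller p β)
    {M : GL (Fin 2) k} (hM : Slope q α β M) {A : CoeffRing p k} {ρ : G →* GL (Fin 2) A} :
    h.special β A ρ ↔ IsLifting ρbar A ρ ∧
      ∃ N : GL (Fin 2) A, Matrix.GeneralLinearGroup.map A.res N = M ∧ HasShape χ ε N ρ := by
  have hβ2 := hM.sq hα
  have hεσ : algebraMap (WittVector p k) A (ε σ) = A.teich β := by rw [hβ]; rfl
  have hq1 := h.q_ne_one hα
  constructor
  · intro hs
    have hmem := (h.special_iff.mp hs).1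
    refine ⟨hmem.1, ?_⟩
    obtain ⟨ρ', S, w, x, y, z, he, hf⟩ := h.exists_strictEquiv_inForm hmem
    obtain ⟨N₀, hN₀, hN₀'⟩ := exists_teich_lift A M
    have hrow : ∀ j, (N₀ : Matrix (Fin 2) (Fin 2) A) 1 j =
      A.teich ((M : Matrix (Fin 2) (Fin 2) k) 1 j) := fun j => congrFun (congrFun hN₀' 1) j
    obtain ⟨b, hσ, hb, hbr⟩ := h.sigma_entries hf hα
    have hshape : HasShape χ ε N₀ ρ' := by
      obtain ⟨-, hdσ, hdτ⟩ := h.liftingsWithDet_iff.mp hf.mem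
      refine h.hasShape_of_generators hεI hε hf.mem.1 (by
        rw [hdσ, hεσ, A.teich_sq hβ2, mul_one]) hdτ N₀ ?_ ?_
      · rw [hεσ, hσ]
        rcases hM with ⟨rfl, hM⟩ | ⟨rfl, hqm, hM⟩
        · have hs' := (h.special_iff_upper hα hf).mp
            ((h.isDeformationCondition_special (h.slope_upper hα)).strictEquiv _ _ _ he hs)
          have hbe : b = A.teich β := by
            rw [hs'.1] at hb
            linear_combination A.teich β * hb - b * A.teich_sq hα
          funext j
          fin_cases j <;> simp [Matrix.vecMul, dotProduct, Fin.sum_univ_two, hrow, hM,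
            CoeffRing.teich_zero, hbe, mul_comm]
        · have hs' := (h.special_iff_lower hα hqm hf).mp
            ((h.isDeformationCondition_special (h.slope_lower hα hqm)).strictEquiv _ _ _ he hs)
          have hae : q * (A.teich α * (1 + S)) = -A.teich α := by
            linear_combination A.teich α * hs'.2
          rw [hae, teich_neg A h.odd]
          funext j
          fin_cases j <;> simp [Matrix.vecMul, dotProduct, Fin.sum_univ_two, hrow, hM,
            CoeffRing.teich_zero, mul_comm]
      · rw [hf.tau]
        rcases hM with ⟨rfl, hM⟩ | ⟨rfl, hqm, hM⟩
        · have hs' := (h.special_iff_upper hα hf).mp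
            ((h.isDeformationCondition_special (h.slope_upper hα)).strictEquiv _ _ _ he hs)
          have hw := hf.normal.w_eq_one h.two_ne_zero hq1 (by rw [hs'.2, mul_zero])
          have hz := (hf.normal.w_eq_z hq1).symm.trans hw
          funext j
          fin_cases j <;> simp [Matrix.vecMul, dotProduct, Fin.sum_univ_two, hrow, hM,
            CoeffRing.teich_zero, hz, hs'.2]
        · have hs' := (h.special_iff_lower hα hqm hf).mp
            ((h.isDeformationCondition_special (h.slope_lower hα hqm)).strictEquiv _ _ _ he hs)
          have hw := hf.normal.w_eq_one h.two_ne_zero hq1 (by rw [hs'.1, zero_mul])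
          funext j
          fin_cases j <;> simp [Matrix.vecMul, dotProduct, Fin.sum_univ_two, hrow, hM,
            CoeffRing.teich_zero, hw, hs'.1]
    obtain ⟨M', hM', hc⟩ := he
    refine ⟨N₀ * M', by rw [map_mul, hN₀, hM', mul_one], fun g => ?_⟩
    have e : N₀ * M' * ρ g * (N₀ * M')⁻¹ = N₀ * ρ' g * N₀⁻¹ := by rw [← hc]; group
    rw [e]
    exact hshape g
  · rintro ⟨hlift, N, hN, hshape⟩
    set ρ' : G →* GL (Fin 2) A := (MulAut.conj N).toMonoidHom.comp ρ with hρ'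
    have hχσ : algebraMap (WittVector p k) A ((χ σ * ε σ : _ˣ) : WittVector p k) =
        q * A.teich β := by
      rw [Units.val_mul, map_mul, h.char_frob, map_natCast, hεσ]
    have hχτ : algebraMap (WittVector p k) A ((χ τ * ε τ : _ˣ) : WittVector p k) = 1 := by
      rw [h.char_inertia τ h.tame.tau_mem, hεI τ h.tame.tau_mem, one_mul, Units.val_one, map_one]
    have hετ : algebraMap (WittVector p k) A (ε τ : WittVector p k) = 1 := by
      rw [hεI τ h.tame.tau_mem, Units.val_one, map_one]
    obtain ⟨b, hσ⟩ : ∃ b, (ρ' σ : Matrix (Fin 2) (Fin 2) A) = !![q * A.teich β, b; 0, A.teich β] := by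
      obtain ⟨h1, h2, h3⟩ := hshape σ
      refine ⟨(ρ' σ : Matrix (Fin 2) (Fin 2) A) 0 1, ?_⟩
      rw [Matrix.eta_fin_two (ρ' σ : Matrix (Fin 2) (Fin 2) A)]
      rw [hχσ] at h1
      rw [hεσ] at h3
      rw [show (ρ' σ : Matrix (Fin 2) (Fin 2) A) 0 0 = _ from h1,
        show (ρ' σ : Matrix (Fin 2) (Fin 2) A) 1 0 = _ from h2,
        show (ρ' σ : Matrix (Fin 2) (Fin 2) A) 1 1 = _ from h3]
      simp
    obtain ⟨c, hτ⟩ : ∃ c, (ρ' τ : Matrix (Fin 2) (Fin 2) A) = !![1, c; 0, 1] := by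
      obtain ⟨h1, h2, h3⟩ := hshape τ
      refine ⟨(ρ' τ : Matrix (Fin 2) (Fin 2) A) 0 1, ?_⟩
      rw [Matrix.eta_fin_two (ρ' τ : Matrix (Fin 2) (Fin 2) A)]
      rw [hχτ] at h1
      rw [hετ] at h3
      rw [show (ρ' τ : Matrix (Fin 2) (Fin 2) A) 0 0 = _ from h1,
        show (ρ' τ : Matrix (Fin 2) (Fin 2) A) 1 0 = _ from h2,
        show (ρ' τ : Matrix (Fin 2) (Fin 2) A) 1 1 = _ from h3]
      simp
    have hconj : ∀ g, (ρ g : Matrix (Fin 2) (Fin 2) A) =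
        ((N⁻¹ : GL (Fin 2) A) : Matrix (Fin 2) (Fin 2) A) * ρ' g * N := fun g => by
      have e : ρ g = N⁻¹ * ρ' g * N := by
        change ρ g = N⁻¹ * (N * ρ g * N⁻¹) * N
        group
      rw [e, Units.val_mul, Units.val_mul]
    have hdet : ∀ g, (ρ g : Matrix (Fin 2) (Fin 2) A).det =
        (ρ' g : Matrix (Fin 2) (Fin 2) A).det := fun g => by
      rw [hconj, Matrix.det_mul, Matrix.det_mul, mul_comm, ← mul_assoc, ← Matrix.det_mul, N.mul_inv,
        Matrix.det_one, one_mul]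
    have hNN : ((N⁻¹ : GL (Fin 2) A) : Matrix (Fin 2) (Fin 2) A) * N = 1 := N.inv_mul
    have hNN' : (N : Matrix (Fin 2) (Fin 2) A) * ((N⁻¹ : GL (Fin 2) A) :
      Matrix (Fin 2) (Fin 2) A) = 1 := N.mul_inv
    have hone : ∀ (X : Matrix (Fin 2) (Fin 2) A),
      X - 1 = X - (1 : A) • (1 : Matrix (Fin 2) (Fin 2) A) := fun X => by rw [one_smul]
    have e1 : ∀ a b c d f : A, !![a, b; c, d] - f • (1 : Matrix (Fin 2) (Fin 2) A) =
        !![a - f, b; c, d - f] := fun a b c d f => by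
      ext i j; fin_cases i <;> fin_cases j <;> simp
    have ht2 := A.teich_sq hβ2
    refine h.special_iff.mpr ⟨h.liftingsWithDet_iff.mpr ⟨hlift, ?_, ?_⟩, ?_, ?_, ?_⟩
    · rw [hdet, hσ, Matrix.det_fin_two_of]
      linear_combination q * ht2
    · rw [hdet, hτ, Matrix.det_fin_two_of]
      ring
    · rw [hconj, Matrix.trace_mul_comm, ← mul_assoc, hNN', one_mul, hσ, Matrix.trace_fin_two_of]
      ring
    · rw [hone, hconj, hconj, conj_sub_smul hNN, conj_sub_smul hNN, conj_mul_conj hNN', hσ, hτ, e1,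
        e1, Matrix.mul_fin_two]
      have e2 : (!![(q * A.teich β - q * A.teich β) * (1 - 1) + b * 0,
          (q * A.teich β - q * A.teich β) * c + b * (1 - 1);
          0 * (1 - 1) + (A.teich β - q * A.teich β) * 0,
          0 * c + (A.teich β - q * A.teich β) * (1 - 1)] : Matrix (Fin 2) (Fin 2) A) = 0 := by
        ext i j; fin_cases i <;> fin_cases j <;> simp
      rw [e2, mul_zero, zero_mul]
    · rw [hone, hconj, hconj, conj_sub_smul hNN, conj_sub_smul hNN, conj_mul_conj hNN', hσ, hτ, e1,
        e1, Matrix.mul_fin_two]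
      have e2 : (!![(1 - 1) * (q * A.teich β - A.teich β) + c * 0,
          (1 - 1) * b + c * (A.teich β - A.teich β);
          0 * (q * A.teich β - A.teich β) + (1 - 1) * 0,
          0 * b + (1 - 1) * (A.teich β - A.teich β)] : Matrix (Fin 2) (Fin 2) A) = 0 := by
        ext i j; fin_cases i <;> fin_cases j <;> simp
      rw [e2, mul_zero, zero_mul]

theorem exists_steinberg (hα : α ^ 2 = 1) {β : k} {M : GL (Fin 2) k} (hM : Slope q α β M)
    (hne : ∃ (ρ : G →* GL (Fin 2) (powerSeriesCoeff p k Unit)), h.special β _ ρ) :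
    ∃ ε : G →* (WittVector p k)ˣ, (∀ i ∈ I, ε i = 1) ∧
      (ε σ : WittVector p k) = WittVector.teichmuller p β ∧ IsSteinbergFor ρbar χ ε (h.special β) := by
  have hβ0 : β ≠ 0 := fun h0 => by
    have := hM.sq hα
    rw [h0] at this
    simp at this
  -- An unramified character with value `β` at `σ`, from the universal property with `T = 1` and `m
  -- = 0`; `ε` is its Teichmüller lift.
  obtain ⟨Φ, hΦo, hΦσ, hΦτ, hΦI, -⟩ := h.tame.exists_hom kˣ (Units.mk0 β hβ0) 1 0
    (one_pow _) (by simp)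
  set ε : G →* (WittVector p k)ˣ := (Units.map (WittVector.teichmuller p : k →* WittVector p k)).comp Φ
    with hε
  have hεI : ∀ i ∈ I, ε i = 1 := fun i hi => by
    have := hΦI i hi
    rw [pow_zero, pow_one] at this
    rw [hε, MonoidHom.comp_apply, this, map_one]
  have hεσ : (ε σ : WittVector p k) = WittVector.teichmuller p β := by
    rw [hε, MonoidHom.comp_apply, hΦσ]
    rfl
  have hεc : IsContChar ε := isContChar_of_isOpen hΦo fun g hg => by
    rw [hε, MonoidHom.comp_apply, MonoidHom.mem_ker.mp hg, map_one]
  refine ⟨ε, hεI, hεσ, hεc, M, ?_, fun _ => ⟨σ, ?_⟩, fun A ρ =>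
    h.special_iff_hasShape hα hεI hεc hεσ hM⟩
  · obtain ⟨ρ, hρ⟩ := hne
    obtain ⟨hl, N, hN, hs⟩ := (h.special_iff_hasShape hα hεI hεc hεσ hM).mp hρ
    intro g
    have e : M * ρbar g * M⁻¹ =
        Matrix.GeneralLinearGroup.map (powerSeriesCoeff p k Unit).res (N * ρ g * N⁻¹) := by
      rw [map_mul, map_mul, map_inv, hN, hl.res_apply]
    obtain ⟨h1, h2, h3⟩ := hs g
    rw [e]
    simp only [Matrix.GeneralLinearGroup.map_apply]
    rw [h1, h2, h3, map_zero, CoeffRing.res_algebraMap, CoeffRing.res_algebraMap]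
    exact ⟨rfl, rfl, rfl⟩
  · rw [h.char_frob, map_natCast]
    exact h.q_ne_one hα

/-- A priori only the residue of `ε σ` is restricted. To see that `ε σ` is a Teichmüller element, a
member of `D` is constructed; since its determinant must be `χ`, it follows that `(ε σ) ^ 2 = 1`,
and a square root of one is determined by its residue. -/
theorem eq_special_of_isSteinbergFor (hα : α ^ 2 = 1) {D : Collection p k G} (hdet : HasDet χ D)
    {ε : G →* (WittVector p k)ˣ} (hS : IsSteinbergFor ρbar χ ε D) :
    (D = h.special α ∧ (ε σ : WittVector p k) = WittVector.teichmuller p α) ∨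
      ((q : k) = -1 ∧ D = h.special (-α) ∧
        (ε σ : WittVector p k) = WittVector.teichmuller p (-α)) := by
  obtain ⟨hεc, M, hM, -, hD⟩ := hS
  have hεI : ∀ i ∈ I, ε i = 1 := by
    refine h.tame.char_inertia h.q_pos (h.q_ne_one hα) hεc fun i hi => ?_
    have h1 := (hM i).2.2
    rw [h.inertia i hi, mul_one, mul_inv_cancel] at h1
    exact h1.symm
  set β := WittVector.constantCoeff (ε σ : WittVector p k) with hβ
  obtain ⟨h00, h10, h11⟩ := hM σ
  have hc : WittVector.constantCoeff ((χ σ * ε σ : _ˣ) : WittVector p k) = q * β := by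
    rw [Units.val_mul, map_mul, h.char_frob, map_natCast]
  rw [hc] at h00
  have hslope : Slope q α β M := h.slope_of_residual_shape hα h00 h10 h11
  set A := powerSeriesCoeff p k Unit
  have hres : A.res (algebraMap (WittVector p k) A (ε σ)) = β := A.res_algebraMap _
  obtain ⟨N, hN, -⟩ := exists_teich_lift A M
  set e := algebraMap (WittVector p k) A (ε σ) with he
  -- The image of `σ` in the basis `N` for the test member: triangular with the prescribed diagonal,
  -- and lifting the residual matrix. The element `τ` acts trivially.
  set U : Matrix (Fin 2) (Fin 2) A := !![q * e, A.teich ((M * ρbar σ * M⁻¹) 0 1); 0, e] with hU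
  have hβ0 : β ≠ 0 := fun h0 => by
    have := hslope.sq hα
    rw [h0] at this
    simp at this
  have hUd : U.det = q * e ^ 2 := by rw [hU, Matrix.det_fin_two_of]; ring
  have hUu : IsUnit U.det := by
    rw [hUd, CoeffRing.isUnit_iff, map_mul, map_pow, map_natCast, hres]
    exact mul_ne_zero h.q_ne_zero (pow_ne_zero _ hβ0)
  set V := Matrix.GeneralLinearGroup.mk'' U hUu with hV
  have hVres : Matrix.GeneralLinearGroup.map A.res V = M * ρbar σ * M⁻¹ := by
    refine Matrix.GeneralLinearGroup.ext fun i j => ?_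
    change A.res (U i j) = _
    fin_cases i <;> fin_cases j
    · change A.res (q * e) = (M * ρbar σ * M⁻¹) 0 0
      rw [h00, map_mul, map_natCast, hres]
    · exact A.res_teich _
    · exact (map_zero _).trans h10.symm
    · exact hres.trans h11.symm
  obtain ⟨ρ, hρ, hρσ, hρτ⟩ := h.tame.exists_lifting h.inertia h.isOpen_ker A (N⁻¹ * V * N) 1
    (by rw [map_mul, map_mul, map_inv, hN, hVres]; group) (map_one _) (by simp)
  have hdσ : (ρ σ : Matrix (Fin 2) (Fin 2) A).det = q * e ^ 2 := by
    rw [hρσ, ← hUd]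
    exact congrArg Units.val (show Matrix.GeneralLinearGroup.det (N⁻¹ * V * N) =
      Matrix.GeneralLinearGroup.det V by
        rw [map_mul, map_mul, map_inv, inv_mul_cancel_comm])
  have hmul : (N : Matrix (Fin 2) (Fin 2) A) * ρ σ = U * N := by
    have : N * ρ σ = V * N := by rw [hρσ]; group
    exact congrArg Units.val this
  have hshape := h.hasShape_of_generators hεI hεc hρ hdσ
    (by rw [hρτ, Units.val_one, Matrix.det_one]) N (by
      rw [← Matrix.mul_apply_eq_vecMul, hmul]
      funext j
      rw [Matrix.mul_apply, Fin.sum_univ_two]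
      simp [hU, he]) (by rw [hρτ, Units.val_one, Matrix.vecMul_one])
  have hDρ : D A ρ := (hD A ρ).mpr ⟨hρ, N, hN, hshape⟩
  have hd := hdet A ρ hDρ σ
  rw [hdσ, h.char_frob, map_natCast] at hd
  have he2 : e ^ 2 = 1 := by
    refine (CoeffRing.isUnit_iff.mpr ?_ : IsUnit (q : A)).mul_left_cancel (hd.trans (mul_one _).symm)
    rw [map_natCast]
    exact h.q_ne_zero
  have het : e = A.teich β := CoeffRing.eq_of_sq_eq h.two_ne_zero
    (by rw [he2, A.teich_sq (hslope.sq hα)]) (by rw [hres, A.res_teich]) (by rw [A.res_teich]; exact hβ0)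
  have hεσ : (ε σ : WittVector p k) = WittVector.teichmuller p β :=
    algebraMap_powerSeriesCoeff_injective het
  have hDs : D = h.special β := by
    funext B ρ'
    exact propext ((hD B ρ').trans (h.special_iff_hasShape hα hεI hεc hεσ hslope).symm)
  rcases hslope with ⟨hβα, -⟩ | ⟨hβα, hqm, -⟩
  · rw [hβα] at hDs hεσ
    exact Or.inl ⟨hDs, hεσ⟩
  · rw [hβα] at hDs hεσ
    exact Or.inr ⟨hqm, hDs, hεσ⟩

end LocalSetup

theorem forall_mem_comap_span_pair {R Q A W : Type*} [CommRing R] [CommRing Q] [CommRing A]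
    [CommRing W] [Algebra W R] [Algebra W Q] [Algebra W A] (e : R ≃ₐ[W] Q) (f : R →ₐ[W] A) (a b : Q) :
    (∀ x ∈ (Ideal.span {a, b}).comap e, f x = 0) ↔ f (e.symm a) = 0 ∧ f (e.symm b) = 0 := by
  constructor
  · refine fun h => ⟨h _ ?_, h _ ?_⟩
    · rw [Ideal.mem_comap, AlgEquiv.apply_symm_apply]
      exact Ideal.subset_span (Or.inl rfl)
    · rw [Ideal.mem_comap, AlgEquiv.apply_symm_apply]
      exact Ideal.subset_span (Or.inr rfl)
  · rintro ⟨ha, hb⟩ x hx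
    obtain ⟨c, d, hcd⟩ := Ideal.mem_span_pair.mp (Ideal.mem_comap.mp hx)
    rw [← e.symm_apply_apply x, ← hcd, map_add, map_mul, map_mul, map_add, map_mul, map_mul, ha, hb,
      mul_zero, mul_zero, add_zero]

/-! ### Transport of the results to an arbitrary versal pair. -/

section Collections

variable {p : ℕ} [Fact p.Prime] {k : Type u} [Field k] [CharP k p] [Finite k] {G : Type v} [Group G]

/-- An ideal determines the collection that corresponds to it, so it is enough that `D₀` does. For
`D₀` one needs that a specialisation belongs to it exactly when the ideal is killed. -/
theorem correspondsTo_iff {R : CoeffRing p k} {ρ : G →* GL (Fin 2) R} {I : Ideal R}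
    {D₀ D : Collection p k G}
    (hex : ∀ A ρ', D₀ A ρ' → ∃ f : CoeffHom R A, StrictEquiv (push f ρ) ρ')
    (hs : ∀ (A : CoeffRing p k) (ρ ρ' : G →* GL (Fin 2) A), StrictEquiv ρ ρ' → D₀ A ρ → D₀ A ρ')
    (hI : ∀ (A : CoeffRing p k) (f : CoeffHom R A),
      D₀ A (push f ρ) ↔ ∀ x ∈ I, f.toAlgHom x = 0) :
    CorrespondsTo ρ I D ↔ D = D₀ := by
  have key : CorrespondsTo ρ I D₀ := fun A ρ' => by
    constructor
    · intro h
      obtain ⟨f, hf⟩ := hex A ρ' h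
      exact ⟨f, (hI A f).mp (hs _ _ _ hf.symm h), hf⟩
    · rintro ⟨f, hf, hf'⟩
      exact hs _ _ _ hf' ((hI A f).mpr hf)
  constructor
  · intro h
    funext A ρ'
    exact propext ((h A ρ').trans (key A ρ').symm)
  · rintro rfl
    exact key

end Collections

section Ideals

variable {p : ℕ} [Fact p.Prime] {k : Type u} [Field k] [CharP k p] [Finite k]

theorem span_diag_le (q : ℕ) : Ideal.span {(1 + varX p k 1) ^ q - (1 + varX p k 1)} ≤
    maximalIdeal (powerSeriesCoeff p k (Fin 2)) := by
  rw [Ideal.span_singleton_le_iff_mem, CoeffRing.mem_maximalIdeal, map_sub, map_pow, map_add, map_one,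
    res_varX, add_zero, one_pow, sub_self]

theorem span_upper_le : Ideal.span {varX p k 0 * varX p k 1} ≤
    maximalIdeal (powerSeriesCoeff p k (Fin 2)) := by
  rw [Ideal.span_singleton_le_iff_mem, CoeffRing.mem_maximalIdeal, map_mul, res_varX, zero_mul]

theorem oddIdeal_le (q : ℕ) (r : powerSeriesCoeff p k (Fin 3)) :
    oddIdeal q (varX p k 0) (varX p k 1) (varX p k 2) r ≤
      maximalIdeal (powerSeriesCoeff p k (Fin 3)) := by
  rw [oddIdeal, Ideal.span_le]
  rintro x (rfl | rfl) <;>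
    rw [SetLike.mem_coe, CoeffRing.mem_maximalIdeal, map_mul, res_varX, zero_mul]

theorem exists_sqrt_one_add (hp : (2 : k) ≠ 0) : ∃ r : powerSeriesCoeff p k (Fin 3),
    r ^ 2 = 1 + varX p k 1 * varX p k 2 ∧ (powerSeriesCoeff p k (Fin 3)).res r = 1 :=
  CoeffRing.exists_sqrt _ hp (by rw [map_add, map_mul, map_one, res_varX, zero_mul, add_zero])

theorem constantCoeff_sqrt_one_add (hp : (2 : k) ≠ 0) {r : MvPowerSeries (Fin 3) (WittVector p k)}
    (hr : r ^ 2 = 1 + MvPowerSeries.X 1 * MvPowerSeries.X 2)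
    (hr1 : WittVector.constantCoeff (MvPowerSeries.constantCoeff r) = 1) :
    MvPowerSeries.constantCoeff r = 1 := by
  have h1 := congrArg MvPowerSeries.constantCoeff hr
  rw [map_pow, map_add, map_mul, map_one, MvPowerSeries.constantCoeff_X, zero_mul, add_zero] at h1
  rcases mul_self_eq_one_iff.mp ((sq _).symm.trans h1) with h2 | h2
  · exact h2
  · exfalso
    rw [h2, map_neg, map_one] at hr1
    exact hp (by linear_combination -hr1)

theorem scaledDiagMatrix_eq {A : CoeffRing p k} {α : k} (hα : α ^ 2 = 1) (q : ℕ) {S : A}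
    (hS : A.res S = 0) : scaledDiagMatrix q (A.teich α) S = diagMatrix q (A.teich α) S := by
  have hα0 : α ≠ 0 := fun h0 => by rw [h0] at hα; simp at hα
  have h1 : IsUnit (A.teich α * (1 + S)) :=
    CoeffRing.isUnit_iff.mpr (by rw [res_unit_part hS]; exact hα0)
  have h2 : IsUnit (1 + S) := CoeffRing.isUnit_iff.mpr (by simp [hS])
  have h3 : Ring.inverse (A.teich α * (1 + S)) = A.teich α * Ring.inverse (1 + S) := by
    refine h1.mul_left_cancel ?_
    rw [Ring.mul_inverse_cancel _ h1]
    linear_combination -A.teich α ^ 2 * Ring.mul_inverse_cancel _ h2 - A.teich_sq hα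
  rw [scaledDiagMatrix, diagMatrix, h3]
  ext i j
  fin_cases i <;> fin_cases j <;> simp
  ring

end Ideals

namespace LocalSetup

variable {p : ℕ} [Fact p.Prime] {k : Type u} [Field k] [CharP k p] [Finite k] {G : Type v} [Group G]
  [TopologicalSpace G] [IsTopologicalGroup G] {q : ℕ} {I P : Subgroup G} {σ τ : G}
  {ρbar : G →* GL (Fin 2) k} {χ : G →* (WittVector p k)ˣ} {α : k}
  (h : LocalSetup q I P σ τ ρbar χ α)

include h

theorem exists_isVersal_liftingsWithDet (hcase : α ^ 2 = 1 ∨ (q : k) ^ 2 * α ^ 2 ≠ 1) :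
    ∃ (R : CoeffRing p k) (ρ : G →* GL (Fin 2) R), IsVersal (liftingsWithDet ρbar χ) R ρ := by
  by_cases hα : α ^ 2 = 1
  · by_cases hq2 : (q : k) ^ 2 = 1
    · obtain ⟨r, hr, hr1⟩ := exists_sqrt_one_add (p := p) h.two_ne_zero
      obtain ⟨ρ, hρ, -⟩ := h.exists_isVersal_symmetric hα (h.q_ne_one hα) hr hr1 rfl (oddIdeal_le q r)
      exact ⟨_, ρ, hρ⟩
    · obtain ⟨ρ, hρ, -⟩ := h.exists_isVersal_upper hα (h.q_ne_one hα) hq2 rfl span_upper_le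
      exact ⟨_, ρ, hρ⟩
  · obtain ⟨ρ, hρ, -⟩ := h.exists_isVersal_diag hα (hcase.resolve_left hα) rfl (span_diag_le q)
    exact ⟨_, ρ, hρ⟩

theorem exists_algEquiv {R Q : CoeffRing p k} {ρ : G →* GL (Fin 2) R}
    (hR : IsVersal (liftingsWithDet ρbar χ) R ρ) {ρQ : G →* GL (Fin 2) Q}
    (hQ : IsVersal (liftingsWithDet ρbar χ) Q ρQ) {S w x y z : Q} (hf : h.InForm ρQ S w x y z) :
    ∃ (e : R ≃ₐ[WittVector p k] Q) (ρ' : G →* GL (Fin 2) R), StrictEquiv ρ ρ' ∧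
      h.InForm ρ' (e.symm S) (e.symm w) (e.symm x) (e.symm y) (e.symm z) ∧
      (ρ' σ : Matrix (Fin 2) (Fin 2) R).map e = diagMatrix q (Q.teich α) S ∧
      (ρ' τ : Matrix (Fin 2) (Fin 2) R).map e = !![w, x; y, z] := by
  obtain ⟨f, hfb, hs⟩ := hR.exists_equiv liftingsWithDet_pushClosed hQ
  have hcomp : ∀ g, (push (f.inverse hfb) ρQ g : Matrix (Fin 2) (Fin 2) R).map f.toAlgHom = ρQ g :=
    fun g => by
      ext i j
      exact f.apply_inverse hfb _
  have hρ : push (f.inverse hfb) (push f ρ) = ρ := by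
    ext g i j
    exact f.inverse_apply hfb _
  refine ⟨AlgEquiv.ofBijective f.toAlgHom hfb, push (f.inverse hfb) ρQ, ?_,
    h.inForm_push hf (f.inverse hfb), ?_, ?_⟩
  · have := hs.push (f.inverse hfb)
    rwa [hρ] at this
  · exact (hcomp σ).trans hf.sigma
  · exact (hcomp τ).trans hf.tau

/-- The predicate `Φ` is meant for the Frobenius elements. As `ε` is trivial on inertia, its value
at `σ` is its value at all of them; the slope `-α` is excluded since `α ≠ -α`. -/
theorem exists_isSteinbergFor_upper_iff (hα : α ^ 2 = 1) {D : Collection p k G} (hdet : HasDet χ D)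
    {Φ : G → Prop} (hσ : Φ σ) (hΦ : ∀ φ, Φ φ → σ⁻¹ * φ ∈ I) :
    D = h.special α ↔ ∃ ε : G →* (WittVector p k)ˣ, IsSteinbergFor ρbar χ ε D ∧
      ∀ φ, Φ φ → (ε φ : WittVector p k) = WittVector.teichmuller p α := by
  constructor
  · rintro rfl
    obtain ⟨ρ, hρ, -⟩ := h.exists_isVersal_special_upper hα
    obtain ⟨ε, hεI, hεσ, hε⟩ := h.exists_steinberg hα (M := 1) (β := α) (Or.inl ⟨rfl, by simp⟩)
      ⟨ρ, hρ.mem⟩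
    refine ⟨ε, hε, fun φ hφ => ?_⟩
    rw [← hεσ, ← mul_inv_cancel_left σ φ, map_mul, hεI _ (hΦ φ hφ), mul_one]
  · rintro ⟨ε, hε, hεΦ⟩
    rcases h.eq_special_of_isSteinbergFor hα hdet hε with ⟨hD, -⟩ | ⟨-, -, h2⟩
    · exact hD
    · exfalso
      have h3 := congrArg WittVector.constantCoeff ((hεΦ σ hσ).symm.trans h2)
      have h4 : α = -α := (WittVector.teichmuller_coeff_zero p α).symm.trans
        (h3.trans (WittVector.teichmuller_coeff_zero p (-α)))
      exact mul_ne_zero h.two_ne_zero h.unit (by linear_combination h4)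

theorem exists_isSteinbergFor_lower_iff (hα : α ^ 2 = 1) (hqm : (q : k) = -1) {D : Collection p k G}
    (hdet : HasDet χ D) {Φ : G → Prop} (hσ : Φ σ) (hΦ : ∀ φ, Φ φ → σ⁻¹ * φ ∈ I) :
    D = h.special (-α) ↔ ∃ ε : G →* (WittVector p k)ˣ, IsSteinbergFor ρbar χ ε D ∧
      ∀ φ, Φ φ → (ε φ : WittVector p k) = -WittVector.teichmuller p α := by
  constructor
  · rintro rfl
    obtain ⟨ρ, hρ, -⟩ := h.exists_isVersal_special_lower hα hqm
    obtain ⟨ε, hεI, hεσ, hε⟩ := h.exists_steinberg hα (β := -α)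
      -- The exchange of the two basis vectors, so that the eigenvector for `-α` comes second.
      (M := Matrix.GeneralLinearGroup.mk'' !![0, 1; 1, 0] (by simp [Matrix.det_fin_two_of]))
      (Or.inr ⟨rfl, hqm, rfl⟩) ⟨ρ, hρ.mem⟩
    refine ⟨ε, hε, fun φ hφ => ?_⟩
    rw [← teichmuller_neg h.odd, ← hεσ, ← mul_inv_cancel_left σ φ, map_mul, hεI _ (hΦ φ hφ), mul_one]
  · rintro ⟨ε, hε, hεΦ⟩
    rcases h.eq_special_of_isSteinbergFor hα hdet hε with ⟨-, h2⟩ | ⟨-, hD, -⟩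
    · exfalso
      have h3 := congrArg WittVector.constantCoeff ((hεΦ σ hσ).symm.trans h2)
      rw [← teichmuller_neg h.odd] at h3
      have h4 : -α = α := (WittVector.teichmuller_coeff_zero p (-α)).symm.trans
        (h3.trans (WittVector.teichmuller_coeff_zero p α))
      exact mul_ne_zero h.two_ne_zero h.unit (by linear_combination -h4)
    · exact hD

theorem exists_isSteinbergFor_iff (hα : α ^ 2 = 1) {D : Collection p k G} (hdet : HasDet χ D) :
    (∃ ε : G →* (WittVector p k)ˣ, IsSteinbergFor ρbar χ ε D) ↔
      D = h.special α ∨ ((q : k) = -1 ∧ D = h.special (-α)) := by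
  have hΦ : ∀ φ, φ = σ → σ⁻¹ * φ ∈ I := by
    rintro φ rfl
    rw [inv_mul_cancel]
    exact I.one_mem
  constructor
  · rintro ⟨ε, hε⟩
    rcases h.eq_special_of_isSteinbergFor hα hdet hε with ⟨hD, -⟩ | ⟨hqm, hD, -⟩
    · exact Or.inl hD
    · exact Or.inr ⟨hqm, hD⟩
  · rintro (hD | ⟨hqm, hD⟩)
    · obtain ⟨ε, hε, -⟩ := (h.exists_isSteinbergFor_upper_iff hα hdet (Φ := (· = σ)) rfl hΦ).mp hD
      exact ⟨ε, hε⟩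
    · obtain ⟨ε, hε, -⟩ := (h.exists_isSteinbergFor_lower_iff hα hqm hdet (Φ := (· = σ)) rfl hΦ).mp hD
      exact ⟨ε, hε⟩

section Corresponds

variable {R : CoeffRing p k} {ρ ρ' : G →* GL (Fin 2) R} (hR : IsVersal (liftingsWithDet ρbar χ) R ρ)
  (hs : StrictEquiv ρ ρ') {S w x y z : R} (hf : h.InForm ρ' S w x y z) {J : Ideal R}
  {D : Collection p k G}

include hR hs hf

theorem correspondsTo_special_upper (hα : α ^ 2 = 1) (hJ : ∀ (A : CoeffRing p k) (f : CoeffHom R A),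
    (∀ x ∈ J, f.toAlgHom x = 0) ↔ f.toAlgHom S = 0 ∧ f.toAlgHom y = 0) :
    CorrespondsTo ρ J D ↔ D = h.special α := by
  have hd := h.isDeformationCondition_special (h.slope_upper hα)
  refine correspondsTo_iff (fun A ρ' hρ' => hR.exists_hom A ρ' (h.special_iff.mp hρ').1)
    hd.strictEquiv fun A f => ?_
  rw [hJ, ← h.special_iff_upper hα (h.inForm_push hf f)]
  exact ⟨hd.strictEquiv _ _ _ (hs.push f), hd.strictEquiv _ _ _ (hs.push f).symm⟩

theorem correspondsTo_special_lower (hα : α ^ 2 = 1) (hqm : (q : k) = -1)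
    (hJ : ∀ (A : CoeffRing p k) (f : CoeffHom R A),
      (∀ x ∈ J, f.toAlgHom x = 0) ↔ f.toAlgHom x = 0 ∧ f.toAlgHom (1 + q * (1 + S)) = 0) :
    CorrespondsTo ρ J D ↔ D = h.special (-α) := by
  have hd := h.isDeformationCondition_special (h.slope_lower hα hqm)
  refine correspondsTo_iff (fun A ρ' hρ' => hR.exists_hom A ρ' (h.special_iff.mp hρ').1)
    hd.strictEquiv fun A f => ?_
  have e : f.toAlgHom (1 + q * (1 + S)) = 1 + q * (1 + f.toAlgHom S) := by
    rw [map_add, map_mul, map_add, map_one, map_natCast]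
  rw [hJ, e, ← h.special_iff_lower hα hqm (h.inForm_push hf f)]
  exact ⟨hd.strictEquiv _ _ _ (hs.push f), hd.strictEquiv _ _ _ (hs.push f).symm⟩

end Corresponds

end LocalSetup

/-! ### The case of the absolute Galois group. -/

section Main

variable {p l : ℕ} [Fact p.Prime] [Fact l.Prime] {k : Type u} [Field k] [Finite k] [CharP k p]
  {F : Type v} [Field F] [Algebra ℚ_[l] F] [FiniteDimensional ℚ_[l] F]

/-- From here on the Galois group enters only through `LocalSetup`, for arbitrary lifts `s` and `t`
of `σ` and `τ` to the absolute Galois group. -/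
theorem exists_localSetup (hp : p ≠ 2) (hlp : l ≠ p) (α : kˣ)
    (ρbar : (AlgebraicClosure F ≃ₐ[F] AlgebraicClosure F) →* GL (Fin 2) k)
    (hcont : IsOpen (ρbar.ker : Set (AlgebraicClosure F ≃ₐ[F] AlgebraicClosure F)))
    (hunr : ∀ g ∈ inertia l F (AlgebraicClosure F), ρbar g = 1)
    (hfrob : ∀ φ, IsFrobenius l F (AlgebraicClosure F) φ →
      (ρbar φ : Matrix (Fin 2) (Fin 2) k) = !![(residueCard l F : k) * α, 0; 0, (α : k)⁻¹])
    (hne : (residueCard l F : k) * α ≠ (α : k)⁻¹)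
    (σ τ : maxTame l F ≃ₐ[F] maxTame l F) (hσ : IsFrobenius l F (maxTame l F) σ)
    (hτ : closure (Subgroup.zpowers τ : Set (maxTame l F ≃ₐ[F] maxTame l F)) =
      inertia l F (maxTame l F)) :
    ∃ s t, tameRestrict l F s = σ ∧ tameRestrict l F t = τ ∧
      IsFrobenius l F (AlgebraicClosure F) s ∧
      LocalSetup (residueCard l F) (inertiaSubgroup l F) (tameRestrict l F).ker s t ρbar
        (cyclo p k F) (α : k) := by
  obtain ⟨s, hs⟩ := tameRestrict_surjective (l := l) (F := F) σ
  obtain ⟨t, ht⟩ := tameRestrict_surjective (l := l) (F := F) τ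
  have hsF := isFrobenius_of_tameRestrict hσ hs
  have := charZero_of_padic l F
  exact ⟨s, t, hs, ht, hsF,
    { tame := tameData hlp hτ hsF ht
      odd := hp
      inertia := hunr
      isOpen_ker := hcont
      frob := hfrob s hsF
      unit := α.ne_zero
      ne := hne
      char_inertia := fun i hi => cyclo_inertia hlp hi
      char_cont := isOpen_cyclo
      char_frob := cyclo_frobenius hlp hsF }⟩

theorem isTamePresentation_of_strictEquiv {σ τ : maxTame l F ≃ₐ[F] maxTame l F}
    {s t : AlgebraicClosure F ≃ₐ[F] AlgebraicClosure F} (hs : tameRestrict l F s = σ)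
    (ht : tameRestrict l F t = τ) {R : CoeffRing p k}
    {ρ ρ' : (AlgebraicClosure F ≃ₐ[F] AlgebraicClosure F) →* GL (Fin 2) R} (he : StrictEquiv ρ ρ')
    (hker : ∀ g ∈ (tameRestrict l F).ker, ρ' g = 1)
    {Q : Type u} [CommRing Q] [Algebra (WittVector p k) Q] {e : R ≃ₐ[WittVector p k] Q}
    {Mσ Mτ : Matrix (Fin 2) (Fin 2) Q} (hσ : (ρ' s : Matrix (Fin 2) (Fin 2) R).map e = Mσ)
    (hτ : (ρ' t : Matrix (Fin 2) (Fin 2) R).map e = Mτ) : IsTamePresentation l σ τ ρ e Mσ Mτ := by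
  set ρt := (tameRestrict l F).liftOfSurjective tameRestrict_surjective ⟨ρ', hker⟩
  have hρt : ∀ g, ρt (tameRestrict l F g) = ρ' g :=
    MonoidHom.liftOfRightInverse_comp_apply _ _ _ ⟨ρ', hker⟩
  refine ⟨ρt, ?_, ?_, ?_⟩
  · rwa [show ρt.comp (tameRestrict l F) = ρ' from MonoidHom.ext hρt]
  · rw [← hs, hρt, hσ]
  · rw [← ht, hρt, hτ]

theorem isTamePresentation_of_eq {σ τ : maxTame l F ≃ₐ[F] maxTame l F} {R : CoeffRing p k}
    {ρ : (AlgebraicClosure F ≃ₐ[F] AlgebraicClosure F) →* GL (Fin 2) R}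
    {Q : Type u} [CommRing Q] [Algebra (WittVector p k) Q] {e : R ≃ₐ[WittVector p k] Q}
    {Mσ Mτ Nσ Nτ : Matrix (Fin 2) (Fin 2) Q} (hσ : Nσ = Mσ) (hτ : Nτ = Mτ)
    (h : IsTamePresentation l σ τ ρ e Mσ Mτ) : IsTamePresentation l σ τ ρ e Nσ Nτ := by
  rwa [hσ, hτ]

variable {s t : AlgebraicClosure F ≃ₐ[F] AlgebraicClosure F}
  {ρbar : (AlgebraicClosure F ≃ₐ[F] AlgebraicClosure F) →* GL (Fin 2) k} {α : kˣ}
  (h : LocalSetup (residueCard l F) (inertiaSubgroup l F) (tameRestrict l F).ker s t ρbar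
    (cyclo p k F) (α : k))
  {D : Collection p k (AlgebraicClosure F ≃ₐ[F] AlgebraicClosure F)}

theorem isUnramifiedCondition_iff :
    IsUnramifiedCondition l ρbar (cyclo p k F) D ↔ D = h.unramified := by
  constructor
  · intro hD
    funext A ρ
    exact propext ((hD A ρ).trans h.unramified_iff_inertia.symm)
  · rintro rfl A ρ
    exact h.unramified_iff_inertia

theorem isSubstantial_iff (hlp : l ≠ p)
    (hcase : (α : k) ^ 2 = 1 ∨ (residueCard l F : k) ^ 2 * (α : k) ^ 2 ≠ 1)
    (hdet : HasDet (cyclo p k F) D) :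
    IsSubstantial l ρbar D ↔ D = h.unramified ∨ ((α : k) ^ 2 = 1 ∧ D = h.special α) ∨
      ((α : k) ^ 2 = 1 ∧ (residueCard l F : k) = -1 ∧ D = h.special (-α)) := by
  have hq : 1 < residueCard l F := by
    obtain ⟨f, hf, e⟩ := residueCard_eq_pow (l := l) (L := F)
    rw [e]
    exact Nat.one_lt_pow hf.ne' (Fact.out : l.Prime).one_lt
  rw [IsSubstantial, if_neg hlp, add_zero]
  exact h.substantial_iff hq hcase hdet

theorem natCast_eq_one_iff (q : ℕ) : (q : k) = 1 ↔ q ≡ 1 [MOD p] := by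
  rw [← CharP.natCast_eq_natCast k p, Nat.cast_one]

theorem natCast_eq_neg_one_iff (q : ℕ) : (q : k) = -1 ↔ p ∣ q + 1 := by
  rw [← CharP.cast_eq_zero_iff k p, Nat.cast_add, Nat.cast_one, eq_neg_iff_add_eq_zero]

theorem isSteinberg_iff (hα : (α : k) ^ 2 = 1) (hdet : HasDet (cyclo p k F) D) :
    (∃ ε : (AlgebraicClosure F ≃ₐ[F] AlgebraicClosure F) →* (WittVector p k)ˣ,
      IsSteinbergCondition ρbar ε D) ↔
      D = h.special α ∨ ((residueCard l F : k) = -1 ∧ D = h.special (-α)) :=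
  h.exists_isSteinbergFor_iff hα hdet

include h in
theorem isSubstantial_iff_isSteinberg (hlp : l ≠ p) (hα : (α : k) ^ 2 = 1)
    (hdet : HasDet (cyclo p k F) D) :
    IsSubstantial l ρbar D ↔ IsUnramifiedCondition l ρbar (cyclo p k F) D ∨
      ∃ ε : (AlgebraicClosure F ≃ₐ[F] AlgebraicClosure F) →* (WittVector p k)ˣ,
        IsSteinbergCondition ρbar ε D := by
  rw [isSubstantial_iff h hlp (Or.inl hα) hdet, isUnramifiedCondition_iff h,
    isSteinberg_iff h hα hdet]
  simp only [hα, true_and]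

variable {σ τ : maxTame l F ≃ₐ[F] maxTame l F} (hs : tameRestrict l F s = σ)
  (ht : tameRestrict l F t = τ) {R : CoeffRing p k}
  {ρ : (AlgebraicClosure F ≃ₐ[F] AlgebraicClosure F) →* GL (Fin 2) R}
  (hR : IsVersal (liftingsWithDet ρbar (cyclo p k F)) R ρ)

include h hs ht hR

theorem exists_isTamePresentation {Q : CoeffRing p k}
    {ρQ : (AlgebraicClosure F ≃ₐ[F] AlgebraicClosure F) →* GL (Fin 2) Q}
    (hQ : IsVersal (liftingsWithDet ρbar (cyclo p k F)) Q ρQ) {S w x y z : Q}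
    (hf : h.InForm ρQ S w x y z) :
    ∃ e : R ≃ₐ[WittVector p k] Q,
      IsTamePresentation l σ τ ρ e (diagMatrix (residueCard l F) (Q.teich α) S) !![w, x; y, z] ∧
      ∃ ρ' : (AlgebraicClosure F ≃ₐ[F] AlgebraicClosure F) →* GL (Fin 2) R, StrictEquiv ρ ρ' ∧
        h.InForm ρ' (e.symm S) (e.symm w) (e.symm x) (e.symm y) (e.symm z) := by
  obtain ⟨e, ρ', he, hf', hσ, hτ⟩ := h.exists_algEquiv hR hQ hf
  exact ⟨e, isTamePresentation_of_strictEquiv hs ht he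
    (fun g hg => h.tame.lifting_wild h.inertia hf'.mem.1 hg) hσ hτ, ρ', he, hf'⟩

theorem exists_presentation_diag (hα1 : (α : k) ^ 2 ≠ 1)
    (hα2 : (residueCard l F : k) ^ 2 * (α : k) ^ 2 ≠ 1)
    {J : Ideal (MvPowerSeries (Fin 2) (WittVector p k))}
    (hJ : J = Ideal.span {(1 + MvPowerSeries.X 1) ^ residueCard l F - (1 + MvPowerSeries.X 1)}) :
    ∃ e : R ≃ₐ[WittVector p k] (MvPowerSeries (Fin 2) (WittVector p k) ⧸ J),
      IsTamePresentation l σ τ ρ e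
        ((diagMatrix (residueCard l F) (MvPowerSeries.C (WittVector.teichmuller p (α : k)))
          (MvPowerSeries.X 0)).map (Ideal.Quotient.mk J))
        (Matrix.map !![1 + MvPowerSeries.X 1, 0; 0, Ring.inverse (1 + MvPowerSeries.X 1)]
          (Ideal.Quotient.mk J)) := by
  subst hJ
  obtain ⟨ρQ, hQ, hf⟩ := h.exists_isVersal_diag hα1 hα2 rfl (span_diag_le (residueCard l F))
  obtain ⟨e, he, -⟩ := exists_isTamePresentation h hs ht hR hQ hf
  refine ⟨e, isTamePresentation_of_eq
    (LocalSetup.map_diagMatrix α.ne_zero (res_varX (0 : Fin 2)) (CoeffHom.toQuot _ _ _)) ?_ he⟩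
  ext i j
  fin_cases i <;> fin_cases j <;> rfl

theorem exists_presentation_unramified (hα1 : (α : k) ^ 2 ≠ 1)
    (hα2 : (residueCard l F : k) ^ 2 * (α : k) ^ 2 ≠ 1) (hq1 : (residueCard l F : k) ≠ 1) :
    ∃ e : R ≃ₐ[WittVector p k] PowerSeries (WittVector p k),
      IsTamePresentation l σ τ ρ e
        (diagMatrix (residueCard l F) (PowerSeries.C (WittVector.teichmuller p (α : k)))
          PowerSeries.X) 1 := by
  obtain ⟨ρQ, hQ, hf⟩ := h.exists_isVersal_unramified (D := liftingsWithDet ρbar (cyclo p k F))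
    fun A ρ => ⟨fun hρ => ⟨hρ, h.tau_eq_one_of_diag hα1 hα2 hq1 hρ⟩, And.left⟩
  obtain ⟨e, he, -⟩ := exists_isTamePresentation h hs ht hR hQ hf
  refine ⟨e, ?_⟩
  rw [Matrix.one_fin_two]
  exact he

theorem exists_presentation_upper (hα : (α : k) ^ 2 = 1) (hq2 : (residueCard l F : k) ^ 2 ≠ 1)
    {J : Ideal (MvPowerSeries (Fin 2) (WittVector p k))}
    (hJ : J = Ideal.span {MvPowerSeries.X 0 * MvPowerSeries.X 1}) :
    ∃ e : R ≃ₐ[WittVector p k] (MvPowerSeries (Fin 2) (WittVector p k) ⧸ J),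
      IsTamePresentation l σ τ ρ e
        ((scaledDiagMatrix (residueCard l F) (MvPowerSeries.C (WittVector.teichmuller p (α : k)))
          (MvPowerSeries.X 0)).map (Ideal.Quotient.mk J))
        (Matrix.map !![1, MvPowerSeries.X 1; 0, 1] (Ideal.Quotient.mk J)) := by
  subst hJ
  obtain ⟨ρQ, hQ, hf⟩ := h.exists_isVersal_upper hα (h.q_ne_one hα) hq2 rfl span_upper_le
  obtain ⟨e, he, -⟩ := exists_isTamePresentation h hs ht hR hQ hf
  refine ⟨e, isTamePresentation_of_eq
    ((congrArg (fun M : Matrix (Fin 2) (Fin 2) (powerSeriesCoeff p k (Fin 2)) =>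
      M.map (CoeffHom.toQuot _ _ span_upper_le).toAlgHom) (scaledDiagMatrix_eq hα _ (res_varX 0))).trans
      (LocalSetup.map_diagMatrix α.ne_zero (res_varX (0 : Fin 2)) (CoeffHom.toQuot _ _ _))) ?_ he⟩
  ext i j
  fin_cases i <;> fin_cases j <;> rfl

theorem exists_presentation_symmetric (hα : (α : k) ^ 2 = 1)
    {r : MvPowerSeries (Fin 3) (WittVector p k)}
    (hr : r ^ 2 = 1 + MvPowerSeries.X 1 * MvPowerSeries.X 2)
    (hr1 : MvPowerSeries.constantCoeff r = 1)
    {J : Ideal (MvPowerSeries (Fin 3) (WittVector p k))}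
    (hJ : J = oddIdeal (residueCard l F) (MvPowerSeries.X 0) (MvPowerSeries.X 1)
      (MvPowerSeries.X 2) r) :
    ∃ e : R ≃ₐ[WittVector p k] (MvPowerSeries (Fin 3) (WittVector p k) ⧸ J),
      IsTamePresentation l σ τ ρ e
        ((scaledDiagMatrix (residueCard l F) (MvPowerSeries.C (WittVector.teichmuller p (α : k)))
          (MvPowerSeries.X 0)).map (Ideal.Quotient.mk J))
        (Matrix.map !![r, MvPowerSeries.X 1; MvPowerSeries.X 2, r] (Ideal.Quotient.mk J)) ∧
      ∃ (ρ' : (AlgebraicClosure F ≃ₐ[F] AlgebraicClosure F) →* GL (Fin 2) R) (w z : R),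
        StrictEquiv ρ ρ' ∧
        h.InForm ρ' (e.symm (Ideal.Quotient.mk J (MvPowerSeries.X 0))) w
          (e.symm (Ideal.Quotient.mk J (MvPowerSeries.X 1)))
          (e.symm (Ideal.Quotient.mk J (MvPowerSeries.X 2))) z := by
  subst hJ
  have hr2 : (powerSeriesCoeff p k (Fin 3)).res r = 1 :=
    (congrArg WittVector.constantCoeff hr1).trans (map_one _)
  obtain ⟨ρQ, hQ, hf⟩ := h.exists_isVersal_symmetric hα (h.q_ne_one hα) hr hr2 rfl
    (oddIdeal_le (residueCard l F) r)
  obtain ⟨e, he, ρ', hs', hf'⟩ := exists_isTamePresentation h hs ht hR hQ hf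
  refine ⟨e, isTamePresentation_of_eq
    ((congrArg (fun M : Matrix (Fin 2) (Fin 2) (powerSeriesCoeff p k (Fin 3)) =>
      M.map (CoeffHom.toQuot _ _ (oddIdeal_le _ r)).toAlgHom) (scaledDiagMatrix_eq hα _ (res_varX 0))).trans
      (LocalSetup.map_diagMatrix α.ne_zero (res_varX (0 : Fin 3)) (CoeffHom.toQuot _ _ _))) ?_ he,
    ρ', _, _, hs', hf'⟩
  ext i j
  fin_cases i <;> fin_cases j <;> rfl

end Main

end LocalDef
end

open LocalDef in
theorem mainTheorem6 {p l : ℕ} [Fact p.Prime] [Fact l.Prime] (hp : p ≠ 2) (hlp : l ≠ p)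
    {k : Type u} [Field k] [Finite k] [CharP k p]
    {F : Type v} [Field F] [Algebra ℚ_[l] F] [FiniteDimensional ℚ_[l] F]
    -- the order of the residue field of `F`
    (q : ℕ) (hq : q = residueCard l F)
    -- the residual representation: unramified, with Frobenius acting as `diag(q α, α⁻¹)`
    (α : kˣ) (ρbar : (AlgebraicClosure F ≃ₐ[F] AlgebraicClosure F) →* GL (Fin 2) k)
    (hcont : IsOpen (ρbar.ker : Set (AlgebraicClosure F ≃ₐ[F] AlgebraicClosure F)))
    (hunr : ∀ g ∈ inertia l F (AlgebraicClosure F), ρbar g = 1)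
    (hfrob : ∀ φ, IsFrobenius l F (AlgebraicClosure F) φ →
      (ρbar φ : Matrix (Fin 2) (Fin 2) k) = !![(q : k) * α, 0; 0, (α : k)⁻¹])
    (hne : (q : k) * α ≠ (α : k)⁻¹)
    -- a lift `σ` of Frobenius and a topological generator `τ` of the tame inertia group
    (σ τ : maxTame l F ≃ₐ[F] maxTame l F)
    (hσ : IsFrobenius l F (maxTame l F) σ)
    (hτ : closure (Subgroup.zpowers τ : Set (maxTame l F ≃ₐ[F] maxTame l F)) =
      inertia l F (maxTame l F)) :
    -- in the cases considered the versal deformation ring and representation with determinant `χ`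
    -- exist
    ((α : k) ^ 2 = 1 ∨ (q : k) ^ 2 * (α : k) ^ 2 ≠ 1 →
      ∃ (R : CoeffRing p k) (ρ : (AlgebraicClosure F ≃ₐ[F] AlgebraicClosure F) →* GL (Fin 2) R),
        IsVersal (liftingsWithDet ρbar (cyclo p k F)) R ρ) ∧
    -- (i)
    ((α : k) ^ 2 ≠ 1 → (q : k) ^ 2 * (α : k) ^ 2 ≠ 1 →
      (q ≡ 1 [MOD p] →
        ∀ (S T a : MvPowerSeries (Fin 2) (WittVector p k))
          (J : Ideal (MvPowerSeries (Fin 2) (WittVector p k))),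
        S = MvPowerSeries.X 0 → T = MvPowerSeries.X 1 →
        a = MvPowerSeries.C (WittVector.teichmuller p (α : k)) →
        J = Ideal.span {(1 + T) ^ q - (1 + T)} →
        ∀ (R : CoeffRing p k) (ρ : (AlgebraicClosure F ≃ₐ[F] AlgebraicClosure F) →* GL (Fin 2) R),
          IsVersal (liftingsWithDet ρbar (cyclo p k F)) R ρ →
          ∃ e : R ≃ₐ[WittVector p k] (MvPowerSeries (Fin 2) (WittVector p k) ⧸ J),
            IsTamePresentation l σ τ ρ e
              ((diagMatrix q a S).map (Ideal.Quotient.mk J))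
              (Matrix.map !![1 + T, 0; 0, Ring.inverse (1 + T)] (Ideal.Quotient.mk J))) ∧
      (¬ q ≡ 1 [MOD p] →
        ∀ (R : CoeffRing p k) (ρ : (AlgebraicClosure F ≃ₐ[F] AlgebraicClosure F) →* GL (Fin 2) R),
          IsVersal (liftingsWithDet ρbar (cyclo p k F)) R ρ →
          ∃ e : R ≃ₐ[WittVector p k] PowerSeries (WittVector p k),
            IsTamePresentation l σ τ ρ e
              (diagMatrix q (PowerSeries.C (WittVector.teichmuller p (α : k))) PowerSeries.X) 1) ∧
      ∀ D : Collection p k (AlgebraicClosure F ≃ₐ[F] AlgebraicClosure F), HasDet (cyclo p k F) D →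
        (IsSubstantial l ρbar D ↔ IsUnramifiedCondition l ρbar (cyclo p k F) D)) ∧
    -- (ii)
    ((α : k) ^ 2 = 1 → ¬ q ^ 2 ≡ 1 [MOD p] →
      (∀ (S T a : MvPowerSeries (Fin 2) (WittVector p k))
          (J : Ideal (MvPowerSeries (Fin 2) (WittVector p k))),
        S = MvPowerSeries.X 0 → T = MvPowerSeries.X 1 →
        a = MvPowerSeries.C (WittVector.teichmuller p (α : k)) →
        J = Ideal.span {S * T} →
        ∀ (R : CoeffRing p k) (ρ : (AlgebraicClosure F ≃ₐ[F] AlgebraicClosure F) →* GL (Fin 2) R),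
          IsVersal (liftingsWithDet ρbar (cyclo p k F)) R ρ →
          ∃ e : R ≃ₐ[WittVector p k] (MvPowerSeries (Fin 2) (WittVector p k) ⧸ J),
            IsTamePresentation l σ τ ρ e
              ((scaledDiagMatrix q a S).map (Ideal.Quotient.mk J))
              (Matrix.map !![1, T; 0, 1] (Ideal.Quotient.mk J))) ∧
      ∀ D : Collection p k (AlgebraicClosure F ≃ₐ[F] AlgebraicClosure F), HasDet (cyclo p k F) D →
        (IsSubstantial l ρbar D ↔
          IsUnramifiedCondition l ρbar (cyclo p k F) D ∨
            ∃ ε : (AlgebraicClosure F ≃ₐ[F] AlgebraicClosure F) →* (WittVector p k)ˣ, IsSteinbergCondition ρbar ε D)) ∧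
    -- (iii)
    ((α : k) ^ 2 = 1 → p ∣ q + 1 →
      (∀ S T₁ T₂ a : MvPowerSeries (Fin 3) (WittVector p k),
        S = MvPowerSeries.X 0 → T₁ = MvPowerSeries.X 1 → T₂ = MvPowerSeries.X 2 →
        a = MvPowerSeries.C (WittVector.teichmuller p (α : k)) →
        -- `r` is the square root of `1 + T₁ T₂` with constant term `1`
        ∃ r : MvPowerSeries (Fin 3) (WittVector p k),
          r ^ 2 = 1 + T₁ * T₂ ∧ MvPowerSeries.constantCoeff r = 1 ∧
          ∀ J : Ideal (MvPowerSeries (Fin 3) (WittVector p k)), J = oddIdeal q S T₁ T₂ r →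
          ∀ (R : CoeffRing p k) (ρ : (AlgebraicClosure F ≃ₐ[F] AlgebraicClosure F) →* GL (Fin 2) R),
            IsVersal (liftingsWithDet ρbar (cyclo p k F)) R ρ →
            ∃ e : R ≃ₐ[WittVector p k] (MvPowerSeries (Fin 3) (WittVector p k) ⧸ J),
              IsTamePresentation l σ τ ρ e
                ((scaledDiagMatrix q a S).map (Ideal.Quotient.mk J))
                (Matrix.map !![r, T₁; T₂, r] (Ideal.Quotient.mk J)) ∧
              -- the ideals of `R` that correspond to `(S, T₂)` and `(T₁, 1 + q (1 + S))`
              ∀ I₁ I₂ : Ideal R,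
                I₁ = (Ideal.map (Ideal.Quotient.mk J) (Ideal.span {S, T₂})).comap e →
                I₂ = (Ideal.map (Ideal.Quotient.mk J)
                  (Ideal.span {T₁, 1 + (q : MvPowerSeries (Fin 3) (WittVector p k)) * (1 + S)})).comap
                    e →
                ∀ D : Collection p k (AlgebraicClosure F ≃ₐ[F] AlgebraicClosure F), HasDet (cyclo p k F) D →
                  ((IsSubstantial l ρbar D ∧ ¬ IsUnramifiedCondition l ρbar (cyclo p k F) D) ↔
                    CorrespondsTo ρ I₁ D ∨ CorrespondsTo ρ I₂ D) ∧
                  (CorrespondsTo ρ I₁ D ↔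
                    ∃ ε : (AlgebraicClosure F ≃ₐ[F] AlgebraicClosure F) →* (WittVector p k)ˣ, IsSteinbergCondition ρbar ε D ∧
                      ∀ φ, IsFrobenius l F (AlgebraicClosure F) φ →
                        (ε φ : WittVector p k) = WittVector.teichmuller p (α : k)) ∧
                  (CorrespondsTo ρ I₂ D ↔
                    ∃ ε : (AlgebraicClosure F ≃ₐ[F] AlgebraicClosure F) →* (WittVector p k)ˣ, IsSteinbergCondition ρbar ε D ∧
                      ∀ φ, IsFrobenius l F (AlgebraicClosure F) φ →
                        (ε φ : WittVector p k) = - WittVector.teichmuller p (α : k))) ∧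
      ∀ D : Collection p k (AlgebraicClosure F ≃ₐ[F] AlgebraicClosure F), HasDet (cyclo p k F) D →
        (IsSubstantial l ρbar D ↔
          IsUnramifiedCondition l ρbar (cyclo p k F) D ∨
            ∃ ε : (AlgebraicClosure F ≃ₐ[F] AlgebraicClosure F) →* (WittVector p k)ˣ, IsSteinbergCondition ρbar ε D)) := by
  subst hq
  obtain ⟨s, t, hs, ht, hsF, h⟩ := exists_localSetup hp hlp α ρbar hcont hunr hfrob hne σ τ hσ hτ
  refine ⟨h.exists_isVersal_liftingsWithDet, fun hα1 hα2 => ⟨?_, ?_, ?_⟩, fun hα hq2 => ⟨?_, ?_⟩,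
    fun hα hqm => ⟨?_, ?_⟩⟩
  · rintro - S T a J rfl rfl rfl hJ R ρ hR
    exact exists_presentation_diag h hs ht hR hα1 hα2 hJ
  · intro hq1 R ρ hR
    exact exists_presentation_unramified h hs ht hR hα1 hα2
      (fun h1 => hq1 ((natCast_eq_one_iff _).mp h1))
  · intro D hdet
    rw [isSubstantial_iff h hlp (Or.inr hα2) hdet, isUnramifiedCondition_iff h]
    simp only [hα1, false_and, or_false]
  · rintro S T a J rfl rfl rfl hJ R ρ hR
    exact exists_presentation_upper h hs ht hR hα
      (fun h1 => hq2 ((natCast_eq_one_iff (k := k) _).mp (by rwa [Nat.cast_pow]))) hJ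
  · exact fun D hdet => isSubstantial_iff_isSteinberg h hlp hα hdet
  · rintro S T₁ T₂ a rfl rfl rfl rfl
    obtain ⟨r, hr, hr1⟩ := exists_sqrt_one_add (p := p) h.two_ne_zero
    -- Hensel's lemma controls only the residue of `r`. Its constant term is a square root of one in
    -- `W` with residue one, hence one.
    have hr2 := constantCoeff_sqrt_one_add h.two_ne_zero hr hr1
    refine ⟨r, hr, hr2, fun J hJ R ρ hR => ?_⟩
    obtain ⟨e, he, ρ', w, z, hs', hf⟩ := exists_presentation_symmetric h hs ht hR hα hr hr2 hJ
    refine ⟨e, he, ?_⟩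
    rintro I₁ I₂ hI₁ hI₂ D hdet
    have hqk := (natCast_eq_neg_one_iff (k := k) (residueCard l F)).mpr hqm
    have h1 : CorrespondsTo ρ I₁ D ↔ D = h.special α :=
      h.correspondsTo_special_upper hR hs' hf hα fun A f => by
        rw [hI₁, Ideal.map_span, Set.image_pair]
        exact forall_mem_comap_span_pair e f.toAlgHom _ _
    have h2 : CorrespondsTo ρ I₂ D ↔ D = h.special (-α) :=
      h.correspondsTo_special_lower hR hs' hf hα hqk fun A f => by
        rw [hI₂, Ideal.map_span, Set.image_pair]
        refine (forall_mem_comap_span_pair e f.toAlgHom _ _).trans ?_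
        simp only [map_add, map_mul, map_one, map_natCast]
    have hΦ : ∀ φ, IsFrobenius l F (AlgebraicClosure F) φ → s⁻¹ * φ ∈ inertiaSubgroup l F :=
      fun φ hφ => hsF.inv_mul_mem hφ
    refine ⟨?_, h1.trans (h.exists_isSteinbergFor_upper_iff hα hdet hsF hΦ),
      h2.trans (h.exists_isSteinbergFor_lower_iff hα hqk hdet hsF hΦ)⟩
    rw [h1, h2, isSubstantial_iff h hlp (Or.inl hα) hdet, isUnramifiedCondition_iff h]
    simp only [hα, hqk, true_and]
    constructor
    · rintro ⟨hD | hD, hn⟩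
      · exact absurd hD hn
      · exact hD
    · rintro (rfl | rfl)
      · exact ⟨Or.inr (Or.inl rfl), h.special_upper_ne_unramified hα⟩
      · exact ⟨Or.inr (Or.inr rfl), h.special_lower_ne_unramified hα hqk⟩
  · exact fun D hdet => isSubstantial_iff_isSteinberg h hlp hα hdet
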